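/- **Setting.** Let $\Omega\subset\mathbb R^d$ be a bounded domain with $C^1$ boundary, and let $\Omega_0^+$ be an open set with $\overline{\Omega_0^+}\subset\Omega$ whose boundary $\Sigma_0=\partial\Omega_0^+$ is a nonempty closed smooth embedded hypersurface with $\Omega_0^+$ on one side of it. Put $\Omega_0^-=\Omega\setminus\overline{\Omega_0^+}$. Let $\mathrm d_\Sigma$ be the signed distance to $\Sigma_0$, positive in $\Omega_0^+$ and negative in $\Omega_0^-$, and $B_r(\Sigma_0)=\{x\in\Omega:|\mathrm d_\Sigma(x)|<r\}$. Let $\mathfrak m_\pm=\partial U_\pm$ be disjoint smooth closed connected hypersurfaces in $\mathbb R^n$ enclosing disjoint bounded open sets $U_\pm$. Put $\mathfrak m=\mathfrak m_+\cup\mathfrak m_-$ and $\mathrm{dist}_{\mathfrak m}=\inf_{p^\pm\in\mathfrak m_\pm}|p^+-p^-|$. Let $\delta_0>0$ be such that the nearest-point projections onto $\mathfrak m$ and onto $\Sigma_0$ are (uniquely defined and) smooth on the $2\delta_0$-neighbourhood of $\mathfrak m$ and on $B_{4\delta_0}(\Sigma_0)$ respectively, and such that $\mathrm{dist}(\Sigma_0,\partial\Omega)\ge\delta_0$.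 Let $F:\mathbb R^n\to[0,\infty)$ be smooth with $F(u)=f(\mathrm{dist}(u,\mathfrak m)^2)$, where $f$ is $C^2$ on $(0,\infty)$ and, for positive constants $c_1,\dots,c_4$, $c_1s\le f(s)\le c_2s$ for $0\le s\le\delta_0^2$, $f(s)=c_3$ for $s\ge\delta_0^2$, and $\lim_{s\downarrow0}f(s)/s=c_4$. Put $c_F=2\int_0^{\mathrm{dist}_{\mathfrak m}/2}\sqrt{2f(\lambda^2)}\,d\lambda$. Let $\mathrm d_{\mathfrak m_+}$ be the signed distance to $\mathfrak m_+$, positive in $U_+$ and negative outside $\overline{U_+}$, and define $\mathrm d_F:\mathbb R^n\to\mathbb R$ by $$\mathrm d_F(u)=\begin{cases}\int_0^{\mathrm{dist}(u,\mathfrak m_-)}\sqrt{2f(\lambda^2)}\,d\lambda&\text{if }\mathrm{dist}(u,\mathfrak m_-)\le\tfrac12\mathrm{dist}_{\mathfrak m},\\ c_F+\int_0^{\mathrm d_{\mathfrak m_+}(u)}\sqrt{2f(\lambda^2)}\,d\lambda&\text{otherwise, if }u\in U_+\text{ or }\mathrm{dist}(u,\mathfrak m_+)\le\tfrac12\mathrm{dist}_{\mathfrak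 m},\\ \tfrac12c_F&\text{in all other cases.}\end{cases}$$ Let $\phi\ge0$ be a smooth even function on $\mathbb R$, nonincreasing on $[0,1]$, with $\phi>0$ on $(-1,1)$, $\phi=0$ elsewhere, and $1-4x^2\le\phi(x)\le1-\frac12x^2$ for $|x|\le\frac12$. Put $\xi=\phi(\mathrm d_\Sigma/\delta_0)\nabla\mathrm d_\Sigma$, $\eta(r)=\max(-\delta_0,\min(r,\delta_0))$ and $\chi=\mathbf 1_{\Omega_0^+}-\mathbf 1_{\Omega_0^-}$. For $u:\Omega\to\mathbb R^n$, with $\psi=\mathrm d_F\circ u$ and $h^\pm=\max(\pm h,0)$, let $$E_\varepsilon[u|\Sigma_0]=\int_\Omega\Big(\frac\varepsilon2|\nabla u|^2+\frac1\varepsilon F(u)-\xi\cdot\nabla\psi\Big)dx,$$ $$B[u|\Sigma_0]=\int_\Omega\big(c_F\chi-c_F+2(\psi-c_F)^-\big)\,\eta\circ\mathrm d_\Sigma\,dx+\int_\Omega(\psi-c_F)^+\,|\eta\circ\mathrm d_\Sigma|\,dx.$$ **Theorem 1.2.** Let $\delta\in(0,\delta_0)$, and let $u^{in}_\pm\in H^1(\Omega_0^\pm,\mathbb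 R^n)$ take values in $\mathfrak m_\pm$ a.e. and have traces on $\Sigma_0$ that form a minimal pair: $$|u^{in}_+(p)-u^{in}_-(p)|=\mathrm{dist}_{\mathfrak m}\qquad\text{for }\mathcal H^{d-1}\text{-a.e. }p\in\Sigma_0.$$ Then there is a constant $C$, which depends on $\delta$, $u^{in}_\pm$ and the data of the setting but not on $\varepsilon$, such that for every $\varepsilon>0$ there is $u^{in}_\varepsilon\in H^1(\Omega,\mathbb R^n)\cap L^\infty(\Omega,\mathbb R^n)$ with $\mathrm d_F\circ u^{in}_\varepsilon\in H^1(\Omega)$ and $$u^{in}_\varepsilon=u^{in}_\pm\ \text{ in }\Omega_0^\pm\setminus B_{2\delta}(\Sigma_0),\qquad E_\varepsilon[u^{in}_\varepsilon|\Sigma_0]\le C\varepsilon,\qquad B[u^{in}_\varepsilon|\Sigma_0]\le C\varepsilon.$$ -/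

import Mathlib

open Set Filter Topology MeasureTheory
open scoped ContDiff

noncomputable section

namespace KRS

/-- Euclidean space `ℝ^d` with its Euclidean norm. -/
abbrev E (d : ℕ) := EuclideanSpace ℝ (Fin d)

/-- The `i`-th standard basis vector of `ℝ^d`. -/
def basisVec {d : ℕ} (i : Fin d) : E d := EuclideanSpace.single i (1 : ℝ)

/-! ### Domains, hypersurfaces and distances -/

/-- The open set `U` has a boundary of class `C^k`: near each of its boundary points `U` is the
superlevel set `{0 < g}` of a `C^k` function `g` whose gradient does not vanish there. The boundary
`frontier U` is then (locally `{g = 0}`) an embedded hypersurface without boundary, of class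
`C^k`, which has `U` on exactly one side. -/
def HasBoundaryOfClass {d : ℕ} (k : WithTop ℕ∞) (U : Set (E d)) : Prop :=
  ∀ x ∈ frontier U, ∃ g : E d → ℝ,
    ContDiff ℝ k g ∧ fderiv ℝ g x ≠ 0 ∧ ∀ᶠ y in 𝓝 x, (y ∈ U ↔ 0 < g y)

/-- Every point of `N` has a unique nearest point on `S`, and the resulting nearest-point
projection `N → S` is smooth. -/
def HasSmoothProjection {d : ℕ} (S N : Set (E d)) : Prop :=
  ∃ P : E d → E d, ContDiffOn ℝ ∞ P N ∧
    ∀ x ∈ N, P x ∈ S ∧ ∀ y ∈ S, y ≠ P x → dist x (P x) < dist x y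

open Classical in
/-- The signed distance to the boundary of `U`: positive in `U`, negative outside `closure U`. -/
def sgnDist {d : ℕ} (U : Set (E d)) (x : E d) : ℝ :=
  if x ∈ U then Metric.infDist x (frontier U) else -Metric.infDist x (frontier U)

/-! ### The wells and the potential -/

/-- The wells `𝔪₊ = frontier Up` and `𝔪₋ = frontier Um` are disjoint, smooth, closed, connected
hypersurfaces of `ℝ^n` enclosing the disjoint bounded open sets `Up` and `Um`, and the
nearest-point projection onto `𝔪₊ ∪ 𝔪₋` is smooth on the `2 δ₀`-neighbourhood. -/
structure IsWells {n : ℕ} (Up Um : Set (E n)) (δ₀ : ℝ) : Prop where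
  isOpen_plus : IsOpen Up
  isOpen_minus : IsOpen Um
  bounded_plus : Bornology.IsBounded Up
  bounded_minus : Bornology.IsBounded Um
  smooth_plus : HasBoundaryOfClass ∞ Up
  smooth_minus : HasBoundaryOfClass ∞ Um
  connected_plus : IsConnected (frontier Up)
  connected_minus : IsConnected (frontier Um)
  disjoint_inside : Disjoint Up Um
  disjoint_wells : Disjoint (frontier Up) (frontier Um)
  projection : HasSmoothProjection (frontier Up ∪ frontier Um)
    {u | Metric.infDist u (frontier Up ∪ frontier Um) < 2 * δ₀}

/-- The Euclidean distance `dist_𝔪` between `𝔪₊` and `𝔪₋`. -/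
def wellDist {n : ℕ} (Up Um : Set (E n)) : ℝ :=
  sInf {r : ℝ | ∃ p ∈ frontier Up, ∃ q ∈ frontier Um, r = dist p q}

/-- The assumptions on the profile `f` of the potential. -/
structure IsProfile (f : ℝ → ℝ) (c₁ c₂ c₃ c₄ δ₀ : ℝ) : Prop where
  c₁_pos : 0 < c₁
  c₂_pos : 0 < c₂
  c₃_pos : 0 < c₃
  c₄_pos : 0 < c₄
  contDiffOn : ContDiffOn ℝ 2 f (Ioi 0)
  lower : ∀ s, 0 ≤ s → s ≤ δ₀ ^ 2 → c₁ * s ≤ f s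
  upper : ∀ s, 0 ≤ s → s ≤ δ₀ ^ 2 → f s ≤ c₂ * s
  const : ∀ s, δ₀ ^ 2 ≤ s → f s = c₃
  slope : Tendsto (fun s => f s / s) (𝓝[>] 0) (𝓝 c₄)

/-- The potential `F(u) = f(d_𝔪(u)^2)`; the square of the signed distance is the square of the
distance. -/
def potential {n : ℕ} (f : ℝ → ℝ) (Up Um : Set (E n)) (u : E n) : ℝ :=
  f (Metric.infDist u (frontier Up ∪ frontier Um) ^ 2)

/-- The surface tension coefficient `c_F = 2 ∫_0^{dist_𝔪 / 2} √(2 f(λ²)) dλ`. -/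
def surfaceTension {n : ℕ} (f : ℝ → ℝ) (Up Um : Set (E n)) : ℝ :=
  2 * ∫ l in (0 : ℝ)..(wellDist Up Um / 2), Real.sqrt (2 * f (l ^ 2))

open Classical in
/-- The quasi-distance function `d_F`. The signed distance to `𝔪₊` is positive in `Up`, so that
`d_F` is below `c_F` outside `𝔪₊` and above it inside; the last case collects the points of `Um`,
and those outside `Up` and `Um`, at distance more than `dist_𝔪 / 2` from both wells. -/
def quasiDist {n : ℕ} (f : ℝ → ℝ) (Up Um : Set (E n)) (u : E n) : ℝ :=
  if Metric.infDist u (frontier Um) ≤ wellDist Up Um / 2 then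
    ∫ l in (0 : ℝ)..(Metric.infDist u (frontier Um)), Real.sqrt (2 * f (l ^ 2))
  else if u ∈ Up ∨ Metric.infDist u (frontier Up) ≤ wellDist Up Um / 2 then
    surfaceTension f Up Um + ∫ l in (0 : ℝ)..(sgnDist Up u), Real.sqrt (2 * f (l ^ 2))
  else
    surfaceTension f Up Um / 2

/-! ### The interface -/

/-- `Ω ⊆ ℝ^d` is a bounded domain with `C¹` boundary, and `Σ₀ = frontier Ωp` is a closed smooth
hypersurface in `Ω`, enclosing `Ωp`, at distance at least `δ₀` from the boundary of `Ω`; the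
nearest-point projection onto `Σ₀` is smooth on the `4 δ₀`-neighbourhood of `Σ₀` in `Ω`. -/
structure IsInterface {d : ℕ} (Ω Ωp : Set (E d)) (δ₀ : ℝ) : Prop where
  isOpen_domain : IsOpen Ω
  connected_domain : IsConnected Ω
  bounded_domain : Bornology.IsBounded Ω
  boundary_domain : HasBoundaryOfClass 1 Ω
  isOpen_plus : IsOpen Ωp
  closure_plus : closure Ωp ⊆ Ω
  nonempty_interface : (frontier Ωp).Nonempty
  smooth_interface : HasBoundaryOfClass ∞ Ωp
  far : ∀ x ∈ frontier Ωp, ∀ y ∈ frontier Ω, δ₀ ≤ dist x y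
  projection : HasSmoothProjection (frontier Ωp)
    {x | x ∈ Ω ∧ Metric.infDist x (frontier Ωp) < 4 * δ₀}

/-- The assumptions on the cut-off function `φ` in the extension of the normal field. -/
structure IsCutoff (φ : ℝ → ℝ) : Prop where
  smooth : ContDiff ℝ ∞ φ
  nonneg : ∀ x, 0 ≤ φ x
  even : ∀ x, φ (-x) = φ x
  antitone : AntitoneOn φ (Icc 0 1)
  pos : ∀ x, |x| < 1 → 0 < φ x
  zero : ∀ x, 1 ≤ |x| → φ x = 0
  lower : ∀ x, |x| ≤ 1 / 2 → 1 - 4 * x ^ 2 ≤ φ x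
  upper : ∀ x, |x| ≤ 1 / 2 → φ x ≤ 1 - x ^ 2 / 2

/-- The extended inner normal field `ξ = φ(d_Σ / δ₀) ∇ d_Σ`. -/
def normalExt {d : ℕ} (φ : ℝ → ℝ) (δ₀ : ℝ) (Ωp : Set (E d)) (x : E d) : E d :=
  φ (sgnDist Ωp x / δ₀) • gradient (sgnDist Ωp) x

/-- The truncation `η` of the identity at height `δ₀`. -/
def trunc (δ₀ r : ℝ) : ℝ := max (-δ₀) (min r δ₀)

/-- `χ = 1` in `Ωp`, and `χ = -1` in `Ω⁻ = Ω \ closure Ωp`. -/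
def phase {d : ℕ} (Ω Ωp : Set (E d)) (x : E d) : ℝ :=
  Ωp.indicator (fun _ => (1 : ℝ)) x - (Ω \ closure Ωp).indicator (fun _ => (1 : ℝ)) x

/-! ### Sobolev spaces and traces -/

/-- `g` is the weak partial derivative of `u` in direction `i` on the open set `U`. -/
def IsWeakPartial {d : ℕ} {V : Type*} [NormedAddCommGroup V] [NormedSpace ℝ V]
    (U : Set (E d)) (i : Fin d) (u g : E d → V) : Prop :=
  ∀ θ : E d → ℝ, ContDiff ℝ ∞ θ → HasCompactSupport θ → tsupport θ ⊆ U →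
    ∫ x in U, (fderiv ℝ θ x (basisVec i)) • u x = -∫ x in U, θ x • g x

/-- `u ∈ H¹(U, V)`, with weak partial derivatives `Du i`. -/
structure MemH1 {d : ℕ} {V : Type*} [NormedAddCommGroup V] [NormedSpace ℝ V]
    (U : Set (E d)) (u : E d → V) (Du : Fin d → E d → V) : Prop where
  memLp : MemLp u 2 (volume.restrict U)
  memLp_deriv : ∀ i, MemLp (Du i) 2 (volume.restrict U)
  weak : ∀ i, IsWeakPartial U i u (Du i)

/-- `T ∈ L²(S, H^{d-1})` is the trace on `S ⊆ frontier U` of the function `u ∈ H¹(U, V)` with weak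
partial derivatives `Du`: some smooth functions on `ℝ^d` converge to `u` in `H¹(U)` while their
restrictions to `S` converge to `T` in `L²(S, H^{d-1})`. -/
def IsTrace {d : ℕ} {V : Type*} [NormedAddCommGroup V] [NormedSpace ℝ V]
    (U S : Set (E d)) (u : E d → V) (Du : Fin d → E d → V) (T : E d → V) : Prop :=
  MemLp T 2 ((Measure.hausdorffMeasure ((d : ℝ) - 1)).restrict S) ∧
  ∃ w : ℕ → E d → V, (∀ k, ContDiff ℝ ∞ (w k)) ∧
    Tendsto (fun k => eLpNorm (fun x => w k x - u x) 2 (volume.restrict U)) atTop (𝓝 0) ∧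
    (∀ i, Tendsto (fun k => eLpNorm (fun x => fderiv ℝ (w k) x (basisVec i) - Du i x) 2
      (volume.restrict U)) atTop (𝓝 0)) ∧
    Tendsto (fun k => eLpNorm (fun x => w k x - T x) 2
      ((Measure.hausdorffMeasure ((d : ℝ) - 1)).restrict S)) atTop (𝓝 0)

/-! ### The modulated energies -/

/-- The modulated energy
`E_ε[u | Σ₀] = ∫_Ω (ε/2 |∇u|² + F(u)/ε - ξ · ∇ψ)`, where `Du` are the weak partial derivatives of
`u` and `Dψ` those of `ψ = d_F ∘ u`; `|∇u|` is the Euclidean (Frobenius) norm. -/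
def modulatedEnergy {d n : ℕ} (f : ℝ → ℝ) (Up Um : Set (E n)) (φ : ℝ → ℝ) (δ₀ : ℝ)
    (Ω Ωp : Set (E d)) (ε : ℝ) (u : E d → E n) (Du : Fin d → E d → E n)
    (Dψ : Fin d → E d → ℝ) : ℝ :=
  ∫ x in Ω, (ε / 2 * (∑ i, ‖Du i x‖ ^ 2) + 1 / ε * potential f Up Um (u x)
    - ∑ i, normalExt φ δ₀ Ωp x i * Dψ i x)

/-- The modulated bulk energy `B[u | Σ₀]`; here `max (c_F - ψ) 0` and `max (ψ - c_F) 0` are the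
negative and the positive part of `ψ - c_F`. -/
def bulkEnergy {d n : ℕ} (f : ℝ → ℝ) (Up Um : Set (E n)) (δ₀ : ℝ)
    (Ω Ωp : Set (E d)) (u : E d → E n) : ℝ :=
  (∫ x in Ω, (surfaceTension f Up Um * phase Ω Ωp x - surfaceTension f Up Um
      + 2 * max (surfaceTension f Up Um - quasiDist f Up Um (u x)) 0)
        * trunc δ₀ (sgnDist Ωp x))
  + ∫ x in Ω, max (quasiDist f Up Um (u x) - surfaceTension f Up Um) 0
        * |trunc δ₀ (sgnDist Ωp x)|

end KRS

end

open Set Filter Topology MeasureTheory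
open scoped ContDiff

noncomputable section

namespace KRS

/-! ### The signed distance function -/

section SignedDistance

variable {d : ℕ} {U : Set (E d)}

/-! On each side of the interface, the given map into its well is pushed off the well along the
outward unit normal `ν`. At distance `t` from the interface the displacement is `s(t)`, which falls
from `ℓ`, half the distance of the wells, to `0`. The segment joining a minimal pair is normal to
both wells, so both traces are carried to its midpoint and the two halves glue to an `H¹` map.

The profile (`exists_profile`) solves `ε s' = -G(s) - ε Λ √s` with `G(l) = √(2 f(l²))` and `Λ =
2√ℓ/δ`. The first term is the optimal transition. The second makes `s` vanish from distance `δ` on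
and adds only `O(ε)` to the energy. Since `G(l) ≥ κ l` on `[0, ℓ]`, `s` decays at a rate of order
`1/ε`, hence `t s(t) ≤ K ε`. This inequality carries all the error estimates.

Energy. The weak derivatives of the given map `p` are tangential to the well, and so are those of
`ν`. Hence `|∇u|² ≤ s'² + C |∇p|²` with coefficient exactly one in front of `s'²`, which is of order
`ε⁻²` (`exists_norm_fderiv_sideMap_sq_le`). Moreover `F(u) = f(s²)` (`potential_sideMap`).
Completing the square gives `ε/2 s'² + f(s²)/ε = G(s)(-s') + O(ε)`, and `G(s)(-s')` is the
derivative of the one-dimensional profile `Ψ` of `d_F`. The cut-off in `ξ` loses `1 - φ(t/δ₀) ≤ 4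
t²/δ₀²`, which `t s(t) ≤ K ε` absorbs (`exists_transition_energy_le`). Finally `ψ = d_F ∘ u` and `Ψ
∘ d_Σ` differ by a bounded amount, and only in a layer of width `O(ε)`. Integrating by parts against
the smooth field `ξ` replaces one by the other at cost `O(ε)` (`exists_calibration_error_le`). The
bulk energy is bounded by integrals of `t s(t)`, because `d_F` is Lipschitz.

One obstacle remains. An `H¹` map may take values far from the minimal pairs arbitrarily close to
the interface, and the normals there may run into a well again. The displacement is therefore
shortened to `s - μ(p)² c(s)`. The weight `μ` vanishes at the points of least distance to the other
well, and where `μ = 1` the displacement stays below `2 δ₀`. The potential is already constant from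
distance `δ₀` on, so this leaves the energy density unchanged. The square on `μ` preserves the
coefficient one above (`sq_sub_le`).

The analysis rests on comparing integrals over thin slabs with surface integrals in bi-Lipschitz
charts. This gives an estimate for boundary terms (`exists_boundary_estimate`), from which
`memH1_ite_comp` glues functions with equal traces. It also gives a trace inequality
(`exists_trace_inequality`), by which the traces lie in the wells (`ae_trace_mem`). As `d_F` is
merely Lipschitz, the weak derivatives of `ψ` arise as weak limits (`exists_memH1_lipschitz_comp`).
-/

lemma exists_mem_frontier_of_mem_of_notMem {x y : E d} (hx : x ∈ U) (hy : y ∉ U) :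
    ∃ t ∈ Icc (0 : ℝ) 1, x + t • (y - x) ∈ frontier U := by
  set γ : ℝ → E d := fun t => x + t • (y - x) with hγ
  have hc : Continuous γ := by fun_prop
  have hpre : IsPreconnected (γ '' Icc 0 1) := isPreconnected_Icc.image _ hc.continuousOn
  by_contra! hcon
  have hsub : γ '' Icc 0 1 ⊆ interior U ∪ (closure U)ᶜ := by
    rintro _ ⟨t, ht, rfl⟩
    have := hcon t ht
    by_cases h : γ t ∈ closure U
    · left
      by_contra h'
      exact this ⟨h, h'⟩
    · exact Or.inr h
  have h0 : γ 0 ∈ γ '' Icc 0 1 := ⟨0, by simp, rfl⟩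
  have h1 : γ 1 ∈ γ '' Icc 0 1 := ⟨1, by simp, rfl⟩
  have hx0 : γ 0 = x := by simp [hγ]
  have hy1 : γ 1 = y := by simp [hγ]
  have hi : γ 0 ∈ interior U := by
    rcases hsub h0 with h | h
    · exact h
    · exact absurd (subset_closure (hx0 ▸ hx)) h
  have ho : γ 1 ∈ (closure U)ᶜ := by
    rcases hsub h1 with h | h
    · exact absurd (interior_subset h) (hy1 ▸ hy)
    · exact h
  obtain ⟨z, -, hz1, hz2⟩ := hpre _ _ isOpen_interior isClosed_closure.isOpen_compl hsub
    ⟨_, h0, hi⟩ ⟨_, h1, ho⟩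
  exact hz2 (subset_closure (interior_subset hz1))

lemma exists_mem_frontier_dist_add {x y : E d} (hx : x ∈ U) (hy : y ∉ U) :
    ∃ z ∈ frontier U, dist x z + dist z y = dist x y := by
  obtain ⟨t, ht, hz⟩ := exists_mem_frontier_of_mem_of_notMem hx hy
  refine ⟨_, hz, ?_⟩
  have h1 : dist x (x + t • (y - x)) = t * dist x y := by
    rw [dist_eq_norm, dist_eq_norm, ← norm_neg (x - y)]
    simp [norm_smul, abs_of_nonneg ht.1]
  have h2 : dist (x + t • (y - x)) y = (1 - t) * dist x y := by
    rw [dist_eq_norm, dist_eq_norm]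
    have : x + t • (y - x) - y = (1 - t) • (x - y) := by module
    rw [this, norm_smul, Real.norm_of_nonneg (by linarith [ht.2])]
  rw [h1, h2]; ring

lemma abs_sgnDist (U : Set (E d)) (x : E d) :
    |sgnDist U x| = Metric.infDist x (frontier U) := by
  unfold sgnDist
  split_ifs
  · exact abs_of_nonneg Metric.infDist_nonneg
  · rw [abs_neg]; exact abs_of_nonneg Metric.infDist_nonneg

lemma sgnDist_eq_zero_iff (hne : (frontier U).Nonempty) {x : E d} :
    sgnDist U x = 0 ↔ x ∈ frontier U := by
  rw [← abs_eq_zero, abs_sgnDist, isClosed_frontier.mem_iff_infDist_zero hne]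

lemma sgnDist_pos_iff (hU : IsOpen U) (hne : (frontier U).Nonempty) {x : E d} :
    0 < sgnDist U x ↔ x ∈ U := by
  constructor
  · intro h
    by_contra hx
    rw [sgnDist, if_neg hx] at h
    linarith [Metric.infDist_nonneg (x := x) (s := frontier U)]
  · intro hx
    have h0 : sgnDist U x ≠ 0 := by
      rw [Ne, sgnDist_eq_zero_iff hne]
      intro h
      rw [hU.frontier_eq] at h
      exact h.2 hx
    rw [sgnDist, if_pos hx] at h0 ⊢
    exact lt_of_le_of_ne Metric.infDist_nonneg h0.symm

lemma sgnDist_neg_iff (hU : IsOpen U) (hne : (frontier U).Nonempty) {x : E d} :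
    sgnDist U x < 0 ↔ x ∉ closure U := by
  rw [closure_eq_self_union_frontier, mem_union, not_or, ← sgnDist_eq_zero_iff hne,
    ← sgnDist_pos_iff hU hne]
  constructor
  · intro h; constructor <;> [exact not_lt.2 h.le; exact h.ne]
  · rintro ⟨h1, h2⟩; exact lt_of_le_of_ne (not_lt.1 h1) h2

/-- Points on opposite sides are separated by a frontier point on the segment between them, so their
distances to the frontier add up to at most their mutual distance. -/
lemma sgnDist_lipschitz (U : Set (E d)) : LipschitzWith 1 (sgnDist U) := by
  have key : ∀ x y, x ∈ U → y ∉ U →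
      Metric.infDist x (frontier U) + Metric.infDist y (frontier U) ≤ dist x y := by
    intro x y hx hy
    obtain ⟨z, hz, h⟩ := exists_mem_frontier_dist_add hx hy
    have h1 := Metric.infDist_le_dist_of_mem (x := x) hz
    have h2 := Metric.infDist_le_dist_of_mem (x := y) hz
    rw [dist_comm y z] at h2
    linarith
  refine LipschitzWith.of_dist_le_mul fun x y => ?_
  rw [Real.dist_eq, NNReal.coe_one, one_mul]
  have hl : |Metric.infDist x (frontier U) - Metric.infDist y (frontier U)| ≤ dist x y := by
    have := (Metric.lipschitz_infDist_pt (frontier U)).dist_le_mul x y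
    rwa [Real.dist_eq, NNReal.coe_one, one_mul] at this
  have hx0 := Metric.infDist_nonneg (x := x) (s := frontier U)
  have hy0 := Metric.infDist_nonneg (x := y) (s := frontier U)
  unfold sgnDist
  split_ifs with h1 h2 h2
  · exact hl
  · rw [sub_neg_eq_add, abs_of_nonneg (by positivity)]; exact key x y h1 h2
  · have := key y x h2 h1
    rw [dist_comm y x] at this
    rw [abs_le]; constructor <;> linarith
  · rw [neg_sub_neg, abs_sub_comm]; exact hl

lemma mem_iff_of_segment_disjoint {x y : E d}
    (h : ∀ t ∈ Icc (0 : ℝ) 1, x + t • (y - x) ∉ frontier U) : x ∈ U ↔ y ∈ U := by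
  constructor
  · intro hx
    by_contra hy
    obtain ⟨t, ht, hz⟩ := exists_mem_frontier_of_mem_of_notMem hx hy
    exact h t ht hz
  · intro hy
    by_contra hx
    obtain ⟨t, ht, hz⟩ := exists_mem_frontier_of_mem_of_notMem hy hx
    refine h (1 - t) ⟨by linarith [ht.2], by linarith [ht.1]⟩ ?_
    convert hz using 1
    module

/-- Moving from `x` towards a nearest point `z` on the frontier by the fraction `t` multiplies the
signed distance by `1 - t`. -/
lemma sgnDist_add_smul_sub {x z : E d} (hz : z ∈ frontier U)
    (hx : Metric.infDist x (frontier U) = dist x z) {t : ℝ} (ht : t ∈ Icc (0 : ℝ) 1) :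
    sgnDist U (x + t • (z - x)) = (1 - t) * sgnDist U x := by
  have hne : (frontier U).Nonempty := ⟨z, hz⟩
  have hd1 : ∀ s ∈ Icc (0 : ℝ) 1, dist x (x + s • (z - x)) = s * dist x z := by
    intro s hs
    rw [dist_eq_norm, dist_eq_norm, ← norm_neg (x - z)]
    simp [norm_smul, abs_of_nonneg hs.1]
  have hd2 : ∀ s ∈ Icc (0 : ℝ) 1, dist (x + s • (z - x)) z = (1 - s) * dist x z := by
    intro s hs
    rw [dist_eq_norm, dist_eq_norm]
    have : x + s • (z - x) - z = (1 - s) • (x - z) := by module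
    rw [this, norm_smul, Real.norm_of_nonneg (by linarith [hs.2])]
  have hinf : ∀ s ∈ Icc (0 : ℝ) 1,
      Metric.infDist (x + s • (z - x)) (frontier U) = (1 - s) * dist x z := by
    intro s hs
    apply le_antisymm
    · rw [← hd2 s hs]; exact Metric.infDist_le_dist_of_mem hz
    · have := Metric.infDist_le_infDist_add_dist (s := frontier U) (x := x)
        (y := x + s • (z - x))
      rw [hx, hd1 s hs] at this
      linarith
  rcases eq_or_lt_of_le ht.2 with h1 | h1
  · subst h1
    have : x + (1 : ℝ) • (z - x) = z := by module
    rw [this, (sgnDist_eq_zero_iff hne).2 hz]; simp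
  rcases eq_or_ne (dist x z) 0 with h0 | h0
  · have : x = z := by simpa using h0
    subst this
    simp [(sgnDist_eq_zero_iff hne).2 hz]
  have hmem : x ∈ U ↔ x + t • (z - x) ∈ U := by
    apply mem_iff_of_segment_disjoint
    intro s hs
    have e : x + s • (x + t • (z - x) - x) = x + (s * t) • (z - x) := by module
    have hst : s * t ∈ Icc (0 : ℝ) 1 := ⟨mul_nonneg hs.1 ht.1, mul_le_one₀ hs.2 ht.1 ht.2⟩
    rw [e, isClosed_frontier.mem_iff_infDist_zero hne, hinf _ hst]
    have : s * t < 1 := by nlinarith [hs.1, hs.2, ht.1]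
    exact mul_ne_zero (by linarith) h0
  unfold sgnDist
  by_cases h : x ∈ U
  · rw [if_pos h, if_pos (hmem.1 h), hinf t ht, hx]
  · rw [if_neg h, if_neg (fun h' => h (hmem.2 h')), hinf t ht, hx]; ring

lemma infDist_eq_dist_of_forall_lt {S : Set (E d)} {x z : E d} (hz : z ∈ S)
    (h : ∀ y ∈ S, y ≠ z → dist x z < dist x y) : Metric.infDist x S = dist x z := by
  apply le_antisymm (Metric.infDist_le_dist_of_mem hz)
  refine (Metric.le_infDist ⟨z, hz⟩).2 fun y hy => ?_
  by_cases hyz : y = z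
  · rw [hyz]
  · exact (h y hy hyz).le

/-- The displacement to the nearest point is normal to the hypersurface, and its orientation
decides on which side a point lies. -/
lemma exists_smul_gradient_of_nearest {g : E d → ℝ} (hg : ContDiff ℝ ∞ g) {y z : E d}
    (hz : z ∈ frontier U)
    (hUg : ∀ᶠ w in 𝓝 z, (w ∈ U ↔ 0 < g w)) (hgz : fderiv ℝ g z ≠ 0)
    (hmin : ∀ w ∈ frontier U, w ≠ z → dist y z < dist y w) (hU : IsOpen U) :
    ∃ l : ℝ, y - z = l • gradient g z ∧ (y ∈ U ↔ 0 < l) := by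
  have hgd : Differentiable ℝ g := hg.differentiable (by simp)
  have hzU : z ∉ U := by rw [hU.frontier_eq] at hz; exact hz.2
  have hg0 : g z = 0 := by
    apply le_antisymm
    · by_contra h
      exact hzU (hUg.self_of_nhds.2 (not_le.1 h))
    · by_contra! h
      have h1 : ∀ᶠ w in 𝓝 z, g w < 0 := hgd.continuous.continuousAt.eventually_lt
        continuousAt_const h
      have h2 : ∀ᶠ w in 𝓝 z, w ∉ U := by
        filter_upwards [h1, hUg] with w hw1 hw2 hw
        linarith [hw2.1 hw]
      have h3 := frontier_subset_closure hz
      rw [mem_closure_iff_frequently] at h3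
      exact h3 h2
  have hfront : ∀ᶠ w in 𝓝 z, g w = 0 → w ∈ frontier U := by
    have h1 : ∀ᶠ w in 𝓝 z, fderiv ℝ g w ≠ 0 :=
      ((hg.continuous_fderiv (by simp)).continuousAt).eventually_ne hgz
    filter_upwards [h1, hUg.eventually_nhds, hUg] with w hw1 hw2 hw3 hw0
    rw [hU.frontier_eq]
    refine ⟨?_, fun h => by linarith [hw3.1 h]⟩
    rw [mem_closure_iff_frequently]
    intro hcon
    have hloc : IsLocalMax g w := by
      filter_upwards [hw2, hcon] with v hv1 hv2
      rw [hw0]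
      by_contra h
      exact hv2 (hv1.2 (not_le.1 h))
    exact hw1 hloc.fderiv_eq_zero
  have hgstrict : HasStrictFDerivAt g (fderiv ℝ g z) z :=
    (hg.contDiffAt).hasStrictFDerivAt (by simp)
  have hnorm : HasStrictFDerivAt (fun w => ‖w - y‖ ^ 2) (2 • (innerSL ℝ (z - y))) z := by
    have h1 : HasStrictFDerivAt (fun w : E d => w - y) (ContinuousLinearMap.id ℝ (E d)) z :=
      (hasStrictFDerivAt_id z).sub_const y
    simpa using (hasStrictFDerivAt_norm_sq (z - y)).comp z h1
  have hext : IsLocalExtrOn (fun w => ‖w - y‖ ^ 2) {w | g w = g z} z := by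
    left
    change ∀ᶠ w in 𝓝[{w | g w = g z}] z, ‖z - y‖ ^ 2 ≤ ‖w - y‖ ^ 2
    rw [eventually_nhdsWithin_iff]
    filter_upwards [hfront] with w hw hw'
    have hwf : w ∈ frontier U := hw (by rw [← hg0]; exact hw')
    have : dist y z ≤ dist y w := by
      by_cases h : w = z
      · rw [h]
      · exact (hmin w hwf h).le
    rw [dist_comm y, dist_comm y, dist_eq_norm, dist_eq_norm] at this
    gcongr
  -- The point `z` minimises the distance to `y` on a level set of `g`, so Lagrange multipliers make
  -- `y - z` parallel to the gradient.
  obtain ⟨a, b, hab, hsum⟩ := hext.exists_multipliers_of_hasStrictFDerivAt_1d hgstrict hnorm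
  have hb : b ≠ 0 := by
    rintro rfl
    simp only [zero_smul, add_zero, smul_eq_zero] at hsum
    rcases hsum with h | h
    · exact hab (by simp [h])
    · exact hgz h
  have hgrad : ∀ v, fderiv ℝ g z v = inner ℝ (gradient g z) v := fun v => by
    simp [gradient]
  obtain ⟨l, hl⟩ : ∃ l : ℝ, y - z = l • gradient g z := by
    refine ⟨a / (2 * b), ?_⟩
    apply ext_inner_right ℝ
    intro v
    have := congrArg (fun T : StrongDual ℝ (E d) => T v) hsum
    simp only [add_apply, smul_apply, zero_apply, smul_eq_mul, innerSL_apply_apply, hgrad,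
      nsmul_eq_mul] at this
    have e : inner ℝ (z - y) v = -inner ℝ (y - z) v := by
      rw [← inner_neg_left, neg_sub]
    rw [e] at this
    rw [inner_smul_left]
    simp only [conj_trivial]
    field_simp
    push_cast at this
    linarith
  refine ⟨l, hl, ?_⟩
  have hinf := infDist_eq_dist_of_forall_lt hz hmin
  -- The sign of `l` is the sign of `g` just after leaving `z` towards `y`. The side does not change
  -- along this segment, so it is also the side of `y`.
  have hder : HasDerivAt (fun t : ℝ => g (z + t • (y - z))) (l * ‖gradient g z‖ ^ 2) 0 := by
    have h1 : HasDerivAt (fun t : ℝ => z + t • (y - z)) (y - z) 0 := by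
      simpa using ((hasDerivAt_id (0 : ℝ)).smul_const (y - z)).const_add z
    have h2 : HasFDerivAt g (fderiv ℝ g z) (z + (0 : ℝ) • (y - z)) := by
      simpa using (hgd z).hasFDerivAt
    have := h2.comp_hasDerivAt (0 : ℝ) h1
    refine this.congr_deriv ?_
    rw [hgrad, hl, inner_smul_right, real_inner_self_eq_norm_sq]
  have hgn : 0 < ‖gradient g z‖ ^ 2 := by
    have : gradient g z ≠ 0 := by
      simpa [gradient] using hgz
    positivity
  have hline : Tendsto (fun t : ℝ => z + t • (y - z)) (𝓝[>] 0) (𝓝 z) := by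
    have : Continuous (fun t : ℝ => z + t • (y - z)) := by fun_prop
    have := this.tendsto 0
    simp only [zero_smul, add_zero] at this
    exact this.mono_left nhdsWithin_le_nhds
  have hsgn : ∀ t ∈ Ioc (0 : ℝ) 1, sgnDist U (z + t • (y - z)) = t * sgnDist U y := by
    intro t ht
    have := sgnDist_add_smul_sub hz hinf (t := 1 - t) ⟨by linarith [ht.2], by linarith [ht.1]⟩
    rw [show y + (1 - t) • (z - y) = z + t • (y - z) by module] at this
    rw [this]; ring
  have hne : (frontier U).Nonempty := ⟨z, hz⟩
  have hev : ∀ᶠ t : ℝ in 𝓝[>] 0, (y ∈ U ↔ 0 < g (z + t • (y - z))) := by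
    filter_upwards [hline.eventually hUg, Ioc_mem_nhdsGT (zero_lt_one)] with t h1 h2
    rw [← h1, ← sgnDist_pos_iff hU hne, ← sgnDist_pos_iff hU hne, hsgn t h2]
    exact ⟨fun h => mul_pos h2.1 h, fun h => pos_of_mul_pos_right h h2.1.le⟩
  have hslope : Tendsto (fun t : ℝ => t⁻¹ * g (z + t • (y - z))) (𝓝[>] 0)
      (𝓝 (l * ‖gradient g z‖ ^ 2)) := by
    have := hder.tendsto_slope_zero_right
    simpa [hg0] using this
  constructor
  · intro hy
    by_contra hl0
    have hy0 : y ≠ z := fun h => hzU (h ▸ hy)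
    have hlne : l ≠ 0 := by
      rintro rfl
      rw [zero_smul, sub_eq_zero] at hl
      exact hy0 hl
    have hneg : l * ‖gradient g z‖ ^ 2 < 0 :=
      mul_neg_of_neg_of_pos (lt_of_le_of_ne (not_lt.1 hl0) hlne) hgn
    obtain ⟨t, ht1, ht2, ht3⟩ := ((hslope.eventually_lt tendsto_const_nhds hneg).and
      (hev.and self_mem_nhdsWithin)).exists
    have := ht2.1 hy
    have h4 : 0 < t⁻¹ * g (z + t • (y - z)) := mul_pos (inv_pos.2 ht3) this
    linarith
  · intro hl0
    obtain ⟨t, ht1, ht2, ht3⟩ := ((tendsto_const_nhds.eventually_lt hslope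
      (mul_pos hl0 hgn)).and (hev.and self_mem_nhdsWithin)).exists
    exact ht2.2 (pos_of_mul_pos_right ht1 (inv_pos.2 ht3).le)

end SignedDistance

/-! ### Smoothness of the signed distance and its behaviour along normals -/

section SmoothDistance

variable {d : ℕ} {U N : Set (E d)}

/-- Off the frontier the function is `± ‖y - P y‖`. At the frontier this norm is not smooth. There
it is replaced by the component of `y - P y` along the unit normal at `P y`, which has the right
sign because `y - P y` is a multiple of that normal. -/
lemma contDiffOn_sgnDist (hU : IsOpen U) (hb : HasBoundaryOfClass ∞ U)
    (hN : IsOpen N) (hP : HasSmoothProjection (frontier U) N) :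
    ContDiffOn ℝ ∞ (sgnDist U) N := by
  obtain ⟨P, hPs, hPmin⟩ := hP
  intro x hx
  apply ContDiffAt.contDiffWithinAt
  have hne : (frontier U).Nonempty := ⟨_, (hPmin x hx).1⟩
  have hPx : ContDiffAt ℝ ∞ P x := hPs.contDiffAt (hN.mem_nhds hx)
  have hinf : ∀ y ∈ N, Metric.infDist y (frontier U) = ‖y - P y‖ := fun y hy => by
    rw [infDist_eq_dist_of_forall_lt (hPmin y hy).1 (hPmin y hy).2, dist_eq_norm]
  by_cases hxf : x ∈ frontier U
  · have hPxx : P x = x := by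
      by_contra h
      have := (hPmin x hx).2 x hxf (fun h' => h h'.symm)
      rw [dist_self] at this
      exact absurd this (not_lt.2 dist_nonneg)
    obtain ⟨g, hg, hgx, hUg⟩ := hb x hxf
    have hgrad : ContDiff ℝ ∞ (gradient g) := by
      have h1 : ContDiff ℝ ∞ (fderiv ℝ g) := hg.fderiv_right (by simp)
      exact (InnerProductSpace.toDual ℝ (E d)).symm.contDiff.comp h1
    have hPt : Tendsto P (𝓝 x) (𝓝 x) := by
      have := hPx.continuousAt.tendsto
      rwa [hPxx] at this
    have hgne : ∀ᶠ w in 𝓝 x, fderiv ℝ g w ≠ 0 :=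
      ((hg.continuous_fderiv (by simp)).continuousAt).eventually_ne hgx
    have hgx' : gradient g (P x) ≠ 0 := by
      rw [hPxx]; simpa [gradient] using hgx
    have hcomp : ContDiffAt ℝ ∞ (fun y => gradient g (P y)) x :=
      hgrad.contDiffAt.comp x hPx
    have hform : ContDiffAt ℝ ∞ (fun y => inner ℝ (y - P y) (gradient g (P y)) /
        ‖gradient g (P y)‖) x := by
      refine ContDiffAt.div ?_ (hcomp.norm ℝ hgx') (by simpa using hgx')
      exact (contDiffAt_id.sub hPx).inner ℝ hcomp
    refine hform.congr_of_eventuallyEq ?_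
    filter_upwards [hN.mem_nhds hx, hPt.eventually hgne, hPt.eventually hUg.eventually_nhds]
      with y hy hy1 hy2
    obtain ⟨l, hl, hl2⟩ := exists_smul_gradient_of_nearest hg (hPmin y hy).1 hy2 hy1
      (hPmin y hy).2 hU
    have hpos : 0 < ‖gradient g (P y)‖ := by
      rw [norm_pos_iff]; simpa [gradient] using hy1
    have hval : inner ℝ (y - P y) (gradient g (P y)) / ‖gradient g (P y)‖
        = l * ‖gradient g (P y)‖ := by
      rw [hl, inner_smul_left, real_inner_self_eq_norm_sq]
      simp only [conj_trivial]
      field_simp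
    rw [hval, sgnDist, hinf y hy, hl, norm_smul]
    split_ifs with h
    · rw [Real.norm_of_nonneg (hl2.1 h).le]
    · rw [Real.norm_of_nonpos (not_lt.1 fun h' => h (hl2.2 h'))]; ring
  · have hxP : x - P x ≠ 0 := by
      rw [sub_ne_zero]
      intro h
      exact hxf (h ▸ (hPmin x hx).1)
    have hform : ContDiffAt ℝ ∞ (fun y => ‖y - P y‖) x :=
      (contDiffAt_id.sub hPx).norm ℝ hxP
    by_cases h : x ∈ U
    · refine hform.congr_of_eventuallyEq ?_
      filter_upwards [hN.mem_nhds hx, hU.mem_nhds h] with y hy hyU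
      rw [sgnDist, if_pos hyU, hinf y hy]
    · refine hform.neg.congr_of_eventuallyEq ?_
      have h2 : x ∈ (closure U)ᶜ := by
        rw [mem_compl_iff, closure_eq_self_union_frontier]
        exact fun h' => h'.elim h hxf
      filter_upwards [hN.mem_nhds hx, isClosed_closure.isOpen_compl.mem_nhds h2] with y hy hyU
      rw [sgnDist, if_neg (fun h => hyU (subset_closure h)), hinf y hy]

/-- The Lipschitz bound gives `≤ 1`. Off the frontier the signed distance is affine on the segment
to the nearest point, with slope `± 1` per unit length, which gives `≥ 1`. Frontier points follow by
continuity from inside `U`. -/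
lemma norm_fderiv_sgnDist (hU : IsOpen U) (hb : HasBoundaryOfClass ∞ U)
    (hN : IsOpen N) (hP : HasSmoothProjection (frontier U) N) {x : E d} (hx : x ∈ N) :
    ‖fderiv ℝ (sgnDist U) x‖ = 1 := by
  have hsm := contDiffOn_sgnDist hU hb hN hP
  obtain ⟨P, hPs, hPmin⟩ := hP
  have hne : (frontier U).Nonempty := ⟨_, (hPmin x hx).1⟩
  have hle : ∀ y, ‖fderiv ℝ (sgnDist U) y‖ ≤ 1 := fun y => by
    simpa using norm_fderiv_le_of_lipschitz ℝ (sgnDist_lipschitz U) (x₀ := y)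
  have hoff : ∀ y ∈ N, y ∉ frontier U → ‖fderiv ℝ (sgnDist U) y‖ = 1 := by
    intro y hy hyf
    apply le_antisymm (hle y)
    have hinf := infDist_eq_dist_of_forall_lt (hPmin y hy).1 (hPmin y hy).2
    have hd : HasFDerivAt (sgnDist U) (fderiv ℝ (sgnDist U) y) (y + (0 : ℝ) • (P y - y)) := by
      simpa using ((hsm.contDiffAt (hN.mem_nhds hy)).differentiableAt (by simp)).hasFDerivAt
    have h1 : HasDerivAt (fun t : ℝ => y + t • (P y - y)) (P y - y) 0 := by
      simpa using ((hasDerivAt_id (0 : ℝ)).smul_const (P y - y)).const_add y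
    have h2 : HasDerivWithinAt (fun t : ℝ => sgnDist U (y + t • (P y - y)))
        (fderiv ℝ (sgnDist U) y (P y - y)) (Icc 0 1) 0 :=
      (HasFDerivAt.comp_hasDerivAt (f := fun t : ℝ => y + t • (P y - y)) (0 : ℝ) hd
        h1).hasDerivWithinAt
    have h3 : HasDerivWithinAt (fun t : ℝ => sgnDist U (y + t • (P y - y)))
        (-sgnDist U y) (Icc 0 1) 0 := by
      have : HasDerivAt (fun t : ℝ => (1 - t) * sgnDist U y) (-sgnDist U y) 0 := by
        simpa using ((hasDerivAt_id (0 : ℝ)).const_sub 1).mul_const (sgnDist U y)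
      refine this.hasDerivWithinAt.congr (fun t ht => ?_) ?_
      · exact sgnDist_add_smul_sub (hPmin y hy).1 hinf ht
      · simp
    -- The affine formula holds only on `[0, 1]`, so the derivatives are compared as one-sided ones.
    have h4 := (uniqueDiffOn_Icc (zero_lt_one (α := ℝ)) 0 (by simp)).eq_deriv _ h2 h3
    have h5 := (fderiv ℝ (sgnDist U) y).le_opNorm (P y - y)
    rw [h4, norm_neg, Real.norm_eq_abs, abs_sgnDist, hinf, ← dist_eq_norm, dist_comm] at h5
    have h6 : 0 < dist (P y) y := by
      rw [dist_pos]; intro h; exact hyf (h ▸ (hPmin y hy).1)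
    exact le_of_mul_le_mul_right (by linarith) h6
  by_cases hxf : x ∈ frontier U
  · have hcont : ContinuousAt (fun y => ‖fderiv ℝ (sgnDist U) y‖) x :=
      (((hsm.contDiffAt (hN.mem_nhds hx)).fderiv_right (m := 0) (by simp)).continuousAt).norm
    have hfr : ∃ᶠ y in 𝓝 x, y ∈ U := by
      rw [← mem_closure_iff_frequently]; exact frontier_subset_closure hxf
    have hfr2 : ∃ᶠ y in 𝓝 x, ‖fderiv ℝ (sgnDist U) y‖ = 1 := by
      refine (hfr.and_eventually (hN.mem_nhds hx)).mono fun y hy => hoff y hy.2 ?_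
      rw [hU.frontier_eq]
      exact fun h => h.2 hy.1
    by_contra h
    exact hfr2 (hcont.eventually_ne h)
  · exact hoff x hx hxf

/-- The signed distance is affine, with slope one, along the normal lines. -/
lemma sgnDist_sub_smul_gradient {ρ : ℝ} (hsm : ContDiffOn ℝ ∞ (sgnDist U)
      {x | Metric.infDist x (frontier U) < ρ})
    (hnorm : ∀ x, Metric.infDist x (frontier U) < ρ → ‖fderiv ℝ (sgnDist U) x‖ = 1)
    {p : E d} (hp : p ∈ frontier U) {t : ℝ} (ht : t ∈ Ico (0 : ℝ) ρ) :
    sgnDist U (p - t • gradient (sgnDist U) p) = -t := by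
  set D := sgnDist U with hD
  set N := {x : E d | Metric.infDist x (frontier U) < ρ} with hNdef
  have hN : IsOpen N := isOpen_lt (Metric.continuous_infDist_pt _) continuous_const
  have hgrad : ∀ x v, fderiv ℝ D x v = inner ℝ (gradient D x) v := fun x v => by
    simp [gradient]
  have hgn : ∀ x, ‖gradient D x‖ = ‖fderiv ℝ D x‖ := fun x => by simp [gradient]
  have hpN : p ∈ N := by
    rw [hNdef, mem_ofPred_eq, (isClosed_frontier.mem_iff_infDist_zero ⟨p, hp⟩).1 hp]
    exact lt_of_le_of_lt ht.1 ht.2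
  set w := gradient D p with hw
  have hw1 : ‖w‖ = 1 := by rw [hw, hgn, hnorm p hpN]
  set γ : ℝ → E d := fun s => p - s • w with hγ
  have hγN : ∀ s ∈ Icc (0 : ℝ) t, γ s ∈ N := by
    intro s hs
    have : dist (γ s) p = s := by
      rw [dist_eq_norm]; simp [hγ, norm_smul, hw1, abs_of_nonneg hs.1]
    have h2 := Metric.infDist_le_dist_of_mem (x := γ s) hp
    rw [hNdef, mem_ofPred_eq]
    linarith [hs.2, ht.2]
  have hγd : ∀ s, HasDerivAt γ (-w) s := fun s => by
    simpa [hγ] using ((hasDerivAt_id s).smul_const w).const_sub p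
  have hf1 : ∀ x ∈ N, ContDiffAt ℝ ∞ (fderiv ℝ D) x := fun x hx =>
    (hsm.contDiffAt (hN.mem_nhds hx)).fderiv_right (by simp)
  have hf2 : ∀ x ∈ N, HasFDerivAt (fderiv ℝ D) (fderiv ℝ (fderiv ℝ D) x) x := fun x hx =>
    ((hf1 x hx).differentiableAt (by simp)).hasFDerivAt
  -- Differentiate `|∇D|² = 1` and use the symmetry of the Hessian.
  have hkill : ∀ x ∈ N, fderiv ℝ (fderiv ℝ D) x (gradient D x) = 0 := by
    intro x hx
    ext v
    have hsymm : IsSymmSndFDerivAt ℝ D x :=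
      (hsm.contDiffAt (hN.mem_nhds hx)).isSymmSndFDerivAt
        (by rw [minSmoothness_of_isRCLikeNormedField]; exact WithTop.coe_le_coe.2 (le_top : (2 : ℕ∞) ≤ ⊤))
    rw [hsymm.eq]
    have hgd : HasFDerivAt (gradient D)
        ((InnerProductSpace.toDual ℝ (E d)).symm.toContinuousLinearEquiv.toContinuousLinearMap.comp
          (fderiv ℝ (fderiv ℝ D) x)) x :=
      ((InnerProductSpace.toDual ℝ (E d)).symm.toContinuousLinearEquiv.hasFDerivAt).comp x
        (hf2 x hx)
    have h1 := hgd.norm_sq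
    have h2 : HasFDerivAt (fun y => ‖gradient D y‖ ^ 2) (0 : E d →L[ℝ] ℝ) x := by
      refine (hasFDerivAt_const (1 : ℝ) x).congr_of_eventuallyEq ?_
      filter_upwards [hN.mem_nhds hx] with y hy
      rw [hgn, hnorm y hy, one_pow]
    have h3 := congrArg (fun T : E d →L[ℝ] ℝ => T v) (h1.unique h2)
    simp only [smul_apply, ContinuousLinearMap.comp_apply, innerSL_apply_apply,
      zero_apply, nsmul_eq_mul] at h3
    have h4 : inner ℝ (gradient D x) ((InnerProductSpace.toDual ℝ (E d)).symm
        (fderiv ℝ (fderiv ℝ D) x v)) = 0 := by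
      have := h3
      push_cast at this
      simpa using this
    rwa [real_inner_comm, InnerProductSpace.toDual_symm_apply] at h4
  have hcontH : ContinuousOn (fun s => ‖fderiv ℝ (fderiv ℝ D) (γ s)‖) (Icc 0 t) := by
    intro s hs
    have h0 : ContDiffAt ℝ 0 (fderiv ℝ (fderiv ℝ D)) (γ s) :=
      (hf1 _ (hγN s hs)).fderiv_right (by simp)
    have h1 : ContinuousAt (fun y => ‖fderiv ℝ (fderiv ℝ D) y‖) (γ s) :=
      Filter.Tendsto.norm (E := E d →L[ℝ] E d →L[ℝ] ℝ) (f := fderiv ℝ (fderiv ℝ D)) h0.continuousAt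
    exact (ContinuousAt.comp h1 (hγd s).continuousAt).continuousWithinAt
  obtain ⟨K, hK⟩ : ∃ K, ∀ s ∈ Icc (0 : ℝ) t, ‖fderiv ℝ (fderiv ℝ D) (γ s)‖ ≤ K := by
    obtain ⟨K, hK⟩ := isCompact_Icc.bddAbove_image hcontH
    exact ⟨K, fun s hs => hK ⟨s, hs, rfl⟩⟩
  set e : ℝ → StrongDual ℝ (E d) := fun s => fderiv ℝ D (γ s) - fderiv ℝ D p with he
  have hed : ∀ s ∈ Icc (0 : ℝ) t, HasDerivAt e (fderiv ℝ (fderiv ℝ D) (γ s) (-w)) s := by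
    intro s hs
    exact ((hf2 _ (hγN s hs)).comp_hasDerivAt s (hγd s)).sub_const _
  -- Grönwall: since the Hessian kills `∇D`, the derivative of `e` is the Hessian applied to `∇D(γ
  -- s) - w`, a vector of norm `‖e s‖`. Hence the gradient is constant along the straight normal
  -- line.
  have hezero : ∀ s ∈ Icc (0 : ℝ) t, e s = 0 := by
    apply eq_zero_of_abs_deriv_le_mul_abs_self_of_eq_zero_right (K := K)
      (f' := fun s => fderiv ℝ (fderiv ℝ D) (γ s) (-w))
    · exact fun s hs => (hed s hs).continuousAt.continuousWithinAt
    · exact fun s hs => (hed s (Ico_subset_Icc_self hs)).hasDerivWithinAt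
    · simp [he, hγ]
    · intro s hs
      have hs' := Ico_subset_Icc_self hs
      have h1 : fderiv ℝ (fderiv ℝ D) (γ s) (-w)
          = fderiv ℝ (fderiv ℝ D) (γ s) (gradient D (γ s) - w) := by
        rw [map_sub, hkill _ (hγN s hs'), map_neg, zero_sub]
      have h2 : ‖gradient D (γ s) - w‖ = ‖e s‖ := by
        rw [he, hw]
        simp only [gradient]
        rw [← map_sub, LinearIsometryEquiv.norm_map]
      rw [h1, ← h2]
      exact (ContinuousLinearMap.le_opNorm _ _).trans
        (mul_le_mul_of_nonneg_right (hK s hs') (norm_nonneg _))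
  have hline : ∀ s ∈ Icc (0 : ℝ) t, HasDerivAt (fun s => D (γ s) + s) 0 s := by
    intro s hs
    have h1 : HasFDerivAt D (fderiv ℝ D (γ s)) (γ s) :=
      ((hsm.contDiffAt (hN.mem_nhds (hγN s hs))).differentiableAt (by simp)).hasFDerivAt
    have h2 := (h1.comp_hasDerivAt s (hγd s)).add (hasDerivAt_id s)
    refine h2.congr_deriv ?_
    have : fderiv ℝ D (γ s) = fderiv ℝ D p := sub_eq_zero.1 (hezero s hs)
    rw [this, hgrad, inner_neg_right, ← hw, real_inner_self_eq_norm_sq, hw1]; norm_num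
  have hconst := constant_of_has_deriv_right_zero (f := fun s => D (γ s) + s) (a := 0) (b := t)
    (fun s hs => (hline s hs).continuousAt.continuousWithinAt)
    (fun s hs => (hline s (Ico_subset_Icc_self hs)).hasDerivWithinAt) t ⟨ht.1, le_rfl⟩
  have h0 : D (γ 0) = 0 := by
    simp only [hγ, zero_smul, sub_zero]
    exact (sgnDist_eq_zero_iff ⟨p, hp⟩).2 hp
  simp only [h0, add_zero] at hconst
  change D (γ t) = -t
  linarith

end SmoothDistance

/-! ### Flattening a level set -/

section Chart

open scoped NNReal ENNReal

variable {m : ℕ}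

/-- A bi-Lipschitz chart which turns the function `D` into a coordinate. -/
structure FlatChart (D : E (m + 1) → ℝ) (p : E (m + 1)) where
  W : Set (E (m + 1))
  isOpen_W : IsOpen W
  mem_W : p ∈ W
  j : Fin (m + 1)
  c : Fin (m + 1) → ℝ
  c_j : c j = 0
  ρ : ℝ
  ρ_pos : 0 < ρ
  K : ℝ≥0
  toFun : E (m + 1) → (Fin (m + 1) → ℝ)
  invFun : (Fin (m + 1) → ℝ) → E (m + 1)
  mapsTo : MapsTo toFun W (Metric.ball c ρ)
  mapsTo_inv : MapsTo invFun (Metric.ball c ρ) W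
  left_inv : ∀ x ∈ W, invFun (toFun x) = x
  right_inv : ∀ y ∈ Metric.ball c ρ, toFun (invFun y) = y
  lipschitz : LipschitzOnWith K toFun W
  lipschitz_inv : LipschitzOnWith K invFun (Metric.ball c ρ)
  apply_j : ∀ x, toFun x j = D x
  measurable_inv : Measurable invFun

/-- Choose a coordinate in whose direction `D` has nonzero derivative and replace it by `D`. The
quantitative inverse function theorem gives Lipschitz bounds for the map and its inverse. -/
lemma nonempty_flatChart {D : E (m + 1) → ℝ} {p : E (m + 1)} (hD : ContDiffAt ℝ 1 D p)
    (hp : D p = 0) (hgrad : fderiv ℝ D p ≠ 0) : Nonempty (FlatChart D p) := by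
  obtain ⟨j, hj⟩ : ∃ j, fderiv ℝ D p (basisVec j) ≠ 0 := by
    by_contra! h
    apply hgrad
    ext x
    have hx : x = ∑ i, x i • (basisVec i : E (m + 1)) := by
      have := (EuclideanSpace.basisFun (Fin (m + 1)) ℝ).sum_repr x
      simpa [basisVec] using this.symm
    rw [hx, map_sum]
    simp [h]
  set Ψ : E (m + 1) → (Fin (m + 1) → ℝ) := fun x i => if i = j then D x else x i with hΨ
  set L : E (m + 1) →L[ℝ] (Fin (m + 1) → ℝ) := ContinuousLinearMap.pi
    (fun i => if i = j then fderiv ℝ D p else EuclideanSpace.proj i) with hL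
  have hstrict : HasStrictFDerivAt Ψ L p := by
    rw [hasStrictFDerivAt_pi']
    intro i
    by_cases hi : i = j
    · have h1 : HasStrictFDerivAt D (fderiv ℝ D p) p := hD.hasStrictFDerivAt (by simp)
      simpa [hΨ, hL, hi, ContinuousLinearMap.proj_pi] using h1
    · have h1 : HasStrictFDerivAt (fun x : E (m + 1) => x i)
          (EuclideanSpace.proj i : E (m + 1) →L[ℝ] ℝ) p :=
        (EuclideanSpace.proj i : E (m + 1) →L[ℝ] ℝ).hasStrictFDerivAt
      simpa [hΨ, hL, hi, ContinuousLinearMap.proj_pi] using h1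
  have hinj : Function.Injective L := by
    rw [injective_iff_map_eq_zero]
    intro v hv
    have h1 : ∀ i, i ≠ j → v i = 0 := fun i hi => by
      have := congrFun hv i
      simpa [hL, hi] using this
    have h2 : fderiv ℝ D p v = 0 := by
      have := congrFun hv j
      simpa [hL] using this
    have h3 : v = v j • (basisVec j : E (m + 1)) := by
      ext i
      by_cases hi : i = j
      · subst hi; simp [basisVec]
      · simp [basisVec, h1 i hi, hi]
    rw [h3, map_smul, smul_eq_mul] at h2
    rcases mul_eq_zero.1 h2 with h | h
    · rw [h3, h, zero_smul]
    · exact absurd h hj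
  set Le : E (m + 1) ≃L[ℝ] (Fin (m + 1) → ℝ) :=
    (LinearEquiv.ofInjectiveOfFinrankEq L.toLinearMap hinj
      (by simp)).toContinuousLinearEquiv with hLe
  have hLeL : (Le : E (m + 1) →L[ℝ] (Fin (m + 1) → ℝ)) = L := by
    ext x i
    simp only [hLe, ContinuousLinearEquiv.coe_coe, LinearEquiv.coe_toContinuousLinearEquiv']
    rfl
  rw [← hLeL] at hstrict
  have : Nontrivial (E (m + 1)) := ⟨⟨basisVec j, 0, by
    intro h
    exact hj (by rw [h, map_zero])⟩⟩
  obtain ⟨s, hps, hs, happ⟩ := hstrict.approximates_deriv_on_open_nhds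
  have hc : Subsingleton (E (m + 1)) ∨
      ‖(Le.symm : (Fin (m + 1) → ℝ) →L[ℝ] E (m + 1))‖₊⁻¹ / 2 <
      ‖(Le.symm : (Fin (m + 1) → ℝ) →L[ℝ] E (m + 1))‖₊⁻¹ := by
    right
    exact NNReal.half_lt_self (ne_of_gt (inv_pos.2 Le.nnnorm_symm_pos))
  set e := happ.toOpenPartialHomeomorph Ψ s hc hs with he
  have hes : e.source = s := rfl
  have hecoe : (e : E (m + 1) → (Fin (m + 1) → ℝ)) = Ψ := rfl
  have hpt : Ψ p ∈ e.target := e.map_source hps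
  obtain ⟨ρ, hρ, hball⟩ := Metric.isOpen_iff.1 e.open_target _ hpt
  have hlip := happ.lipschitz
  have hanti := happ.antilipschitz hc
  set K1 := ‖(Le : E (m + 1) →L[ℝ] (Fin (m + 1) → ℝ))‖₊ +
    ‖(Le.symm : (Fin (m + 1) → ℝ) →L[ℝ] E (m + 1))‖₊⁻¹ / 2
  set K2 := (‖(Le.symm : (Fin (m + 1) → ℝ) →L[ℝ] E (m + 1))‖₊⁻¹ -
    ‖(Le.symm : (Fin (m + 1) → ℝ) →L[ℝ] E (m + 1))‖₊⁻¹ / 2)⁻¹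
  have hapj : ∀ x, Ψ x j = D x := fun x => by simp [hΨ]
  classical
  -- Giving the inverse the constant value `p` outside the ball makes it measurable on the whole
  -- space.
  have hpw : ∀ y ∈ Metric.ball (Ψ p) ρ,
      (Metric.ball (Ψ p) ρ).piecewise e.symm (fun _ => p) y = e.symm y :=
    fun y hy => piecewise_eq_of_mem _ _ _ hy
  refine ⟨{ W := e.source ∩ e ⁻¹' (Metric.ball (Ψ p) ρ)
            isOpen_W := e.isOpen_inter_preimage Metric.isOpen_ball
            mem_W := ⟨hps, Metric.mem_ball_self hρ⟩
            j := j
            c := Ψ p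
            c_j := by rw [hapj, hp]
            ρ := ρ
            ρ_pos := hρ
            K := max K1 K2
            toFun := Ψ
            invFun := (Metric.ball (Ψ p) ρ).piecewise e.symm (fun _ => p)
            mapsTo := fun x hx => hx.2
            mapsTo_inv := fun y hy => by
              rw [hpw y hy]
              exact ⟨e.map_target (hball hy), by
                rw [mem_preimage, e.right_inv (hball hy)]; exact hy⟩
            left_inv := fun x hx => (hpw _ hx.2).trans (e.left_inv hx.1)
            right_inv := fun y hy => by rw [hpw y hy]; exact e.right_inv (hball hy)
            lipschitz := ?_
            lipschitz_inv := ?_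
            apply_j := hapj
            measurable_inv := ContinuousOn.measurable_piecewise
              (e.continuousOn_symm.mono hball) continuousOn_const measurableSet_ball }⟩
  · have h1 : LipschitzOnWith K1 Ψ s := lipschitzOnWith_iff_restrict.2 hlip
    exact (h1.mono (fun x hx => hx.1)).weaken (le_max_left _ _)
  · have h1 : LipschitzOnWith K2 e.symm (Metric.ball (Ψ p) ρ) := by
      intro y hy y' hy'
      have := hanti ⟨e.symm y, e.map_target (hball hy)⟩ ⟨e.symm y', e.map_target (hball hy')⟩
      simp only [domRestrict_apply] at this
      have e1 : Ψ (e.symm y) = y := e.right_inv (hball hy)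
      have e2 : Ψ (e.symm y') = y' := e.right_inv (hball hy')
      rwa [e1, e2] at this
    have h2 : LipschitzOnWith K2 ((Metric.ball (Ψ p) ρ).piecewise e.symm (fun _ => p))
        (Metric.ball (Ψ p) ρ) := fun y hy y' hy' => by
      rw [hpw y hy, hpw y' hy']; exact h1 hy hy'
    exact h2.weaken (le_max_right _ _)

/-- A comparison of measures along a map yields a comparison of integrals. -/
lemma setLIntegral_le_of_measure_le {X Y : Type*} [MeasurableSpace X] [MeasurableSpace Y]
    {μ : Measure X} {ν : Measure Y} {S : Set X} {T : Set Y} {f : X → Y} {C : ℝ≥0∞}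
    (hf : AEMeasurable f (μ.restrict S)) (hS : MeasurableSet S)
    (h : ∀ A, MeasurableSet A → ν (A ∩ T) ≤ C * μ (S ∩ f ⁻¹' A))
    {g : Y → ℝ≥0∞} (hg : Measurable g) :
    ∫⁻ y in T, g y ∂ν ≤ C * ∫⁻ x in S, g (f x) ∂μ := by
  have hle : ν.restrict T ≤ C • (μ.restrict S).map f := by
    rw [Measure.le_iff]
    intro A hA
    rw [Measure.restrict_apply hA, Measure.smul_apply, smul_eq_mul,
      Measure.map_apply_of_aemeasurable hf hA, Measure.restrict_apply' hS, inter_comm _ S]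
    exact h A hA
  calc ∫⁻ y in T, g y ∂ν ≤ ∫⁻ y, g y ∂(C • (μ.restrict S).map f) := lintegral_mono' hle le_rfl
    _ = C * ∫⁻ x in S, g (f x) ∂μ := by
      rw [lintegral_smul_measure, smul_eq_mul, lintegral_map' hg.aemeasurable hf]

lemma setLIntegral_comp_le_of_measure_le {X Y : Type*} [MeasurableSpace X] [MeasurableSpace Y]
    {μ : Measure X} {ν : Measure Y} {S : Set X} {T : Set Y} {f : X → Y} {C : ℝ≥0∞}
    (hf : AEMeasurable f (μ.restrict S)) (hS : MeasurableSet S)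
    (h : ∀ A, MeasurableSet A → μ (S ∩ f ⁻¹' A) ≤ C * ν (A ∩ T))
    {g : Y → ℝ≥0∞} (hg : Measurable g) :
    ∫⁻ x in S, g (f x) ∂μ ≤ C * ∫⁻ y in T, g y ∂ν := by
  have hle : (μ.restrict S).map f ≤ C • ν.restrict T := by
    rw [Measure.le_iff]
    intro A hA
    rw [Measure.smul_apply, smul_eq_mul, Measure.restrict_apply hA,
      Measure.map_apply_of_aemeasurable hf hA, Measure.restrict_apply' hS, inter_comm _ S]
    exact h A hA
  calc ∫⁻ x in S, g (f x) ∂μ = ∫⁻ y, g y ∂((μ.restrict S).map f) :=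
        (lintegral_map' hg.aemeasurable hf).symm
    _ ≤ ∫⁻ y, g y ∂(C • ν.restrict T) := lintegral_mono' hle le_rfl
    _ = _ := by rw [lintegral_smul_measure, smul_eq_mul]

lemma volume_eq_volume_ofLp_image {d : ℕ} (S : Set (E d)) :
    volume S = volume ((WithLp.ofLp : E d → (Fin d → ℝ)) '' S) := by
  have h1 := (PiLp.volume_preserving_toLp (Fin d)).measure_preimage_equiv
    (f := MeasurableEquiv.toLp 2 (Fin d → ℝ)) S
  rw [← h1]
  congr 1
  ext y
  constructor
  · intro h; exact ⟨_, h, rfl⟩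
  · rintro ⟨x, hx, rfl⟩; exact hx

/-- Lebesgue measure on `Fin d → ℝ` is the `d`-dimensional Hausdorff measure of the sup norm, and
passing from the Euclidean to the sup norm is 1-Lipschitz and preserves volume. The companion below
goes the other way and pays a dimensional constant. -/
lemma volume_image_le_of_lipschitzOnWith {d : ℕ} {K : ℝ≥0} {f : (Fin d → ℝ) → E d}
    {S : Set (Fin d → ℝ)} (hf : LipschitzOnWith K f S) :
    volume (f '' S) ≤ (K : ℝ≥0∞) ^ (d : ℝ) * volume S := by
  have h1 : LipschitzOnWith K ((WithLp.ofLp : E d → (Fin d → ℝ)) ∘ f) S := by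
    have := (PiLp.lipschitzWith_ofLp 2 (fun _ : Fin d => ℝ)).comp_lipschitzOnWith hf
    rwa [one_mul] at this
  have h2 := h1.hausdorffMeasure_image_le (d := (d : ℝ)) (by positivity)
  rw [image_comp, show (d : ℝ) = ((Fintype.card (Fin d) : ℕ) : ℝ) by simp,
    hausdorffMeasure_pi_real] at h2
  rw [volume_eq_volume_ofLp_image]
  simpa using h2

lemma volume_image_le_of_lipschitzOnWith' {d : ℕ} {K : ℝ≥0} {f : E d → (Fin d → ℝ)}
    {S : Set (E d)} (hf : LipschitzOnWith K f S) :
    ∃ C : ℝ≥0, ∀ A ⊆ S, volume (f '' A) ≤ C * volume A := by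
  set K2 : ℝ≥0 := (Fintype.card (Fin d) : ℝ≥0) ^ (1 / (2 : ℝ≥0∞)).toReal with hK2
  refine ⟨(K * K2) ^ (d : ℝ), fun A hA => ?_⟩
  have h0 := PiLp.lipschitzWith_toLp 2 (fun _ : Fin d => ℝ)
  have h1 : LipschitzOnWith (K * K2) (f ∘ WithLp.toLp 2)
      ((WithLp.ofLp : E d → (Fin d → ℝ)) '' A) := by
    refine (hf.mono hA).comp h0.lipschitzOnWith ?_
    rintro _ ⟨x, hx, rfl⟩
    exact hx
  have h2 := h1.hausdorffMeasure_image_le (d := (d : ℝ)) (by positivity)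
  rw [show (d : ℝ) = ((Fintype.card (Fin d) : ℕ) : ℝ) by simp, hausdorffMeasure_pi_real,
    ← volume_eq_volume_ofLp_image, ← image_comp] at h2
  simp only [Fintype.card_fin] at h2
  rw [ENNReal.coe_rpow_of_nonneg _ (by positivity)]
  convert h2 using 2
  ext y
  simp

end Chart

/-! ### Slab integrals against surface integrals in one chart -/

section ChartEstimates

open scoped NNReal ENNReal

variable {m : ℕ}

/-- The surface measure, of dimension `d - 1`, in `ℝ^d`. -/
abbrev surf (d : ℕ) : Measure (E d) := Measure.hausdorffMeasure ((d : ℝ) - 1)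

lemma ENNReal_add_sq_le (a b : ℝ≥0∞) : (a + b) ^ 2 ≤ 2 * a ^ 2 + 2 * b ^ 2 := by
  rcases eq_or_ne a ⊤ with rfl | ha
  · simp
  rcases eq_or_ne b ⊤ with rfl | hb
  · simp
  lift a to ℝ≥0 using ha
  lift b to ℝ≥0 using hb
  norm_cast
  rw [← NNReal.coe_le_coe]
  push_cast
  nlinarith [sq_nonneg ((a : ℝ) - b)]

lemma enorm_sq_le_of_norm_sub_le {V : Type*} [NormedAddCommGroup V] {a b : V} {η : ℝ≥0}
    (h : ‖a - b‖ ≤ η) : ‖a‖ₑ ^ 2 ≤ 2 * ‖b‖ₑ ^ 2 + 2 * (η : ℝ≥0∞) ^ 2 := by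
  refine le_trans ?_ (ENNReal_add_sq_le _ _)
  gcongr
  have h1 : ‖a‖ₑ ≤ ‖b‖ₑ + ‖a - b‖ₑ := by
    have := enorm_add_le b (a - b)
    simpa using this
  refine h1.trans ?_
  gcongr
  rw [enorm_eq_nnnorm]
  exact_mod_cast h

namespace FlatChart

variable {D : E (m + 1) → ℝ} {p : E (m + 1)} (ch : FlatChart D p)

/-- The domain of the coordinates. -/
abbrev B : Set (Fin (m + 1) → ℝ) := Metric.ball ch.c ch.ρ

/-- The domain of the coordinates along the level set. -/
abbrev Q : Set (Fin m → ℝ) := Metric.ball (Fin.removeNth ch.j ch.c) ch.ρ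

/-- The parametrization of the zero level set. -/
def γ (y : Fin m → ℝ) : E (m + 1) := ch.invFun (ch.j.insertNth (0 : ℝ) y)

lemma mem_B_iff {y : Fin (m + 1) → ℝ} :
    y ∈ ch.B ↔ |y ch.j| < ch.ρ ∧ Fin.removeNth ch.j y ∈ ch.Q := by
  rw [Metric.mem_ball, Metric.mem_ball, dist_pi_lt_iff ch.ρ_pos, dist_pi_lt_iff ch.ρ_pos,
    ch.j.forall_iff_succAbove, ch.c_j, Real.dist_eq, sub_zero]
  rfl

lemma insertNth_mem_B {y : Fin m → ℝ} (hy : y ∈ ch.Q) :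
    (ch.j.insertNth (0 : ℝ) y : Fin (m + 1) → ℝ) ∈ ch.B := by
  rw [mem_B_iff]
  simpa [ch.ρ_pos] using hy

lemma apply_invFun {y : Fin (m + 1) → ℝ} (hy : y ∈ ch.B) : D (ch.invFun y) = y ch.j := by
  rw [← ch.apply_j, ch.right_inv y hy]

lemma measurable_insertNth : Measurable fun y : Fin m → ℝ =>
    (ch.j.insertNth (0 : ℝ) y : Fin (m + 1) → ℝ) := by
  rw [measurable_pi_iff, ch.j.forall_iff_succAbove]
  constructor
  · simp
  · intro i; simpa using measurable_pi_apply i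

lemma measurable_γ : Measurable ch.γ := ch.measurable_inv.comp ch.measurable_insertNth

lemma dist_insertNth (y : Fin (m + 1) → ℝ) :
    dist y (ch.j.insertNth (0 : ℝ) (Fin.removeNth ch.j y) : Fin (m + 1) → ℝ) ≤ |y ch.j| := by
  rw [dist_pi_le_iff (abs_nonneg _), ch.j.forall_iff_succAbove]
  simp [Fin.removeNth]

lemma lipschitz_removeNth : LipschitzWith 1 (Fin.removeNth (α := fun _ => ℝ) ch.j) :=
  LipschitzWith.of_dist_le_mul fun x y => by
    rw [NNReal.coe_one, one_mul, dist_pi_le_iff dist_nonneg]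
    exact fun i => dist_le_pi_dist x y _

lemma lipschitz_insertNth : LipschitzWith 1 fun y : Fin m → ℝ =>
    (ch.j.insertNth (0 : ℝ) y : Fin (m + 1) → ℝ) :=
  LipschitzWith.of_dist_le_mul fun x y => by
    rw [NNReal.coe_one, one_mul, dist_pi_le_iff dist_nonneg, ch.j.forall_iff_succAbove]
    simpa using fun i => dist_le_pi_dist x y i

lemma dist_invFun_γ {y : Fin (m + 1) → ℝ} (hy : y ∈ ch.B) :
    dist (ch.invFun y) (ch.γ (Fin.removeNth ch.j y)) ≤ ch.K * |y ch.j| := by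
  have h := ch.lipschitz_inv.dist_le_mul y hy _ (ch.insertNth_mem_B (ch.mem_B_iff.1 hy).2)
  exact h.trans (mul_le_mul_of_nonneg_left (ch.dist_insertNth y) ch.K.coe_nonneg)

/-- In the sup norm the ball of coordinates is a product, so this is Tonelli for a function
independent of the `j`-th coordinate. -/
lemma setLIntegral_slab {I : Set ℝ} (hIρ : ∀ t ∈ I, |t| < ch.ρ)
    {F : (Fin m → ℝ) → ℝ≥0∞} (hF : Measurable F) :
    ∫⁻ y in ch.B ∩ {y | y ch.j ∈ I}, F (Fin.removeNth ch.j y)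
      = volume I * ∫⁻ z in ch.Q, F z := by
  have hmp := volume_preserving_piFinSuccAbove (fun _ : Fin (m + 1) => ℝ) ch.j
  have hset : ch.B ∩ {y | y ch.j ∈ I} =
      (MeasurableEquiv.piFinSuccAbove (fun _ : Fin (m + 1) => ℝ) ch.j) ⁻¹' (I ×ˢ ch.Q) := by
    ext y
    simp only [mem_inter_iff, mem_B_iff, mem_preimage, mem_prod]
    exact ⟨fun h => ⟨h.2, h.1.2⟩, fun h => ⟨⟨hIρ _ h.1, h.2⟩, h.1⟩⟩
  rw [hset]
  have h1 := hmp.setLIntegral_comp_preimage_emb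
    (MeasurableEquiv.measurableEmbedding _) (fun z => F z.2) (I ×ˢ ch.Q)
  refine h1.trans ?_
  rw [Measure.volume_eq_prod, ← Measure.prod_restrict, lintegral_prod _ (by fun_prop)]
  simp [mul_comm]

variable (D) in
-- Lipschitz images control the measure from both sides, so no Jacobian is needed.
lemma exists_volume_bounds :
    ∃ C : ℝ≥0, 0 < C ∧ (∀ g : E (m + 1) → ℝ≥0∞, Measurable g →
      ∫⁻ x in ch.W, g x ≤ C * ∫⁻ y in ch.B, g (ch.invFun y)) ∧
      (∀ g : E (m + 1) → ℝ≥0∞, Measurable g →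
      ∫⁻ y in ch.B, g (ch.invFun y) ≤ C * ∫⁻ x in ch.W, g x) := by
  obtain ⟨C2, hC2⟩ := volume_image_le_of_lipschitzOnWith' ch.lipschitz
  refine ⟨max 1 (max (ch.K ^ ((m + 1 : ℕ) : ℝ)) C2), by positivity, fun g hg => ?_,
    fun g hg => ?_⟩
  · refine setLIntegral_le_of_measure_le ch.measurable_inv.aemeasurable measurableSet_ball ?_ hg
    intro A hA
    have hsub : A ∩ ch.W ⊆ ch.invFun '' (ch.B ∩ ch.invFun ⁻¹' A) := by
      rintro x ⟨hxA, hxW⟩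
      exact ⟨ch.toFun x, ⟨ch.mapsTo hxW, by rw [mem_preimage, ch.left_inv x hxW]; exact hxA⟩,
        ch.left_inv x hxW⟩
    refine (measure_mono hsub).trans
      ((volume_image_le_of_lipschitzOnWith (ch.lipschitz_inv.mono inter_subset_left)).trans ?_)
    gcongr
    rw [← ENNReal.coe_rpow_of_nonneg _ (by positivity)]
    exact ENNReal.coe_le_coe.2 ((le_max_left _ _).trans (le_max_right _ _))
  · refine setLIntegral_comp_le_of_measure_le ch.measurable_inv.aemeasurable measurableSet_ball
      ?_ hg
    intro A hA
    have hsub : ch.B ∩ ch.invFun ⁻¹' A ⊆ ch.toFun '' (A ∩ ch.W) := by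
      rintro y ⟨hyB, hyA⟩
      exact ⟨ch.invFun y, ⟨hyA, ch.mapsTo_inv hyB⟩, ch.right_inv y hyB⟩
    refine (measure_mono hsub).trans ((hC2 _ inter_subset_right).trans ?_)
    gcongr
    exact (le_max_right _ _).trans (le_max_right _ _)

variable (D) in
-- The parametrization of the level set and its inverse are Lipschitz, so the `m`-dimensional
-- Hausdorff measure on the level set is comparable to Lebesgue measure on `Q`.
lemma exists_surf_bounds :
    ∃ C : ℝ≥0, 0 < C ∧ (∀ g : E (m + 1) → ℝ≥0∞, Measurable g →
      ∫⁻ x in ch.W ∩ {x | D x = 0}, g x ∂(surf (m + 1)) ≤ C * ∫⁻ y in ch.Q, g (ch.γ y)) ∧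
      (∀ g : E (m + 1) → ℝ≥0∞, Measurable g →
      ∫⁻ y in ch.Q, g (ch.γ y) ≤ C * ∫⁻ x in ch.W ∩ {x | D x = 0}, g x ∂(surf (m + 1))) := by
  have hdim : ((m + 1 : ℕ) : ℝ) - 1 = ((Fintype.card (Fin m) : ℕ) : ℝ) := by simp
  have hγ : LipschitzOnWith ch.K ch.γ ch.Q := by
    have := ch.lipschitz_inv.comp (ch.lipschitz_insertNth.lipschitzOnWith (s := ch.Q))
      (fun y hy => ch.insertNth_mem_B hy)
    rwa [mul_one] at this
  have hinv : LipschitzOnWith ch.K (fun x => Fin.removeNth ch.j (ch.toFun x)) ch.W := by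
    have := ch.lipschitz_removeNth.comp_lipschitzOnWith ch.lipschitz
    rwa [one_mul] at this
  have hrem : ∀ x ∈ ch.W ∩ {x | D x = 0},
      (ch.j.insertNth (0 : ℝ) (Fin.removeNth ch.j (ch.toFun x)) : Fin (m + 1) → ℝ)
        = ch.toFun x := by
    rintro x ⟨-, hx0⟩
    have : (0 : ℝ) = ch.toFun x ch.j := by rw [ch.apply_j]; exact hx0.symm
    rw [this, Fin.insertNth_self_removeNth]
  have hpow : ((ch.K : ℝ≥0∞)) ^ (((m + 1 : ℕ) : ℝ) - 1)
      ≤ ((max 1 (ch.K ^ (((m + 1 : ℕ) : ℝ) - 1)) : ℝ≥0) : ℝ≥0∞) := by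
    rw [← ENNReal.coe_rpow_of_nonneg _ (by simp)]
    exact ENNReal.coe_le_coe.2 (le_max_right _ _)
  refine ⟨max 1 (ch.K ^ (((m + 1 : ℕ) : ℝ) - 1)), by positivity, fun g hg => ?_, fun g hg => ?_⟩
  · refine setLIntegral_le_of_measure_le ch.measurable_γ.aemeasurable measurableSet_ball ?_ hg
    intro A hA
    have hsub : A ∩ (ch.W ∩ {x | D x = 0}) ⊆ ch.γ '' (ch.Q ∩ ch.γ ⁻¹' A) := by
      rintro x ⟨hxA, hxW⟩
      have e : ch.γ (Fin.removeNth ch.j (ch.toFun x)) = x := by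
        rw [γ, hrem x hxW, ch.left_inv x hxW.1]
      refine ⟨_, ⟨(ch.mem_B_iff.1 (ch.mapsTo hxW.1)).2, ?_⟩, e⟩
      rw [mem_preimage, e]; exact hxA
    refine (measure_mono hsub).trans (((hγ.mono inter_subset_left).hausdorffMeasure_image_le
      (by simp)).trans ?_)
    refine mul_le_mul' hpow (le_of_eq ?_)
    rw [hdim, hausdorffMeasure_pi_real]
  · refine setLIntegral_comp_le_of_measure_le ch.measurable_γ.aemeasurable measurableSet_ball
      ?_ hg
    intro A hA
    have hsub : ch.Q ∩ ch.γ ⁻¹' A ⊆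
        (fun x => Fin.removeNth ch.j (ch.toFun x)) '' (A ∩ (ch.W ∩ {x | D x = 0})) := by
      rintro y ⟨hyQ, hyA⟩
      have hB := ch.insertNth_mem_B hyQ
      refine ⟨ch.γ y, ⟨hyA, ch.mapsTo_inv hB, ?_⟩, ?_⟩
      · change D (ch.invFun _) = 0
        rw [ch.apply_invFun hB]; simp
      · change Fin.removeNth ch.j (ch.toFun (ch.invFun _)) = y
        rw [ch.right_inv _ hB]; simp
    have h1 := (hinv.mono (inter_subset_right.trans inter_subset_left)
      (s := A ∩ (ch.W ∩ {x | D x = 0}))).hausdorffMeasure_image_le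
      (d := ((m + 1 : ℕ) : ℝ) - 1) (by simp)
    refine le_trans ?_ (h1.trans (mul_le_mul' hpow le_rfl))
    rw [hdim, hausdorffMeasure_pi_real]
    exact measure_mono hsub

/-- Uniform continuity on the compact closure of the chart: on a thin slab `v` may be replaced by
its value at the base point on the level set. -/
lemma exists_modulus {v : E (m + 1) → ℝ} (hv : Continuous v) {η : ℝ} (hη : 0 < η) :
    ∃ r₁ > 0, r₁ ≤ ch.ρ ∧ ∀ y ∈ ch.B, |y ch.j| < r₁ →
      ‖v (ch.invFun y) - v (ch.γ (Fin.removeNth ch.j y))‖ ≤ η := by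
  have hbdd : Bornology.IsBounded (ch.invFun '' ch.B) := by
    rw [Metric.isBounded_iff]
    refine ⟨ch.K * (2 * ch.ρ), ?_⟩
    rintro _ ⟨y, hy, rfl⟩ _ ⟨y', hy', rfl⟩
    refine (ch.lipschitz_inv.dist_le_mul y hy y' hy').trans
      (mul_le_mul_of_nonneg_left ?_ ch.K.coe_nonneg)
    have := dist_triangle_right y y' ch.c
    linarith [Metric.mem_ball.1 hy, Metric.mem_ball.1 hy']
  have hcomp : IsCompact (closure (ch.invFun '' ch.B)) := hbdd.isCompact_closure
  have huc := hcomp.uniformContinuousOn_of_continuous hv.continuousOn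
  obtain ⟨τ, hτ, huc⟩ := Metric.uniformContinuousOn_iff.1 huc η hη
  refine ⟨min ch.ρ (τ / (ch.K + 1)), by have := ch.ρ_pos; positivity, min_le_left _ _, ?_⟩
  intro y hy hyr
  have hQ := (ch.mem_B_iff.1 hy).2
  refine (huc _ (subset_closure ⟨y, hy, rfl⟩) _
    (subset_closure ⟨_, ch.insertNth_mem_B hQ, rfl⟩) ?_).le
  refine lt_of_le_of_lt (ch.dist_invFun_γ hy) ?_
  have h1 : |y ch.j| < τ / (ch.K + 1) := lt_of_lt_of_le hyr (min_le_right _ _)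
  rw [lt_div_iff₀ (by positivity)] at h1
  nlinarith [abs_nonneg (y ch.j), ch.K.coe_nonneg]

/-- The volume of a thin slab is of the order of its thickness. -/
lemma exists_volume_slab_le (hD : Continuous D) :
    ∃ C : ℝ≥0, ∀ r ∈ Ioc 0 ch.ρ,
      volume (ch.W ∩ {x | |D x| < r}) ≤ C * ENNReal.ofReal r := by
  obtain ⟨C1, -, hC1, -⟩ := ch.exists_volume_bounds
  refine ⟨C1 * 2 * (volume ch.Q).toNNReal, fun r hr => ?_⟩
  have hmeas : MeasurableSet {x | |D x| < r} :=
    (isOpen_lt hD.abs continuous_const).measurableSet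
  have h1 := hC1 ({x | |D x| < r}.indicator 1) (measurable_one.indicator hmeas)
  rw [setLIntegral_indicator hmeas, inter_comm] at h1
  simp only [Pi.one_apply, setLIntegral_one] at h1
  refine h1.trans ?_
  have h2 : ∫⁻ y in ch.B, {x | |D x| < r}.indicator 1 (ch.invFun y)
      = ∫⁻ y in ch.B ∩ {y | y ch.j ∈ Ioo (-r) r}, 1 := by
    have hmeasj : MeasurableSet {y : Fin (m + 1) → ℝ | y ch.j ∈ Ioo (-r) r} :=
      measurable_pi_apply ch.j measurableSet_Ioo
    rw [inter_comm, ← setLIntegral_indicator hmeasj]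
    refine setLIntegral_congr_fun measurableSet_ball fun y hy => ?_
    simp only [indicator, mem_ofPred_eq, ch.apply_invFun hy, abs_lt, mem_Ioo, Pi.one_apply]
  rw [h2, ch.setLIntegral_slab (I := Ioo (-r) r) (F := fun _ => 1)
    (fun t ht => (abs_lt.2 ht).trans_le hr.2) measurable_const]
  simp only [Real.volume_Ioo, setLIntegral_one]
  have hQ : volume ch.Q = ((volume ch.Q).toNNReal : ℝ≥0∞) :=
    (ENNReal.coe_toNNReal measure_ball_lt_top.ne).symm
  rw [show r - -r = 2 * r by ring, ENNReal.ofReal_mul (by norm_num)]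
  conv_lhs => rw [hQ]
  push_cast
  rw [show ENNReal.ofReal 2 = 2 by simp]
  apply le_of_eq; ring

/-- The mean of a continuous function over a thin slab is controlled by its surface integral. -/
lemma exists_slab_le_surf (hD : Continuous D) :
    ∃ C : ℝ≥0, ∀ v : E (m + 1) → ℝ, Continuous v → ∀ η : ℝ, 0 < η →
      ∃ r₁ > 0, ∀ r ∈ Ioo 0 r₁, ∫⁻ x in ch.W ∩ {x | |D x| < r}, ‖v x‖ₑ ^ 2 ≤
        C * ENNReal.ofReal r * (∫⁻ x in ch.W ∩ {x | D x = 0}, ‖v x‖ₑ ^ 2 ∂(surf (m + 1))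
          + ENNReal.ofReal η) := by
  obtain ⟨C1, -, hC1, -⟩ := ch.exists_volume_bounds
  obtain ⟨C2, hC20, -, hC2⟩ := ch.exists_surf_bounds
  set q : ℝ≥0 := (volume ch.Q).toNNReal with hq
  have hQ : volume ch.Q = q := (ENNReal.coe_toNNReal measure_ball_lt_top.ne).symm
  refine ⟨C1 * 2 * (2 * C2 + 2 * q), fun v hv η hη => ?_⟩
  -- The minimum with `1` ensures `τ² ≤ η`.
  set τ : ℝ := min 1 η with hτ
  have hτ0 : 0 < τ := lt_min one_pos hη
  obtain ⟨r₁, hr₁, hr₁ρ, hmod⟩ := ch.exists_modulus hv hτ0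
  refine ⟨r₁, hr₁, fun r hr => ?_⟩
  have hmeas : MeasurableSet {x | |D x| < r} :=
    (isOpen_lt hD.abs continuous_const).measurableSet
  have hvm : Measurable fun x => ‖v x‖ₑ ^ 2 := (hv.measurable.enorm).pow_const 2
  have h1 := hC1 ({x | |D x| < r}.indicator fun x => ‖v x‖ₑ ^ 2) (hvm.indicator hmeas)
  rw [setLIntegral_indicator hmeas, inter_comm] at h1
  refine h1.trans ?_
  have hγm : Measurable fun z => ‖v (ch.γ z)‖ₑ ^ 2 := hvm.comp ch.measurable_γ
  have hτη : (τ.toNNReal : ℝ≥0∞) ^ 2 ≤ ENNReal.ofReal η := by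
    change ENNReal.ofReal τ ^ 2 ≤ _
    rw [← ENNReal.ofReal_pow hτ0.le]
    apply ENNReal.ofReal_le_ofReal
    nlinarith [min_le_left 1 η, min_le_right 1 η]
  have h2 : ∫⁻ y in ch.B, {x | |D x| < r}.indicator (fun x => ‖v x‖ₑ ^ 2) (ch.invFun y)
      ≤ ∫⁻ y in ch.B ∩ {y | y ch.j ∈ Ioo (-r) r},
          (2 * ‖v (ch.γ (Fin.removeNth ch.j y))‖ₑ ^ 2 + 2 * (τ.toNNReal : ℝ≥0∞) ^ 2) := by
    have hmeasj : MeasurableSet {y : Fin (m + 1) → ℝ | y ch.j ∈ Ioo (-r) r} :=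
      measurable_pi_apply ch.j measurableSet_Ioo
    rw [inter_comm, ← setLIntegral_indicator hmeasj]
    refine setLIntegral_mono' measurableSet_ball fun y hy => ?_
    simp only [indicator, mem_ofPred_eq, ch.apply_invFun hy, ← abs_lt, mem_Ioo]
    split_ifs with h
    · apply enorm_sq_le_of_norm_sub_le
      rw [Real.coe_toNNReal _ hτ0.le]
      exact hmod y hy (h.trans hr.2)
    · exact le_rfl
  have h3 := ch.setLIntegral_slab (I := Ioo (-r) r)
    (F := fun z => 2 * ‖v (ch.γ z)‖ₑ ^ 2 + 2 * (τ.toNNReal : ℝ≥0∞) ^ 2)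
    (fun t ht => (abs_lt.2 ht).trans_le (hr.2.le.trans hr₁ρ)) (by fun_prop)
  refine (mul_le_mul_right (h2.trans_eq h3) _).trans ?_
  rw [lintegral_add_right _ measurable_const, lintegral_const_mul _ hγm]
  simp only [lintegral_const, Measure.restrict_apply MeasurableSet.univ, univ_inter, hQ,
    Real.volume_Ioo]
  have h4 := hC2 _ hvm
  rw [show r - -r = 2 * r by ring, ENNReal.ofReal_mul (by norm_num),
    show ENNReal.ofReal 2 = 2 by simp]
  set J := ∫⁻ x in ch.W ∩ {x | D x = 0}, ‖v x‖ₑ ^ 2 ∂(surf (m + 1))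
  push_cast
  calc (C1 : ℝ≥0∞) * (2 * ENNReal.ofReal r * ((2 * ∫⁻ z in ch.Q, ‖v (ch.γ z)‖ₑ ^ 2)
        + 2 * (τ.toNNReal : ℝ≥0∞) ^ 2 * q))
      ≤ C1 * (2 * ENNReal.ofReal r * (2 * (C2 * J) + 2 * ENNReal.ofReal η * q)) := by gcongr
    _ = C1 * 2 * ENNReal.ofReal r * (2 * C2 * J + 2 * q * ENNReal.ofReal η) := by ring
    _ ≤ C1 * 2 * ENNReal.ofReal r * ((2 * C2 + 2 * q) * J + (2 * C2 + 2 * q) * ENNReal.ofReal η) := by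
      gcongr
      · exact le_self_add
      · exact le_add_self
    _ = C1 * 2 * (2 * C2 + 2 * q) * ENNReal.ofReal r * (J + ENNReal.ofReal η) := by ring

/-- The surface integral of a continuous function is controlled by its means over thin
one-sided slabs. -/
lemma exists_surf_le_slab (hD : Continuous D) :
    ∃ C : ℝ≥0, ∀ v : E (m + 1) → ℝ, Continuous v → ∀ η : ℝ, 0 < η →
      ∃ r₁ > 0, ∀ r ∈ Ioo 0 r₁,
        ENNReal.ofReal r * ∫⁻ x in ch.W ∩ {x | D x = 0}, ‖v x‖ₑ ^ 2 ∂(surf (m + 1)) ≤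
        C * ((∫⁻ x in ch.W ∩ {x | D x ∈ Ioo r (2 * r)}, ‖v x‖ₑ ^ 2)
          + ENNReal.ofReal r * ENNReal.ofReal η) := by
  obtain ⟨C1, -, -, hC1⟩ := ch.exists_volume_bounds
  obtain ⟨C2, hC20, hC2, -⟩ := ch.exists_surf_bounds
  set q : ℝ≥0 := (volume ch.Q).toNNReal with hq
  have hQ : volume ch.Q = q := (ENNReal.coe_toNNReal measure_ball_lt_top.ne).symm
  refine ⟨C2 * (2 * C1 + 2 * q), fun v hv η hη => ?_⟩
  set τ : ℝ := min 1 η with hτ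
  have hτ0 : 0 < τ := lt_min one_pos hη
  obtain ⟨r₁, hr₁, hr₁ρ, hmod⟩ := ch.exists_modulus hv hτ0
  -- Halved because the slab reaches up to `2 r`.
  refine ⟨r₁ / 2, by positivity, fun r hr => ?_⟩
  have hr2 : 2 * r < r₁ := by linarith [hr.2]
  have hmeas : MeasurableSet {x | D x ∈ Ioo r (2 * r)} :=
    (hD.measurable measurableSet_Ioo)
  have hvm : Measurable fun x => ‖v x‖ₑ ^ 2 := (hv.measurable.enorm).pow_const 2
  have h1 := hC1 ({x | D x ∈ Ioo r (2 * r)}.indicator fun x => ‖v x‖ₑ ^ 2) (hvm.indicator hmeas)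
  rw [setLIntegral_indicator hmeas, inter_comm] at h1
  have hγm : Measurable fun z => ‖v (ch.γ z)‖ₑ ^ 2 := hvm.comp ch.measurable_γ
  have hτη : (τ.toNNReal : ℝ≥0∞) ^ 2 ≤ ENNReal.ofReal η := by
    change ENNReal.ofReal τ ^ 2 ≤ _
    rw [← ENNReal.ofReal_pow hτ0.le]
    apply ENNReal.ofReal_le_ofReal
    nlinarith [min_le_left 1 η, min_le_right 1 η]
  have habs : ∀ t ∈ Ioo r (2 * r), |t| < r₁ := fun t ht => by
    rw [abs_of_pos (hr.1.trans ht.1)]; exact ht.2.trans hr2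
  have h3 := ch.setLIntegral_slab (I := Ioo r (2 * r))
    (F := fun z => ‖v (ch.γ z)‖ₑ ^ 2) (fun t ht => (habs t ht).trans_le hr₁ρ) hγm
  have h5 := ch.setLIntegral_slab (I := Ioo r (2 * r))
    (F := fun z => 1) (fun t ht => (habs t ht).trans_le hr₁ρ) measurable_const
  simp only [Real.volume_Ioo, setLIntegral_one, hQ, show 2 * r - r = r by ring] at h3 h5
  have hmeasj : MeasurableSet {y : Fin (m + 1) → ℝ | y ch.j ∈ Ioo r (2 * r)} :=
    measurable_pi_apply ch.j measurableSet_Ioo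
  have h2 : ∫⁻ y in ch.B ∩ {y | y ch.j ∈ Ioo r (2 * r)}, ‖v (ch.γ (Fin.removeNth ch.j y))‖ₑ ^ 2
      ≤ ∫⁻ y in ch.B ∩ {y | y ch.j ∈ Ioo r (2 * r)},
          (2 * ‖v (ch.invFun y)‖ₑ ^ 2 + 2 * (τ.toNNReal : ℝ≥0∞) ^ 2) := by
    refine setLIntegral_mono' (measurableSet_ball.inter hmeasj) fun y hy => ?_
    apply enorm_sq_le_of_norm_sub_le
    rw [Real.coe_toNNReal _ hτ0.le, norm_sub_rev]
    exact hmod y hy.1 (habs _ hy.2)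
  have h6 : ∫⁻ y in ch.B ∩ {y | y ch.j ∈ Ioo r (2 * r)}, ‖v (ch.invFun y)‖ₑ ^ 2
      = ∫⁻ y in ch.B, ({x | D x ∈ Ioo r (2 * r)}.indicator fun x => ‖v x‖ₑ ^ 2) (ch.invFun y) := by
    rw [inter_comm, ← setLIntegral_indicator hmeasj]
    refine setLIntegral_congr_fun measurableSet_ball fun y hy => ?_
    simp only [indicator, mem_ofPred_eq, ch.apply_invFun hy]
  rw [h3, lintegral_add_right _ measurable_const,
    lintegral_const_mul 2 (f := fun y => ‖v (ch.invFun y)‖ₑ ^ 2) (hvm.comp ch.measurable_inv), h6, ← mul_one (2 * (τ.toNNReal : ℝ≥0∞) ^ 2),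
    lintegral_const_mul _ measurable_const, setLIntegral_one, h5] at h2
  have h4 := hC2 _ hvm
  set J := ∫⁻ x in ch.W ∩ {x | D x = 0}, ‖v x‖ₑ ^ 2 ∂(surf (m + 1))
  set I := ∫⁻ x in ch.W ∩ {x | D x ∈ Ioo r (2 * r)}, ‖v x‖ₑ ^ 2
  push_cast
  calc ENNReal.ofReal r * J
      ≤ ENNReal.ofReal r * (C2 * ∫⁻ z in ch.Q, ‖v (ch.γ z)‖ₑ ^ 2) := by gcongr
    _ = C2 * (ENNReal.ofReal r * ∫⁻ z in ch.Q, ‖v (ch.γ z)‖ₑ ^ 2) := by ring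
    _ ≤ C2 * (2 * (C1 * I) + 2 * ENNReal.ofReal η * (ENNReal.ofReal r * q)) := by
      gcongr
      refine h2.trans ?_
      gcongr
    _ = C2 * (2 * C1 * I + 2 * q * (ENNReal.ofReal r * ENNReal.ofReal η)) := by ring
    _ ≤ C2 * ((2 * C1 + 2 * q) * I + (2 * C1 + 2 * q) * (ENNReal.ofReal r * ENNReal.ofReal η)) := by
      gcongr
      · exact le_self_add
      · exact le_add_self
    _ = _ := by ring

end FlatChart

end ChartEstimates

/-! ### From charts to the whole compact level set -/

section Defining

open scoped NNReal ENNReal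

/-- `D` behaves like a signed distance function to its compact zero level set, up to the
distance `δ₀`. -/
structure IsDefining {d : ℕ} (D : E d → ℝ) (δ₀ : ℝ) : Prop where
  pos : 0 < δ₀
  lipschitz : LipschitzWith 1 D
  smooth : ContDiffOn ℝ ∞ D {x | |D x| < δ₀}
  norm_fderiv : ∀ x, |D x| < δ₀ → ‖fderiv ℝ D x‖ = 1
  isCompact : ∀ r, IsCompact {x | |D x| ≤ r}

namespace IsDefining

variable {d : ℕ} {D : E d → ℝ} {δ₀ : ℝ} (h : IsDefining D δ₀)

include h

lemma neg : IsDefining (fun x => -D x) δ₀ where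
  pos := h.pos
  lipschitz := h.lipschitz.neg
  smooth := by simpa using h.smooth.neg
  norm_fderiv := fun x hx => by
    rw [fderiv_fun_neg, norm_neg]
    exact h.norm_fderiv x (by simpa using hx)
  isCompact := by simpa using h.isCompact

lemma continuous : Continuous D := h.lipschitz.continuous

lemma isOpen_slab (r : ℝ) : IsOpen {x | |D x| < r} :=
  isOpen_lt h.continuous.abs continuous_const

lemma contDiffAt {x : E d} (hx : |D x| < δ₀) : ContDiffAt ℝ ∞ D x :=
  h.smooth.contDiffAt ((h.isOpen_slab δ₀).mem_nhds hx)

end IsDefining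

lemma setLIntegral_le_sum_cover {X ι : Type*} [MeasurableSpace X] {μ : Measure X}
    {t : Finset ι} {W : ι → Set X} {S : Set X} (hS : S ⊆ ⋃ p ∈ t, W p) (g : X → ℝ≥0∞) :
    ∫⁻ x in S, g x ∂μ ≤ ∑ p ∈ t, ∫⁻ x in W p ∩ S, g x ∂μ := by
  have h1 : S ⊆ ⋃ p : t, W p ∩ S := by
    intro x hx
    obtain ⟨p, hp, hxp⟩ := mem_iUnion₂.1 (hS hx)
    exact mem_iUnion.2 ⟨⟨p, hp⟩, hxp, hx⟩
  calc ∫⁻ x in S, g x ∂μ ≤ ∫⁻ x in ⋃ p : t, W p ∩ S, g x ∂μ := lintegral_mono_set h1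
    _ ≤ ∑' p : t, ∫⁻ x in W p ∩ S, g x ∂μ := lintegral_iUnion_le _ _
    _ = ∑ p ∈ t, ∫⁻ x in W p ∩ S, g x ∂μ := by
      rw [tsum_fintype, ← Finset.sum_coe_sort t]

namespace IsDefining

variable {m : ℕ} {D : E (m + 1) → ℝ} {δ₀ : ℝ} (h : IsDefining D δ₀)

include h

lemma nonempty_flatChart (p : {p // D p = 0}) : Nonempty (FlatChart D p) := by
  have hp : |D p| < δ₀ := by rw [p.2, abs_zero]; exact h.pos
  refine KRS.nonempty_flatChart ((h.contDiffAt hp).of_le (by simp)) p.2 ?_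
  intro h0
  have := h.norm_fderiv p hp
  rw [h0, norm_zero] at this
  exact zero_ne_one this

/-- The charts around the points of the zero level set. -/
def chart (p : {p // D p = 0}) : FlatChart D p := (h.nonempty_flatChart p).some

/-- Finitely many charts cover the compact zero set. On the part of `{|D| ≤ 1}` outside them `|D|`
has a positive minimum, so a whole slab is covered. -/
lemma exists_cover : ∃ (t : Finset {p // D p = 0}), ∃ r₀ > 0,
    {x | |D x| < r₀} ⊆ ⋃ p ∈ t, (h.chart p).W := by
  have hc0 : IsCompact {x | D x = 0} := by
    have := h.isCompact 0
    simpa using this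
  obtain ⟨t, ht⟩ := hc0.elim_finite_subcover (fun p => (h.chart p).W)
    (fun p => (h.chart p).isOpen_W) (fun x hx => mem_iUnion.2 ⟨⟨x, hx⟩, (h.chart ⟨x, hx⟩).mem_W⟩)
  refine ⟨t, ?_⟩
  set O := ⋃ p ∈ t, (h.chart p).W with hO
  have hOo : IsOpen O := isOpen_biUnion fun p _ => (h.chart p).isOpen_W
  have hK : IsCompact ({x | |D x| ≤ 1} \ O) := (h.isCompact 1).diff hOo
  rcases ({x | |D x| ≤ 1} \ O).eq_empty_or_nonempty with he | hne
  · refine ⟨1, one_pos, fun x hx => ?_⟩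
    by_contra hxO
    have : x ∈ {x | |D x| ≤ 1} \ O := ⟨show |D x| ≤ 1 from le_of_lt hx, hxO⟩
    rw [he] at this
    exact this
  · obtain ⟨x₀, hx₀, hmin⟩ := hK.exists_isMinOn hne h.continuous.abs.continuousOn
    have hpos : 0 < |D x₀| := by
      rw [abs_pos]
      intro h0
      exact hx₀.2 (ht h0)
    refine ⟨min 1 |D x₀|, lt_min one_pos hpos, fun x hx => ?_⟩
    by_contra hxO
    have hx' : |D x| < min 1 |D x₀| := hx
    have h1 : x ∈ {x | |D x| ≤ 1} \ O := ⟨(hx'.trans_le (min_le_left _ _)).le, hxO⟩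
    exact absurd (hx'.trans_le (min_le_right _ _)) (not_lt.2 (hmin h1))

lemma exists_volume_le : ∃ C : ℝ≥0, ∃ r₀ > 0, ∀ r ∈ Ioo 0 r₀,
    volume {x | |D x| < r} ≤ C * ENNReal.ofReal r := by
  obtain ⟨t, r₀, hr₀, hcov⟩ := h.exists_cover
  choose C hC using fun p => (h.chart p).exists_volume_slab_le h.continuous
  have hev : ∀ᶠ r in 𝓝[>] (0 : ℝ), r < r₀ ∧ ∀ p ∈ t, r ∈ Ioc 0 (h.chart p).ρ := by
    refine (eventually_nhdsWithin_of_eventually_nhds (eventually_lt_nhds hr₀)).and ?_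
    rw [Filter.eventually_all_finset]
    exact fun p _ => Ioc_mem_nhdsGT (h.chart p).ρ_pos
  obtain ⟨r₁, hr₁, hr₁'⟩ := mem_nhdsGT_iff_exists_Ioo_subset.1 hev
  refine ⟨∑ p ∈ t, C p, r₁, hr₁, fun r hr => ?_⟩
  have hr2 := hr₁' hr
  have h1 := setLIntegral_le_sum_cover (μ := volume) (S := {x | |D x| < r})
    (fun x hx => hcov (lt_trans hx hr2.1)) (fun _ => 1)
  simp only [setLIntegral_one] at h1
  refine h1.trans ?_
  push_cast
  rw [Finset.sum_mul]
  exact Finset.sum_le_sum fun p hp => hC p r (hr2.2 p hp)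

lemma exists_slab_le_surf : ∃ C : ℝ≥0, ∀ v : E (m + 1) → ℝ, Continuous v → ∀ η : ℝ, 0 < η →
    ∀ᶠ r in 𝓝[>] (0 : ℝ), ∫⁻ x in {x | |D x| < r}, ‖v x‖ₑ ^ 2 ≤
      C * ENNReal.ofReal r * (∫⁻ x in {x | D x = 0}, ‖v x‖ₑ ^ 2 ∂(surf (m + 1))
        + ENNReal.ofReal η) := by
  obtain ⟨t, r₀, hr₀, hcov⟩ := h.exists_cover
  choose C hC using fun p => (h.chart p).exists_slab_le_surf h.continuous
  refine ⟨∑ p ∈ t, C p, fun v hv η hη => ?_⟩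
  have hev : ∀ᶠ r in 𝓝[>] (0 : ℝ), r < r₀ ∧ ∀ p ∈ t,
      ∫⁻ x in (h.chart p).W ∩ {x | |D x| < r}, ‖v x‖ₑ ^ 2 ≤
        C p * ENNReal.ofReal r * (∫⁻ x in (h.chart p).W ∩ {x | D x = 0}, ‖v x‖ₑ ^ 2
          ∂(surf (m + 1)) + ENNReal.ofReal η) := by
    refine (eventually_nhdsWithin_of_eventually_nhds (eventually_lt_nhds hr₀)).and ?_
    rw [Filter.eventually_all_finset]
    intro p _
    obtain ⟨r₁, hr₁, hr₁'⟩ := hC p v hv η hη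
    filter_upwards [Ioo_mem_nhdsGT hr₁] with r hr using hr₁' r hr
  filter_upwards [hev] with r hr
  refine (setLIntegral_le_sum_cover (fun x hx => hcov (lt_trans hx hr.1)) _).trans ?_
  push_cast
  rw [Finset.sum_mul, Finset.sum_mul]
  refine Finset.sum_le_sum fun p hp => (hr.2 p hp).trans ?_
  gcongr
  exact inter_subset_right

lemma exists_surf_le_slab : ∃ C : ℝ≥0, ∀ v : E (m + 1) → ℝ, Continuous v → ∀ η : ℝ, 0 < η →
    ∀ᶠ r in 𝓝[>] (0 : ℝ),
      ENNReal.ofReal r * ∫⁻ x in {x | D x = 0}, ‖v x‖ₑ ^ 2 ∂(surf (m + 1)) ≤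
      C * ((∫⁻ x in {x | D x ∈ Ioo r (2 * r)}, ‖v x‖ₑ ^ 2)
        + ENNReal.ofReal r * ENNReal.ofReal η) := by
  obtain ⟨t, r₀, hr₀, hcov⟩ := h.exists_cover
  choose C hC using fun p => (h.chart p).exists_surf_le_slab h.continuous
  refine ⟨∑ p ∈ t, C p, fun v hv η hη => ?_⟩
  have hev : ∀ᶠ r in 𝓝[>] (0 : ℝ), ∀ p ∈ t,
      ENNReal.ofReal r * ∫⁻ x in (h.chart p).W ∩ {x | D x = 0}, ‖v x‖ₑ ^ 2 ∂(surf (m + 1)) ≤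
      C p * ((∫⁻ x in (h.chart p).W ∩ {x | D x ∈ Ioo r (2 * r)}, ‖v x‖ₑ ^ 2)
        + ENNReal.ofReal r * ENNReal.ofReal η) := by
    rw [Filter.eventually_all_finset]
    intro p _
    obtain ⟨r₁, hr₁, hr₁'⟩ := hC p v hv η hη
    filter_upwards [Ioo_mem_nhdsGT hr₁] with r hr using hr₁' r hr
  filter_upwards [hev] with r hr
  have hcov0 : {x | D x = 0} ⊆ ⋃ p ∈ t, (h.chart p).W := fun x hx => hcov (by
    have h0 : D x = 0 := hx
    simpa [h0] using hr₀)
  refine (mul_le_mul_right (setLIntegral_le_sum_cover hcov0 _) _).trans ?_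
  push_cast
  rw [Finset.mul_sum, Finset.sum_mul]
  refine Finset.sum_le_sum fun p hp => (hr p hp).trans ?_
  gcongr
  exact inter_subset_right

/-- The surface lies in slabs of volume `O(r)`. This allows integrals over the domain to be split
into the two sides. -/
lemma volume_zero_set : volume {x | D x = 0} = 0 := by
  obtain ⟨C, r₀, hr₀, hC⟩ := h.exists_volume_le
  have h1 : Tendsto (fun r : ℝ => (C : ℝ≥0∞) * ENNReal.ofReal r) (𝓝[>] 0) (𝓝 0) := by
    have h2 : Tendsto (fun r : ℝ => ENNReal.ofReal r) (𝓝[>] 0) (𝓝 0) := by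
      have := (ENNReal.continuous_ofReal.tendsto 0).mono_left
        (nhdsWithin_le_nhds (s := Ioi (0 : ℝ)))
      simpa using this
    simpa using ENNReal.Tendsto.const_mul h2 (Or.inr ENNReal.coe_ne_top)
  refine le_antisymm (ge_of_tendsto h1 ?_) zero_le
  filter_upwards [Ioo_mem_nhdsGT hr₀] with r hr
  refine (measure_mono fun x hx => ?_).trans (hC r hr)
  have h0 : D x = 0 := hx
  simpa [h0] using hr.1

end IsDefining

end Defining

/-! ### Ramps across the surface and integration by parts -/

section Slabs

open scoped NNReal ENNReal

lemma lintegral_mul_sq_le {X : Type*} [MeasurableSpace X] {μ : Measure X} {f g : X → ℝ≥0∞}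
    (hf : AEMeasurable f μ) (hg : AEMeasurable g μ) :
    (∫⁻ x, f x * g x ∂μ) ^ 2 ≤ (∫⁻ x, f x ^ 2 ∂μ) * ∫⁻ x, g x ^ 2 ∂μ := by
  have h := ENNReal.lintegral_mul_le_Lp_mul_Lq μ Real.HolderConjugate.two_two hf hg
  simp only [Pi.mul_apply, ENNReal.rpow_ofNat] at h
  calc (∫⁻ x, f x * g x ∂μ) ^ 2
      ≤ ((∫⁻ x, f x ^ 2 ∂μ) ^ (1 / 2 : ℝ) * (∫⁻ x, g x ^ 2 ∂μ) ^ (1 / 2 : ℝ)) ^ 2 := by gcongr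
    _ = _ := by
      rw [mul_pow, ← ENNReal.rpow_natCast, ← ENNReal.rpow_natCast, ← ENNReal.rpow_mul,
        ← ENNReal.rpow_mul]
      norm_num

lemma setLIntegral_sq_le {X : Type*} [MeasurableSpace X] {μ : Measure X} {f : X → ℝ≥0∞}
    (hf : Measurable f) (S : Set X) :
    (∫⁻ x in S, f x ∂μ) ^ 2 ≤ μ S * ∫⁻ x in S, f x ^ 2 ∂μ := by
  have := lintegral_mul_sq_le (μ := μ.restrict S) (f := fun _ => 1) (g := f)
    aemeasurable_const hf.aemeasurable
  simpa using this

/-- A `C¹` transition from `0` to `1`, whose derivative is a trapezoid. -/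
lemma exists_ramp : ∃ (h ρ : ℝ → ℝ) (κ : ℝ), 0 < κ ∧ Continuous ρ ∧
    (∀ t, HasDerivAt h (ρ t) t) ∧ (∀ t ≤ 0, h t = 0) ∧ (∀ t, 3 ≤ t → h t = 1) ∧
    (∀ t, h t ∈ Icc (0 : ℝ) 1) ∧ (∀ t, ρ t ∈ Icc 0 κ) ∧ (∀ t ∈ Icc (1 : ℝ) 2, ρ t = κ) ∧
    (∀ t, t ∉ Ioo (0 : ℝ) 3 → ρ t = 0) := by
  set τ : ℝ → ℝ := fun s => max 0 (min 1 (min s (3 - s))) with hτ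
  have hτc : Continuous τ := by fun_prop
  have hτ0 : ∀ s, 0 ≤ τ s := fun s => le_max_left _ _
  have hτ1 : ∀ s, τ s ≤ 1 := fun s => max_le zero_le_one (min_le_left _ _)
  have hτI : ∀ s ∈ Icc (1 : ℝ) 2, τ s = 1 := by
    intro s hs
    have : (1 : ℝ) ≤ min s (3 - s) := le_min hs.1 (by linarith [hs.2])
    simp only [hτ, min_eq_left this]
    norm_num
  have hτo : ∀ s, s ∉ Ioo (0 : ℝ) 3 → τ s = 0 := by
    intro s hs
    have : min s (3 - s) ≤ 0 := by
      by_contra! h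
      exact hs ⟨(lt_min_iff.1 h).1, by linarith [(lt_min_iff.1 h).2]⟩
    exact max_eq_left ((min_le_right _ _).trans this)
  set M := ∫ s in (0 : ℝ)..3, τ s with hM
  have hMpos : 0 < M := by
    refine intervalIntegral.integral_pos (by norm_num) hτc.continuousOn (fun x _ => hτ0 x)
      ⟨1, by norm_num, ?_⟩
    rw [hτI 1 (by norm_num)]; norm_num
  have hderiv : ∀ t, HasDerivAt (fun t => (∫ s in (0 : ℝ)..t, τ s) / M) (τ t / M) t := fun t =>
    (intervalIntegral.integral_hasDerivAt_right (hτc.intervalIntegrable _ _)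
      (hτc.stronglyMeasurableAtFilter _ _) hτc.continuousAt).div_const M
  have hle0 : ∀ t ≤ 0, (∫ s in (0 : ℝ)..t, τ s) / M = 0 := by
    intro t ht
    rw [intervalIntegral.integral_congr (g := fun _ => 0)]
    · simp
    · intro s hs
      rw [uIcc_of_ge ht] at hs
      exact hτo s (fun h => absurd h.1 (not_lt.2 hs.2))
  have hge3 : ∀ t, 3 ≤ t → (∫ s in (0 : ℝ)..t, τ s) / M = 1 := by
    intro t ht
    rw [← intervalIntegral.integral_add_adjacent_intervals
      (hτc.intervalIntegrable 0 3) (hτc.intervalIntegrable 3 t),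
      intervalIntegral.integral_congr (a := 3) (g := fun _ => 0)]
    · simp [← hM, hMpos.ne']
    · intro s hs
      rw [uIcc_of_le ht] at hs
      exact hτo s (fun h => absurd h.2 (not_lt.2 hs.1))
  have hmono : Monotone (fun t => (∫ s in (0 : ℝ)..t, τ s) / M) :=
    monotone_of_hasDerivAt_nonneg hderiv (fun t => div_nonneg (hτ0 t) hMpos.le)
  refine ⟨_, fun t => τ t / M, 1 / M, by positivity, by fun_prop, hderiv, hle0, hge3,
    fun t => ⟨?_, ?_⟩, fun t => ⟨div_nonneg (hτ0 t) hMpos.le,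
      div_le_div_of_nonneg_right (hτ1 t) hMpos.le⟩,
    fun t ht => by simp only [hτI t ht], fun t ht => by simp [hτo t ht]⟩
  · have := hmono (min_le_left t 0)
    beta_reduce at this
    rwa [hle0 _ (min_le_right t 0)] at this
  · have := hmono (le_max_left t 3)
    beta_reduce at this
    rwa [hge3 _ (le_max_right t 3)] at this

section Ibp

variable {d : ℕ} {F : Type*} [NormedAddCommGroup F] [NormedSpace ℝ F]

lemma continuous_fderiv_basisVec {f : E d → F} (hf : ContDiff ℝ 1 f) (i : Fin d) :
    Continuous fun x => fderiv ℝ f x (basisVec i) :=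
  (hf.continuous_fderiv (by simp)).clm_apply continuous_const

lemma hasCompactSupport_fderiv_basisVec {f : E d → F} (hf : HasCompactSupport f) (i : Fin d) :
    HasCompactSupport fun x => fderiv ℝ f x (basisVec i) :=
  (hf.fderiv ℝ).comp_left (g := fun T : E d →L[ℝ] F => T (basisVec i)) (by simp)

lemma integral_smul_fderiv_eq_neg {f : E d → ℝ} {g : E d → F} (hf : ContDiff ℝ 1 f)
    (hg : ContDiff ℝ 1 g) (hgc : HasCompactSupport g) (i : Fin d) :
    ∫ x, f x • fderiv ℝ g x (basisVec i) = -∫ x, fderiv ℝ f x (basisVec i) • g x := by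
  refine integral_smul_fderiv_eq_neg_fderiv_smul_of_integrable ?_ ?_ ?_
    (fun x _ => (hf.differentiable (by simp)) x) (fun x _ => (hg.differentiable (by simp)) x)
  · exact ((continuous_fderiv_basisVec hf i).smul hg.continuous).integrable_of_hasCompactSupport
      hgc.smul_left
  · exact (hf.continuous.smul
      (continuous_fderiv_basisVec hg i)).integrable_of_hasCompactSupport
      (hasCompactSupport_fderiv_basisVec hgc i).smul_left
  · exact (hf.continuous.smul hg.continuous).integrable_of_hasCompactSupport hgc.smul_left

lemma integral_fderiv_eq_zero {g : E d → F} (hg : ContDiff ℝ 1 g) (hgc : HasCompactSupport g)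
    (i : Fin d) : ∫ x, fderiv ℝ g x (basisVec i) = 0 := by
  have := integral_smul_fderiv_eq_neg (f := fun _ => 1) contDiff_const hg hgc i
  simpa using this

lemma gradient_coord (f : E d → ℝ) (x : E d) (i : Fin d) :
    gradient f x i = fderiv ℝ f x (basisVec i) := by
  have h : inner ℝ (gradient f x) (basisVec i) = fderiv ℝ f x (basisVec i) := by simp [gradient]
  rw [← h, basisVec, EuclideanSpace.inner_single_right]
  simp

lemma sum_fderiv_sq (f : E d → ℝ) (x : E d) :
    ∑ i, fderiv ℝ f x (basisVec i) ^ 2 = ‖fderiv ℝ f x‖ ^ 2 := by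
  have h : ‖fderiv ℝ f x‖ = ‖gradient f x‖ := by simp [gradient]
  rw [h, EuclideanSpace.norm_sq_eq]
  simp [gradient_coord]

lemma norm_basisVec (i : Fin d) : ‖(basisVec i : E d)‖ = 1 := by simp [basisVec]

end Ibp

namespace IsDefining

section General

variable {d : ℕ} {D : E d → ℝ} {δ₀ : ℝ} (h : IsDefining D δ₀)

include h

/-- Outside the slab `{|D| < δ₀}` neither `D` nor `B` need be smooth, but the factor `q ∘ D` already
vanishes in a neighbourhood of such points. -/
lemma contDiff_comp_smul {F : Type*} [NormedAddCommGroup F] [NormedSpace ℝ F] {k : ℕ∞ω}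
    (hk : k ≤ ((⊤ : ℕ∞) : ℕ∞ω)) {q : ℝ → ℝ} (hq : ContDiff ℝ k q) {r : ℝ} (hr : r < δ₀)
    (hq0 : ∀ t, r < |t| → q t = 0) {B : E d → F} (hB : ContDiffOn ℝ k B {x | |D x| < δ₀}) :
    ContDiff ℝ k fun x => q (D x) • B x := by
  rw [contDiff_iff_contDiffAt]
  intro x
  by_cases hx : |D x| < δ₀
  · exact (hq.contDiffAt.comp x ((h.contDiffAt hx).of_le hk)).smul
      (hB.contDiffAt ((h.isOpen_slab δ₀).mem_nhds hx))
  · have hx' : r < |D x| := hr.trans_le (not_lt.1 hx)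
    refine contDiffAt_const (c := (0 : F)) |>.congr_of_eventuallyEq ?_
    filter_upwards [(isOpen_lt continuous_const h.continuous.abs).mem_nhds hx'] with y hy
    rw [hq0 _ hy, zero_smul]

lemma tsupport_comp_smul_subset {F : Type*} [NormedAddCommGroup F] [NormedSpace ℝ F]
    {q : ℝ → ℝ} {r : ℝ} (hq0 : ∀ t, r < |t| → q t = 0) (B : E d → F) :
    tsupport (fun x => q (D x) • B x) ⊆ {x | |D x| ≤ r} := by
  refine closure_minimal (fun x hx => ?_) (isClosed_le h.continuous.abs continuous_const)
  by_contra hcon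
  exact hx (by simp only [hq0 _ (not_le.1 hcon), zero_smul])

lemma hasCompactSupport_comp_smul {F : Type*} [NormedAddCommGroup F] [NormedSpace ℝ F]
    {q : ℝ → ℝ} {r : ℝ} (hq0 : ∀ t, r < |t| → q t = 0) (B : E d → F) :
    HasCompactSupport (fun x => q (D x) • B x) :=
  (h.isCompact r).of_isClosed_subset (isClosed_tsupport _) (h.tsupport_comp_smul_subset hq0 B)

/-- The formula holds everywhere, also where `D` is not differentiable: there `|D| ≥ δ₀ > 3 r`, the
ramp is locally constant and `ρ` vanishes. -/
lemma hasFDerivAt_ramp {k ρ : ℝ → ℝ} (hk : ∀ t, HasDerivAt k (ρ t) t)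
    (hρ : ∀ t, t ∉ Ioo (0 : ℝ) 3 → ρ t = 0) {r : ℝ} (hr : 0 < r) (hr' : 3 * r < δ₀)
    (hk0 : ∀ t ≤ 0, k t = 0) (hk1 : ∀ t, 3 ≤ t → k t = 1) (x : E d) :
    HasFDerivAt (fun x => k (D x / r)) ((ρ (D x / r) / r) • fderiv ℝ D x) x := by
  by_cases hx : |D x| < δ₀
  · have h1 := ((h.contDiffAt hx).differentiableAt (by simp)).hasFDerivAt
    have h2 : HasDerivAt (fun t => k (t / r)) (ρ (D x / r) / r) (D x) := by
      have := (hk (D x / r)).comp (D x) ((hasDerivAt_id (D x)).div_const r)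
      refine this.congr_deriv ?_
      ring
    exact h2.comp_hasFDerivAt x h1
  · have hx' : 3 * r < |D x| := hr'.trans_le (not_lt.1 hx)
    have hz : ρ (D x / r) = 0 := by
      apply hρ
      rintro ⟨h1, h2⟩
      rw [div_lt_iff₀ hr] at h2
      rw [abs_of_pos ((div_pos_iff_of_pos_right hr).1 h1)] at hx'
      linarith
    rw [hz, zero_div, zero_smul]
    rcases lt_abs.1 hx' with h1 | h1
    · refine (hasFDerivAt_const (1 : ℝ) x).congr_of_eventuallyEq ?_
      filter_upwards [(isOpen_lt continuous_const h.continuous).mem_nhds h1] with y hy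
      exact hk1 _ (by rw [le_div_iff₀ hr]; exact le_of_lt hy)
    · refine (hasFDerivAt_const (0 : ℝ) x).congr_of_eventuallyEq ?_
      have h1' : D x < 0 := by linarith
      filter_upwards [(isOpen_lt h.continuous continuous_const).mem_nhds h1'] with y hy
      exact hk0 _ (div_nonpos_of_nonpos_of_nonneg (le_of_lt hy) hr.le)

lemma contDiff_ramp {k ρ : ℝ → ℝ} (hρc : Continuous ρ) (hk : ∀ t, HasDerivAt k (ρ t) t)
    {r : ℝ} (hr : 0 < r) (hr' : 3 * r < δ₀)
    (hk0 : ∀ t ≤ 0, k t = 0) (hk1 : ∀ t, 3 ≤ t → k t = 1) :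
    ContDiff ℝ 1 (fun x => k (D x / r)) := by
  have hk1' : ContDiff ℝ 1 k := by
    rw [contDiff_one_iff_deriv]
    refine ⟨fun t => (hk t).differentiableAt, ?_⟩
    have : deriv k = ρ := funext fun t => (hk t).deriv
    rwa [this]
  rw [contDiff_iff_contDiffAt]
  intro x
  by_cases hx : |D x| < δ₀
  · have := ((h.contDiffAt hx).of_le (m := 1) (by simp)).div_const r
    exact hk1'.contDiffAt.comp x this
  · have hx' : 3 * r < |D x| := hr'.trans_le (not_lt.1 hx)
    rcases lt_abs.1 hx' with h1 | h1
    · refine (contDiffAt_const (c := (1 : ℝ))).congr_of_eventuallyEq ?_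
      filter_upwards [(isOpen_lt continuous_const h.continuous).mem_nhds h1] with y hy
      exact hk1 _ (by rw [le_div_iff₀ hr]; exact le_of_lt hy)
    · refine (contDiffAt_const (c := (0 : ℝ))).congr_of_eventuallyEq ?_
      have h1' : D x < 0 := by linarith
      filter_upwards [(isOpen_lt h.continuous continuous_const).mem_nhds h1'] with y hy
      exact hk0 _ (div_nonpos_of_nonpos_of_nonneg (le_of_lt hy) hr.le)

end General

end IsDefining

end Slabs

/-! ### Trace inequality and estimate of boundary terms -/

section TraceInequality

open scoped NNReal ENNReal

lemma exists_cutoff {a b : ℝ} (ha : 0 < a) (hab : a < b) : ∃ χ : ℝ → ℝ,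
    ContDiff ℝ ((⊤ : ℕ∞) : ℕ∞ω) χ ∧ (∀ t, |t| ≤ a → χ t = 1) ∧ (∀ t, b ≤ |t| → χ t = 0) ∧
    ∀ t, χ t ∈ Icc (0 : ℝ) 1 := by
  let f : ContDiffBump (0 : ℝ) := ⟨a, b, ha, hab⟩
  refine ⟨f, f.contDiff, fun t ht => f.one_of_mem_closedBall ?_, fun t ht => f.zero_of_le_dist ?_,
    fun t => ⟨f.nonneg, f.le_one⟩⟩
  · simpa [f] using ht
  · simpa [f] using ht

namespace IsDefining

section Trace

variable {m : ℕ} {D : E (m + 1) → ℝ} {δ₀ : ℝ} (h : IsDefining D δ₀)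

include h

lemma integrableOn_of_continuous {F : Type*} [NormedAddCommGroup F] {f : E (m + 1) → F}
    (hf : Continuous f) {r : ℝ} {S : Set (E (m + 1))} (hS : S ⊆ {x | |D x| ≤ r}) :
    IntegrableOn f S :=
  (hf.continuousOn.integrableOn_compact (h.isCompact r)).mono_set hS

/-- Integrate the ramp `k(D/r)` by parts against the field `χ(D) v² ∇D`. The derivative of the ramp
along this field is `κ v²/r` on the slab, since `|∇D| = 1`. The other side contains only `v²` and
`|v| |∇v|`, with a constant independent of `r`. -/
lemma exists_trace_inequality_aux : ∃ C : ℝ, 0 ≤ C ∧ ∀ v : E (m + 1) → ℝ, ContDiff ℝ 1 v →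
    ∀ r, 0 < r → 8 * r < δ₀ →
    ∫ x in {x | D x ∈ Ioo r (2 * r)}, v x ^ 2 ≤
      C * r * ∫ x in {x | 0 < D x ∧ |D x| < δ₀}, (v x ^ 2 + |v x| * ‖fderiv ℝ v x‖) := by
  obtain ⟨χ, hχ, hχ1, hχ0, hχI⟩ := exists_cutoff (a := δ₀ / 4) (b := δ₀ / 2)
    (by linarith [h.pos]) (by linarith [h.pos])
  obtain ⟨k, ρ, κ, hκ, hρc, hk, hk0, hk1, hkI, hρI, hρκ, hρ0⟩ := exists_ramp
  have hχ0' : ∀ t, δ₀ / 2 < |t| → χ t = 0 := fun t ht => hχ0 t ht.le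
  have hδ := h.pos
  set Y : Fin (m + 1) → E (m + 1) → ℝ := fun i x => χ (D x) • fderiv ℝ D x (basisVec i) with hY
  have hYs : ∀ i, ContDiff ℝ 1 (Y i) := by
    intro i
    refine h.contDiff_comp_smul (by simp) (hχ.of_le (by simp)) (by linarith : δ₀ / 2 < δ₀) hχ0' ?_
    intro x hx
    have h1 : ContDiffAt ℝ 1 (fderiv ℝ D) x := (h.contDiffAt hx).fderiv_right (by
      rw [one_add_one_eq_two]; exact WithTop.coe_le_coe.2 le_top)
    exact (h1.clm_apply contDiffAt_const).contDiffWithinAt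
  have hYc : ∀ i, HasCompactSupport (Y i) := fun i => h.hasCompactSupport_comp_smul hχ0' _
  obtain ⟨M, hM0, hM1, hM2⟩ : ∃ M : ℝ, 0 ≤ M ∧ (∀ i x, |Y i x| ≤ M) ∧
      ∀ i x, |fderiv ℝ (Y i) x (basisVec i)| ≤ M := by
    choose M1 hM1 using fun i => (hYc i).exists_bound_of_continuous (hYs i).continuous
    choose M2 hM2 using fun i => (hasCompactSupport_fderiv_basisVec (hYc i) i).exists_bound_of_continuous
      (continuous_fderiv_basisVec (hYs i) i)
    have p1 : ∀ i, 0 ≤ M1 i := fun i => (norm_nonneg _).trans (hM1 i 0)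
    have p2 : ∀ i, 0 ≤ M2 i := fun i => (norm_nonneg _).trans (hM2 i 0)
    refine ⟨∑ i, (M1 i + M2 i), Finset.sum_nonneg fun i _ => add_nonneg (p1 i) (p2 i),
      fun i x => ?_, fun i x => ?_⟩
    · calc |Y i x| ≤ M1 i := hM1 i x
        _ ≤ M1 i + M2 i := by linarith [p2 i]
        _ ≤ _ := Finset.single_le_sum (f := fun i => M1 i + M2 i)
          (fun i _ => add_nonneg (p1 i) (p2 i)) (Finset.mem_univ i)
    · calc |fderiv ℝ (Y i) x (basisVec i)| ≤ M2 i := hM2 i x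
        _ ≤ M1 i + M2 i := by linarith [p1 i]
        _ ≤ _ := Finset.single_le_sum (f := fun i => M1 i + M2 i)
          (fun i _ => add_nonneg (p1 i) (p2 i)) (Finset.mem_univ i)
  -- There are `m + 1` coordinate directions. Each contributes `2 M`, where the factor `2` comes
  -- from differentiating `v²`.
  refine ⟨(m + 1) * (2 * M) / κ, by positivity, fun v hv r hr hr' => ?_⟩
  set H : E (m + 1) → ℝ := fun x => k (D x / r) with hH
  have hr3 : 3 * r < δ₀ := by linarith
  have hHs : ContDiff ℝ 1 H := h.contDiff_ramp hρc hk hr hr3 hk0 hk1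
  have hHd : ∀ x, HasFDerivAt H ((ρ (D x / r) / r) • fderiv ℝ D x) x :=
    h.hasFDerivAt_ramp hk hρ0 hr hr3 hk0 hk1
  set g : Fin (m + 1) → E (m + 1) → ℝ := fun i x => Y i x * v x ^ 2 with hg
  have hgs : ∀ i, ContDiff ℝ 1 (g i) := fun i => (hYs i).mul (hv.pow 2)
  have hgc : ∀ i, HasCompactSupport (g i) := fun i => (hYc i).mul_right
  have hibp := fun i => integral_smul_fderiv_eq_neg hHs (hgs i) (hgc i) i
  have hvd : ∀ x, HasFDerivAt v (fderiv ℝ v x) x := fun x =>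
    ((hv.differentiable (by simp)) x).hasFDerivAt
  have hgd : ∀ i x, fderiv ℝ (g i) x (basisVec i) =
      Y i x * (2 * v x * fderiv ℝ v x (basisVec i)) +
        v x ^ 2 * fderiv ℝ (Y i) x (basisVec i) := by
    intro i x
    have h1 := (((hYs i).differentiable (by simp)) x).hasFDerivAt
    have h2 := h1.mul ((hvd x).pow 2)
    have h3 : fderiv ℝ (g i) x = _ := h2.fderiv
    rw [h3]
    simp
  set R : Set (E (m + 1)) := {x | 0 < D x ∧ |D x| < δ₀} with hR
  have hRm : MeasurableSet R :=
    (h.continuous.measurable measurableSet_Ioi).inter (h.isOpen_slab δ₀).measurableSet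
  have hnn : ∀ x, 0 ≤ v x ^ 2 + |v x| * ‖fderiv ℝ v x‖ := fun x => by positivity
  have hcont : Continuous fun x => v x ^ 2 + |v x| * ‖fderiv ℝ v x‖ :=
    (hv.continuous.pow 2).add (hv.continuous.abs.mul (hv.continuous_fderiv (by simp)).norm)
  have hintR : IntegrableOn (fun x => v x ^ 2 + |v x| * ‖fderiv ℝ v x‖) R :=
    h.integrableOn_of_continuous hcont (r := δ₀) fun x hx => le_of_lt hx.2
  -- The integrand lives on `R`: the ramp vanishes where `D ≤ 0`, the field where `|D| > δ₀ / 2`.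
  have hleft : ∀ i, |∫ x, H x • fderiv ℝ (g i) x (basisVec i)| ≤
      2 * M * ∫ x in R, (v x ^ 2 + |v x| * ‖fderiv ℝ v x‖) := by
    intro i
    rw [← Real.norm_eq_abs, ← integral_const_mul, ← integral_indicator hRm]
    refine norm_integral_le_of_norm_le (IntegrableOn.integrable_indicator
      (hintR.const_mul (2 * M)) hRm) ?_
    refine Eventually.of_forall fun x => ?_
    by_cases hxR : x ∈ R
    · rw [indicator_of_mem hxR, norm_smul, hgd i x, Real.norm_eq_abs, Real.norm_eq_abs,
        abs_of_nonneg (hkI _).1]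
      have e1 : |fderiv ℝ v x (basisVec i)| ≤ ‖fderiv ℝ v x‖ := by
        have := (fderiv ℝ v x).le_opNorm (basisVec i)
        rwa [norm_basisVec, mul_one] at this
      have e2 : |Y i x * (2 * v x * fderiv ℝ v x (basisVec i)) +
          v x ^ 2 * fderiv ℝ (Y i) x (basisVec i)| ≤
          M * (2 * |v x| * ‖fderiv ℝ v x‖) + v x ^ 2 * M := by
        refine (abs_add_le _ _).trans (add_le_add ?_ ?_)
        · rw [abs_mul, abs_mul, abs_mul, abs_two]
          gcongr
          exact hM1 i x
        · rw [abs_mul, abs_of_nonneg (sq_nonneg _)]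
          gcongr
          exact hM2 i x
      calc _ ≤ 1 * (M * (2 * |v x| * ‖fderiv ℝ v x‖) + v x ^ 2 * M) := by
            gcongr
            exact (hkI _).2
        _ ≤ _ := by nlinarith [mul_nonneg hM0 (sq_nonneg (v x))]
    · rw [indicator_of_notMem hxR]
      have : H x • fderiv ℝ (g i) x (basisVec i) = 0 := by
        by_cases hD0 : D x ≤ 0
        · rw [hH]
          simp only [hk0 _ (div_nonpos_of_nonpos_of_nonneg hD0 hr.le), zero_smul]
        · have hD1 : δ₀ ≤ |D x| := by
            by_contra hcon
            exact hxR ⟨not_le.1 hD0, not_le.1 hcon⟩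
          have hts : x ∉ tsupport (g i) := by
            intro hx
            have h1 : x ∈ tsupport (Y i) := closure_mono (fun y (hy : g i y ≠ 0) (h0 : Y i y = 0) =>
              hy (by simp only [hg, h0, zero_mul])) hx
            have h2 : |D x| ≤ δ₀ / 2 := h.tsupport_comp_smul_subset hχ0' _ h1
            linarith
          rw [fderiv_of_notMem_tsupport ℝ hts]
          simp
      rw [this, norm_zero]
  have hsum : ∑ i, ∫ x, fderiv ℝ H x (basisVec i) • g i x =
      ∫ x, (ρ (D x / r) / r) * χ (D x) * ‖fderiv ℝ D x‖ ^ 2 * v x ^ 2 := by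
    rw [← integral_finsetSum]
    · refine integral_congr_ae (Eventually.of_forall fun x => ?_)
      simp only [(hHd x).fderiv, hg, hY, ← sum_fderiv_sq]
      rw [Finset.mul_sum, Finset.sum_mul]
      refine Finset.sum_congr rfl fun i _ => ?_
      simp
      ring
    · intro i _
      exact ((continuous_fderiv_basisVec hHs i).smul
        (hgs i).continuous).integrable_of_hasCompactSupport (hgc i).smul_left
  have hlower : κ / r * ∫ x in {x | D x ∈ Ioo r (2 * r)}, v x ^ 2 ≤
      ∫ x, (ρ (D x / r) / r) * χ (D x) * ‖fderiv ℝ D x‖ ^ 2 * v x ^ 2 := by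
    have hSm : MeasurableSet {x | D x ∈ Ioo r (2 * r)} := h.continuous.measurable measurableSet_Ioo
    rw [← integral_const_mul, ← integral_indicator hSm]
    refine integral_mono_of_nonneg (Eventually.of_forall fun x => ?_) ?_
      (Eventually.of_forall fun x => ?_)
    · refine indicator_nonneg (fun x _ => ?_) x
      positivity
    · have hi : ∀ i ∈ Finset.univ, Integrable
          (fun x => fderiv ℝ H x (basisVec i) • g i x) := fun i _ =>
        ((continuous_fderiv_basisVec hHs i).smul
          (hgs i).continuous).integrable_of_hasCompactSupport (hgc i).smul_left
      refine (integrable_finsetSum Finset.univ hi).congr (Eventually.of_forall fun x => ?_)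
      simp only [(hHd x).fderiv, hg, hY, ← sum_fderiv_sq]
      rw [Finset.mul_sum, Finset.sum_mul]
      refine Finset.sum_congr rfl fun i _ => ?_
      simp
      ring
    · by_cases hx : x ∈ {x | D x ∈ Ioo r (2 * r)}
      · rw [indicator_of_mem hx]
        have hx1 : D x ∈ Ioo r (2 * r) := hx
        have hx2 : |D x| < δ₀ / 4 := by
          rw [abs_of_pos (hr.trans hx1.1)]; linarith [hx1.2]
        beta_reduce
        rw [hχ1 _ hx2.le, h.norm_fderiv x (by linarith), hρκ]
        · apply le_of_eq; ring
        · constructor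
          · rw [le_div_iff₀ hr]; linarith [hx1.1]
          · rw [div_le_iff₀ hr]; linarith [hx1.2]
      · rw [indicator_of_notMem hx]
        have := (hρI (D x / r)).1
        have := (hχI (D x)).1
        positivity
  have htot : κ / r * ∫ x in {x | D x ∈ Ioo r (2 * r)}, v x ^ 2 ≤
      (m + 1) * (2 * M * ∫ x in R, (v x ^ 2 + |v x| * ‖fderiv ℝ v x‖)) := by
    refine hlower.trans ?_
    rw [← hsum]
    calc ∑ i, ∫ x, fderiv ℝ H x (basisVec i) • g i x
        ≤ ∑ i : Fin (m + 1), 2 * M * ∫ x in R, (v x ^ 2 + |v x| * ‖fderiv ℝ v x‖) := by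
          refine Finset.sum_le_sum fun i _ => ?_
          have h1 := hleft i
          rw [hibp i, abs_neg] at h1
          exact (le_abs_self _).trans h1
      _ = _ := by simp
  calc ∫ x in {x | D x ∈ Ioo r (2 * r)}, v x ^ 2
      = r / κ * (κ / r * ∫ x in {x | D x ∈ Ioo r (2 * r)}, v x ^ 2) := by field_simp
    _ ≤ r / κ * ((m + 1) * (2 * M * ∫ x in R, (v x ^ 2 + |v x| * ‖fderiv ℝ v x‖))) := by gcongr
    _ = _ := by ring

/-- The trace inequality: the surface integral of `v²` is controlled by an integral over the
positive side of the surface. -/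
lemma exists_trace_inequality : ∃ C : ℝ≥0, ∀ v : E (m + 1) → ℝ, ContDiff ℝ 1 v →
    ∫⁻ x in {x | D x = 0}, ‖v x‖ₑ ^ 2 ∂(surf (m + 1)) ≤
      C * ∫⁻ x in {x | 0 < D x ∧ |D x| < δ₀}, (‖v x‖ₑ ^ 2 + ‖v x‖ₑ * ‖fderiv ℝ v x‖ₑ) := by
  obtain ⟨C1, hC10, hC1⟩ := h.exists_trace_inequality_aux
  obtain ⟨C2, hC2⟩ := h.exists_surf_le_slab
  refine ⟨C2 * C1.toNNReal, fun v hv => ?_⟩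
  set S := ∫⁻ x in {x | D x = 0}, ‖v x‖ₑ ^ 2 ∂(surf (m + 1))
  set R : Set (E (m + 1)) := {x | 0 < D x ∧ |D x| < δ₀} with hR
  set J := ∫⁻ x in R, (‖v x‖ₑ ^ 2 + ‖v x‖ₑ * ‖fderiv ℝ v x‖ₑ) with hJ
  have hcont : Continuous fun x => v x ^ 2 + |v x| * ‖fderiv ℝ v x‖ :=
    (hv.continuous.pow 2).add (hv.continuous.abs.mul (hv.continuous_fderiv (by simp)).norm)
  have hJr : ENNReal.ofReal (∫ x in R, (v x ^ 2 + |v x| * ‖fderiv ℝ v x‖)) = J := by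
    rw [ofReal_integral_eq_lintegral_ofReal
      (h.integrableOn_of_continuous hcont (r := δ₀) fun x hx => le_of_lt hx.2)
      (Eventually.of_forall fun x => by positivity)]
    refine lintegral_congr fun x => ?_
    rw [ENNReal.ofReal_add (by positivity) (by positivity), ENNReal.ofReal_mul (by positivity),
      ← Real.norm_eq_abs, ofReal_norm, ofReal_norm, ← sq_abs, ENNReal.ofReal_pow (abs_nonneg _),
      ← Real.norm_eq_abs, ofReal_norm]
  -- Surface against slab, then slab against volume: both estimates carry a factor `r`, which
  -- cancels for a single small `r`. The error `η` is removed afterwards.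
  have key : ∀ η : ℝ, 0 < η → S ≤ C2 * (C1.toNNReal * J + ENNReal.ofReal η) := by
    intro η hη
    obtain ⟨r, hr1, hr2, hr3⟩ := ((hC2 v hv.continuous η hη).and
      ((eventually_nhdsWithin_of_eventually_nhds
        (eventually_lt_nhds (show (0 : ℝ) < δ₀ / 8 by linarith [h.pos]))).and
        self_mem_nhdsWithin)).exists
    have hr : 0 < r := hr3
    have h1 := hC1 v hv r hr (by linarith)
    have h2 : ∫⁻ x in {x | D x ∈ Ioo r (2 * r)}, ‖v x‖ₑ ^ 2 ≤
        ENNReal.ofReal r * (C1.toNNReal * J) := by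
      have e : ∫⁻ x in {x | D x ∈ Ioo r (2 * r)}, ‖v x‖ₑ ^ 2
          = ENNReal.ofReal (∫ x in {x | D x ∈ Ioo r (2 * r)}, v x ^ 2) := by
        rw [ofReal_integral_eq_lintegral_ofReal
          (h.integrableOn_of_continuous (f := fun x => v x ^ 2) (hv.continuous.pow 2) (r := 2 * r) fun x hx => by
            have hx' : D x ∈ Ioo r (2 * r) := hx
            change |D x| ≤ 2 * r
            rw [abs_of_pos (hr.trans hx'.1)]
            exact hx'.2.le)
          (Eventually.of_forall fun x => by positivity)]
        refine lintegral_congr fun x => ?_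
        rw [← sq_abs, ENNReal.ofReal_pow (abs_nonneg _), ← Real.norm_eq_abs, ofReal_norm]
      rw [e]
      refine (ENNReal.ofReal_le_ofReal h1).trans (le_of_eq ?_)
      rw [ENNReal.ofReal_mul (mul_nonneg hC10 hr.le), ENNReal.ofReal_mul hC10, hJr]
      change ENNReal.ofReal C1 * ENNReal.ofReal r * J = ENNReal.ofReal r * (ENNReal.ofReal C1 * J)
      ring
    have h3 : ENNReal.ofReal r * S ≤
        ENNReal.ofReal r * (C2 * (C1.toNNReal * J + ENNReal.ofReal η)) := by
      refine hr1.trans ?_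
      calc _ ≤ C2 * (ENNReal.ofReal r * (C1.toNNReal * J)
            + ENNReal.ofReal r * ENNReal.ofReal η) := by gcongr
        _ = _ := by ring
    exact (ENNReal.mul_le_mul_iff_right (by simpa using hr) ENNReal.ofReal_ne_top).1 h3
  have hlim : Tendsto (fun η : ℝ => (C2 : ℝ≥0∞) * (C1.toNNReal * J + ENNReal.ofReal η))
      (𝓝[>] 0) (𝓝 (C2 * (C1.toNNReal * J + 0))) := by
    have h2 : Tendsto (fun r : ℝ => ENNReal.ofReal r) (𝓝[>] 0) (𝓝 0) := by
      have := (ENNReal.continuous_ofReal.tendsto 0).mono_left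
        (nhdsWithin_le_nhds (s := Ioi (0 : ℝ)))
      simpa using this
    exact ENNReal.Tendsto.const_mul (tendsto_const_nhds.add h2) (Or.inr ENNReal.coe_ne_top)
  have := ge_of_tendsto hlim (by filter_upwards [self_mem_nhdsWithin] with η hη using key η hη)
  rw [add_zero] at this
  push_cast
  rwa [mul_assoc]

/-- The integral of a partial derivative over one side of the surface is controlled by the
surface integral. -/
lemma exists_boundary_estimate : ∃ C : ℝ≥0, ∀ {F : Type} [NormedAddCommGroup F] [NormedSpace ℝ F]
    [CompleteSpace F] (v : E (m + 1) → F), ContDiff ℝ 1 v → HasCompactSupport v → ∀ i,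
    ‖∫ x in {x | 0 < D x}, fderiv ℝ v x (basisVec i)‖ₑ ^ 2 ≤
      C * ∫⁻ x in {x | D x = 0}, ‖v x‖ₑ ^ 2 ∂(surf (m + 1)) := by
  obtain ⟨k, ρ, κ, hκ, hρc, hk, hk0, hk1, hkI, hρI, hρκ, hρ0⟩ := exists_ramp
  obtain ⟨C1, r₀, hr₀, hC1⟩ := h.exists_volume_le
  obtain ⟨C2, hC2⟩ := h.exists_slab_le_surf
  -- The factor `9` is the square of the `3` in the slab width `3 r`.
  refine ⟨κ.toNNReal ^ 2 * 9 * C1 * C2, fun {F} _ _ _ v hv hvc i => ?_⟩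
  have hδ := h.pos
  set S := ∫⁻ x in {x | D x = 0}, ‖v x‖ₑ ^ 2 ∂(surf (m + 1)) with hS
  have hlim : Tendsto (fun r => ∫ x, k (D x / r) • fderiv ℝ v x (basisVec i)) (𝓝[>] 0)
      (𝓝 (∫ x in {x | 0 < D x}, fderiv ℝ v x (basisVec i))) := by
    have hpm : MeasurableSet {x | 0 < D x} := h.continuous.measurable measurableSet_Ioi
    rw [← integral_indicator hpm]
    have hint : Integrable (fun x => fderiv ℝ v x (basisVec i)) :=
      (continuous_fderiv_basisVec hv i).integrable_of_hasCompactSupport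
        (hasCompactSupport_fderiv_basisVec hvc i)
    have hkc : Continuous k := continuous_iff_continuousAt.2 fun t => (hk t).continuousAt
    refine tendsto_integral_filter_of_dominated_convergence
      (fun x => ‖fderiv ℝ v x (basisVec i)‖) ?_ ?_ hint.norm ?_
    · refine Eventually.of_forall fun r => ?_
      exact ((hkc.comp (h.continuous.div_const r)).smul
        (continuous_fderiv_basisVec hv i)).aestronglyMeasurable
    · refine Eventually.of_forall fun r => Eventually.of_forall fun x => ?_
      rw [norm_smul, Real.norm_of_nonneg (hkI _).1]
      exact mul_le_of_le_one_left (norm_nonneg _) (hkI _).2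
    · refine Eventually.of_forall fun x => ?_
      by_cases hx : 0 < D x
      · rw [indicator_of_mem (show x ∈ {x | 0 < D x} from hx)]
        refine tendsto_const_nhds.congr' ?_
        filter_upwards [Ioo_mem_nhdsGT (show 0 < D x / 3 by positivity)] with r hr
        rw [hk1 _ (by rw [le_div_iff₀ hr.1]; linarith [hr.2]), one_smul]
      · rw [indicator_of_notMem (show x ∉ {x | 0 < D x} from hx)]
        refine tendsto_const_nhds.congr' ?_
        filter_upwards [self_mem_nhdsWithin] with r hr
        rw [hk0 _ (div_nonpos_of_nonpos_of_nonneg (not_lt.1 hx) (le_of_lt hr)), zero_smul]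
  -- After integration by parts the ramp contributes at most `κ/r` on the slab `{|D| < 3r}`. By
  -- Cauchy–Schwarz the square is bounded by `r⁻²` times the volume `O(r)` times the slab integral
  -- of `‖v‖²`, which is `O(r)` times the surface integral, so the powers of `r` cancel.
  have key : ∀ η : ℝ, 0 < η → ∀ᶠ r in 𝓝[>] (0 : ℝ),
      ‖∫ x, k (D x / r) • fderiv ℝ v x (basisVec i)‖ₑ ^ 2 ≤
        (κ.toNNReal ^ 2 * 9 * C1 * C2 : ℝ≥0∞) * (S + ENNReal.ofReal η) := by
    intro η hη
    have hev := hC2 (fun x => ‖v x‖) hv.continuous.norm η hη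
    have hmap : Tendsto (fun r : ℝ => 3 * r) (𝓝[>] 0) (𝓝[>] 0) := by
      have h1 : Tendsto (fun r : ℝ => 3 * r) (𝓝 0) (𝓝 0) := by
        have : Continuous fun r : ℝ => 3 * r := by fun_prop
        simpa using this.tendsto 0
      refine tendsto_nhdsWithin_of_tendsto_nhds_of_eventually_within _
        (h1.mono_left nhdsWithin_le_nhds) ?_
      filter_upwards [self_mem_nhdsWithin] with r hr
      have : (0 : ℝ) < r := hr
      exact mul_pos three_pos this
    filter_upwards [hmap.eventually hev, Ioo_mem_nhdsGT (show 0 < δ₀ / 3 by positivity),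
      Ioo_mem_nhdsGT (show 0 < r₀ / 3 by positivity)] with r hr1 hr2 hr3
    have hr : 0 < r := hr2.1
    have hr3' : 3 * r < δ₀ := by linarith [hr2.2]
    have hvol := hC1 (3 * r) ⟨by positivity, by linarith [hr3.2]⟩
    simp only [enorm_norm] at hr1
    set A : Set (E (m + 1)) := {x | |D x| < 3 * r} with hA
    have hHs : ContDiff ℝ 1 fun x => k (D x / r) := h.contDiff_ramp hρc hk hr hr3' hk0 hk1
    have hHd := h.hasFDerivAt_ramp hk hρ0 hr hr3' hk0 hk1
    rw [integral_smul_fderiv_eq_neg hHs hv hvc i, enorm_neg]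
    have h1 : ‖∫ x, fderiv ℝ (fun x => k (D x / r)) x (basisVec i) • v x‖ₑ ≤
        ENNReal.ofReal (κ / r) * ∫⁻ x in A, ‖v x‖ₑ := by
      refine (enorm_integral_le_lintegral_enorm _).trans ?_
      rw [← lintegral_const_mul _ hv.continuous.enorm.measurable,
        ← lintegral_indicator (h.isOpen_slab _).measurableSet]
      refine lintegral_mono fun x => ?_
      rw [(hHd x).fderiv, enorm_smul]
      by_cases hx : x ∈ A
      · rw [indicator_of_mem hx]
        gcongr
        rw [← ofReal_norm]
        apply ENNReal.ofReal_le_ofReal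
        have hxA : |D x| < 3 * r := hx
        have e1 : ‖fderiv ℝ D x (basisVec i)‖ ≤ 1 := by
          have := (fderiv ℝ D x).le_opNorm (basisVec i)
          rwa [norm_basisVec, mul_one, h.norm_fderiv x (hxA.trans hr3')] at this
        simp only [smul_apply, norm_smul, Real.norm_eq_abs, abs_div]
        rw [abs_of_nonneg (hρI _).1, abs_of_pos hr]
        calc ρ (D x / r) / r * |fderiv ℝ D x (basisVec i)| ≤ κ / r * 1 := by
              gcongr
              · exact (hρI _).2
              · exact e1
          _ = κ / r := mul_one _
      · rw [indicator_of_notMem hx]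
        have hxA : 3 * r ≤ |D x| := not_lt.1 hx
        have : ρ (D x / r) = 0 := by
          apply hρ0
          rintro ⟨h1, h2⟩
          rw [div_lt_iff₀ hr] at h2
          rw [abs_of_pos ((div_pos_iff_of_pos_right hr).1 h1)] at hxA
          linarith
        simp [this]
    have h2 := setLIntegral_sq_le (μ := volume) hv.continuous.enorm.measurable A
    have h3r : ENNReal.ofReal (κ / r) ^ 2 * ENNReal.ofReal (3 * r) ^ 2
        = (κ.toNNReal : ℝ≥0∞) ^ 2 * 9 := by
      rw [← mul_pow, ← ENNReal.ofReal_mul (by positivity),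
        show κ / r * (3 * r) = κ * 3 by field_simp, ENNReal.ofReal_mul hκ.le, mul_pow]
      change ENNReal.ofReal κ ^ 2 * _ = ENNReal.ofReal κ ^ 2 * _
      rw [show ENNReal.ofReal 3 = 3 by simp]
      norm_num
    calc ‖∫ x, fderiv ℝ (fun x => k (D x / r)) x (basisVec i) • v x‖ₑ ^ 2
        ≤ (ENNReal.ofReal (κ / r) * ∫⁻ x in A, ‖v x‖ₑ) ^ 2 := by gcongr
      _ = ENNReal.ofReal (κ / r) ^ 2 * (∫⁻ x in A, ‖v x‖ₑ) ^ 2 := mul_pow _ _ _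
      _ ≤ ENNReal.ofReal (κ / r) ^ 2 * ((C1 * ENNReal.ofReal (3 * r)) *
          (C2 * ENNReal.ofReal (3 * r) * (S + ENNReal.ofReal η))) := by
        gcongr
        exact h2.trans (mul_le_mul' hvol hr1)
      _ = (ENNReal.ofReal (κ / r) ^ 2 * ENNReal.ofReal (3 * r) ^ 2) * C1 * C2 *
          (S + ENNReal.ofReal η) := by ring
      _ = _ := by rw [h3r]
  have hle : ∀ η : ℝ, 0 < η → ‖∫ x in {x | 0 < D x}, fderiv ℝ v x (basisVec i)‖ₑ ^ 2 ≤
      (κ.toNNReal ^ 2 * 9 * C1 * C2 : ℝ≥0∞) * (S + ENNReal.ofReal η) := by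
    intro η hη
    refine le_of_tendsto ?_ (key η hη)
    exact (ENNReal.continuous_pow 2).continuousAt.tendsto.comp
      ((continuous_enorm.tendsto _).comp hlim)
  have hlim2 : Tendsto (fun η : ℝ => (κ.toNNReal ^ 2 * 9 * C1 * C2 : ℝ≥0∞) *
      (S + ENNReal.ofReal η)) (𝓝[>] 0) (𝓝 ((κ.toNNReal ^ 2 * 9 * C1 * C2 : ℝ≥0∞) * (S + 0))) := by
    have h2 : Tendsto (fun r : ℝ => ENNReal.ofReal r) (𝓝[>] 0) (𝓝 0) := by
      have := (ENNReal.continuous_ofReal.tendsto 0).mono_left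
        (nhdsWithin_le_nhds (s := Ioi (0 : ℝ)))
      simpa using this
    refine ENNReal.Tendsto.const_mul (tendsto_const_nhds.add h2) (Or.inr ?_)
    have : (κ.toNNReal ^ 2 * 9 * C1 * C2 : ℝ≥0∞) = ((κ.toNNReal ^ 2 * 9 * C1 * C2 : ℝ≥0) : ℝ≥0∞) := by
      push_cast; ring
    rw [this]
    exact ENNReal.coe_ne_top
  have := ge_of_tendsto hlim2 (by filter_upwards [self_mem_nhdsWithin] with η hη using hle η hη)
  rw [add_zero] at this
  push_cast
  exact this

end Trace

end IsDefining

end TraceInequality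

/-! ### Convergence in `L²` and composition in `H¹` -/

section Glue

open scoped NNReal ENNReal

section LTwo

variable {X : Type*} [MeasurableSpace X] {μ : Measure X} {F : Type*} [NormedAddCommGroup F]

lemma eLpNorm_two_sq (f : X → F) : eLpNorm f 2 μ ^ 2 = ∫⁻ x, ‖f x‖ₑ ^ 2 ∂μ := by
  rw [eLpNorm_eq_lintegral_rpow_enorm_toReal (by simp) (by simp)]
  simp only [ENNReal.toReal_ofNat, ENNReal.rpow_ofNat]
  rw [← ENNReal.rpow_natCast, ← ENNReal.rpow_mul]
  norm_num

lemma tendsto_eLpNorm_two_iff {ι : Type*} {l : Filter ι} {f : ι → X → F} :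
    Tendsto (fun k => eLpNorm (f k) 2 μ) l (𝓝 0) ↔
      Tendsto (fun k => ∫⁻ x, ‖f k x‖ₑ ^ 2 ∂μ) l (𝓝 0) := by
  simp_rw [← eLpNorm_two_sq]
  constructor
  · intro h
    have h1 := (ENNReal.continuous_pow 2).continuousAt.tendsto.comp h
    simpa [Function.comp_def] using h1
  · intro h
    have h1 := (ENNReal.continuous_rpow_const (y := (1 / 2 : ℝ))).continuousAt.tendsto.comp h
    have e : ∀ k, ((fun x : ℝ≥0∞ => x ^ (1 / 2 : ℝ)) ∘ fun k => eLpNorm (f k) 2 μ ^ 2) k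
        = eLpNorm (f k) 2 μ := fun k => by
      simp only [Function.comp]
      rw [← ENNReal.rpow_natCast, ← ENNReal.rpow_mul]
      norm_num
    rw [show (fun k => eLpNorm (f k) 2 μ) = _ from (funext e).symm]
    simpa using h1

lemma tendsto_integral_smul_of_tendsto_eLpNorm [NormedSpace ℝ F] [IsFiniteMeasure μ]
    {f : ℕ → X → F} {g : X → F} (hf : ∀ k, MemLp (f k) 2 μ) (hg : MemLp g 2 μ)
    (h : Tendsto (fun k => eLpNorm (fun x => f k x - g x) 2 μ) atTop (𝓝 0))
    {θ : X → ℝ} (hθ : AEStronglyMeasurable θ μ) {C : ℝ} (hC : ∀ x, ‖θ x‖ ≤ C) :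
    Tendsto (fun k => ∫ x, θ x • f k x ∂μ) atTop (𝓝 (∫ x, θ x • g x ∂μ)) := by
  have hint : ∀ {u : X → F}, MemLp u 2 μ → Integrable (fun x => θ x • u x) μ := fun hu =>
    (hu.integrable (by norm_num)).bdd_smul C hθ (Eventually.of_forall hC)
  refine tendsto_integral_of_L1' _ (hint hg).aestronglyMeasurable (Eventually.of_forall fun k => hint (hf k)) ?_
  have hle : ∀ k, eLpNorm ((fun x => θ x • f k x) - fun x => θ x • g x) 1 μ ≤
      ENNReal.ofReal C * (eLpNorm (fun x => f k x - g x) 2 μ *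
        μ univ ^ (1 / (1 : ℝ≥0∞).toReal - 1 / (2 : ℝ≥0∞).toReal)) := by
    intro k
    have h1 : eLpNorm ((fun x => θ x • f k x) - fun x => θ x • g x) 1 μ ≤
        ENNReal.ofReal C * eLpNorm (fun x => f k x - g x) 1 μ := by
      refine eLpNorm_le_mul_eLpNorm_of_ae_le_mul (Eventually.of_forall fun x => ?_) 1
      rw [Pi.sub_apply, ← smul_sub, norm_smul]
      exact mul_le_mul_of_nonneg_right (hC x) (norm_nonneg _)
    refine h1.trans ?_
    gcongr
    exact eLpNorm_le_eLpNorm_mul_rpow_measure_univ (by norm_num)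
      ((hf k).aestronglyMeasurable.sub hg.aestronglyMeasurable)
  refine tendsto_of_tendsto_of_tendsto_of_le_of_le tendsto_const_nhds ?_ (fun _ => zero_le) hle
  have hfin : μ univ ^ (1 / (1 : ℝ≥0∞).toReal - 1 / (2 : ℝ≥0∞).toReal) ≠ ⊤ :=
    ENNReal.rpow_ne_top_of_nonneg (by norm_num) (measure_ne_top _ _)
  have h2 := ENNReal.Tendsto.mul_const (b := μ univ ^ (1 / (1 : ℝ≥0∞).toReal
    - 1 / (2 : ℝ≥0∞).toReal)) h (Or.inr hfin)
  have h3 := ENNReal.Tendsto.const_mul (a := ENNReal.ofReal C) h2 (Or.inr ENNReal.ofReal_ne_top)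
  simpa using h3

end LTwo

lemma memLp_const_mul_one_add_norm {X F : Type*} [MeasurableSpace X] {μ : Measure X}
    [IsFiniteMeasure μ] [NormedAddCommGroup F] (M : ℝ) {g : X → F} {p : ℝ≥0∞} (hg : MemLp g p μ) :
    MemLp (fun x => M * (1 + ‖g x‖)) p μ := by
  have h0 : MemLp (fun x => (1 : ℝ) + ‖g x‖) p μ := (memLp_const (1 : ℝ)).add hg.norm
  exact h0.const_mul M

lemma memLp_of_continuous_of_isBounded {d : ℕ} {F : Type*} [NormedAddCommGroup F]
    {f : E d → F} (hf : Continuous f) {R : Set (E d)}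
    (hR : Bornology.IsBounded R) (p : ℝ≥0∞) : MemLp f p (volume.restrict R) := by
  obtain ⟨C, hC⟩ := hR.isCompact_closure.exists_bound_of_continuousOn hf.continuousOn
  have h1 : MemLp f p (volume.restrict (closure R)) := by
    have : IsFiniteMeasure (volume.restrict (closure R)) :=
      ⟨by rw [Measure.restrict_apply_univ]; exact hR.isCompact_closure.measure_lt_top⟩
    refine MemLp.of_bound hf.aestronglyMeasurable C ?_
    filter_upwards [ae_restrict_mem isClosed_closure.measurableSet] with x hx using hC x hx
  exact h1.mono_measure (Measure.restrict_mono subset_closure le_rfl)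

section Composition

variable {d : ℕ} {F₁ F₂ : Type} [NormedAddCommGroup F₁] [NormedSpace ℝ F₁]
  [NormedAddCommGroup F₂] [NormedSpace ℝ F₂]

/-- The expected weak partial derivative of `x ↦ Φ (x, u x)`. -/
def compDeriv (Φ : E d × F₁ → F₂) (u : E d → F₁) (Du : Fin d → E d → F₁) (i : Fin d)
    (x : E d) : F₂ :=
  fderiv ℝ Φ (x, u x) (basisVec i, Du i x)

lemma norm_comp_sub_le {Φ : E d × F₁ → F₂} (hΦ : ContDiff ℝ 1 Φ) {M : ℝ}
    (hM : ∀ z, ‖fderiv ℝ Φ z‖ ≤ M) (x : E d) (a b : F₁) :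
    ‖Φ (x, a) - Φ (x, b)‖ ≤ M * ‖a - b‖ := by
  have h := Convex.norm_image_sub_le_of_norm_fderiv_le (f := Φ) (s := univ)
    (fun z _ => (hΦ.differentiable (by simp)) z) (fun z _ => hM z) convex_univ
    (mem_univ (x, b)) (mem_univ (x, a))
  have e : ((x, a) : E d × F₁) - (x, b) = (0, a - b) := by simp
  rw [e] at h
  simpa [Prod.norm_def] using h

lemma fderiv_comp_prodMk {Φ : E d × F₁ → F₂} (hΦ : ContDiff ℝ 1 Φ) {w : E d → F₁}
    (hw : ContDiff ℝ 1 w) (x : E d) (i : Fin d) :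
    fderiv ℝ (fun x => Φ (x, w x)) x (basisVec i)
      = compDeriv Φ w (fun i x => fderiv ℝ w x (basisVec i)) i x := by
  have h1 : HasFDerivAt (fun x => (x, w x))
      ((ContinuousLinearMap.id ℝ (E d)).prod (fderiv ℝ w x)) x :=
    (hasFDerivAt_id x).prodMk ((hw.differentiable (by simp)) x).hasFDerivAt
  have h2 : HasFDerivAt Φ (fderiv ℝ Φ (x, w x)) (x, w x) :=
    ((hΦ.differentiable (by simp)) _).hasFDerivAt
  have h3 := (h2.comp x h1).fderiv
  change fderiv ℝ (Φ ∘ fun x => (x, w x)) x (basisVec i) = _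
  rw [h3]
  simp [compDeriv]

lemma aestronglyMeasurable_compDeriv [FiniteDimensional ℝ F₁] [FiniteDimensional ℝ F₂]
    {Φ : E d × F₁ → F₂} (hΦ : ContDiff ℝ 1 Φ)
    {μ : Measure (E d)} {u : E d → F₁} {Du : Fin d → E d → F₁}
    (hu : AEStronglyMeasurable u μ) (hDu : ∀ i, AEStronglyMeasurable (Du i) μ) (i : Fin d) :
    AEStronglyMeasurable (compDeriv Φ u Du i) μ := by
  have hc : Continuous fun z : (E d × F₁) × F₁ => fderiv ℝ Φ z.1 (basisVec i, z.2) :=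
    ((hΦ.continuous_fderiv (by simp)).comp continuous_fst).clm_apply
      (continuous_const.prodMk continuous_snd)
  exact hc.comp_aestronglyMeasurable ((aestronglyMeasurable_id.prodMk hu).prodMk (hDu i))

lemma norm_compDeriv_le {Φ : E d × F₁ → F₂} {M : ℝ} (hM : ∀ z, ‖fderiv ℝ Φ z‖ ≤ M)
    (u : E d → F₁) (Du : Fin d → E d → F₁) (i : Fin d) (x : E d) :
    ‖compDeriv Φ u Du i x‖ ≤ M * (1 + ‖Du i x‖) := by
  have hM0 : 0 ≤ M := (norm_nonneg _).trans (hM 0)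
  refine ((fderiv ℝ Φ (x, u x)).le_opNorm _).trans (mul_le_mul (hM _) ?_ (norm_nonneg _) hM0)
  rw [Prod.norm_def]
  exact max_le (by simp [norm_basisVec]) (by simp)

variable [FiniteDimensional ℝ F₁] [FiniteDimensional ℝ F₂]

lemma memLp_compDeriv {Φ : E d × F₁ → F₂} (hΦ : ContDiff ℝ 1 Φ) {M : ℝ}
    (hM : ∀ z, ‖fderiv ℝ Φ z‖ ≤ M) {μ : Measure (E d)} [IsFiniteMeasure μ]
    {u : E d → F₁} {Du : Fin d → E d → F₁}
    (hu : AEStronglyMeasurable u μ) (hDu : ∀ i, MemLp (Du i) 2 μ) (i : Fin d) :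
    MemLp (compDeriv Φ u Du i) 2 μ := by
  have h1 := memLp_const_mul_one_add_norm M (hDu i)
  refine h1.mono (aestronglyMeasurable_compDeriv hΦ hu
    (fun i => (hDu i).aestronglyMeasurable) i) (Eventually.of_forall fun x => ?_)
  exact (norm_compDeriv_le hM u Du i x).trans (le_abs_self _)

/-- Composition with a `C¹` map with bounded derivative is continuous in `H¹`. -/
lemma exists_subseq_tendsto_comp {Φ : E d × F₁ → F₂} (hΦ : ContDiff ℝ 1 Φ) {M : ℝ}
    (hM : ∀ z, ‖fderiv ℝ Φ z‖ ≤ M) {μ : Measure (E d)} [IsFiniteMeasure μ]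
    {u : E d → F₁} {Du : Fin d → E d → F₁}
    (hu : AEStronglyMeasurable u μ) (hDu : ∀ i, MemLp (Du i) 2 μ)
    {w : ℕ → E d → F₁} (hw : ∀ k, ContDiff ℝ 1 (w k))
    (hwu : Tendsto (fun k => eLpNorm (fun x => w k x - u x) 2 μ) atTop (𝓝 0))
    (hwD : ∀ i, Tendsto (fun k => eLpNorm (fun x => fderiv ℝ (w k) x (basisVec i) - Du i x) 2 μ)
      atTop (𝓝 0)) :
    ∃ φ : ℕ → ℕ, StrictMono φ ∧
      Tendsto (fun k => eLpNorm (fun x => Φ (x, w (φ k) x) - Φ (x, u x)) 2 μ) atTop (𝓝 0) ∧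
      ∀ i, Tendsto (fun k => eLpNorm (fun x => fderiv ℝ (fun x => Φ (x, w (φ k) x)) x (basisVec i)
        - compDeriv Φ u Du i x) 2 μ) atTop (𝓝 0) := by
  have hM0 : 0 ≤ M := (norm_nonneg _).trans (hM 0)
  -- Since the derivative of `Φ` is merely continuous, almost everywhere convergence is needed to
  -- pass to the limit in it; hence the subsequence.
  have hmeas : TendstoInMeasure μ w atTop u :=
    tendstoInMeasure_of_tendsto_eLpNorm (p := 2) (by norm_num)
      (fun k => (hw k).continuous.aestronglyMeasurable) hu hwu
  obtain ⟨φ, hφ, hae⟩ := hmeas.exists_seq_tendsto_ae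
  refine ⟨φ, hφ, ?_, fun i => ?_⟩
  · have hle : ∀ k, eLpNorm (fun x => Φ (x, w (φ k) x) - Φ (x, u x)) 2 μ ≤
        ENNReal.ofReal M * eLpNorm (fun x => w (φ k) x - u x) 2 μ := fun k =>
      eLpNorm_le_mul_eLpNorm_of_ae_le_mul
        (Eventually.of_forall fun x => norm_comp_sub_le hΦ hM x _ _) 2
    refine tendsto_of_tendsto_of_tendsto_of_le_of_le tendsto_const_nhds ?_
      (fun _ => zero_le) hle
    simpa using ENNReal.Tendsto.const_mul (a := ENNReal.ofReal M) (hwu.comp hφ.tendsto_atTop)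
      (Or.inr ENNReal.ofReal_ne_top)
  -- `A` carries the error in the derivatives of `w` and is controlled by `M`. `B` carries the error
  -- in the base point and tends to zero by dominated convergence.
  · set A : ℕ → E d → F₂ := fun k x => fderiv ℝ Φ (x, w (φ k) x)
      (0, fderiv ℝ (w (φ k)) x (basisVec i) - Du i x) with hA
    set B : ℕ → E d → F₂ := fun k x => fderiv ℝ Φ (x, w (φ k) x) (basisVec i, Du i x)
      - fderiv ℝ Φ (x, u x) (basisVec i, Du i x) with hB
    have hAB : ∀ k, (fun x => fderiv ℝ (fun x => Φ (x, w (φ k) x)) x (basisVec i)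
        - compDeriv Φ u Du i x) = A k + B k := by
      intro k
      funext x
      rw [fderiv_comp_prodMk hΦ (hw _)]
      simp only [compDeriv, hA, hB, Pi.add_apply]
      rw [← add_sub_assoc, ← map_add]
      congr 2
      simp
    have hAm : ∀ k, AEStronglyMeasurable (A k) μ := fun k => by
      have hc : Continuous fun z : (E d × F₁) × F₁ => fderiv ℝ Φ z.1 ((0 : E d), z.2) :=
        ((hΦ.continuous_fderiv (by simp)).comp continuous_fst).clm_apply
          (continuous_const.prodMk continuous_snd)
      exact hc.comp_aestronglyMeasurable ((aestronglyMeasurable_id.prodMk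
        (hw _).continuous.aestronglyMeasurable).prodMk
        ((continuous_fderiv_basisVec (hw _) i).aestronglyMeasurable.sub
          (hDu i).aestronglyMeasurable))
    have hBm : ∀ k, AEStronglyMeasurable (B k) μ := fun k =>
      (aestronglyMeasurable_compDeriv hΦ (hw _).continuous.aestronglyMeasurable
        (fun i => (hDu i).aestronglyMeasurable) i).sub
      (aestronglyMeasurable_compDeriv hΦ hu (fun i => (hDu i).aestronglyMeasurable) i)
    have hAt : Tendsto (fun k => eLpNorm (A k) 2 μ) atTop (𝓝 0) := by
      have hle : ∀ k, eLpNorm (A k) 2 μ ≤ ENNReal.ofReal M *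
          eLpNorm (fun x => fderiv ℝ (w (φ k)) x (basisVec i) - Du i x) 2 μ := fun k =>
        eLpNorm_le_mul_eLpNorm_of_ae_le_mul (Eventually.of_forall fun x => by
          refine ((fderiv ℝ Φ (x, w (φ k) x)).le_opNorm _).trans ?_
          have : ‖((0 : E d), fderiv ℝ (w (φ k)) x (basisVec i) - Du i x)‖
              = ‖fderiv ℝ (w (φ k)) x (basisVec i) - Du i x‖ := by simp [Prod.norm_def]
          rw [this]
          exact mul_le_mul_of_nonneg_right (hM _) (norm_nonneg _)) 2
      refine tendsto_of_tendsto_of_tendsto_of_le_of_le tendsto_const_nhds ?_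
        (fun _ => zero_le) hle
      simpa using ENNReal.Tendsto.const_mul (a := ENNReal.ofReal M)
        ((hwD i).comp hφ.tendsto_atTop) (Or.inr ENNReal.ofReal_ne_top)
    have hBt : Tendsto (fun k => eLpNorm (B k) 2 μ) atTop (𝓝 0) := by
      rw [tendsto_eLpNorm_two_iff]
      have hdom := memLp_const_mul_one_add_norm (2 * M) (hDu i)
      have h0 : (0 : ℝ≥0∞) = ∫⁻ _, 0 ∂μ := by simp
      rw [h0]
      refine tendsto_lintegral_of_dominated_convergence'
        (fun x => ‖2 * M * (1 + ‖Du i x‖)‖ₑ ^ 2) ?_ ?_ ?_ ?_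
      · exact fun k => (hBm k).enorm.pow_const 2
      · intro k
        refine Eventually.of_forall fun x => ?_
        beta_reduce
        gcongr
        rw [← ofReal_norm, ← ofReal_norm]
        apply ENNReal.ofReal_le_ofReal
        refine (norm_sub_le _ _).trans ?_
        have h1 := norm_compDeriv_le hM (w (φ k)) Du i x
        have h2 := norm_compDeriv_le hM u Du i x
        refine le_trans ?_ (le_abs_self _)
        simp only [compDeriv] at h1 h2
        linarith
      · rw [← eLpNorm_two_sq]
        exact ENNReal.pow_ne_top hdom.eLpNorm_ne_top
      · filter_upwards [hae] with x hx
        have hcx : Continuous fun a : F₁ => fderiv ℝ Φ (x, a) (basisVec i, Du i x) :=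
          ((hΦ.continuous_fderiv (by simp)).comp (Continuous.prodMk_right x)).clm_apply
            continuous_const
        have h1 : Tendsto (fun k => B k x) atTop (𝓝 0) := by
          have := ((hcx.tendsto (u x)).comp hx).sub_const
            (fderiv ℝ Φ (x, u x) (basisVec i, Du i x))
          simpa using this
        have h2 := (ENNReal.continuous_pow 2).continuousAt.tendsto.comp
          ((continuous_enorm.tendsto _).comp h1)
        simpa [Function.comp_def] using h2
    have hle : ∀ k, eLpNorm (fun x => fderiv ℝ (fun x => Φ (x, w (φ k) x)) x (basisVec i)
        - compDeriv Φ u Du i x) 2 μ ≤ eLpNorm (A k) 2 μ + eLpNorm (B k) 2 μ := by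
      intro k
      rw [hAB]
      exact eLpNorm_add_le (hAm k) (hBm k) (by norm_num)
    refine tendsto_of_tendsto_of_tendsto_of_le_of_le tendsto_const_nhds ?_ (fun _ => zero_le) hle
    simpa using hAt.add hBt

end Composition

end Glue

/-! ### Gluing across the interface, and constraints on traces -/

section Gluing

open scoped NNReal ENNReal

lemma measure_lt_top_of_isBounded {d : ℕ} {R : Set (E d)} (hR : Bornology.IsBounded R) :
    volume R < ⊤ :=
  (measure_mono subset_closure).trans_lt hR.isCompact_closure.measure_lt_top

lemma isFiniteMeasure_restrict_of_isBounded {d : ℕ} {R : Set (E d)} (hR : Bornology.IsBounded R) :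
    IsFiniteMeasure (volume.restrict R) :=
  ⟨by rw [Measure.restrict_apply_univ]; exact measure_lt_top_of_isBounded hR⟩

lemma fderiv_smul_basisVec {d : ℕ} {F : Type*} [NormedAddCommGroup F] [NormedSpace ℝ F]
    {θ : E d → ℝ} {v : E d → F} (hθ : ContDiff ℝ 1 θ) (hv : ContDiff ℝ 1 v) (x : E d)
    (i : Fin d) : fderiv ℝ (fun x => θ x • v x) x (basisVec i) =
      fderiv ℝ θ x (basisVec i) • v x + θ x • fderiv ℝ v x (basisVec i) := by
  have h := ((hθ.differentiable (by simp)) x).hasFDerivAt.smul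
    ((hv.differentiable (by simp)) x).hasFDerivAt
  have h' : fderiv ℝ (fun x => θ x • v x) x = _ := h.fderiv
  rw [h']
  simp [add_comm]

/-- The limit of the integrals of `∂ᵢ (θ v_k)` when `v_k → V` in `H¹(R)`. -/
lemma tendsto_setIntegral_fderiv_smul {d : ℕ} {F : Type*} [NormedAddCommGroup F] [NormedSpace ℝ F]
    {R : Set (E d)} (hR : Bornology.IsBounded R) {θ : E d → ℝ} (hθ : ContDiff ℝ 1 θ)
    (hθc : HasCompactSupport θ) {v : ℕ → E d → F} (hv : ∀ k, ContDiff ℝ 1 (v k)) {i : Fin d}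
    {V W : E d → F} (hV : MemLp V 2 (volume.restrict R)) (hW : MemLp W 2 (volume.restrict R))
    (h0 : Tendsto (fun k => eLpNorm (fun x => v k x - V x) 2 (volume.restrict R)) atTop (𝓝 0))
    (h1 : Tendsto (fun k => eLpNorm (fun x => fderiv ℝ (v k) x (basisVec i) - W x) 2
      (volume.restrict R)) atTop (𝓝 0)) :
    Tendsto (fun k => ∫ x in R, fderiv ℝ (fun x => θ x • v k x) x (basisVec i)) atTop
      (𝓝 ((∫ x in R, fderiv ℝ θ x (basisVec i) • V x) + ∫ x in R, θ x • W x)) := by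
  have := isFiniteMeasure_restrict_of_isBounded hR
  have hθ' := continuous_fderiv_basisVec hθ i
  obtain ⟨C1, hC1⟩ := hθc.exists_bound_of_continuous hθ.continuous
  obtain ⟨C2, hC2⟩ := (hasCompactSupport_fderiv_basisVec hθc i).exists_bound_of_continuous hθ'
  have hv2 : ∀ k, MemLp (v k) 2 (volume.restrict R) := fun k =>
    memLp_of_continuous_of_isBounded (hv k).continuous hR 2
  have hw2 : ∀ k, MemLp (fun x => fderiv ℝ (v k) x (basisVec i)) 2 (volume.restrict R) := fun k =>
    memLp_of_continuous_of_isBounded (continuous_fderiv_basisVec (hv k) i) hR 2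
  have t1 := tendsto_integral_smul_of_tendsto_eLpNorm hv2 hV h0 hθ'.aestronglyMeasurable hC2
  have t2 := tendsto_integral_smul_of_tendsto_eLpNorm hw2 hW h1
    hθ.continuous.aestronglyMeasurable hC1
  refine (t1.add t2).congr fun k => ?_
  rw [← integral_add]
  · exact integral_congr_ae (Eventually.of_forall fun x =>
      (fderiv_smul_basisVec hθ (hv k) x i).symm)
  · exact ((hv2 k).integrable (by norm_num)).bdd_smul C2 hθ'.aestronglyMeasurable
      (Eventually.of_forall hC2)
  · exact ((hw2 k).integrable (by norm_num)).bdd_smul C1 hθ.continuous.aestronglyMeasurable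
      (Eventually.of_forall hC1)

lemma memLp_comp {d : ℕ} {F₁ F₂ : Type} [NormedAddCommGroup F₁] [NormedSpace ℝ F₁]
    [NormedAddCommGroup F₂] [NormedSpace ℝ F₂] {R : Set (E d)} (hR : Bornology.IsBounded R)
    {Φ : E d × F₁ → F₂} (hΦ : ContDiff ℝ 1 Φ) {M : ℝ}
    (hM : ∀ z, ‖fderiv ℝ Φ z‖ ≤ M) {p : ℝ≥0∞} {u : E d → F₁} (hu : MemLp u p (volume.restrict R)) :
    MemLp (fun x => Φ (x, u x)) p (volume.restrict R) := by
  have h0 : MemLp (fun x => Φ (x, (0 : F₁))) p (volume.restrict R) :=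
    memLp_of_continuous_of_isBounded (hΦ.continuous.comp (Continuous.prodMk_left 0)) hR p
  have h1 : MemLp (fun x => Φ (x, u x) - Φ (x, (0 : F₁))) p (volume.restrict R) := by
    refine (hu.norm.const_mul M).mono ?_ (Eventually.of_forall fun x => ?_)
    · exact (hΦ.continuous.comp_aestronglyMeasurable
        (aestronglyMeasurable_id.prodMk hu.aestronglyMeasurable)).sub h0.aestronglyMeasurable
    · refine le_trans ?_ (le_abs_self _)
      simpa using norm_comp_sub_le hΦ hM x (u x) 0
  have h2 := h1.add h0
  have e : ((fun x => Φ (x, u x) - Φ (x, (0 : F₁))) + fun x => Φ (x, (0 : F₁))) =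
      fun x => Φ (x, u x) := by
    funext x
    simp
  rwa [e] at h2

/-- Both compositions converge on the surface to the same function, namely the common value of the
composed traces. -/
lemma tendsto_eLpNorm_comp_sub_comp {d : ℕ} {F₁ F₂ : Type} [NormedAddCommGroup F₁]
    [NormedSpace ℝ F₁] [FiniteDimensional ℝ F₁] [NormedAddCommGroup F₂] [NormedSpace ℝ F₂]
    [FiniteDimensional ℝ F₂] {μ : Measure (E d)}
    {Φp Φm : E d × F₁ → F₂} (hΦp : ContDiff ℝ 1 Φp) (hΦm : ContDiff ℝ 1 Φm) {Mp Mm : ℝ}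
    (hMp : ∀ z, ‖fderiv ℝ Φp z‖ ≤ Mp) (hMm : ∀ z, ‖fderiv ℝ Φm z‖ ≤ Mm)
    {w y : ℕ → E d → F₁} (hw : ∀ k, Continuous (w k)) (hy : ∀ k, Continuous (y k))
    {Tp Tm : E d → F₁} (hTp : AEStronglyMeasurable Tp μ) (hTm : AEStronglyMeasurable Tm μ)
    (hwT : Tendsto (fun k => eLpNorm (fun x => w k x - Tp x) 2 μ) atTop (𝓝 0))
    (hyT : Tendsto (fun k => eLpNorm (fun x => y k x - Tm x) 2 μ) atTop (𝓝 0))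
    (hT : ∀ᵐ x ∂μ, Φp (x, Tp x) = Φm (x, Tm x)) :
    Tendsto (fun k => eLpNorm (fun x => Φp (x, w k x) - Φm (x, y k x)) 2 μ) atTop (𝓝 0) := by
  have key : ∀ {Φ : E d × F₁ → F₂}, ContDiff ℝ 1 Φ → ∀ {v : E d → F₁},
      AEStronglyMeasurable v μ → AEStronglyMeasurable (fun x => Φ (x, v x)) μ :=
    fun hΦ _ hv => hΦ.continuous.comp_aestronglyMeasurable (aestronglyMeasurable_id.prodMk hv)
  have hle : ∀ k, eLpNorm (fun x => Φp (x, w k x) - Φm (x, y k x)) 2 μ ≤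
      ENNReal.ofReal Mp * eLpNorm (fun x => w k x - Tp x) 2 μ +
      ENNReal.ofReal Mm * eLpNorm (fun x => y k x - Tm x) 2 μ := by
    intro k
    have e : (fun x => Φp (x, w k x) - Φm (x, y k x)) =ᵐ[μ]
        (fun x => Φp (x, w k x) - Φp (x, Tp x)) - (fun x => Φm (x, y k x) - Φm (x, Tm x)) := by
      filter_upwards [hT] with x hx
      simp [hx]
    rw [eLpNorm_congr_ae e]
    refine (eLpNorm_sub_le ?_ ?_ (by norm_num)).trans (add_le_add ?_ ?_)
    · exact (key hΦp (hw k).aestronglyMeasurable).sub (key hΦp hTp)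
    · exact (key hΦm (hy k).aestronglyMeasurable).sub (key hΦm hTm)
    · exact eLpNorm_le_mul_eLpNorm_of_ae_le_mul
        (Eventually.of_forall fun x => norm_comp_sub_le hΦp hMp x _ _) 2
    · exact eLpNorm_le_mul_eLpNorm_of_ae_le_mul
        (Eventually.of_forall fun x => norm_comp_sub_le hΦm hMm x _ _) 2
  refine tendsto_of_tendsto_of_tendsto_of_le_of_le tendsto_const_nhds ?_ (fun _ => zero_le) hle
  have a1 := ENNReal.Tendsto.const_mul (a := ENNReal.ofReal Mp) hwT (Or.inr ENNReal.ofReal_ne_top)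
  have a2 := ENNReal.Tendsto.const_mul (a := ENNReal.ofReal Mm) hyT (Or.inr ENNReal.ofReal_ne_top)
  simpa using a1.add a2

lemma norm_le_sum_basisVec {d : ℕ} {F : Type*} [NormedAddCommGroup F] [NormedSpace ℝ F]
    (T : E d →L[ℝ] F) : ‖T‖ ≤ ∑ i, ‖T (basisVec i)‖ := by
  refine T.opNorm_le_bound (Finset.sum_nonneg fun _ _ => norm_nonneg _) fun x => ?_
  have hx : x = ∑ i, x i • (basisVec i : E d) := by
    have := (EuclideanSpace.basisFun (Fin d) ℝ).sum_repr x
    simpa [basisVec] using this.symm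
  conv_lhs => rw [hx, map_sum]
  rw [Finset.sum_mul]
  refine (norm_sum_le _ _).trans (Finset.sum_le_sum fun i _ => ?_)
  rw [map_smul, norm_smul, mul_comm]
  gcongr
  exact PiLp.norm_apply_le x i

namespace IsDefining

variable {m : ℕ} {D : E (m + 1) → ℝ} {δ₀ : ℝ} (h : IsDefining D δ₀)
  {Ω : Set (E (m + 1))}

include h

omit h in
lemma isBounded_pos (hΩb : Bornology.IsBounded Ω) (hsub : {x | 0 ≤ D x} ⊆ Ω) :
    Bornology.IsBounded {x | 0 < D x} :=
  hΩb.subset fun x hx => hsub (le_of_lt (show 0 < D x from hx) : 0 ≤ D x)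

omit h in
lemma disjoint_pos_neg : Disjoint {x | 0 < D x} (Ω ∩ {x | D x < 0}) := by
  rw [Set.disjoint_left]
  rintro x hx ⟨-, hx'⟩
  exact lt_asymm (show 0 < D x from hx) hx'

lemma measurableSet_pos : MeasurableSet {x | 0 < D x} :=
  (isOpen_lt continuous_const h.continuous).measurableSet

lemma measurableSet_neg (hΩ : IsOpen Ω) : MeasurableSet (Ω ∩ {x | D x < 0}) :=
  (hΩ.inter (isOpen_lt h.continuous continuous_const)).measurableSet

lemma ae_eq_union (hsub : {x | 0 ≤ D x} ⊆ Ω) :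
    Ω =ᵐ[volume] ({x | 0 < D x} ∪ (Ω ∩ {x | D x < 0}) : Set (E (m + 1))) := by
  have h0 : ∀ᵐ x ∂(volume : Measure (E (m + 1))), D x ≠ 0 := by
    rw [ae_iff]
    simpa using h.volume_zero_set
  filter_upwards [h0] with x hx
  apply propext
  change x ∈ Ω ↔ (0 < D x ∨ (x ∈ Ω ∧ D x < 0))
  rcases lt_or_gt_of_ne hx with h1 | h1
  · exact ⟨fun h => Or.inr ⟨h, h1⟩, fun h => h.elim (fun h => absurd h (not_lt.2 h1.le)) And.left⟩
  · exact ⟨fun _ => Or.inl h1, fun _ => hsub h1.le⟩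

lemma setIntegral_eq_add (hΩ : IsOpen Ω) (hsub : {x | 0 ≤ D x} ⊆ Ω) {F : Type*}
    [NormedAddCommGroup F] [NormedSpace ℝ F] {g : E (m + 1) → F}
    (h1 : IntegrableOn g {x | 0 < D x}) (h2 : IntegrableOn g (Ω ∩ {x | D x < 0})) :
    ∫ x in Ω, g x = (∫ x in {x | 0 < D x}, g x) + ∫ x in Ω ∩ {x | D x < 0}, g x := by
  rw [setIntegral_congr_set (h.ae_eq_union hsub), setIntegral_union disjoint_pos_neg
    (h.measurableSet_neg hΩ) h1 h2]

open Classical in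
lemma memLp_ite (hsub : {x | 0 ≤ D x} ⊆ Ω) {F : Type*}
    [NormedAddCommGroup F] {g₁ g₂ : E (m + 1) → F} {p : ℝ≥0∞}
    (h1 : MemLp g₁ p (volume.restrict {x | 0 < D x}))
    (h2 : MemLp g₂ p (volume.restrict (Ω ∩ {x | D x < 0}))) :
    MemLp (fun x => if 0 < D x then g₁ x else g₂ x) p (volume.restrict Ω) := by
  have hm := h.measurableSet_pos
  rw [Measure.restrict_congr_set (h.ae_eq_union hsub)]
  have e : (fun x => if 0 < D x then g₁ x else g₂ x) = {x | 0 < D x}.piecewise g₁ g₂ := rfl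
  rw [e]
  refine MemLp.piecewise hm ?_ ?_
  · refine h1.mono_measure ?_
    rw [Measure.restrict_restrict hm]
    exact Measure.restrict_mono inter_subset_left le_rfl
  · refine h2.mono_measure ?_
    rw [Measure.restrict_restrict hm.compl]
    refine Measure.restrict_mono ?_ le_rfl
    rintro x ⟨hx1, hx2⟩
    exact hx2.resolve_left hx1

open Classical in
/-- Two `H¹` functions with the same trace on `{D = 0}` can be glued. -/
lemma isWeakPartial_ite (hΩ : IsOpen Ω) (hΩb : Bornology.IsBounded Ω) (hsub : {x | 0 ≤ D x} ⊆ Ω)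
    {F : Type} [NormedAddCommGroup F] [NormedSpace ℝ F] [CompleteSpace F] {i : Fin (m + 1)}
    {v z : ℕ → E (m + 1) → F} (hv : ∀ k, ContDiff ℝ 1 (v k)) (hz : ∀ k, ContDiff ℝ 1 (z k))
    {V DV Z DZ : E (m + 1) → F}
    (hV : MemLp V 2 (volume.restrict {x | 0 < D x}))
    (hDV : MemLp DV 2 (volume.restrict {x | 0 < D x}))
    (hZ : MemLp Z 2 (volume.restrict (Ω ∩ {x | D x < 0})))
    (hDZ : MemLp DZ 2 (volume.restrict (Ω ∩ {x | D x < 0})))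
    (hvV : Tendsto (fun k => eLpNorm (fun x => v k x - V x) 2 (volume.restrict {x | 0 < D x}))
      atTop (𝓝 0))
    (hvD : Tendsto (fun k => eLpNorm (fun x => fderiv ℝ (v k) x (basisVec i) - DV x) 2
      (volume.restrict {x | 0 < D x})) atTop (𝓝 0))
    (hzZ : Tendsto (fun k => eLpNorm (fun x => z k x - Z x) 2
      (volume.restrict (Ω ∩ {x | D x < 0}))) atTop (𝓝 0))
    (hzD : Tendsto (fun k => eLpNorm (fun x => fderiv ℝ (z k) x (basisVec i) - DZ x) 2
      (volume.restrict (Ω ∩ {x | D x < 0}))) atTop (𝓝 0))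
    (hvz : Tendsto (fun k => eLpNorm (fun x => v k x - z k x) 2
      ((surf (m + 1)).restrict {x | D x = 0})) atTop (𝓝 0)) :
    IsWeakPartial Ω i (fun x => if 0 < D x then V x else Z x)
      (fun x => if 0 < D x then DV x else DZ x) := by
  intro θ hθ hθc hθΩ
  replace hθ : ContDiff ℝ 1 θ := hθ.of_le (by simp)
  have hpb := isBounded_pos hΩb hsub
  have hnb : Bornology.IsBounded (Ω ∩ {x | D x < 0}) := hΩb.subset inter_subset_left
  have hmp := h.measurableSet_pos
  have hmn := h.measurableSet_neg hΩ
  have := isFiniteMeasure_restrict_of_isBounded hpb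
  have := isFiniteMeasure_restrict_of_isBounded hnb
  have hθ' := continuous_fderiv_basisVec hθ i
  obtain ⟨C1, hC1⟩ := hθc.exists_bound_of_continuous hθ.continuous
  obtain ⟨C2, hC2⟩ := (hasCompactSupport_fderiv_basisVec hθc i).exists_bound_of_continuous hθ'
  have t1 := tendsto_setIntegral_fderiv_smul hpb hθ hθc hv hV hDV hvV hvD
  have t2 := tendsto_setIntegral_fderiv_smul hnb hθ hθc hz hZ hDZ hzZ hzD
  have hcs : ∀ (y : E (m + 1) → F), ContDiff ℝ 1 y → Integrable
      (fun x => fderiv ℝ (fun x => θ x • y x) x (basisVec i)) := fun y hy =>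
    (continuous_fderiv_basisVec (hθ.smul hy) i).integrable_of_hasCompactSupport
      (hasCompactSupport_fderiv_basisVec hθc.smul_right i)
  -- The integral of `∂ᵢ(θ z_k)` over the whole domain is zero. Thus the two one-sided integrals
  -- combine to one over the positive side, for `θ (v_k - z_k)`.
  have hJ : ∀ k, (∫ x in {x | 0 < D x}, fderiv ℝ (fun x => θ x • v k x) x (basisVec i)) +
      (∫ x in Ω ∩ {x | D x < 0}, fderiv ℝ (fun x => θ x • z k x) x (basisVec i)) =
      ∫ x in {x | 0 < D x}, fderiv ℝ (fun x => θ x • (v k x - z k x)) x (basisVec i) := by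
    intro k
    have e1 : ∫ x in Ω, fderiv ℝ (fun x => θ x • z k x) x (basisVec i) = 0 := by
      rw [setIntegral_eq_integral_of_forall_compl_eq_zero]
      · exact integral_fderiv_eq_zero (hθ.smul (hz k)) hθc.smul_right i
      · intro x hx
        have hx' : x ∉ tsupport fun x => θ x • z k x := fun hx' =>
          hx (hθΩ (tsupport_smul_subset_left θ (z k) hx'))
        have : fderiv ℝ (fun x => θ x • z k x) x = 0 := by
          by_contra hne
          exact hx' (support_fderiv_subset ℝ hne)
        rw [this]
        rfl
    rw [h.setIntegral_eq_add hΩ hsub (hcs _ (hz k)).integrableOn (hcs _ (hz k)).integrableOn] at e1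
    have e2 : ∫ x in {x | 0 < D x}, fderiv ℝ (fun x => θ x • (v k x - z k x)) x (basisVec i) =
        (∫ x in {x | 0 < D x}, fderiv ℝ (fun x => θ x • v k x) x (basisVec i)) -
        ∫ x in {x | 0 < D x}, fderiv ℝ (fun x => θ x • z k x) x (basisVec i) := by
      rw [← integral_sub (hcs _ (hv k)).integrableOn (hcs _ (hz k)).integrableOn]
      refine integral_congr_ae (Eventually.of_forall fun x => ?_)
      have ha := ((hθ.smul (hv k)).differentiable (by simp)) x
      have hb := ((hθ.smul (hz k)).differentiable (by simp)) x
      simp only [smul_sub]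
      exact congrArg (fun T => T (basisVec i)) (fderiv_sub ha hb)
    rw [e2, eq_neg_of_add_eq_zero_right e1]
    abel
  obtain ⟨C, hC⟩ := h.exists_boundary_estimate
  -- The boundary estimate bounds this by the `L²` norm of `v_k - z_k` on the surface.
  have hlim : Tendsto (fun k => ∫ x in {x | 0 < D x},
      fderiv ℝ (fun x => θ x • (v k x - z k x)) x (basisVec i)) atTop (𝓝 0) := by
    rw [tendsto_zero_iff_norm_tendsto_zero]
    have hle : ∀ k, ‖∫ x in {x | 0 < D x}, fderiv ℝ (fun x => θ x • (v k x - z k x)) x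
        (basisVec i)‖ₑ ^ 2 ≤ C * (ENNReal.ofReal C1 * eLpNorm (fun x => v k x - z k x) 2
          ((surf (m + 1)).restrict {x | D x = 0})) ^ 2 := by
      intro k
      refine (hC _ (hθ.smul ((hv k).sub (hz k))) hθc.smul_right i).trans ?_
      rw [← eLpNorm_two_sq]
      gcongr
      refine eLpNorm_le_mul_eLpNorm_of_ae_le_mul (Eventually.of_forall fun x => ?_) 2
      simp only [Pi.smul_apply', norm_smul]
      gcongr
      exact hC1 x
    have hz : Tendsto (fun k => (C : ℝ≥0∞) * (ENNReal.ofReal C1 *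
        eLpNorm (fun x => v k x - z k x) 2 ((surf (m + 1)).restrict {x | D x = 0})) ^ 2)
        atTop (𝓝 0) := by
      have a1 := ENNReal.Tendsto.const_mul (a := ENNReal.ofReal C1) hvz
        (Or.inr ENNReal.ofReal_ne_top)
      have a2 := (ENNReal.continuous_pow 2).continuousAt.tendsto.comp a1
      have a3 := ENNReal.Tendsto.const_mul (a := (C : ℝ≥0∞)) a2 (Or.inr ENNReal.coe_ne_top)
      simpa [Function.comp_def] using a3
    have h2 := tendsto_of_tendsto_of_tendsto_of_le_of_le tendsto_const_nhds hz
      (fun _ => zero_le) hle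
    have h3 := (ENNReal.continuous_rpow_const (y := (1 / 2 : ℝ))).continuousAt.tendsto.comp h2
    have h4 : Tendsto (fun k => ‖∫ x in {x | 0 < D x}, fderiv ℝ (fun x => θ x • (v k x - z k x)) x
        (basisVec i)‖ₑ) atTop (𝓝 0) := by
      have e : ∀ a : ℝ≥0∞, (a ^ 2) ^ (1 / 2 : ℝ) = a := fun a => by
        rw [← ENNReal.rpow_natCast, ← ENNReal.rpow_mul]
        norm_num
      simpa only [Function.comp_def, e, ENNReal.zero_rpow_of_pos (show (0 : ℝ) < 1 / 2 by norm_num)]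
        using h3
    have h5 := (ENNReal.tendsto_toReal ENNReal.zero_ne_top).comp h4
    simpa [Function.comp_def] using h5
  have hsum : ((∫ x in {x | 0 < D x}, fderiv ℝ θ x (basisVec i) • V x) +
      ∫ x in {x | 0 < D x}, θ x • DV x) + ((∫ x in Ω ∩ {x | D x < 0},
        fderiv ℝ θ x (basisVec i) • Z x) + ∫ x in Ω ∩ {x | D x < 0}, θ x • DZ x) = 0 :=
    tendsto_nhds_unique ((t1.add t2).congr hJ) hlim
  have hspl : ∀ {τ : E (m + 1) → ℝ} {C : ℝ}, Continuous τ → (∀ x, ‖τ x‖ ≤ C) →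
      ∀ {A B : E (m + 1) → F}, MemLp A 2 (volume.restrict {x | 0 < D x}) →
      MemLp B 2 (volume.restrict (Ω ∩ {x | D x < 0})) →
      ∫ x in Ω, τ x • (if 0 < D x then A x else B x) =
        (∫ x in {x | 0 < D x}, τ x • A x) + ∫ x in Ω ∩ {x | D x < 0}, τ x • B x := by
    intro τ C hτ hC A B hA hB
    have i1 : IntegrableOn (fun x => τ x • A x) {x | 0 < D x} :=
      (hA.integrable (by norm_num)).bdd_smul C hτ.aestronglyMeasurable (Eventually.of_forall hC)
    have i2 : IntegrableOn (fun x => τ x • B x) (Ω ∩ {x | D x < 0}) :=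
      (hB.integrable (by norm_num)).bdd_smul C hτ.aestronglyMeasurable (Eventually.of_forall hC)
    have q1 : EqOn (fun x => τ x • A x) (fun x => τ x • (if 0 < D x then A x else B x))
        {x | 0 < D x} := fun x hx => by
      have hx' : 0 < D x := hx
      simp [hx']
    have q2 : EqOn (fun x => τ x • B x) (fun x => τ x • (if 0 < D x then A x else B x))
        (Ω ∩ {x | D x < 0}) := fun x hx => by
      have hx' : ¬ 0 < D x := not_lt.2 (le_of_lt hx.2)
      simp [hx']
    rw [h.setIntegral_eq_add hΩ hsub (i1.congr_fun q1 hmp) (i2.congr_fun q2 hmn),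
      setIntegral_congr_fun hmp q1, setIntegral_congr_fun hmn q2]
  rw [hspl hθ' hC2 hV hZ, hspl hθ.continuous hC1 hDV hDZ]
  rw [eq_neg_iff_add_eq_zero, ← hsum]
  abel

section Compose

variable {F₁ F₂ : Type} [NormedAddCommGroup F₁] [NormedSpace ℝ F₁] [FiniteDimensional ℝ F₁]
  [NormedAddCommGroup F₂] [NormedSpace ℝ F₂] [FiniteDimensional ℝ F₂]

open Classical in
/-- Gluing `H¹` functions after composition with maps that send their traces to the same values. -/
theorem memH1_ite_comp (hΩ : IsOpen Ω) (hΩb : Bornology.IsBounded Ω) (hsub : {x | 0 ≤ D x} ⊆ Ω)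
    {Φp Φm : E (m + 1) × F₁ → F₂} (hΦp : ContDiff ℝ 1 Φp) (hΦm : ContDiff ℝ 1 Φm) {Mp Mm : ℝ}
    (hMp : ∀ z, ‖fderiv ℝ Φp z‖ ≤ Mp) (hMm : ∀ z, ‖fderiv ℝ Φm z‖ ≤ Mm)
    {up um : E (m + 1) → F₁} {Dup Dum : Fin (m + 1) → E (m + 1) → F₁} {Tp Tm : E (m + 1) → F₁}
    (hup : MemLp up 2 (volume.restrict {x | 0 < D x}))
    (hDup : ∀ i, MemLp (Dup i) 2 (volume.restrict {x | 0 < D x}))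
    (hum : MemLp um 2 (volume.restrict (Ω ∩ {x | D x < 0})))
    (hDum : ∀ i, MemLp (Dum i) 2 (volume.restrict (Ω ∩ {x | D x < 0})))
    (hTp : IsTrace {x | 0 < D x} {x | D x = 0} up Dup Tp)
    (hTm : IsTrace (Ω ∩ {x | D x < 0}) {x | D x = 0} um Dum Tm)
    (hT : ∀ᵐ x ∂((surf (m + 1)).restrict {x | D x = 0}), Φp (x, Tp x) = Φm (x, Tm x)) :
    MemH1 Ω (fun x => if 0 < D x then Φp (x, up x) else Φm (x, um x))
      (fun i x => if 0 < D x then compDeriv Φp up Dup i x else compDeriv Φm um Dum i x) := by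
  have hpb := isBounded_pos hΩb hsub
  have hnb : Bornology.IsBounded (Ω ∩ {x | D x < 0}) := hΩb.subset inter_subset_left
  have := isFiniteMeasure_restrict_of_isBounded hpb
  have := isFiniteMeasure_restrict_of_isBounded hnb
  have mp := memLp_comp hpb hΦp hMp hup
  have mm := memLp_comp hnb hΦm hMm hum
  have dp := memLp_compDeriv hΦp hMp hup.aestronglyMeasurable hDup
  have dm := memLp_compDeriv hΦm hMm hum.aestronglyMeasurable hDum
  refine ⟨h.memLp_ite hsub mp mm, fun i => h.memLp_ite hsub (dp i) (dm i), fun i => ?_⟩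
  obtain ⟨hTp2, w, hw, hwu, hwD, hwT⟩ := hTp
  obtain ⟨hTm2, y, hy, hyu, hyD, hyT⟩ := hTm
  have hw1 : ∀ k, ContDiff ℝ 1 (w k) := fun k => (hw k).of_le (by simp)
  have hy1 : ∀ k, ContDiff ℝ 1 (y k) := fun k => (hy k).of_le (by simp)
  obtain ⟨φ, hφ, hφ0, hφ1⟩ := exists_subseq_tendsto_comp hΦp hMp hup.aestronglyMeasurable hDup
    hw1 hwu hwD
  -- The second subsequence is taken inside the first, so that one sequence of indices serves both
  -- sides.
  obtain ⟨ψ, hψ, hψ0, hψ1⟩ := exists_subseq_tendsto_comp hΦm hMm hum.aestronglyMeasurable hDum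
    (fun k => hy1 (φ k)) (hyu.comp hφ.tendsto_atTop) (fun i => (hyD i).comp hφ.tendsto_atTop)
  refine h.isWeakPartial_ite hΩ hΩb hsub (v := fun k x => Φp (x, w (φ (ψ k)) x))
    (z := fun k x => Φm (x, y (φ (ψ k)) x))
    (fun k => hΦp.comp (contDiff_id.prodMk (hw1 _))) (fun k => hΦm.comp (contDiff_id.prodMk (hy1 _)))
    mp (dp i) mm (dm i) (hφ0.comp hψ.tendsto_atTop) ((hφ1 i).comp hψ.tendsto_atTop) hψ0 (hψ1 i) ?_
  have hφψ := hφ.tendsto_atTop.comp hψ.tendsto_atTop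
  exact tendsto_eLpNorm_comp_sub_comp hΦp hΦm hMp hMm (w := fun k => w (φ (ψ k)))
    (y := fun k => y (φ (ψ k))) (fun k => (hw1 _).continuous) (fun k => (hy1 _).continuous)
    hTp2.aestronglyMeasurable hTm2.aestronglyMeasurable (hwT.comp hφψ) (hyT.comp hφψ) hT

/-- A constraint `Z (u) = 0` passes to the trace. -/
lemma ae_trace_eq_zero {R : Set (E (m + 1))}
    (hR : {x | 0 < D x ∧ |D x| < δ₀} ⊆ R) {u : E (m + 1) → F₁} {Du : Fin (m + 1) → E (m + 1) → F₁}
    {T : E (m + 1) → F₁} (hDu : ∀ i, MemLp (Du i) 2 (volume.restrict R))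
    (hT : IsTrace R {x | D x = 0} u Du T) {Z : F₁ → ℝ} (hZ : ContDiff ℝ 1 Z) {M : ℝ}
    (hM : ∀ y, ‖fderiv ℝ Z y‖ ≤ M) (hu : ∀ᵐ x ∂(volume.restrict R), Z (u x) = 0) :
    ∀ᵐ x ∂((surf (m + 1)).restrict {x | D x = 0}), Z (T x) = 0 := by
  obtain ⟨hT2, w, hw, hwu, hwD, hwT⟩ := hT
  have hM0 : 0 ≤ M := (norm_nonneg _).trans (hM 0)
  have hw1 : ∀ k, ContDiff ℝ 1 (w k) := fun k => (hw k).of_le (by simp)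
  have hlip : ∀ a b, ‖Z a - Z b‖ ≤ M * ‖a - b‖ := fun a b =>
    Convex.norm_image_sub_le_of_norm_fderiv_le (s := univ)
      (fun z _ => (hZ.differentiable (by simp)) z) (fun z _ => hM z) convex_univ (mem_univ b)
      (mem_univ a)
  set S : Set (E (m + 1)) := {x | 0 < D x ∧ |D x| < δ₀} with hS
  have hmono : volume.restrict S ≤ volume.restrict R := Measure.restrict_mono hR le_rfl
  obtain ⟨C, hC⟩ := h.exists_trace_inequality
  set B : ℝ≥0∞ := ENNReal.ofReal M * ∑ i, (eLpNorm (Du i) 2 (volume.restrict R) + 1) with hB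
  have hBtop : B ≠ ⊤ := ENNReal.mul_ne_top ENNReal.ofReal_ne_top
    (ENNReal.sum_ne_top.2 fun i _ => ENNReal.add_ne_top.2 ⟨(hDu i).eLpNorm_ne_top, by simp⟩)
  set N : ℕ → ℝ≥0∞ := fun k => ENNReal.ofReal M *
    eLpNorm (fun x => w k x - u x) 2 (volume.restrict R) with hN
  have hNt : Tendsto N atTop (𝓝 0) := by
    simpa using ENNReal.Tendsto.const_mul (a := ENNReal.ofReal M) hwu
      (Or.inr ENNReal.ofReal_ne_top)
  have hv0 : ∀ k, eLpNorm (fun x => Z (w k x)) 2 (volume.restrict S) ≤ N k := by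
    intro k
    refine (eLpNorm_mono_measure _ hmono).trans ?_
    refine eLpNorm_le_mul_eLpNorm_of_ae_le_mul ?_ 2
    filter_upwards [hu] with x hx
    have := hlip (w k x) (u x)
    rwa [hx, sub_zero] at this
  have hv1 : ∀ᶠ k in atTop,
      eLpNorm (fun x => fderiv ℝ (fun x => Z (w k x)) x) 2 (volume.restrict S) ≤ B := by
    have hev : ∀ᶠ k in atTop, ∀ i, eLpNorm (fun x => fderiv ℝ (w k) x (basisVec i) - Du i x) 2
        (volume.restrict R) ≤ 1 := by
      rw [eventually_all]
      exact fun i => (hwD i).eventually_le_const (by simp)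
    filter_upwards [hev] with k hk
    have b1 : eLpNorm (fun x => fderiv ℝ (fun x => Z (w k x)) x) 2 (volume.restrict S) ≤
        ENNReal.ofReal M * eLpNorm (fun x => ∑ i, ‖fderiv ℝ (w k) x (basisVec i)‖) 2
          (volume.restrict R) := by
      refine (eLpNorm_mono_measure _ hmono).trans ?_
      refine eLpNorm_le_mul_eLpNorm_of_ae_le_mul (Eventually.of_forall fun x => ?_) 2
      have e : fderiv ℝ (fun x => Z (w k x)) x = (fderiv ℝ Z (w k x)).comp (fderiv ℝ (w k) x) :=
        fderiv_comp x ((hZ.differentiable (by simp)) _) (((hw1 k).differentiable (by simp)) x)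
      rw [e, Real.norm_of_nonneg (Finset.sum_nonneg fun i _ => norm_nonneg _)]
      refine (ContinuousLinearMap.opNorm_comp_le _ _).trans ?_
      exact mul_le_mul (hM _) (norm_le_sum_basisVec _) (norm_nonneg _) hM0
    refine b1.trans ?_
    rw [hB]
    gcongr
    have b2 := eLpNorm_sum_le (μ := volume.restrict R) (p := 2) (s := Finset.univ)
      (f := fun i x => ‖fderiv ℝ (w k) x (basisVec i)‖)
      (fun i _ => (continuous_fderiv_basisVec (hw1 k) i).norm.aestronglyMeasurable) (by norm_num)
    have e2 : (∑ i, fun x => ‖fderiv ℝ (w k) x (basisVec i)‖) =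
        fun x => ∑ i, ‖fderiv ℝ (w k) x (basisVec i)‖ := by
      funext x
      simp
    rw [e2] at b2
    refine b2.trans (Finset.sum_le_sum fun i _ => ?_)
    rw [eLpNorm_norm]
    have b3 := eLpNorm_add_le (μ := volume.restrict R) (p := 2) (hDu i).aestronglyMeasurable
      ((continuous_fderiv_basisVec (hw1 k) i).aestronglyMeasurable.sub
        (hDu i).aestronglyMeasurable) (by norm_num)
    have e3 : (Du i + ((fun x => fderiv ℝ (w k) x (basisVec i)) - Du i)) =
        fun x => fderiv ℝ (w k) x (basisVec i) := by
      funext x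
      simp
    rw [e3] at b3
    exact b3.trans (add_le_add le_rfl (hk i))
  have hvc : ∀ k, ContDiff ℝ 1 fun x => Z (w k x) := fun k => hZ.comp (hw1 k)
  -- In the trace inequality for `Z ∘ w_k` the functions tend to zero in `L²` and their derivatives
  -- stay bounded in `L²`, so the product term vanishes as well.
  have hS0 : Tendsto (fun k => eLpNorm (fun x => Z (w k x)) 2
      ((surf (m + 1)).restrict {x | D x = 0})) atTop (𝓝 0) := by
    rw [tendsto_eLpNorm_two_iff]
    have hle : ∀ᶠ k in atTop, ∫⁻ x in {x | D x = 0}, ‖Z (w k x)‖ₑ ^ 2 ∂(surf (m + 1)) ≤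
        C * (N k ^ 2 + N k * B) := by
      filter_upwards [hv1] with k hk
      refine (hC _ (hvc k)).trans ?_
      gcongr
      rw [lintegral_add_left ((hvc k).continuous.enorm.measurable.pow_const 2)]
      refine add_le_add ?_ ?_
      · rw [← eLpNorm_two_sq]
        gcongr
        exact hv0 k
      · have b := lintegral_mul_sq_le (μ := volume.restrict S)
          (f := fun x => ‖Z (w k x)‖ₑ) (g := fun x => ‖fderiv ℝ (fun x => Z (w k x)) x‖ₑ)
          (hvc k).continuous.enorm.aemeasurable
          ((hvc k).continuous_fderiv (by simp)).enorm.aemeasurable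
        rw [← eLpNorm_two_sq, ← eLpNorm_two_sq, ← mul_pow,
          ENNReal.pow_le_pow_left_iff (by norm_num)] at b
        exact b.trans (mul_le_mul' (hv0 k) hk)
    have hlim : Tendsto (fun k => (C : ℝ≥0∞) * (N k ^ 2 + N k * B)) atTop (𝓝 0) := by
      have a1 := (ENNReal.continuous_pow 2).continuousAt.tendsto.comp hNt
      have a2 := ENNReal.Tendsto.mul_const (b := B) hNt (Or.inr hBtop)
      have a3 := ENNReal.Tendsto.const_mul (a := (C : ℝ≥0∞)) (a1.add a2)
        (Or.inr ENNReal.coe_ne_top)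
      simpa [Function.comp_def] using a3
    exact tendsto_of_tendsto_of_tendsto_of_le_of_le' tendsto_const_nhds hlim
      (Eventually.of_forall fun _ => zero_le) hle
  have hZT : eLpNorm (fun x => Z (T x)) 2 ((surf (m + 1)).restrict {x | D x = 0}) = 0 := by
    have hle : ∀ k, eLpNorm (fun x => Z (T x)) 2 ((surf (m + 1)).restrict {x | D x = 0}) ≤
        eLpNorm (fun x => Z (w k x)) 2 ((surf (m + 1)).restrict {x | D x = 0}) +
        ENNReal.ofReal M * eLpNorm (fun x => w k x - T x) 2
          ((surf (m + 1)).restrict {x | D x = 0}) := by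
      intro k
      have m1 : AEStronglyMeasurable (fun x => Z (w k x))
        ((surf (m + 1)).restrict {x | D x = 0}) := (hvc k).continuous.aestronglyMeasurable
      have m2 : AEStronglyMeasurable (fun x => Z (w k x) - Z (T x))
          ((surf (m + 1)).restrict {x | D x = 0}) :=
        m1.sub (hZ.continuous.comp_aestronglyMeasurable hT2.aestronglyMeasurable)
      have e : (fun x => Z (T x)) = (fun x => Z (w k x)) - fun x => Z (w k x) - Z (T x) := by
        funext x
        simp
      rw [e]
      refine (eLpNorm_sub_le m1 m2 (by norm_num)).trans (add_le_add le_rfl ?_)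
      exact eLpNorm_le_mul_eLpNorm_of_ae_le_mul (Eventually.of_forall fun x => hlip _ _) 2
    have hlim := hS0.add (ENNReal.Tendsto.const_mul (a := ENNReal.ofReal M) hwT
      (Or.inr ENNReal.ofReal_ne_top))
    rw [mul_zero, add_zero] at hlim
    exact le_antisymm (ge_of_tendsto' hlim hle) zero_le
  rw [eLpNorm_eq_zero_iff (hZ.continuous.comp_aestronglyMeasurable hT2.aestronglyMeasurable)
    (by norm_num)] at hZT
  exact hZT

/-- The trace of a function with values in a closed set takes values in that set. -/
lemma ae_trace_mem {n : ℕ} {R : Set (E (m + 1))}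
    (hR : {x | 0 < D x ∧ |D x| < δ₀} ⊆ R) {u : E (m + 1) → E n} {Du : Fin (m + 1) → E (m + 1) → E n}
    {T : E (m + 1) → E n} (hDu : ∀ i, MemLp (Du i) 2 (volume.restrict R))
    (hT : IsTrace R {x | D x = 0} u Du T) {K : Set (E n)} (hK : IsClosed K)
    (hu : ∀ᵐ x ∂(volume.restrict R), u x ∈ K) :
    ∀ᵐ x ∂((surf (m + 1)).restrict {x | D x = 0}), T x ∈ K := by
  have hall : ∀ j : ℕ, ∀ᵐ x ∂((surf (m + 1)).restrict {x | D x = 0}),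
      T x ∉ Metric.ball (0 : E n) j \ K := by
    intro j
    -- A function whose support is exactly this open set turns the constraint into `Z ∘ u = 0`.
    -- Intersecting with a ball gives compact support, hence a bounded derivative.
    obtain ⟨Z, hZs, hZ, -⟩ := (Metric.isOpen_ball.sdiff hK :
      IsOpen (Metric.ball (0 : E n) j \ K)).exists_contDiff_support_eq (n := 1)
    have hZc : HasCompactSupport Z := by
      refine HasCompactSupport.intro (isCompact_closedBall (0 : E n) j) fun y hy => ?_
      by_contra hne
      have : y ∈ Function.support Z := hne
      rw [hZs] at this
      exact hy (Metric.ball_subset_closedBall this.1)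
    obtain ⟨M, hM⟩ := (hZc.fderiv ℝ).exists_bound_of_continuous (hZ.continuous_fderiv (by simp))
    have := h.ae_trace_eq_zero hR hDu hT hZ hM (by
      filter_upwards [hu] with x hx
      by_contra hne
      have : u x ∈ Function.support Z := hne
      rw [hZs] at this
      exact this.2 hx)
    filter_upwards [this] with x hx hmem
    rw [← hZs] at hmem
    exact hmem hx
  filter_upwards [ae_all_iff.2 hall] with x hx
  by_contra hK'
  obtain ⟨j, hj⟩ := exists_nat_gt ‖T x‖
  exact hx j ⟨by simpa using hj, hK'⟩

end Compose

end IsDefining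

end Gluing

/-! ### Weak derivatives of Lipschitz compositions -/

section WeakCompactness

open scoped NNReal ENNReal

/-- Mollification: averages of translates of `g` keep its Lipschitz constant. -/
lemma exists_contDiff_lipschitz_approx {n : ℕ} {g : E n → ℝ} {K : ℝ≥0} (hg : LipschitzWith K g)
    {ε : ℝ} (hε : 0 < ε) : ∃ f : E n → ℝ, ContDiff ℝ ∞ f ∧ (∀ x, |f x - g x| ≤ K * ε) ∧
      ∀ x, ‖fderiv ℝ f x‖ ≤ K := by
  let φ : ContDiffBump (0 : E n) := ⟨ε / 2, ε, by positivity, by linarith⟩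
  have hφc : HasCompactSupport (φ.normed volume) := φ.hasCompactSupport_normed
  have hgl : LocallyIntegrable g (volume : Measure (E n)) := hg.continuous.locallyIntegrable
  refine ⟨convolution (φ.normed volume) g (ContinuousLinearMap.lsmul ℝ ℝ) volume, ?_, fun x => ?_, fun x => ?_⟩
  · exact hφc.contDiff_convolution_left _ φ.contDiff_normed hgl
  · have := φ.dist_normed_convolution_le (μ := volume) (x₀ := x) (ε := K * ε)
      hg.continuous.aestronglyMeasurable fun y hy => by
        refine (hg.dist_le_mul y x).trans ?_
        gcongr
        exact (Metric.mem_ball.1 hy).le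
    rwa [Real.dist_eq] at this
  · refine norm_fderiv_le_of_lipschitz ℝ (C := K) (LipschitzWith.of_dist_le_mul fun a b => ?_)
    have hex : ∀ a, Integrable (fun t => φ.normed volume t • g (a - t)) volume := fun a =>
      (φ.continuous_normed.smul (hg.continuous.comp (continuous_const.sub
        continuous_id))).integrable_of_hasCompactSupport hφc.smul_right
    rw [Real.dist_eq]
    simp only [convolution_def, ContinuousLinearMap.lsmul_apply]
    rw [← integral_sub (hex a) (hex b)]
    calc |∫ t, (φ.normed volume t • g (a - t) - φ.normed volume t • g (b - t))|
        ≤ ∫ t, φ.normed volume t * (K * dist a b) := by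
          rw [← Real.norm_eq_abs]
          refine norm_integral_le_of_norm_le
            ((φ.integrable_normed (μ := volume)).mul_const _) (Eventually.of_forall fun t => ?_)
          rw [← smul_sub, norm_smul, Real.norm_of_nonneg (φ.nonneg_normed t)]
          refine mul_le_mul_of_nonneg_left ?_ (φ.nonneg_normed t)
          have := hg.dist_le_mul (a - t) (b - t)
          rwa [dist_sub_right, dist_eq_norm] at this
      _ = K * dist a b := by
          rw [integral_mul_const, φ.integral_normed, one_mul]

/-- Bounded sequences in a Hilbert space have weak limits along an ultrafilter. -/
lemma exists_weak_limit {H : Type*} [NormedAddCommGroup H] [InnerProductSpace ℝ H]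
    [CompleteSpace H] {g : ℕ → H} {B : ℝ} (hB : ∀ j, ‖g j‖ ≤ B) :
    ∃ y : H, ∀ z, Tendsto (fun j => inner ℝ (g j) z) (hyperfilter ℕ) (𝓝 (inner ℝ y z)) := by
  set G : ℕ → WeakDual ℝ H := fun j =>
    StrongDual.toWeakDual (InnerProductSpace.toDual ℝ H (g j)) with hG
  have hK := WeakDual.isCompact_closedBall (𝕜 := ℝ) (E := H) 0 B
  obtain ⟨x', -, hx'⟩ := hK.ultrafilter_le_nhds ((hyperfilter ℕ).map G) (by
    rw [le_principal_iff]
    refine Filter.mem_map.2 (univ_mem' fun j => ?_)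
    simpa [hG] using hB j)
  refine ⟨(InnerProductSpace.toDual ℝ H).symm (WeakDual.toStrongDual x'), fun z => ?_⟩
  have h1 : Tendsto (fun j => (G j) z) (hyperfilter ℕ) (𝓝 (x' z)) :=
    ((WeakDual.eval_continuous z).tendsto x').comp (show Tendsto G (hyperfilter ℕ) (𝓝 x') from hx')
  rw [InnerProductSpace.toDual_symm_apply]
  exact h1

/-- A uniform limit of functions with weak partial derivatives bounded in `L²` has a weak partial
derivative in `L²`. -/
lemma exists_isWeakPartial_of_tendsto {d : ℕ} {Ω : Set (E d)} (hΩ : Bornology.IsBounded Ω)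
    {i : Fin d} {v w : ℕ → E d → ℝ} {u : E d → ℝ} (hv : ∀ j, MemLp (v j) 2 (volume.restrict Ω))
    (hw : ∀ j, MemLp (w j) 2 (volume.restrict Ω)) (hu : MemLp u 2 (volume.restrict Ω)) {B : ℝ}
    (hB : ∀ j, eLpNorm (w j) 2 (volume.restrict Ω) ≤ ENNReal.ofReal B)
    (hvw : ∀ j, IsWeakPartial Ω i (v j) (w j))
    (hvu : Tendsto (fun j => eLpNorm (fun x => v j x - u x) 2 (volume.restrict Ω)) atTop (𝓝 0)) :
    ∃ g : E d → ℝ, MemLp g 2 (volume.restrict Ω) ∧ IsWeakPartial Ω i u g := by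
  have := isFiniteMeasure_restrict_of_isBounded hΩ
  have hb : ∀ j, ‖(hw j).toLp (w j)‖ ≤ max B 0 := by
    intro j
    rw [Lp.norm_toLp]
    exact (ENNReal.toReal_mono ENNReal.ofReal_ne_top (hB j)).trans
      (by rw [ENNReal.toReal_ofReal'])
  obtain ⟨y, hy⟩ := exists_weak_limit hb
  refine ⟨y, Lp.memLp y, fun θ hθ hθc hθΩ => ?_⟩
  have hθ1 : ContDiff ℝ 1 θ := hθ.of_le (by simp)
  have hθ2 : MemLp θ 2 (volume.restrict Ω) := memLp_of_continuous_of_isBounded hθ.continuous hΩ 2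
  obtain ⟨C, hC⟩ := (hasCompactSupport_fderiv_basisVec hθc i).exists_bound_of_continuous
    (continuous_fderiv_basisVec hθ1 i)
  have t1 : Tendsto (fun j => ∫ x in Ω, fderiv ℝ θ x (basisVec i) • v j x) (hyperfilter ℕ)
      (𝓝 (∫ x in Ω, fderiv ℝ θ x (basisVec i) • u x)) :=
    (tendsto_integral_smul_of_tendsto_eLpNorm hv hu hvu
      (continuous_fderiv_basisVec hθ1 i).aestronglyMeasurable hC).mono_left
        (Nat.hyperfilter_le_atTop)
  have key : ∀ (f : Lp ℝ 2 (volume.restrict Ω)), inner ℝ f (hθ2.toLp θ) = ∫ x in Ω, θ x • f x := by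
    intro f
    rw [L2.inner_def]
    refine integral_congr_ae ?_
    filter_upwards [hθ2.coeFn_toLp] with x hx
    rw [hx]
    simp
  have t2 := hy (hθ2.toLp θ)
  rw [key] at t2
  have t3 : Tendsto (fun j => ∫ x in Ω, fderiv ℝ θ x (basisVec i) • v j x) (hyperfilter ℕ)
      (𝓝 (-∫ x in Ω, θ x • y x)) := by
    refine t2.neg.congr fun j => ?_
    rw [key, hvw j θ hθ hθc hθΩ]
    congr 1
    refine integral_congr_ae ?_
    filter_upwards [(hw j).coeFn_toLp] with x hx
    rw [hx]
  exact tendsto_nhds_unique t1 t3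

/-- For a Lipschitz `g` of a vector-valued map there is no pointwise chain rule to use. The
compositions with mollifications of `g` have weak derivatives bounded in `L²`, and a weak limit of
these serves as derivative. The energy estimates need only its existence. -/
lemma IsDefining.exists_memH1_lipschitz_comp {m n : ℕ} {D : E (m + 1) → ℝ} {δ₀ : ℝ}
    (h : IsDefining D δ₀) {Ω : Set (E (m + 1))} (hΩ : IsOpen Ω) (hΩb : Bornology.IsBounded Ω)
    (hsub : {x | 0 ≤ D x} ⊆ Ω) {F₁ : Type} [NormedAddCommGroup F₁] [NormedSpace ℝ F₁]
    [FiniteDimensional ℝ F₁] {Φp Φm : E (m + 1) × F₁ → E n} (hΦp : ContDiff ℝ 1 Φp)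
    (hΦm : ContDiff ℝ 1 Φm) {Mp Mm : ℝ}
    (hMp : ∀ z, ‖fderiv ℝ Φp z‖ ≤ Mp) (hMm : ∀ z, ‖fderiv ℝ Φm z‖ ≤ Mm)
    {up um : E (m + 1) → F₁} {Dup Dum : Fin (m + 1) → E (m + 1) → F₁} {Tp Tm : E (m + 1) → F₁}
    (hup : MemLp up 2 (volume.restrict {x | 0 < D x}))
    (hDup : ∀ i, MemLp (Dup i) 2 (volume.restrict {x | 0 < D x}))
    (hum : MemLp um 2 (volume.restrict (Ω ∩ {x | D x < 0})))
    (hDum : ∀ i, MemLp (Dum i) 2 (volume.restrict (Ω ∩ {x | D x < 0})))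
    (hTp : IsTrace {x | 0 < D x} {x | D x = 0} up Dup Tp)
    (hTm : IsTrace (Ω ∩ {x | D x < 0}) {x | D x = 0} um Dum Tm)
    (hT : ∀ᵐ x ∂((surf (m + 1)).restrict {x | D x = 0}), Φp (x, Tp x) = Φm (x, Tm x))
    {u : E (m + 1) → E n} (hup' : ∀ x, 0 < D x → u x = Φp (x, up x))
    (hum' : ∀ x, D x ≤ 0 → u x = Φm (x, um x))
    {g : E n → ℝ} {K : ℝ≥0} (hg : LipschitzWith K g) :
    ∃ Dψ, MemH1 Ω (fun x => g (u x)) Dψ := by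
  classical
  have hpb := isBounded_pos hΩb hsub
  have hnb : Bornology.IsBounded (Ω ∩ {x | D x < 0}) := hΩb.subset inter_subset_left
  have := isFiniteMeasure_restrict_of_isBounded hpb
  have := isFiniteMeasure_restrict_of_isBounded hnb
  have := isFiniteMeasure_restrict_of_isBounded hΩb
  choose f hf hfg hf' using fun j : ℕ =>
    exists_contDiff_lipschitz_approx hg (ε := 1 / ((j : ℝ) + 1)) (by positivity)
  have hf1 : ∀ j, ContDiff ℝ 1 (f j) := fun j => (hf j).of_le (by simp)
  have hcomp : ∀ {Φ : E (m + 1) × F₁ → E n}, ContDiff ℝ 1 Φ → ∀ {M : ℝ},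
      (∀ z, ‖fderiv ℝ Φ z‖ ≤ M) → ∀ j z, ‖fderiv ℝ (fun z => f j (Φ z)) z‖ ≤ K * M := by
    intro Φ hΦ M hM j z
    have e : fderiv ℝ (fun z => f j (Φ z)) z = (fderiv ℝ (f j) (Φ z)).comp (fderiv ℝ Φ z) :=
      fderiv_comp z (((hf1 j).differentiable (by simp)) _) ((hΦ.differentiable (by simp)) z)
    rw [e]
    refine (ContinuousLinearMap.opNorm_comp_le _ _).trans ?_
    exact mul_le_mul (hf' j _) (hM z) (norm_nonneg _) K.2
  have hH := fun j => h.memH1_ite_comp hΩ hΩb hsub ((hf1 j).comp hΦp) ((hf1 j).comp hΦm)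
    (hcomp hΦp hMp j) (hcomp hΦm hMm j) hup hDup hum hDum hTp hTm
    (by filter_upwards [hT] with x hx using congrArg (f j) hx)
  have hu : ∀ j, (fun x => if 0 < D x then (f j ∘ Φp) (x, up x) else (f j ∘ Φm) (x, um x)) =
      fun x => f j (u x) := fun j => by
    funext x
    split_ifs with hx
    · rw [hup' x hx]; rfl
    · rw [hum' x (not_lt.1 hx)]; rfl
  simp only [hu] at hH
  have hum2 : MemLp u 2 (volume.restrict Ω) := by
    refine (h.memLp_ite hsub (memLp_comp hpb hΦp hMp hup) (memLp_comp hnb hΦm hMm hum)).ae_eq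
      (Eventually.of_forall fun x => ?_)
    split_ifs with hx
    · exact (hup' x hx).symm
    · exact (hum' x (not_lt.1 hx)).symm
  have hgu : MemLp (fun x => g (u x)) 2 (volume.restrict Ω) := by
    have h1 : MemLp (fun x => g (u x) - g 0) 2 (volume.restrict Ω) := by
      refine (hum2.norm.const_mul (K : ℝ)).mono ?_ (Eventually.of_forall fun x => ?_)
      · exact (hg.continuous.comp_aestronglyMeasurable hum2.aestronglyMeasurable).sub
          aestronglyMeasurable_const
      · refine le_trans ?_ (le_abs_self _)
        simpa using hg.norm_sub_le (u x) 0
    have h2 := h1.add (memLp_const (g 0))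
    have e : ((fun x => g (u x) - g 0) + fun _ => g 0) = fun x => g (u x) := by
      funext x
      simp
    rwa [e] at h2
  have hlim : Tendsto (fun j => eLpNorm (fun x => f j (u x) - g (u x)) 2 (volume.restrict Ω))
      atTop (𝓝 0) := by
    have hle : ∀ j, eLpNorm (fun x => f j (u x) - g (u x)) 2 (volume.restrict Ω) ≤
        (volume.restrict Ω) univ ^ ((2 : ℝ≥0∞).toReal)⁻¹ *
          ENNReal.ofReal (K * (1 / ((j : ℝ) + 1))) := fun j =>
      eLpNorm_le_of_ae_bound (Eventually.of_forall fun x => hfg j (u x))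
    refine tendsto_of_tendsto_of_tendsto_of_le_of_le tendsto_const_nhds ?_ (fun _ => zero_le) hle
    have h1 : Tendsto (fun j : ℕ => ENNReal.ofReal (K * (1 / ((j : ℝ) + 1)))) atTop (𝓝 0) := by
      have := (tendsto_one_div_add_atTop_nhds_zero_nat (𝕜 := ℝ)).const_mul (K : ℝ)
      have := (ENNReal.continuous_ofReal.tendsto _).comp this
      simpa [Function.comp_def] using this
    have := ENNReal.Tendsto.const_mul
      (a := (volume.restrict Ω) univ ^ ((2 : ℝ≥0∞).toReal)⁻¹) h1
      (Or.inr (ENNReal.rpow_ne_top_of_nonneg (by norm_num) (measure_ne_top _ _)))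
    simpa using this
  have hex : ∀ i, ∃ Dg, MemLp Dg 2 (volume.restrict Ω) ∧
      IsWeakPartial Ω i (fun x => g (u x)) Dg := by
    intro i
    -- This majorant of the derivatives is the same for all `j`, because mollification preserves the
    -- Lipschitz constant `K`.
    obtain ⟨q, hq, hdom⟩ : ∃ q, q = _ ∧ MemLp q 2 _ := ⟨_, rfl, h.memLp_ite hsub (memLp_const_mul_one_add_norm (K * Mp) (hDup i))
      (memLp_const_mul_one_add_norm (K * Mm) (hDum i))⟩
    refine exists_isWeakPartial_of_tendsto hΩb (fun j => (hH j).memLp)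
      (fun j => (hH j).memLp_deriv i) hgu (B := (eLpNorm q 2 (volume.restrict Ω)).toReal) (fun j => ?_)
      (fun j => (hH j).weak i) hlim
    rw [ENNReal.ofReal_toReal hdom.eLpNorm_ne_top]
    refine eLpNorm_mono fun x => ?_
    refine le_trans ?_ (le_abs_self _)
    rw [hq]
    beta_reduce
    split_ifs with hx
    · exact norm_compDeriv_le (hcomp hΦp hMp j) up Dup i x
    · exact norm_compDeriv_le (hcomp hΦm hMm j) um Dum i x
  choose Dg hDg2 hDgw using hex
  exact ⟨Dg, hgu, hDg2, hDgw⟩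

end WeakCompactness

/-! ### The one-dimensional transition profile -/

section Profile

/-- The autonomous equation `q' = -H(q)`, with `H` continuous and bounded between positive
constants, has global solutions. -/
lemma exists_autonomous_solution {H : ℝ → ℝ} (hH : Continuous H) {a b : ℝ} (ha : 0 < a)
    (haH : ∀ y, a ≤ H y) (hHb : ∀ y, H y ≤ b) (y₀ : ℝ) :
    ∃ q : ℝ → ℝ, q 0 = y₀ ∧ ∀ r, HasDerivAt q (-H (q r)) r := by
  have hb : 0 < b := ha.trans_le ((haH 0).trans (hHb 0))
  have hH0 : ∀ y, 0 < H y := fun y => ha.trans_le (haH y)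
  have hc : Continuous fun y => (H y)⁻¹ := hH.inv₀ fun y => (hH0 y).ne'
  -- `S y` is the time needed to fall from `y` to `0`, so the solution is `S⁻¹(S y₀ - r)`. The upper
  -- bound on `H` makes `S` onto the real line and the solution global.
  set S : ℝ → ℝ := fun y => ∫ t in (0 : ℝ)..y, (H t)⁻¹ with hS
  have hSd : ∀ y, HasDerivAt S (H y)⁻¹ y := fun y =>
    intervalIntegral.integral_hasDerivAt_right (hc.intervalIntegrable _ _)
      (hc.stronglyMeasurableAtFilter _ _) hc.continuousAt
  have hSc : Continuous S := continuous_iff_continuousAt.2 fun y => (hSd y).continuousAt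
  have hSm : StrictMono S := strictMono_of_deriv_pos fun y => by
    rw [(hSd y).deriv]
    exact inv_pos.2 (hH0 y)
  have hgrow : Monotone fun y => S y - b⁻¹ * y := by
    refine monotone_of_deriv_nonneg
      (fun y => ((hSd y).sub ((hasDerivAt_id y).const_mul _)).differentiableAt) fun y => ?_
    have := ((hSd y).sub ((hasDerivAt_id y).const_mul b⁻¹)).deriv
    have e : deriv (fun y => S y - b⁻¹ * y) y = (H y)⁻¹ - b⁻¹ * 1 := this
    rw [e, mul_one, sub_nonneg]
    exact inv_anti₀ (hH0 y) (hHb y)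
  have hS0 : S 0 = 0 := by simp [hS]
  have hge : ∀ y, 0 ≤ y → b⁻¹ * y ≤ S y := fun y hy => by
    have := hgrow hy
    simp only [hS0, mul_zero, sub_zero] at this
    linarith
  have hle : ∀ y, y ≤ 0 → S y ≤ b⁻¹ * y := fun y hy => by
    have := hgrow hy
    simp only [hS0, mul_zero, sub_zero] at this
    linarith
  have hbi : 0 < b⁻¹ := inv_pos.2 hb
  have htop : Tendsto S atTop atTop := tendsto_atTop_mono' _
    ((eventually_ge_atTop 0).mono fun y hy => hge y hy) (tendsto_id.const_mul_atTop hbi)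
  have hbot : Tendsto S atBot atBot := tendsto_atBot_mono' _
    ((eventually_le_atBot 0).mono fun y hy => hle y hy) (tendsto_id.const_mul_atBot hbi)
  have hsurj : Function.Surjective S := hSc.surjective htop hbot
  let e := hSm.orderIsoOfSurjective S hsurj
  have heS : ∀ y, S (e.symm y) = y := fun y => hSm.orderIsoOfSurjective_self_symm_apply S hsurj y
  have hed : ∀ y, HasDerivAt e.symm (H (e.symm y)) y := fun y => by
    have := HasDerivAt.of_local_left_inverse (f := S) (g := e.symm) (a := y)
      e.symm.continuous.continuousAt (hSd _) (inv_ne_zero (hH0 _).ne')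
      (Eventually.of_forall heS)
    rwa [inv_inv] at this
  refine ⟨fun r => e.symm (S y₀ - r), ?_, fun r => ?_⟩
  · simp only [sub_zero]
    exact hSm.orderIsoOfSurjective_symm_apply_self S hsurj y₀
  · have h1 : HasDerivAt (fun r => S y₀ - r) (-1) r := (hasDerivAt_id r).const_sub _
    have := HasDerivAt.comp (h₂ := e.symm) r (hed (S y₀ - r)) h1
    exact this.congr_deriv (by ring)

/-- Squaring makes the truncation at zero differentiable, with continuous derivative. This is how
the profile is continued by zero. -/
lemma hasDerivAt_max_sq (x : ℝ) : HasDerivAt (fun y : ℝ => max y 0 ^ 2) (2 * max x 0) x := by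
  rcases lt_trichotomy x 0 with hx | hx | hx
  · rw [max_eq_right hx.le]
    refine ((hasDerivAt_const x (0 : ℝ)).congr_of_eventuallyEq ?_).congr_deriv (by simp)
    filter_upwards [gt_mem_nhds hx] with y hy
    simp [max_eq_right (le_of_lt hy)]
  · subst hx
    rw [hasDerivAt_iff_isLittleO_nhds_zero]
    have h1 : (fun h : ℝ => max (0 + h) 0 ^ 2 - max (0 : ℝ) 0 ^ 2 - h • (2 * max (0 : ℝ) 0)) =O[𝓝 0]
        fun h : ℝ => h ^ 2 := by
      refine Asymptotics.IsBigO.of_bound 1 (Eventually.of_forall fun h => ?_)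
      simp only [zero_add, max_self, ne_eq, OfNat.ofNat_ne_zero, not_false_eq_true, zero_pow,
        sub_zero, mul_zero, smul_eq_mul, norm_pow, Real.norm_eq_abs, one_mul, sq_abs]
      rcases le_total h 0 with hh | hh
      · rw [max_eq_right hh]
        simpa using sq_nonneg h
      · rw [max_eq_left hh]
    exact h1.trans_isLittleO (Asymptotics.isLittleO_pow_id one_lt_two)
  · rw [max_eq_left hx.le]
    refine ((hasDerivAt_pow 2 x).congr_of_eventuallyEq ?_).congr_deriv (by simp)
    filter_upwards [lt_mem_nhds hx] with y hy
    simp [max_eq_left (le_of_lt hy)]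

/-- `s` decreases from the value `ℓ` to `0` on `[0, δ]` and almost solves `ε s' = -G(s)`. -/
structure IsTransition (G : ℝ → ℝ) (ℓ δ δ₁ K ε : ℝ) (s : ℝ → ℝ) : Prop where
  contDiff : ContDiff ℝ 1 s
  map_zero : s 0 = ℓ
  nonneg : ∀ t, 0 ≤ s t
  le : ∀ t, 0 ≤ t → s t ≤ ℓ
  eq_zero : ∀ t, δ ≤ t → s t = 0
  eq_zero_of_abs : ∀ t, δ₁ ≤ |t| → s t = 0
  deriv_eq : ∀ t, 0 ≤ t → deriv s t = -(G (s t) / ε + 2 * √ℓ / δ * √(s t))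
  mul_le : ∀ t, 0 ≤ t → t * s t ≤ K * ε

/-- The optimal profile for the one-dimensional transition, modified so that it reaches the well
at distance `δ`. -/
lemma exists_profile {G : ℝ → ℝ} (hG : Continuous G) {a κ ℓ δ δ₁ : ℝ} (hκ : 0 < κ) (hℓ : 0 < ℓ)
    (hδ : 0 < δ) (hδ₁ : δ < δ₁) (hGa : ∀ l, 0 ≤ l → G l ≤ a * l)
    (hκG : ∀ l, 0 ≤ l → l ≤ ℓ → κ * l ≤ G l) {ε : ℝ} (hε : 0 < ε) :
    ∃ s, IsTransition G ℓ δ δ₁ (ℓ / κ) ε s := by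
  -- The equation is solved for `q = √s`, which satisfies `q' = -(G(q²)/(2 ε q) + Λ/2)`. The right
  -- side is regular at `q = 0`, and since `Λ/2 = √ℓ/δ`, `q` has fallen from `√ℓ` to at most zero by
  -- time `δ`.
  set b := √ℓ with hb
  have hb0 : 0 < b := Real.sqrt_pos.2 hℓ
  have hbb : b ^ 2 = ℓ := Real.sq_sqrt hℓ.le
  have hG0 : G 0 = 0 := le_antisymm (by simpa using hGa 0 le_rfl)
    (by simpa using hκG 0 le_rfl hℓ.le)
  have ha0 : 0 ≤ a := by
    have h1 := hGa ℓ hℓ.le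
    have h2 := hκG ℓ hℓ.le le_rfl
    have : 0 < a * ℓ := lt_of_lt_of_le (by positivity) (h2.trans h1)
    exact (pos_of_mul_pos_left this hℓ.le).le
  set Λ := 2 * b / δ with hΛ
  have hΛ0 : 0 < Λ := by positivity
  set cl : ℝ → ℝ := fun y => max 0 (min y b) with hcl
  have hclc : Continuous cl := by fun_prop
  have hcl0 : ∀ y, 0 ≤ cl y := fun y => le_max_left _ _
  have hclb : ∀ y, cl y ≤ b := fun y => max_le hb0.le (min_le_right _ _)
  -- Where `cl y = 0` the quotient has the default value `0`. This is its continuous value, because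
  -- `G(l) ≤ a l`.
  set g : ℝ → ℝ := fun y => G (cl y ^ 2) / cl y with hg
  have hsq : ∀ y, cl y ^ 2 ≤ ℓ := fun y => by
    rw [← hbb]
    exact pow_le_pow_left₀ (hcl0 y) (hclb y) 2
  have hg0 : ∀ y, 0 ≤ g y := fun y =>
    div_nonneg ((by have := hcl0 y; positivity : 0 ≤ κ * cl y ^ 2).trans
      (hκG _ (by positivity) (hsq y))) (hcl0 y)
  have hga : ∀ y, g y ≤ a * cl y := fun y => by
    rcases (hcl0 y).eq_or_lt with h0 | h0
    · simp [hg, ← h0]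
    · rw [hg]
      beta_reduce
      rw [div_le_iff₀ h0]
      calc G (cl y ^ 2) ≤ a * cl y ^ 2 := hGa _ (by positivity)
        _ = a * cl y * cl y := by ring
  have hgc : Continuous g := by
    rw [continuous_iff_continuousAt]
    intro y
    rcases (hcl0 y).eq_or_lt with h0 | h0
    · have hgy : g y = 0 := by simp [hg, ← h0]
      rw [ContinuousAt, hgy]
      have h1 : Tendsto (fun y => a * cl y) (𝓝 y) (𝓝 0) := by
        have := (hclc.const_mul a).tendsto y
        rwa [← h0, mul_zero] at this
      exact squeeze_zero hg0 hga h1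
    · exact ((hG.comp (hclc.pow 2)).continuousAt).div hclc.continuousAt h0.ne'
  set H : ℝ → ℝ := fun y => g y / (2 * ε) + Λ / 2 with hH
  have hHc : Continuous H := (hgc.div_const _).add continuous_const
  have hHlow : ∀ y, Λ / 2 ≤ H y := fun y => by
    have : 0 ≤ g y / (2 * ε) := div_nonneg (hg0 y) (by positivity)
    simp only [hH]
    linarith
  have hHup : ∀ y, H y ≤ a * b / (2 * ε) + Λ / 2 := fun y => by
    have : g y ≤ a * b := (hga y).trans (mul_le_mul_of_nonneg_left (hclb y) ha0)
    simp only [hH]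
    gcongr
  obtain ⟨q, hq0, hqd⟩ := exists_autonomous_solution hHc (by positivity) hHlow hHup b
  have hqc : Continuous q := continuous_iff_continuousAt.2 fun r => (hqd r).continuousAt
  have hqa : Antitone fun r => q r + Λ / 2 * r := by
    refine antitone_of_deriv_nonpos
      (fun r => ((hqd r).add ((hasDerivAt_id r).const_mul _)).differentiableAt) fun r => ?_
    have e : deriv (fun r => q r + Λ / 2 * r) r = -H (q r) + Λ / 2 * 1 :=
      ((hqd r).add ((hasDerivAt_id r).const_mul (Λ / 2))).deriv
    rw [e]
    linarith [hHlow (q r)]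
  have hqr : ∀ r, 0 ≤ r → q r ≤ b - Λ / 2 * r := fun r hr => by
    have := hqa hr
    simp only [hq0, mul_zero, add_zero] at this
    linarith
  have hqb : ∀ r, 0 ≤ r → q r ≤ b := fun r hr => (hqr r hr).trans (by
    have : 0 ≤ Λ / 2 * r := by positivity
    linarith)
  have hqδ : ∀ r, δ ≤ r → q r ≤ 0 := fun r hr => by
    refine (hqr r (hδ.le.trans hr)).trans ?_
    have : b ≤ Λ / 2 * r := by
      have e : Λ / 2 * δ = b := by
        rw [hΛ]
        field_simp
      rw [← e]
      gcongr
    linarith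
  set p : ℝ → ℝ := fun r => max (q r) 0 ^ 2 with hp
  have hpd : ∀ r, HasDerivAt p (-(2 * max (q r) 0 * H (q r))) r := fun r => by
    have := HasDerivAt.comp r (hasDerivAt_max_sq (q r)) (hqd r)
    exact this.congr_deriv (by ring)
  have hpC : ContDiff ℝ 1 p := by
    rw [contDiff_one_iff_deriv]
    refine ⟨fun r => (hpd r).differentiableAt, ?_⟩
    rw [show deriv p = fun r => -(2 * max (q r) 0 * H (q r)) from funext fun r => (hpd r).deriv]
    exact ((continuous_const.mul (hqc.max continuous_const)).mul (hHc.comp hqc)).neg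
  have hpδ : ∀ r, δ ≤ r → p r = 0 := fun r hr => by simp [hp, max_eq_right (hqδ r hr)]
  have hpℓ : ∀ r, 0 ≤ r → p r ≤ ℓ := fun r hr => by
    rw [← hbb]
    exact pow_le_pow_left₀ (le_max_right _ _) (max_le (hqb r hr) hb0.le) 2
  have hpode : ∀ r, 0 ≤ r → -(2 * max (q r) 0 * H (q r)) = -(G (p r) / ε + Λ * √(p r)) := by
    intro r hr
    rcases le_or_gt (q r) 0 with h0 | h0
    · simp [hp, max_eq_right h0, hG0]
    · have hc : cl (q r) = q r := by
        simp [hcl, min_eq_left (hqb r hr), max_eq_right h0.le]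
      simp only [hp, max_eq_left h0.le, hH, hg, hc, Real.sqrt_sq h0.le]
      field_simp
  -- The lower bound `G(l) ≥ κ l` makes `p(r) exp(κ r/ε)` nonincreasing; combined with `x e⁻ˣ ≤ 1`
  -- this gives the bound for `r p(r)`.
  have hpexp : ∀ r, 0 ≤ r → p r ≤ ℓ * Real.exp (-(κ / ε * r)) := by
    have hanti : AntitoneOn (fun r => p r * Real.exp (κ / ε * r)) (Ici 0) := by
      have hd : ∀ r, HasDerivAt (fun r => p r * Real.exp (κ / ε * r))
          (-(2 * max (q r) 0 * H (q r)) * Real.exp (κ / ε * r) +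
            p r * (Real.exp (κ / ε * r) * (κ / ε * 1))) r := fun r =>
        (hpd r).mul (((hasDerivAt_id r).const_mul (κ / ε)).exp)
      refine antitoneOn_of_deriv_nonpos (convex_Ici 0)
        (fun r _ => (hd r).continuousAt.continuousWithinAt)
        (fun r _ => (hd r).differentiableAt.differentiableWithinAt) fun r hr => ?_
      rw [interior_Ici] at hr
      have hr0 : 0 ≤ r := le_of_lt hr
      rw [(hd r).deriv, hpode r hr0]
      have h1 : κ * p r ≤ G (p r) := hκG _ (by positivity) (hpℓ r hr0)
      have h2 : κ / ε * p r ≤ G (p r) / ε := by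
        rw [div_mul_eq_mul_div]
        gcongr
      have h3 : 0 ≤ Λ * √(p r) := by positivity
      have h4 : -(G (p r) / ε + Λ * √(p r)) + p r * (κ / ε) ≤ 0 := by linarith
      calc _ = (-(G (p r) / ε + Λ * √(p r)) + p r * (κ / ε)) * Real.exp (κ / ε * r) := by ring
        _ ≤ 0 := mul_nonpos_of_nonpos_of_nonneg h4 (Real.exp_pos _).le
    intro r hr
    have h1 := hanti (mem_Ici.2 le_rfl) (mem_Ici.2 hr) hr
    have h2 : p 0 = ℓ := by simp [hp, hq0, max_eq_left hb0.le, hbb]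
    simp only [h2, mul_zero, Real.exp_zero, mul_one] at h1
    rw [Real.exp_neg, ← div_eq_mul_inv, le_div_iff₀ (Real.exp_pos _)]
    exact h1
  have hpr : ∀ r, 0 ≤ r → r * p r ≤ ℓ / κ * ε := by
    intro r hr
    have h1 : κ / ε * r * Real.exp (-(κ / ε * r)) ≤ 1 := by
      rw [Real.exp_neg, ← div_eq_mul_inv, div_le_one (Real.exp_pos _)]
      linarith [Real.add_one_le_exp (κ / ε * r)]
    calc r * p r ≤ r * (ℓ * Real.exp (-(κ / ε * r))) :=
          mul_le_mul_of_nonneg_left (hpexp r hr) hr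
      _ = ℓ / κ * ε * (κ / ε * r * Real.exp (-(κ / ε * r))) := by field_simp
      _ ≤ ℓ / κ * ε * 1 := by gcongr
      _ = _ := mul_one _
  -- The cut-off alters the profile at negative times only, since `p` vanishes from `δ` on. It makes
  -- the support compact.
  obtain ⟨χ, hχ, hχ1, hχ0, hχI⟩ := exists_cutoff (hδ.trans_le (le_refl δ)) hδ₁
  have hs : ∀ t, 0 ≤ t → χ t * p t = p t := fun t ht => by
    rcases le_total t δ with h | h
    · rw [hχ1 t (by rwa [abs_of_nonneg ht]), one_mul]
    · rw [hpδ t h, mul_zero]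
  have hp0 : ∀ t, 0 ≤ p t := fun t => by positivity
  refine ⟨fun t => χ t * p t, (hχ.of_le (by simp)).mul hpC, ?_, fun t => ?_, fun t ht => ?_,
    fun t ht => ?_, fun t ht => ?_, fun t ht => ?_, fun t ht => ?_⟩
  · rw [hs 0 le_rfl]
    simp [hp, hq0, max_eq_left hb0.le, hbb]
  · exact mul_nonneg (hχI t).1 (hp0 t)
  · rw [hs t ht]
    exact hpℓ t ht
  · rw [hpδ t ht, mul_zero]
  · rw [hχ0 t ht, zero_mul]
  · rw [hs t ht, ← hpode t ht]
    have hd : HasDerivAt (fun t => χ t * p t)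
        (deriv χ t * p t + χ t * -(2 * max (q t) 0 * H (q t))) t :=
      ((hχ.differentiable (by simp)) t).hasDerivAt.mul (hpd t)
    rw [hd.deriv]
    rcases lt_or_ge t δ with h | h
    · have h1 : χ =ᶠ[𝓝 t] fun _ => 1 := by
        have : ∀ᶠ y in 𝓝 t, |y| < δ :=
          continuous_abs.continuousAt.eventually_lt_const (by rwa [abs_of_nonneg ht])
        filter_upwards [this] with y hy using hχ1 y hy.le
      rw [h1.deriv_eq, h1.eq_of_nhds]
      simp
    · rw [hpδ t h, max_eq_right (hqδ t h)]
      simp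
  · rw [hs t ht]
    exact hpr t ht

end Profile

/-! ### Geometry of the wells: minimal pairs and normals -/

section Wells

lemma HasSmoothProjection.mono {d : ℕ} {S N N' : Set (E d)} (h : HasSmoothProjection S N)
    (hN : N' ⊆ N) : HasSmoothProjection S N' := by
  obtain ⟨P, hP, hP'⟩ := h
  exact ⟨P, hP.mono hN, fun x hx => hP' x (hN hx)⟩

lemma isCompact_frontier_of_isBounded {d : ℕ} {U : Set (E d)} (hU : Bornology.IsBounded U) :
    IsCompact (frontier U) :=
  hU.isCompact_closure.of_isClosed_subset isClosed_frontier frontier_subset_closure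

lemma isDefining_sgnDist {d : ℕ} {U : Set (E d)} {ρ : ℝ} (hρ : 0 < ρ) (hU : IsOpen U)
    (hUb : Bornology.IsBounded U) (hne : (frontier U).Nonempty) (hb : HasBoundaryOfClass ∞ U)
    (hP : HasSmoothProjection (frontier U) {x | Metric.infDist x (frontier U) < ρ}) :
    IsDefining (sgnDist U) ρ := by
  have hN : IsOpen {x | Metric.infDist x (frontier U) < ρ} :=
    isOpen_lt (Metric.continuous_infDist_pt _) continuous_const
  refine ⟨hρ, sgnDist_lipschitz U, ?_, fun x hx => ?_, fun r => ?_⟩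
  · simp only [abs_sgnDist]
    exact contDiffOn_sgnDist hU hb hN hP
  · rw [abs_sgnDist] at hx
    exact norm_fderiv_sgnDist hU hb hN hP hx
  · have hc := isCompact_frontier_of_isBounded hUb
    refine Metric.isCompact_of_isClosed_isBounded
      (isClosed_le (sgnDist_lipschitz U).continuous.abs continuous_const) ?_
    refine (hc.isBounded.cthickening (δ := r)).subset fun x hx => ?_
    obtain ⟨y, hy, hxy⟩ := hc.exists_infDist_eq_dist hne x
    refine Metric.mem_cthickening_of_dist_le x y r _ hy ?_
    rw [← hxy, ← abs_sgnDist]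
    exact hx

variable {n : ℕ} {Up Um : Set (E n)} {δ₀ : ℝ}

lemma IsWells.symm (h : IsWells Up Um δ₀) : IsWells Um Up δ₀ where
  isOpen_plus := h.isOpen_minus
  isOpen_minus := h.isOpen_plus
  bounded_plus := h.bounded_minus
  bounded_minus := h.bounded_plus
  smooth_plus := h.smooth_minus
  smooth_minus := h.smooth_plus
  connected_plus := h.connected_minus
  connected_minus := h.connected_plus
  disjoint_inside := h.disjoint_inside.symm
  disjoint_wells := h.disjoint_wells.symm
  projection := by
    rw [union_comm]
    exact h.projection

lemma wellDist_comm (Up Um : Set (E n)) : wellDist Up Um = wellDist Um Up := by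
  unfold wellDist
  congr 1
  ext r
  constructor <;>
  · rintro ⟨p, hp, q, hq, rfl⟩
    exact ⟨q, hq, p, hp, dist_comm _ _⟩

lemma wellDist_le {p q : E n} (hp : p ∈ frontier Up) (hq : q ∈ frontier Um) :
    wellDist Up Um ≤ dist p q :=
  csInf_le ⟨0, by rintro r ⟨p, -, q, -, rfl⟩; exact dist_nonneg⟩ ⟨p, hp, q, hq, rfl⟩

lemma potential_comm (f : ℝ → ℝ) (Up Um : Set (E n)) (u : E n) :
    potential f Up Um u = potential f Um Up u := by
  simp only [potential, union_comm]

namespace IsWells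

variable (h : IsWells Up Um δ₀)

include h

lemma notMem_of_mem_frontier {q : E n} (hq : q ∈ frontier Um) : q ∉ Up := fun hqU => by
  obtain ⟨y, hy1, hy2⟩ := mem_closure_iff.1 (frontier_subset_closure hq) Up h.isOpen_plus hqU
  exact Set.disjoint_left.1 h.disjoint_inside hy1 hy2

lemma exists_dist_eq_wellDist :
    ∃ p ∈ frontier Up, ∃ q ∈ frontier Um, dist p q = wellDist Up Um := by
  have h1 := isCompact_frontier_of_isBounded h.bounded_plus
  have h2 := isCompact_frontier_of_isBounded h.bounded_minus
  obtain ⟨p, hp, hmin⟩ := h1.exists_isMinOn h.connected_plus.nonempty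
    (Metric.continuous_infDist_pt (frontier Um)).continuousOn
  obtain ⟨q, hq, hpq⟩ := h2.exists_infDist_eq_dist h.connected_minus.nonempty p
  refine ⟨p, hp, q, hq, le_antisymm ?_ (wellDist_le hp hq)⟩
  refine le_csInf ⟨_, p, hp, q, hq, rfl⟩ ?_
  rintro r ⟨p', hp', q', hq', rfl⟩
  rw [← hpq]
  exact (hmin hp').trans (Metric.infDist_le_dist_of_mem hq')

lemma wellDist_pos : 0 < wellDist Up Um := by
  obtain ⟨p, hp, q, hq, hpq⟩ := h.exists_dist_eq_wellDist
  rw [← hpq, dist_pos]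
  rintro rfl
  exact Set.disjoint_left.1 h.disjoint_wells hp hq

lemma wellDist_le_infDist_add (u : E n) :
    wellDist Up Um ≤ Metric.infDist u (frontier Up) + Metric.infDist u (frontier Um) := by
  obtain ⟨p, hp, hup⟩ := (isCompact_frontier_of_isBounded h.bounded_plus).exists_infDist_eq_dist
    h.connected_plus.nonempty u
  obtain ⟨q, hq, huq⟩ := (isCompact_frontier_of_isBounded h.bounded_minus).exists_infDist_eq_dist
    h.connected_minus.nonempty u
  rw [hup, huq, dist_comm u p]
  exact (wellDist_le hp hq).trans (dist_triangle p u q)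

lemma infDist_union (u : E n) : Metric.infDist u (frontier Up ∪ frontier Um) =
    min (Metric.infDist u (frontier Up)) (Metric.infDist u (frontier Um)) := by
  have hne := h.connected_plus.nonempty
  have hne' := h.connected_minus.nonempty
  refine le_antisymm (le_min (Metric.infDist_le_infDist_of_subset subset_union_left hne)
    (Metric.infDist_le_infDist_of_subset subset_union_right hne')) ?_
  refine (Metric.le_infDist (hne.mono subset_union_left)).2 ?_
  rintro y (hy | hy)
  · exact (min_le_left _ _).trans (Metric.infDist_le_dist_of_mem hy)
  · exact (min_le_right _ _).trans (Metric.infDist_le_dist_of_mem hy)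

/-- Uniqueness of the projection forces the wells to be far apart. -/
lemma four_mul_le_wellDist : 4 * δ₀ ≤ wellDist Up Um := by
  by_contra! hlt
  obtain ⟨p, hp, q, hq, hpq⟩ := h.exists_dist_eq_wellDist
  obtain ⟨P, -, hP⟩ := h.projection
  -- The midpoint of a minimal pair has two nearest points on the wells, so it cannot lie in the
  -- neighbourhood on which the projection is unique.
  set x := midpoint ℝ p q
  have hxp : dist x p = wellDist Up Um / 2 := by
    rw [dist_midpoint_left, ← hpq, Real.norm_of_nonneg (by norm_num)]
    ring
  have hxq : dist x q = wellDist Up Um / 2 := by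
    rw [dist_midpoint_right, ← hpq, Real.norm_of_nonneg (by norm_num)]
    ring
  have hpm : p ∈ frontier Up ∪ frontier Um := Or.inl hp
  have hqm : q ∈ frontier Up ∪ frontier Um := Or.inr hq
  have hxN : Metric.infDist x (frontier Up ∪ frontier Um) < 2 * δ₀ :=
    (Metric.infDist_le_dist_of_mem hpm).trans_lt (by rw [hxp]; linarith)
  have hPx := hP x hxN
  have hmin : ∀ y ∈ frontier Up ∪ frontier Um, wellDist Up Um / 2 ≤ dist x y := by
    rintro y (hy | hy)
    · have := wellDist_le hy hq
      have := dist_triangle y x q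
      rw [dist_comm y x] at this
      linarith
    · have := wellDist_le hp hy
      have := dist_triangle p x y
      rw [dist_comm p x] at this
      linarith
  have hle := hmin _ hPx.1
  have h1 : p = P x := by
    by_contra hne
    have := hPx.2 p hpm hne
    linarith
  have h2 : q = P x := by
    by_contra hne
    have := hPx.2 q hqm hne
    linarith
  have := h.wellDist_pos
  rw [← hpq, h1, h2, dist_self] at this
  exact lt_irrefl _ this

lemma infDist_minus_gt {u : E n} (hu : Metric.infDist u (frontier Up) < 2 * δ₀) :
    2 * δ₀ < Metric.infDist u (frontier Um) := by
  have h1 := h.wellDist_le_infDist_add u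
  have h2 := h.four_mul_le_wellDist
  linarith

lemma hasSmoothProjection_plus :
    HasSmoothProjection (frontier Up) {u | Metric.infDist u (frontier Up) < 2 * δ₀} := by
  obtain ⟨P, hPs, hP⟩ := h.projection
  have hsub : ∀ u, Metric.infDist u (frontier Up) < 2 * δ₀ →
      Metric.infDist u (frontier Up ∪ frontier Um) < 2 * δ₀ := fun u hu => by
    rw [h.infDist_union]
    exact (min_le_left _ _).trans_lt hu
  refine ⟨P, hPs.mono hsub, fun u hu => ?_⟩
  have hPu := hP u (hsub u hu)
  refine ⟨hPu.1.resolve_right fun hm => ?_, fun y hy => hPu.2 y (Or.inl hy)⟩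
  have h1 := h.infDist_minus_gt hu
  have h2 := Metric.infDist_le_dist_of_mem (x := u) hm
  have h3 := infDist_eq_dist_of_forall_lt hPu.1 hPu.2
  have h4 := hsub u hu
  linarith

lemma isDefining (hδ₀ : 0 < δ₀) : IsDefining (sgnDist Up) (2 * δ₀) :=
  isDefining_sgnDist (by positivity) h.isOpen_plus h.bounded_plus h.connected_plus.nonempty
    h.smooth_plus h.hasSmoothProjection_plus

/-- As `p` is a point of its well nearest to `q`, the signed distance rises from `-L` to `0`
linearly on the segment from `q` to `p`. So the unit gradient at `p` has inner product `L = ‖p - q‖`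
with `p - q`, the case of equality in Cauchy–Schwarz. -/
lemma eq_sub_smul_gradient_of_dist_eq (hδ₀ : 0 < δ₀) {p q : E n} (hp : p ∈ frontier Up)
    (hq : q ∈ frontier Um) (hpq : dist p q = wellDist Up Um) :
    q = p - wellDist Up Um • gradient (sgnDist Up) p := by
  set L := wellDist Up Um with hL
  have hD := h.isDefining hδ₀
  have hp0 : sgnDist Up p = 0 := (sgnDist_eq_zero_iff h.connected_plus.nonempty).2 hp
  have hpD : |sgnDist Up p| < 2 * δ₀ := by rw [hp0, abs_zero]; positivity
  have hqi : Metric.infDist q (frontier Up) = dist q p := by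
    refine le_antisymm (Metric.infDist_le_dist_of_mem hp) ?_
    refine (Metric.le_infDist h.connected_plus.nonempty).2 fun y hy => ?_
    rw [dist_comm q p, hpq, dist_comm]
    exact wellDist_le hy hq
  have hDq : sgnDist Up q = -L := by
    rw [sgnDist, if_neg (h.notMem_of_mem_frontier hq), hqi, dist_comm, hpq]
  have hdiff : HasFDerivAt (sgnDist Up) (fderiv ℝ (sgnDist Up) p) p :=
    ((hD.contDiffAt hpD).differentiableAt (by simp)).hasFDerivAt
  have hline : HasDerivAt (fun s : ℝ => q + s • (p - q)) (p - q) 1 := by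
    have := ((hasDerivAt_id (1 : ℝ)).smul_const (p - q)).const_add q
    rwa [one_smul] at this
  have h1 : HasDerivWithinAt (fun s : ℝ => sgnDist Up (q + s • (p - q)))
      (fderiv ℝ (sgnDist Up) p (p - q)) (Icc 0 1) 1 := by
    refine HasDerivAt.hasDerivWithinAt ?_
    have hdiff' : HasFDerivAt (sgnDist Up) (fderiv ℝ (sgnDist Up) p)
        ((fun s : ℝ => q + s • (p - q)) 1) := by simpa using hdiff
    exact hdiff'.comp_hasDerivAt (f := fun s : ℝ => q + s • (p - q)) 1 hline
  have h2 : HasDerivWithinAt (fun s : ℝ => sgnDist Up (q + s • (p - q))) L (Icc 0 1) 1 := by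
    have h3 : HasDerivAt (fun s : ℝ => (1 - s) * -L) L 1 := by
      have := ((hasDerivAt_id (1 : ℝ)).const_sub 1).mul_const (-L)
      simpa using this
    refine h3.hasDerivWithinAt.congr (fun s hs => ?_) ?_
    · rw [sgnDist_add_smul_sub hp hqi hs, hDq]
    · simp [hp0]
  have h4 : fderiv ℝ (sgnDist Up) p (p - q) = L :=
    (uniqueDiffOn_Icc_zero_one 1 (right_mem_Icc.2 zero_le_one)).eq_deriv _ h1 h2
  have h5 : inner ℝ (gradient (sgnDist Up) p) (p - q) = L := by
    rw [← h4]
    simp [gradient]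
  have h6 : ‖gradient (sgnDist Up) p‖ = 1 := by
    rw [← hD.norm_fderiv p hpD]
    simp [gradient]
  have h7 : ‖p - q‖ = L := by rw [← dist_eq_norm, hpq]
  have h8 := inner_eq_norm_mul_iff_real.1
    (show inner ℝ (gradient (sgnDist Up) p) (p - q) = ‖gradient (sgnDist Up) p‖ * ‖p - q‖ by
      rw [h5, h6, h7, one_mul])
  rw [h6, h7, one_smul] at h8
  rw [h8]
  abel

end IsWells

/-- The normal field `ν` of the well `frontier U` and a weight `μ` that vanishes at the points of
the well which are closest to the other well `frontier V`; along the normals at the other points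
with `μ ≠ 1` one stays away from both wells. -/
structure WellFrame (U V : Set (E n)) (δ₀ : ℝ) (ν : E n → E n) (μ : E n → ℝ) : Prop where
  contDiff_normal : ContDiff ℝ 1 ν
  hasCompactSupport : HasCompactSupport ν
  contDiff_weight : ContDiff ℝ 1 μ
  weight_mem : ∀ p, μ p ∈ Icc (0 : ℝ) 1
  norm_normal : ∀ p ∈ frontier U, ‖ν p‖ = 1
  inner_fderiv : ∀ p ∈ frontier U, ∀ v, inner ℝ (ν p) (fderiv ℝ ν p v) = 0
  sgnDist_add : ∀ p ∈ frontier U, ∀ τ ∈ Ico 0 (2 * δ₀), sgnDist U (p + τ • ν p) = -τ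
  eq_add : ∀ p ∈ frontier U, ∀ q ∈ frontier V, dist p q = wellDist U V →
    q = p + wellDist U V • ν p ∧ μ p = 0
  far : ∀ p ∈ frontier U, μ p ≠ 1 → ∀ τ ∈ Icc (2 * δ₀) (wellDist U V / 2),
    δ₀ ≤ Metric.infDist (p + τ • ν p) (frontier U ∪ frontier V)
  exists_defining : ∃ Z : E n → ℝ, ContDiff ℝ 1 Z ∧ (∃ M, ∀ y, ‖fderiv ℝ Z y‖ ≤ M) ∧
    (∀ p ∈ frontier U, Z p = 0) ∧ ∀ p ∈ frontier U, ∀ v, fderiv ℝ Z p v = -inner ℝ (ν p) v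

/-- The normal is `-∇D`, cut off away from the well. The weight is a smooth Urysohn function that
vanishes on the set `M₀` of points nearest to the other well and equals one outside a small
neighbourhood of it. Along normals from `M₀` minimality keeps a distance `2 δ₀` from both wells, and
nearby normals lose at most `δ₀` of it. -/
lemma IsWells.exists_wellFrame (h : IsWells Up Um δ₀) (hδ₀ : 0 < δ₀) :
    ∃ ν μ, WellFrame Up Um δ₀ ν μ := by
  set L := wellDist Up Um with hL
  set D := sgnDist Up with hDdef
  have hD := h.isDefining hδ₀
  have hL4 := h.four_mul_le_wellDist
  have hne := h.connected_plus.nonempty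
  have hcp := isCompact_frontier_of_isBounded h.bounded_plus
  have hcm := isCompact_frontier_of_isBounded h.bounded_minus
  obtain ⟨χ, hχ, hχ1, hχ0, -⟩ := exists_cutoff (a := δ₀ / 2) (b := δ₀) (by positivity)
    (by linarith)
  have hχ0' : ∀ t, δ₀ < |t| → χ t = 0 := fun t ht => hχ0 t ht.le
  set ν : E n → E n := fun x => χ (D x) • -gradient D x with hν
  have hgr : ContDiffOn ℝ 1 (gradient D) {x | |D x| < 2 * δ₀} :=
    (InnerProductSpace.toDual ℝ (E n)).symm.contDiff.comp_contDiffOn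
      (hD.smooth.fderiv_of_isOpen (hD.isOpen_slab _) (m := 1) (by norm_cast))
  have hνC : ContDiff ℝ 1 ν := hD.contDiff_comp_smul (by simp) (hχ.of_le (by simp))
    (by linarith : δ₀ < 2 * δ₀) hχ0' hgr.neg
  have hνc : HasCompactSupport ν := hD.hasCompactSupport_comp_smul hχ0' _
  have hD0 : ∀ p ∈ frontier Up, D p = 0 := fun p hp => (sgnDist_eq_zero_iff hne).2 hp
  have hnear : ∀ p ∈ frontier Up, ∀ᶠ y in 𝓝 p, |D y| < δ₀ / 2 := fun p hp =>
    hD.continuous.abs.continuousAt.eventually_lt_const (by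
      change |D p| < _
      rw [hD0 p hp, abs_zero]
      positivity)
  have hνnear : ∀ p ∈ frontier Up, ∀ᶠ y in 𝓝 p, ν y = -gradient D y ∧ ‖ν y‖ = 1 := by
    intro p hp
    filter_upwards [hnear p hp] with y hy
    have e : ν y = -gradient D y := by simp [hν, hχ1 _ hy.le]
    refine ⟨e, ?_⟩
    have h1 : ‖fderiv ℝ D y‖ = 1 := hD.norm_fderiv y (by linarith : |D y| < 2 * δ₀)
    rw [e, norm_neg, ← h1]
    simp [gradient]
  have hνp : ∀ p ∈ frontier Up, ν p = -gradient D p := fun p hp => (hνnear p hp).self_of_nhds.1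
  obtain ⟨K₀, hK₀⟩ := (hνc.fderiv ℝ).exists_bound_of_continuous (hνC.continuous_fderiv (by simp))
  have hK₀0 : 0 ≤ K₀ := (norm_nonneg _).trans (hK₀ 0)
  have hνL : ∀ x y, ‖ν x - ν y‖ ≤ K₀ * ‖x - y‖ := fun x y =>
    Convex.norm_image_sub_le_of_norm_fderiv_le (s := univ)
      (fun z _ => (hνC.differentiable (by simp)) z) (fun z _ => hK₀ z) convex_univ (mem_univ y)
      (mem_univ x)
  have heq : ∀ p ∈ frontier Up, ∀ q ∈ frontier Um, dist p q = L → q = p + L • ν p := by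
    intro p hp q hq hpq
    rw [hνp p hp, smul_neg, ← sub_eq_add_neg]
    exact h.eq_sub_smul_gradient_of_dist_eq hδ₀ hp hq hpq
  set M₀ : Set (E n) := frontier Up ∩ {p | Metric.infDist p (frontier Um) = L} with hM₀
  have hM₀c : IsClosed M₀ := isClosed_frontier.inter
    (isClosed_eq (Metric.continuous_infDist_pt _) continuous_const)
  have hM₀mem : ∀ p ∈ frontier Up, ∀ q ∈ frontier Um, dist p q = L → p ∈ M₀ := by
    intro p hp q hq hpq
    refine ⟨hp, le_antisymm ?_ ?_⟩
    · rw [← hpq]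
      exact Metric.infDist_le_dist_of_mem hq
    · exact (Metric.le_infDist ⟨q, hq⟩).2 fun y hy => wellDist_le hp hy
  have hM₀ne : M₀.Nonempty := by
    obtain ⟨p, hp, q, hq, hpq⟩ := h.exists_dist_eq_wellDist
    exact ⟨p, hM₀mem p hp q hq hpq⟩
  -- A well point closer than this would shorten the distance between the wells, by the triangle
  -- inequality through `p` or `q`.
  have hM₀far : ∀ p ∈ M₀, ∀ τ ∈ Icc (2 * δ₀) (L / 2),
      2 * δ₀ ≤ Metric.infDist (p + τ • ν p) (frontier Up ∪ frontier Um) := by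
    rintro p ⟨hp, hpL⟩ τ ⟨hτ, hτL⟩
    obtain ⟨q, hq, hpq⟩ := hcm.exists_infDist_eq_dist h.connected_minus.nonempty p
    have hpL' : dist p q = L := by rw [← hpq]; exact hpL
    have hq' := heq p hp q hq hpL'
    have hν1 := (hνnear p hp).self_of_nhds.2
    have hxp : dist p (p + τ • ν p) = τ := by
      rw [dist_self_add_right, norm_smul, hν1, mul_one, Real.norm_of_nonneg (by linarith)]
    have hxq : dist (p + τ • ν p) q = L - τ := by
      conv_lhs => rw [hq']
      rw [dist_add_left, dist_eq_norm, ← sub_smul, norm_smul, hν1, mul_one, ← norm_neg,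
        Real.norm_of_nonneg (by linarith)]
      ring
    refine (Metric.le_infDist (hne.mono subset_union_left)).2 ?_
    rintro y (hy | hy)
    · have h1 := wellDist_le hy hq
      have h2 := dist_triangle y (p + τ • ν p) q
      rw [dist_comm y (p + τ • ν p)] at h2
      linarith
    · have h1 := wellDist_le hp hy
      have h2 := dist_triangle p (p + τ • ν p) y
      linarith
  have hLpos : 0 < L := h.wellDist_pos
  -- Moving the foot point by `r` moves the point at parameter at most `L/2` on its normal by at
  -- most `r (1 + L/2 · K₀) = δ₀`.
  set r := δ₀ / (1 + L / 2 * K₀) with hr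
  have hr0 : 0 < r := by positivity
  have hdisj : Disjoint M₀ {x | r ≤ Metric.infDist x M₀} := by
    rw [Set.disjoint_left]
    intro x hx hx'
    have h1 : r ≤ Metric.infDist x M₀ := hx'
    rw [Metric.infDist_zero_of_mem hx] at h1
    linarith
  obtain ⟨μ, hμ0, hμ1, hμI⟩ := exists_contMDiffMap_zero_one_of_isClosed (n := (⊤ : ℕ∞))
    (modelWithCornersSelf ℝ (E n)) hM₀c
    (isClosed_le continuous_const (Metric.continuous_infDist_pt M₀)) hdisj
  refine ⟨ν, μ, hνC, hνc, (μ.contMDiff.contDiff).of_le (by norm_cast), hμI,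
    fun p hp => (hνnear p hp).self_of_nhds.2, fun p hp v => ?_, fun p hp τ hτ => ?_,
    fun p hp q hq hpq => ⟨heq p hp q hq hpq, hμ0 (hM₀mem p hp q hq hpq)⟩,
    fun p hp hμp τ hτ => ?_, ?_⟩
  · have h1 : HasFDerivAt ν (fderiv ℝ ν p) p := ((hνC.differentiable (by simp)) p).hasFDerivAt
    have h2 := h1.norm_sq
    have h3 : HasFDerivAt (fun y => ‖ν y‖ ^ 2) (0 : E n →L[ℝ] ℝ) p := by
      refine (hasFDerivAt_const (1 : ℝ) p).congr_of_eventuallyEq ?_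
      filter_upwards [hνnear p hp] with y hy
      rw [hy.2]
      norm_num
    have h4 := congrArg (fun T : E n →L[ℝ] ℝ => T v) (h2.unique h3)
    simpa using h4
  · rw [hνp p hp, smul_neg, ← sub_eq_add_neg]
    refine sgnDist_sub_smul_gradient (ρ := 2 * δ₀) ?_ ?_ hp hτ
    · have := hD.smooth
      simp only [abs_sgnDist] at this
      exact this
    · intro x hx
      exact hD.norm_fderiv x (by rwa [abs_sgnDist])
  · have h1 : Metric.infDist p M₀ < r := by
      by_contra! hge
      exact hμp (hμ1 hge)
    obtain ⟨p', hp', hpp'⟩ := (Metric.infDist_lt_iff hM₀ne).1 h1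
    have h2 := hM₀far p' hp' τ hτ
    have h3 : dist (p' + τ • ν p') (p + τ • ν p) ≤ r * (1 + L / 2 * K₀) := by
      rw [dist_eq_norm, show p' + τ • ν p' - (p + τ • ν p) = (p' - p) + τ • (ν p' - ν p) by module]
      refine (norm_add_le _ _).trans ?_
      rw [norm_smul, Real.norm_of_nonneg (by linarith [hτ.1])]
      have h4 : ‖p' - p‖ ≤ r := by
        rw [← dist_eq_norm, dist_comm]
        exact hpp'.le
      have h5 : ‖ν p' - ν p‖ ≤ K₀ * r := (hνL p' p).trans (by gcongr)
      have h6 : τ * ‖ν p' - ν p‖ ≤ L / 2 * (K₀ * r) :=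
        mul_le_mul hτ.2 h5 (norm_nonneg _) (by positivity)
      linarith
    have h7 : r * (1 + L / 2 * K₀) = δ₀ := by
      rw [hr]
      field_simp
    have h8 := Metric.infDist_le_infDist_add_dist (s := frontier Up ∪ frontier Um)
      (x := p' + τ • ν p') (y := p + τ • ν p)
    linarith
  -- The function `χ(D) D` agrees with `D` near the well, so its derivative there is `-⟨ν, ·⟩`. Its
  -- compact support bounds the derivative.
  · have hq0 : ∀ t, δ₀ < |t| → χ t * t = 0 := fun t ht => by rw [hχ0' t ht, zero_mul]
    have hZC : ContDiff ℝ 1 fun x => (χ (D x) * D x) • (1 : ℝ) :=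
      hD.contDiff_comp_smul (q := fun t => χ t * t) (by simp)
        ((hχ.of_le (by simp)).mul contDiff_id) (by linarith : δ₀ < 2 * δ₀) hq0 contDiffOn_const
    have hZc : HasCompactSupport fun x => (χ (D x) * D x) • (1 : ℝ) :=
      hD.hasCompactSupport_comp_smul (q := fun t => χ t * t) hq0 _
    refine ⟨_, hZC, (hZc.fderiv ℝ).exists_bound_of_continuous (hZC.continuous_fderiv (by simp)),
      fun p hp => by simp [hD0 p hp], fun p hp v => ?_⟩
    have e : (fun x => (χ (D x) * D x) • (1 : ℝ)) =ᶠ[𝓝 p] D := by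
      filter_upwards [hnear p hp] with y hy
      simp [hχ1 _ hy.le]
    rw [e.fderiv_eq, hνp p hp, inner_neg_left, neg_neg]
    simp [gradient]

end Wells

/-! ### The speed of the profile and the quasi-distance -/

section QuasiDistance

open scoped NNReal

variable {n : ℕ} {Up Um : Set (E n)} {f : ℝ → ℝ} {c₁ c₂ c₃ c₄ δ₀ : ℝ}

/-- The speed `√(2 f(l²))` of the optimal profile. -/
def speed (f : ℝ → ℝ) (l : ℝ) : ℝ := √(2 * f (l ^ 2))

lemma speed_nonneg (f : ℝ → ℝ) (l : ℝ) : 0 ≤ speed f l := Real.sqrt_nonneg _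

lemma speed_neg (f : ℝ → ℝ) (l : ℝ) : speed f (-l) = speed f l := by simp [speed]

namespace IsProfile

variable (hf : IsProfile f c₁ c₂ c₃ c₄ δ₀)

include hf

lemma nonneg {s : ℝ} (hs : 0 ≤ s) : 0 ≤ f s := by
  rcases le_total s (δ₀ ^ 2) with h | h
  · exact (mul_nonneg hf.c₁_pos.le hs).trans (hf.lower s hs h)
  · rw [hf.const s h]
    exact hf.c₃_pos.le

lemma map_zero : f 0 = 0 :=
  le_antisymm (by simpa using hf.upper 0 le_rfl (sq_nonneg _))
    (by simpa using hf.lower 0 le_rfl (sq_nonneg _))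

lemma speed_sq (l : ℝ) : speed f l ^ 2 = 2 * f (l ^ 2) :=
  Real.sq_sqrt (mul_nonneg zero_le_two (hf.nonneg (sq_nonneg l)))

lemma exists_speed_le (hδ₀ : 0 < δ₀) : ∃ a, 0 < a ∧ ∀ l, 0 ≤ l → speed f l ≤ a * l := by
  refine ⟨√(2 * c₂) + √(2 * c₃) / δ₀, ?_, fun l hl => ?_⟩
  · have h1 := Real.sqrt_pos.2 (mul_pos zero_lt_two hf.c₂_pos)
    positivity
  · rcases le_total l δ₀ with h | h
    · have h1 : speed f l ≤ √(2 * c₂) * l := by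
        rw [speed]
        refine Real.sqrt_le_iff.2 ⟨by positivity, ?_⟩
        rw [mul_pow, Real.sq_sqrt (mul_nonneg zero_le_two hf.c₂_pos.le)]
        linarith [hf.upper (l ^ 2) (sq_nonneg l) (pow_le_pow_left₀ hl h 2)]
      have h2 : 0 ≤ √(2 * c₃) / δ₀ * l := by positivity
      linarith
    · have h1 : speed f l = √(2 * c₃) := by
        rw [speed, hf.const _ (pow_le_pow_left₀ hδ₀.le h 2)]
      have h2 : √(2 * c₃) ≤ √(2 * c₃) / δ₀ * l := by
        rw [div_mul_eq_mul_div, le_div_iff₀ hδ₀]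
        gcongr
      have h3 : 0 ≤ √(2 * c₂) * l := by positivity
      linarith

lemma exists_le_speed (hδ₀ : 0 < δ₀) {ℓ : ℝ} (hℓ : 0 < ℓ) :
    ∃ κ, 0 < κ ∧ ∀ l, 0 ≤ l → l ≤ ℓ → κ * l ≤ speed f l := by
  have h1 := Real.sqrt_pos.2 (mul_pos zero_lt_two hf.c₁_pos)
  have h2 := Real.sqrt_pos.2 (mul_pos zero_lt_two hf.c₃_pos)
  refine ⟨min (√(2 * c₁)) (√(2 * c₃) / ℓ), by positivity, fun l hl hlℓ => ?_⟩
  rcases le_total l δ₀ with h | h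
  · refine (mul_le_mul_of_nonneg_right (min_le_left _ _) hl).trans ?_
    rw [speed]
    refine Real.le_sqrt_of_sq_le ?_
    rw [mul_pow, Real.sq_sqrt (mul_nonneg zero_le_two hf.c₁_pos.le)]
    linarith [hf.lower (l ^ 2) (sq_nonneg l) (pow_le_pow_left₀ hl h 2)]
  · refine (mul_le_mul_of_nonneg_right (min_le_right _ _) hl).trans ?_
    rw [speed, hf.const _ (pow_le_pow_left₀ hδ₀.le h 2), div_mul_eq_mul_div, div_le_iff₀ hℓ]
    gcongr

/-- At zero, where `f` is not assumed differentiable, continuity comes from the linear upper bound.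
-/
lemma continuous_speed (hδ₀ : 0 < δ₀) : Continuous (speed f) := by
  rw [continuous_iff_continuousAt]
  intro l
  by_cases hl : l = 0
  · subst hl
    obtain ⟨a, ha, hal⟩ := hf.exists_speed_le hδ₀
    have h0 : speed f 0 = 0 := by simp [speed, hf.map_zero]
    rw [ContinuousAt, h0]
    have hle : ∀ l, speed f l ≤ a * |l| := fun l => by
      rcases abs_choice l with h | h
      · rw [h]
        exact hal l (by rw [← h]; exact abs_nonneg l)
      · rw [h, ← speed_neg]
        exact hal (-l) (by rw [← h]; exact abs_nonneg l)
    refine squeeze_zero (speed_nonneg f) hle ?_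
    have : Continuous fun l : ℝ => a * |l| := by fun_prop
    simpa using this.tendsto 0
  · have h1 : ContinuousAt f (l ^ 2) :=
      (hf.contDiffOn.continuousOn).continuousAt (Ioi_mem_nhds (by positivity))
    have h2 : ContinuousAt (fun l : ℝ => f (l ^ 2)) l :=
      ContinuousAt.comp (f := fun l : ℝ => l ^ 2) h1 (continuous_pow 2).continuousAt
    exact (h2.const_mul 2).sqrt

lemma exists_speed_bound : ∃ K : ℝ≥0, ∀ l, speed f l ≤ K := by
  refine ⟨⟨√(2 * (c₂ * δ₀ ^ 2 + c₃)), Real.sqrt_nonneg _⟩, fun l => Real.sqrt_le_sqrt ?_⟩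
  have h1 := mul_nonneg hf.c₂_pos.le (sq_nonneg δ₀)
  rcases le_total (l ^ 2) (δ₀ ^ 2) with h | h
  · have h2 := hf.upper _ (sq_nonneg l) h
    have h3 := mul_le_mul_of_nonneg_left h hf.c₂_pos.le
    linarith [hf.c₃_pos]
  · rw [hf.const _ h]
    linarith

lemma exists_primitive_lipschitz (hδ₀ : 0 < δ₀) : ∃ K : ℝ≥0, ∀ a,
    LipschitzWith K fun y => ∫ l in a..y, speed f l := by
  obtain ⟨K, hK⟩ := hf.exists_speed_bound
  have hc := hf.continuous_speed hδ₀
  refine ⟨K, fun a => LipschitzWith.of_dist_le_mul fun x y => ?_⟩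
  rw [Real.dist_eq, intervalIntegral.integral_interval_sub_left (hc.intervalIntegrable _ _)
    (hc.intervalIntegrable _ _), Real.dist_eq, ← Real.norm_eq_abs]
  refine intervalIntegral.norm_integral_le_of_norm_le_const fun l _ => ?_
  rw [Real.norm_of_nonneg (speed_nonneg f l)]
  exact hK l

end IsProfile

lemma quasiDist_of_le {u : E n} (hu : Metric.infDist u (frontier Um) ≤ wellDist Up Um / 2) :
    quasiDist f Up Um u = ∫ l in (0 : ℝ)..(Metric.infDist u (frontier Um)), speed f l := by
  rw [quasiDist, if_pos hu]
  rfl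

lemma quasiDist_of_lt {u : E n} (hu : wellDist Up Um / 2 < Metric.infDist u (frontier Um))
    (hu' : -(wellDist Up Um / 2) ≤ sgnDist Up u) :
    quasiDist f Up Um u = surfaceTension f Up Um +
      ∫ l in (0 : ℝ)..(sgnDist Up u), speed f l := by
  rw [quasiDist, if_neg (not_le.2 hu), if_pos]
  · rfl
  · by_cases h : u ∈ Up
    · exact Or.inl h
    · rw [sgnDist, if_neg h] at hu'
      exact Or.inr (neg_le_neg_iff.1 hu')

lemma integral_speed_neg (f : ℝ → ℝ) (a : ℝ) :
    ∫ l in (0 : ℝ)..(-a), speed f l = -∫ l in (0 : ℝ)..a, speed f l := by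
  have h := intervalIntegral.integral_comp_neg (speed f) (a := 0) (b := a)
  simp only [speed_neg, neg_zero] at h
  rw [h, intervalIntegral.integral_symm]

namespace IsWells

variable (h : IsWells Up Um δ₀)

include h

lemma infDist_minus_of_mem {u : E n} (hu : u ∈ Up) :
    wellDist Up Um < Metric.infDist u (frontier Um) := by
  obtain ⟨q, hq, huq⟩ := (isCompact_frontier_of_isBounded h.bounded_minus).exists_infDist_eq_dist
    h.connected_minus.nonempty u
  obtain ⟨z, hz, hz'⟩ := exists_mem_frontier_dist_add hu (h.notMem_of_mem_frontier hq)
  have h1 := wellDist_le hz hq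
  have h2 : 0 < dist u z := by
    rw [dist_pos]
    rintro rfl
    rw [h.isOpen_plus.frontier_eq] at hz
    exact hz.2 hu
  linarith

/-- The case distinction becomes a sum of two truncated primitives, each contributing at most
`c_F/2` outside `Up`. The distances to the wells add up to at least `wellDist`, so while one term
varies the other is constant. In this form Lipschitz continuity is evident. -/
lemma quasiDist_eq (hf : IsProfile f c₁ c₂ c₃ c₄ δ₀) (hδ₀ : 0 < δ₀) (u : E n) :
    quasiDist f Up Um u =
      (∫ l in (0 : ℝ)..(min (Metric.infDist u (frontier Um)) (wellDist Up Um / 2)), speed f l) +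
      ∫ l in (-(wellDist Up Um / 2))..(max (sgnDist Up u) (-(wellDist Up Um / 2))), speed f l := by
  have hc := hf.continuous_speed hδ₀
  set L := wellDist Up Um with hL
  have hL0 : 0 < L := h.wellDist_pos
  have hsub : ∀ y, ∫ l in (-(L / 2))..y, speed f l =
      (∫ l in (0 : ℝ)..(L / 2), speed f l) + ∫ l in (0 : ℝ)..y, speed f l := fun y => by
    rw [← intervalIntegral.integral_interval_sub_left (a := 0) (hc.intervalIntegrable _ _)
      (hc.intervalIntegrable _ _), integral_speed_neg]
    ring
  have hT : surfaceTension f Up Um = 2 * ∫ l in (0 : ℝ)..(L / 2), speed f l := rfl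
  rcases le_or_gt (Metric.infDist u (frontier Um)) (L / 2) with h1 | h1
  · rw [quasiDist_of_le h1, min_eq_left h1]
    have h2 : u ∉ Up := fun hu => by
      have := h.infDist_minus_of_mem hu
      linarith
    have h3 := h.wellDist_le_infDist_add u
    have h4 : sgnDist Up u ≤ -(L / 2) := by
      rw [sgnDist, if_neg h2]
      linarith
    rw [max_eq_right h4]
    simp
  · rw [min_eq_right h1.le, hsub]
    rcases le_or_gt (-(L / 2)) (sgnDist Up u) with h2 | h2
    · rw [quasiDist_of_lt h1 h2, max_eq_left h2, hT]
      ring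
    · rw [max_eq_right h2.le, integral_speed_neg, quasiDist, if_neg (not_le.2 h1), if_neg, hT]
      · ring
      · rintro (hu | hu)
        · rw [sgnDist, if_pos hu] at h2
          have := Metric.infDist_nonneg (x := u) (s := frontier Up)
          linarith
        · have := abs_sgnDist Up u
          rw [abs_of_neg (by linarith)] at this
          linarith

lemma exists_lipschitz_quasiDist (hf : IsProfile f c₁ c₂ c₃ c₄ δ₀) (hδ₀ : 0 < δ₀) :
    ∃ K : ℝ≥0, LipschitzWith K (quasiDist f Up Um) := by
  obtain ⟨K, hK⟩ := hf.exists_primitive_lipschitz hδ₀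
  refine ⟨K * 1 + K * 1, ?_⟩
  rw [funext (h.quasiDist_eq hf hδ₀)]
  exact ((hK 0).comp ((Metric.lipschitz_infDist_pt (frontier Um)).min_const _)).add
    ((hK _).comp ((sgnDist_lipschitz Up).max_const _))

lemma quasiDist_plus {p : E n} (hp : p ∈ frontier Up) :
    quasiDist f Up Um p = surfaceTension f Up Um := by
  have h0 : sgnDist Up p = 0 := (sgnDist_eq_zero_iff h.connected_plus.nonempty).2 hp
  have h1 : Metric.infDist p (frontier Up) = 0 := Metric.infDist_zero_of_mem hp
  have h2 := h.wellDist_le_infDist_add p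
  have h3 := h.wellDist_pos
  rw [quasiDist_of_lt (by linarith) (by linarith), h0]
  simp

lemma quasiDist_minus {q : E n} (hq : q ∈ frontier Um) : quasiDist f Up Um q = 0 := by
  have h1 : Metric.infDist q (frontier Um) = 0 := Metric.infDist_zero_of_mem hq
  have h3 := h.wellDist_pos
  rw [quasiDist_of_le (by linarith), h1]
  simp

end IsWells

end QuasiDistance

/-! ### Shortening large displacements -/

section Shift

/-- The amount by which a displacement is shortened so that it stays below `2 δ₀`. -/
lemma exists_shift {δ₀ : ℝ} (hδ₀ : 0 < δ₀) : ∃ c γ : ℝ → ℝ, ContDiff ℝ 1 c ∧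
    (∀ s, HasDerivAt c (γ s) s) ∧ (∀ s, γ s ∈ Icc (0 : ℝ) 1) ∧ (∀ s, s ≤ δ₀ → c s = 0) ∧
    (∀ s, 0 ≤ s → 0 ≤ c s ∧ c s ≤ s * γ s) ∧ ∀ s, δ₀ ≤ s → s - c s ∈ Ico δ₀ (2 * δ₀) := by
  -- `γ` rises from `0` at `δ₀` to `1` at `3δ₀/2`, from where `s - c(s)` stays fixed at a value at
  -- most `3δ₀/2`. As `γ` is nondecreasing, its primitive satisfies `c(s) ≤ s γ(s)`.
  set γ : ℝ → ℝ := fun t => max 0 (min ((t - δ₀) / δ₀ * 2) 1) with hγ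
  have hγc : Continuous γ := by fun_prop
  have hγI : ∀ s, γ s ∈ Icc (0 : ℝ) 1 := fun s =>
    ⟨le_max_left _ _, max_le zero_le_one (min_le_right _ _)⟩
  have hγm : Monotone γ := fun s t hst => by
    simp only [hγ]
    gcongr
  have hγ0 : ∀ s, s ≤ δ₀ → γ s = 0 := fun s hs => by
    have : (s - δ₀) / δ₀ * 2 ≤ 0 :=
      mul_nonpos_of_nonpos_of_nonneg (div_nonpos_of_nonpos_of_nonneg (by linarith) hδ₀.le) (by norm_num)
    simp [hγ, (min_le_left _ _).trans this]
  have hγ1 : ∀ s, 3 / 2 * δ₀ ≤ s → γ s = 1 := fun s hs => by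
    have : 1 ≤ (s - δ₀) / δ₀ * 2 := by
      rw [div_mul_eq_mul_div, le_div_iff₀ hδ₀]
      linarith
    simp [hγ, min_eq_right this]
  set c : ℝ → ℝ := fun s => ∫ t in (0 : ℝ)..s, γ t with hc
  have hcd : ∀ s, HasDerivAt c (γ s) s := fun s =>
    intervalIntegral.integral_hasDerivAt_right (hγc.intervalIntegrable _ _)
      (hγc.stronglyMeasurableAtFilter _ _) hγc.continuousAt
  have hcC : ContDiff ℝ 1 c := by
    rw [contDiff_one_iff_deriv]
    refine ⟨fun s => (hcd s).differentiableAt, ?_⟩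
    rwa [show deriv c = γ from funext fun s => (hcd s).deriv]
  have hc0 : ∀ s, s ≤ δ₀ → c s = 0 := fun s hs => by
    rw [hc]
    beta_reduce
    rw [intervalIntegral.integral_congr (g := fun _ => (0 : ℝ)), intervalIntegral.integral_zero]
    intro t ht
    refine hγ0 t ?_
    rcases le_total 0 s with h | h
    · rw [uIcc_of_le h] at ht
      exact ht.2.trans hs
    · rw [uIcc_of_ge h] at ht
      exact ht.2.trans hδ₀.le
  have hb : Monotone fun s => s - c s := by
    refine monotone_of_deriv_nonneg
      (fun s => ((hasDerivAt_id s).sub (hcd s)).differentiableAt) fun s => ?_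
    have e : deriv (fun s => s - c s) s = 1 - γ s := ((hasDerivAt_id s).sub (hcd s)).deriv
    rw [e]
    linarith [(hγI s).2]
  refine ⟨c, γ, hcC, hcd, hγI, hc0, fun s hs => ⟨?_, ?_⟩, fun s hs => ⟨?_, ?_⟩⟩
  · exact intervalIntegral.integral_nonneg hs fun t _ => (hγI t).1
  · have := intervalIntegral.integral_mono_on hs (hγc.intervalIntegrable _ _)
      (continuous_const.intervalIntegrable _ _) (μ := volume) (g := fun _ => γ s)
      fun t ht => hγm ht.2
    simpa [hc] using this
  · have := hb hs
    simpa [hc0 δ₀ le_rfl] using this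
  · have key : ∀ s, 3 / 2 * δ₀ ≤ s → s - c s = 3 / 2 * δ₀ - c (3 / 2 * δ₀) := by
      intro s hs
      have h1 : c s - c (3 / 2 * δ₀) = ∫ t in (3 / 2 * δ₀)..s, γ t :=
        intervalIntegral.integral_interval_sub_left (hγc.intervalIntegrable _ _)
          (hγc.intervalIntegrable _ _)
      rw [intervalIntegral.integral_congr (g := fun _ => (1 : ℝ)),
        intervalIntegral.integral_const, smul_eq_mul, mul_one] at h1
      · linarith
      · intro t ht
        rw [uIcc_of_le hs] at ht
        exact hγ1 t ht.1
    have hnn : 0 ≤ c (3 / 2 * δ₀) :=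
      intervalIntegral.integral_nonneg (by positivity) fun t _ => (hγI t).1
    have h2 := hb (le_max_left s (3 / 2 * δ₀))
    have h3 := key (max s (3 / 2 * δ₀)) (le_max_right _ _)
    simp only at h2
    linarith

end Shift

/-! ### Displacement along the normals of a well -/

section SideMap

variable {d n : ℕ}

/-- A point `p` of a well is displaced by `A x - μ(p)² c(A x)` along the normal. -/
def sideMap (A : E d → ℝ) (c : ℝ → ℝ) (ν : E n → E n) (μ : E n → ℝ) (z : E d × E n) : E n :=
  z.2 + (A z.1 - μ z.2 ^ 2 * c (A z.1)) • ν z.2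

lemma hasCompactSupport_smul_prod {X Y F : Type*} [TopologicalSpace X] [TopologicalSpace Y]
    [R1Space X] [R1Space Y] [NormedAddCommGroup F] [NormedSpace ℝ F] {a : X → ℝ} {b : Y → F}
    (ha : HasCompactSupport a) (hb : HasCompactSupport b) :
    HasCompactSupport fun z : X × Y => a z.1 • b z.2 := by
  refine HasCompactSupport.intro (K := tsupport a ×ˢ tsupport b)
    (IsCompact.prod ha hb) fun z hz => ?_
  by_cases h1 : z.1 ∈ tsupport a
  · have h2 : z.2 ∉ tsupport b := fun h2 => hz ⟨h1, h2⟩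
    rw [image_eq_zero_of_notMem_tsupport h2, smul_zero]
  · rw [image_eq_zero_of_notMem_tsupport h1, zero_smul]

variable {A : E d → ℝ} {c γ : ℝ → ℝ} {ν : E n → E n} {μ : E n → ℝ}

lemma contDiff_sideMap (hA : ContDiff ℝ 1 A) (hc : ContDiff ℝ 1 c) (hν : ContDiff ℝ 1 ν)
    (hμ : ContDiff ℝ 1 μ) : ContDiff ℝ 1 (sideMap A c ν μ) :=
  contDiff_snd.add (((hA.comp contDiff_fst).sub (((hμ.comp contDiff_snd).pow 2).mul
    ((hc.comp hA).comp contDiff_fst))).smul (hν.comp contDiff_snd))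

/-- The map differs from the projection onto the second factor by a `C¹` map with compact support.
-/
lemma exists_norm_fderiv_sideMap_le (hA : ContDiff ℝ 1 A) (hAc : HasCompactSupport A)
    (hc : ContDiff ℝ 1 c) (hc0 : c 0 = 0) (hν : ContDiff ℝ 1 ν) (hνc : HasCompactSupport ν)
    (hμ : ContDiff ℝ 1 μ) : ∃ M, ∀ z, ‖fderiv ℝ (sideMap A c ν μ) z‖ ≤ M := by
  have h1 : HasCompactSupport fun z : E d × E n => A z.1 • ν z.2 :=
    hasCompactSupport_smul_prod hAc hνc
  have h2 : HasCompactSupport fun z : E d × E n => (c ∘ A) z.1 • ((fun p => μ p ^ 2) • ν) z.2 :=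
    hasCompactSupport_smul_prod (hAc.comp_left hc0) hνc.smul_left
  have hW : HasCompactSupport ((fun z : E d × E n => A z.1 • ν z.2) -
      fun z : E d × E n => (c ∘ A) z.1 • ((fun p => μ p ^ 2) • ν) z.2) := h1.sub h2
  have hWC : ContDiff ℝ 1 ((fun z : E d × E n => A z.1 • ν z.2) -
      fun z : E d × E n => (c ∘ A) z.1 • ((fun p => μ p ^ 2) • ν) z.2) :=
    ((hA.comp contDiff_fst).smul (hν.comp contDiff_snd)).sub
      (((hc.comp hA).comp contDiff_fst).smul (((hμ.pow 2).smul hν).comp contDiff_snd))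
  obtain ⟨M, hM⟩ := (hW.fderiv ℝ).exists_bound_of_continuous (hWC.continuous_fderiv (by simp))
  refine ⟨1 + M, fun z => ?_⟩
  have e : sideMap A c ν μ = fun z => z.2 + ((fun z : E d × E n => A z.1 • ν z.2) -
      fun z : E d × E n => (c ∘ A) z.1 • ((fun p => μ p ^ 2) • ν) z.2) z := by
    funext z
    simp only [sideMap, Pi.sub_apply, Function.comp, Pi.smul_apply']
    module
  rw [e, fderiv_fun_add differentiableAt_snd ((hWC.differentiable (by simp)) z), fderiv_snd]
  refine (norm_add_le _ _).trans (add_le_add (ContinuousLinearMap.norm_snd_le _ _ _) (hM z))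

lemma fderiv_sideMap_apply (hA : ContDiff ℝ 1 A) (hc : ∀ s, HasDerivAt c (γ s) s)
    (hν : ContDiff ℝ 1 ν) (hμ : ContDiff ℝ 1 μ) (x : E d) (p : E n) (e : E d) (v : E n) :
    fderiv ℝ (sideMap A c ν μ) (x, p) (e, v) =
      (v + (A x - μ p ^ 2 * c (A x)) • fderiv ℝ ν p v) +
      ((1 - μ p ^ 2 * γ (A x)) * fderiv ℝ A x e - 2 * μ p * fderiv ℝ μ p v * c (A x)) • ν p := by
  have hfst : HasFDerivAt (fun z : E d × E n => z.1) (ContinuousLinearMap.fst ℝ (E d) (E n)) (x, p) :=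
    hasFDerivAt_fst
  have hsnd : HasFDerivAt (fun z : E d × E n => z.2) (ContinuousLinearMap.snd ℝ (E d) (E n)) (x, p) :=
    hasFDerivAt_snd
  have h1 : HasFDerivAt (fun z : E d × E n => A z.1)
      ((fderiv ℝ A x).comp (ContinuousLinearMap.fst ℝ (E d) (E n))) (x, p) :=
    HasFDerivAt.comp (x, p) (((hA.differentiable (by simp)) x).hasFDerivAt) hfst
  have h2 : HasFDerivAt (fun z : E d × E n => ν z.2)
      ((fderiv ℝ ν p).comp (ContinuousLinearMap.snd ℝ (E d) (E n))) (x, p) :=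
    HasFDerivAt.comp (x, p) (((hν.differentiable (by simp)) p).hasFDerivAt) hsnd
  have h3 : HasFDerivAt (fun z : E d × E n => μ z.2)
      ((fderiv ℝ μ p).comp (ContinuousLinearMap.snd ℝ (E d) (E n))) (x, p) :=
    HasFDerivAt.comp (x, p) (((hμ.differentiable (by simp)) p).hasFDerivAt) hsnd
  have h4 : HasFDerivAt (fun z : E d × E n => c (A z.1))
      (γ (A x) • (fderiv ℝ A x).comp (ContinuousLinearMap.fst ℝ (E d) (E n))) (x, p) :=
    HasDerivAt.comp_hasFDerivAt (x, p) (hc (A x)) h1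
  have h5 := hsnd.add ((h1.sub ((h3.pow 2).mul h4)).smul h2)
  have h6 : fderiv ℝ (sideMap A c ν μ) (x, p) = _ := h5.fderiv
  rw [h6]
  simp
  module

/-- Convexity of the square with weights `1 - t` and `t`: `((1 - t) a - e)² ≤ (1 - t) a² + e²/t`.
The coefficient of `a²` does not exceed one, which Young's inequality would not give. -/
lemma sq_sub_le {t a e y : ℝ} (ht : t ∈ Icc (0 : ℝ) 1) (he : e ^ 2 ≤ t * y) (hy : 0 ≤ y) :
    ((1 - t) * a - e) ^ 2 ≤ a ^ 2 + y := by
  rcases ht.1.eq_or_lt with h0 | h0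
  · have : e = 0 := by
      rw [← h0, zero_mul] at he
      exact pow_eq_zero_iff two_ne_zero |>.1 (le_antisymm he (sq_nonneg e))
    rw [this, ← h0]
    linarith
  · have h1 : ((1 - t) * a - e) ^ 2 * t ≤ ((1 - t) * a ^ 2 + y) * t := by
      have h2 : 0 ≤ (1 - t) * (t * a + e) ^ 2 := mul_nonneg (by linarith [ht.2]) (sq_nonneg _)
      nlinarith [h2, he]
    have h3 := le_of_mul_le_mul_right h1 h0
    have h4 : 0 ≤ t * a ^ 2 := by positivity
    linarith

namespace WellFrame

variable {U V : Set (E n)} {δ₀ : ℝ} (w : WellFrame U V δ₀ ν μ)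

include w

/-- The normal displacement costs nothing but the energy of the one-dimensional profile. -/
lemma exists_norm_fderiv_sideMap_sq_le (hU : Bornology.IsBounded U) {ℓ : ℝ} (hℓ : 0 ≤ ℓ) :
    ∃ C : ℝ, 0 ≤ C ∧ ∀ {A : E d → ℝ} {c γ : ℝ → ℝ}, ContDiff ℝ 1 A → (∀ s, HasDerivAt c (γ s) s) →
      (∀ s, γ s ∈ Icc (0 : ℝ) 1) → (∀ s, 0 ≤ s → 0 ≤ c s ∧ c s ≤ s * γ s) →
      ∀ x, A x ∈ Icc 0 ℓ → ∀ p ∈ frontier U, ∀ e v, inner ℝ (ν p) v = 0 →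
        ‖fderiv ℝ (sideMap A c ν μ) (x, p) (e, v)‖ ^ 2 ≤ fderiv ℝ A x e ^ 2 + C * ‖v‖ ^ 2 := by
  have hcp := isCompact_frontier_of_isBounded hU
  obtain ⟨K1, hK1⟩ := hcp.exists_bound_of_continuousOn
    (w.contDiff_normal.continuous_fderiv (by simp)).continuousOn
  obtain ⟨K2, hK2⟩ := hcp.exists_bound_of_continuousOn
    (w.contDiff_weight.continuous_fderiv (by simp)).continuousOn
  -- The first summand bounds the tangential part, with `K1` bounding the derivative of the normal.
  -- The second comes from differentiating the weight.
  refine ⟨(1 + ℓ * K1) ^ 2 + 4 * K2 ^ 2 * ℓ ^ 2, by positivity, ?_⟩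
  intro A c γ hA hc hγ hcs x hx p hp e v hv
  have hK1' : 0 ≤ K1 := (norm_nonneg _).trans (hK1 p hp)
  have hK2' : 0 ≤ K2 := (norm_nonneg _).trans (hK2 p hp)
  rw [fderiv_sideMap_apply hA hc w.contDiff_normal w.contDiff_weight]
  obtain ⟨hc0, hc1⟩ := hcs _ hx.1
  have hμ := w.weight_mem p
  have hμ2 : μ p ^ 2 ∈ Icc (0 : ℝ) 1 := ⟨sq_nonneg _, pow_le_one₀ hμ.1 hμ.2⟩
  have hγA := hγ (A x)
  set a := fderiv ℝ A x e
  set m := fderiv ℝ μ p v with hm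
  set y := v + (A x - μ p ^ 2 * c (A x)) • fderiv ℝ ν p v with hy
  set k := (1 - μ p ^ 2 * γ (A x)) * a - 2 * μ p * m * c (A x) with hk
  -- Both `v` and the derivative of `ν` are orthogonal to `ν p`, so the squares of the tangential
  -- and the normal part add without a mixed term.
  have horth : inner ℝ y (k • ν p) = 0 := by
    rw [inner_smul_right, hy, inner_add_left, inner_smul_left, real_inner_comm, hv,
      real_inner_comm, w.inner_fderiv p hp v]
    simp
  have hnorm : ‖y + k • ν p‖ ^ 2 = ‖y‖ ^ 2 + k ^ 2 := by
    rw [norm_add_sq_real, horth, norm_smul, w.norm_normal p hp, mul_one, Real.norm_eq_abs, sq_abs]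
    ring
  have hcA : c (A x) ≤ A x := hc1.trans (mul_le_of_le_one_right hx.1 hγA.2)
  have hb : |A x - μ p ^ 2 * c (A x)| ≤ ℓ := by
    have h1 : 0 ≤ μ p ^ 2 * c (A x) := mul_nonneg hμ2.1 hc0
    have h2 : μ p ^ 2 * c (A x) ≤ c (A x) := mul_le_of_le_one_left hc0 hμ2.2
    rw [abs_of_nonneg (by linarith)]
    linarith [hx.2]
  have hyn : ‖y‖ ≤ (1 + ℓ * K1) * ‖v‖ := by
    refine (norm_add_le _ _).trans ?_
    rw [norm_smul, Real.norm_eq_abs]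
    have h1 : ‖fderiv ℝ ν p v‖ ≤ K1 * ‖v‖ := (fderiv ℝ ν p).le_of_opNorm_le (hK1 p hp) v
    have h2 := mul_le_mul hb h1 (norm_nonneg _) hℓ
    linarith
  have hmv : |m| ≤ K2 * ‖v‖ := (fderiv ℝ μ p).le_of_opNorm_le (hK2 p hp) v
  have hm2 : m ^ 2 ≤ (K2 * ‖v‖) ^ 2 := sq_le_sq' (by linarith [neg_abs_le m])
    ((le_abs_self m).trans hmv)
  -- Here `t = μ² γ`. Because `μ` enters squared, its derivative leaves a factor `μ`, and with `c ≤
  -- s γ` the square of the extra term is at most `t` times a quantity of order `‖v‖²`.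
  have hk2 : k ^ 2 ≤ a ^ 2 + 4 * m ^ 2 * A x ^ 2 * γ (A x) := by
    refine sq_sub_le ⟨mul_nonneg hμ2.1 hγA.1, mul_le_one₀ hμ2.2 hγA.1 hγA.2⟩ ?_ ?_
    · have h1 : c (A x) ^ 2 ≤ (A x * γ (A x)) ^ 2 := pow_le_pow_left₀ hc0 hc1 2
      have h2 : 0 ≤ 4 * μ p ^ 2 * m ^ 2 := by positivity
      calc (2 * μ p * m * c (A x)) ^ 2 = 4 * μ p ^ 2 * m ^ 2 * c (A x) ^ 2 := by ring
        _ ≤ 4 * μ p ^ 2 * m ^ 2 * (A x * γ (A x)) ^ 2 := mul_le_mul_of_nonneg_left h1 h2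
        _ = μ p ^ 2 * γ (A x) * (4 * m ^ 2 * A x ^ 2 * γ (A x)) := by ring
    · have := hγA.1
      positivity
  have hlast : 4 * m ^ 2 * A x ^ 2 * γ (A x) ≤ 4 * (K2 * ‖v‖) ^ 2 * ℓ ^ 2 := by
    have h1 : A x ^ 2 ≤ ℓ ^ 2 := pow_le_pow_left₀ hx.1 hx.2 2
    calc 4 * m ^ 2 * A x ^ 2 * γ (A x) ≤ 4 * m ^ 2 * A x ^ 2 * 1 := by
          have := hγA.2
          gcongr
      _ = 4 * m ^ 2 * A x ^ 2 := mul_one _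
      _ ≤ _ := by gcongr
  have hyn2 : ‖y‖ ^ 2 ≤ ((1 + ℓ * K1) * ‖v‖) ^ 2 := pow_le_pow_left₀ (norm_nonneg _) hyn 2
  rw [hnorm]
  nlinarith

variable {x : E d} {p : E n}

lemma norm_sideMap_sub_le (hcs : ∀ s, 0 ≤ s → 0 ≤ c s ∧ c s ≤ s * γ s)
    (hγ : ∀ s, γ s ∈ Icc (0 : ℝ) 1) (hx : 0 ≤ A x) (hp : p ∈ frontier U) :
    ‖sideMap A c ν μ (x, p) - p‖ ≤ A x := by
  obtain ⟨hc0, hc1⟩ := hcs _ hx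
  have hμ := w.weight_mem p
  have hcA : c (A x) ≤ A x := hc1.trans (mul_le_of_le_one_right hx (hγ _).2)
  have h1 : 0 ≤ μ p ^ 2 * c (A x) := mul_nonneg (sq_nonneg _) hc0
  have h2 : μ p ^ 2 * c (A x) ≤ c (A x) := mul_le_of_le_one_left hc0 (pow_le_one₀ hμ.1 hμ.2)
  simp only [sideMap, add_sub_cancel_left, norm_smul, w.norm_normal p hp, mul_one]
  rw [Real.norm_of_nonneg (by linarith)]
  linarith

lemma sgnDist_sideMap (hc : ∀ s, s ≤ δ₀ → c s = 0) (hδ₀ : 0 < δ₀) (hx : A x ∈ Icc 0 δ₀)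
    (hp : p ∈ frontier U) : sgnDist U (sideMap A c ν μ (x, p)) = -A x := by
  simp only [sideMap, hc _ hx.2, mul_zero, sub_zero]
  exact w.sgnDist_add p hp _ ⟨hx.1, by linarith [hx.2]⟩

/-- At a member of a minimal pair the weight vanishes, so the displacement is not shortened, and the
normal points at the other member. -/
lemma sideMap_eq_midpoint (hx : A x = wellDist U V / 2) {q : E n} (hp : p ∈ frontier U)
    (hq : q ∈ frontier V) (hpq : dist p q = wellDist U V) :
    sideMap A c ν μ (x, p) = midpoint ℝ p q := by
  obtain ⟨h1, h2⟩ := w.eq_add p hp q hq hpq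
  rw [sideMap, midpoint_eq_smul_add]
  simp only [h2, hx]
  rw [h1]
  simp only [invOf_eq_inv]
  module

lemma infDist_frontier_add (hW : IsWells U V δ₀) (hp : p ∈ frontier U) {τ : ℝ}
    (hτ : τ ∈ Ico 0 (2 * δ₀)) :
    Metric.infDist (p + τ • ν p) (frontier U ∪ frontier V) = τ := by
  have h1 : Metric.infDist (p + τ • ν p) (frontier U) = τ := by
    rw [← abs_sgnDist, w.sgnDist_add p hp τ hτ, abs_neg, abs_of_nonneg hτ.1]
  have h2 := hW.infDist_minus_gt (u := p + τ • ν p) (by rw [h1]; exact hτ.2)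
  rw [hW.infDist_union, h1, min_eq_left (by linarith [hτ.2])]

/-- Up to `δ₀` the displacement is the distance to the wells. Beyond it the potential only has to be
in its constant range. If the shortened displacement is below `2 δ₀`, it is still the distance and
at least `δ₀`. Otherwise `μ ≠ 1`, and the frame keeps the point away from the wells. -/
lemma potential_sideMap {f : ℝ → ℝ} {c₁ c₂ c₃ c₄ : ℝ} (hf : IsProfile f c₁ c₂ c₃ c₄ δ₀)
    (hW : IsWells U V δ₀) (hδ₀ : 0 < δ₀) (hc : ∀ s, s ≤ δ₀ → c s = 0)
    (hcs : ∀ s, 0 ≤ s → 0 ≤ c s ∧ c s ≤ s * γ s)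
    (hcI : ∀ s, δ₀ ≤ s → s - c s ∈ Ico δ₀ (2 * δ₀))
    (hx : A x ∈ Icc 0 (wellDist U V / 2)) (hp : p ∈ frontier U) :
    potential f U V (sideMap A c ν μ (x, p)) = f (A x ^ 2) := by
  rw [potential]
  rcases le_or_gt (A x) δ₀ with h | h
  · simp only [sideMap, hc _ h, mul_zero, sub_zero]
    rw [w.infDist_frontier_add hW hp ⟨hx.1, by linarith⟩]
  · rw [hf.const (A x ^ 2) (pow_le_pow_left₀ hδ₀.le h.le 2)]
    refine hf.const _ (pow_le_pow_left₀ hδ₀.le ?_ 2)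
    obtain ⟨hc0, hc1⟩ := hcs _ hx.1
    have hμ := w.weight_mem p
    have h1 : 0 ≤ μ p ^ 2 * c (A x) := mul_nonneg (sq_nonneg _) hc0
    have h2 : μ p ^ 2 * c (A x) ≤ c (A x) := mul_le_of_le_one_left hc0 (pow_le_one₀ hμ.1 hμ.2)
    have h3 := hcI _ h.le
    simp only [sideMap]
    rcases lt_or_ge (A x - μ p ^ 2 * c (A x)) (2 * δ₀) with h4 | h4
    · rw [w.infDist_frontier_add hW hp ⟨by linarith [h3.1], h4⟩]
      linarith [h3.1]
    · refine w.far p hp (fun hμ1 => ?_) _ ⟨h4, by linarith [hx.2]⟩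
      rw [hμ1] at h4
      have := h3.2
      norm_num at h4
      linarith

end WellFrame

end SideMap

/-! ### Weak derivatives: constants, compositions, tangentiality -/

section WeakDerivatives

open scoped NNReal ENNReal

variable {d : ℕ}

lemma ae_eq_zero_of_isWeakPartial_const {F : Type*} [NormedAddCommGroup F] [NormedSpace ℝ F]
    [CompleteSpace F] {R : Set (E d)} (hR : IsOpen R) {i : Fin d} {u g : E d → F}
    (hug : IsWeakPartial R i u g) (hg : IntegrableOn g R) {b : F}
    (hu : ∀ᵐ x ∂(volume.restrict R), u x = b) : ∀ᵐ x ∂(volume.restrict R), g x = 0 := by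
  rw [ae_restrict_iff' hR.measurableSet]
  refine hR.ae_eq_zero_of_integral_contDiff_smul_eq_zero hg.locallyIntegrableOn
    fun θ hθ hθc hθR => ?_
  have h1 := hug θ hθ hθc hθR
  have h2 : ∫ x in R, fderiv ℝ θ x (basisVec i) • u x = 0 := by
    rw [integral_congr_ae (g := fun x => fderiv ℝ θ x (basisVec i) • b)
      (by filter_upwards [hu] with x hx; rw [hx]), integral_smul_const]
    rw [setIntegral_eq_integral_of_forall_compl_eq_zero, integral_fderiv_eq_zero
      (hθ.of_le (by simp)) hθc, zero_smul]
    intro x hx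
    have : fderiv ℝ θ x = 0 := by
      by_contra hne
      exact hx (hθR (support_fderiv_subset ℝ hne))
    rw [this]
    rfl
  rw [h2] at h1
  rw [← setIntegral_eq_integral_of_forall_compl_eq_zero (s := R), ← neg_eq_zero, ← h1]
  intro x hx
  rw [image_eq_zero_of_notMem_tsupport fun hx' => hx (hθR hx'), zero_smul]

/-- The trace hypothesis is used for its smooth approximations only; the chain rule passes to the
limit along them. -/
lemma isWeakPartial_comp {R : Set (E d)} (hR : Bornology.IsBounded R) {F₁ F₂ : Type}
    [NormedAddCommGroup F₁] [NormedSpace ℝ F₁] [FiniteDimensional ℝ F₁]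
    [NormedAddCommGroup F₂] [NormedSpace ℝ F₂] [FiniteDimensional ℝ F₂]
    {Φ : E d × F₁ → F₂} (hΦ : ContDiff ℝ 1 Φ) {M : ℝ} (hM : ∀ z, ‖fderiv ℝ Φ z‖ ≤ M)
    {u : E d → F₁} {Du : Fin d → E d → F₁} {S : Set (E d)} {T : E d → F₁}
    (hu : MemLp u 2 (volume.restrict R)) (hDu : ∀ i, MemLp (Du i) 2 (volume.restrict R))
    (hT : IsTrace R S u Du T) (i : Fin d) :
    IsWeakPartial R i (fun x => Φ (x, u x)) (compDeriv Φ u Du i) := by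
  have := isFiniteMeasure_restrict_of_isBounded hR
  obtain ⟨-, w, hw, hwu, hwD, -⟩ := hT
  have hw1 : ∀ k, ContDiff ℝ 1 (w k) := fun k => (hw k).of_le (by simp)
  obtain ⟨φ, -, hφ0, hφ1⟩ := exists_subseq_tendsto_comp hΦ hM hu.aestronglyMeasurable hDu
    hw1 hwu hwD
  intro θ hθ hθc hθR
  have hθ1 : ContDiff ℝ 1 θ := hθ.of_le (by simp)
  have hv : ∀ k, ContDiff ℝ 1 fun x => Φ (x, w (φ k) x) := fun k =>
    hΦ.comp (contDiff_id.prodMk (hw1 _))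
  have t := tendsto_setIntegral_fderiv_smul hR hθ1 hθc hv (memLp_comp hR hΦ hM hu)
    (memLp_compDeriv hΦ hM hu.aestronglyMeasurable hDu i) hφ0 (hφ1 i)
  have hz : ∀ k, ∫ x in R, fderiv ℝ (fun x => θ x • Φ (x, w (φ k) x)) x (basisVec i) = 0 := by
    intro k
    rw [setIntegral_eq_integral_of_forall_compl_eq_zero]
    · exact integral_fderiv_eq_zero (hθ1.smul (hv k)) hθc.smul_right i
    · intro x hx
      have : fderiv ℝ (fun x => θ x • Φ (x, w (φ k) x)) x = 0 := by
        by_contra hne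
        exact hx (hθR (tsupport_smul_subset_left θ _ (support_fderiv_subset ℝ hne)))
      rw [this]
      rfl
  rw [eq_neg_iff_add_eq_zero]
  exact tendsto_nhds_unique t (tendsto_const_nhds.congr fun k => (hz k).symm)

/-- The derivatives of a function with values in a well are tangential to the well. -/
lemma WellFrame.ae_inner_eq_zero {n : ℕ} {U V : Set (E n)} {δ₀ : ℝ} {ν : E n → E n} {μ : E n → ℝ}
    (w : WellFrame U V δ₀ ν μ) {R : Set (E d)} (hRo : IsOpen R) (hR : Bornology.IsBounded R)
    {u : E d → E n} {Du : Fin d → E d → E n} {S : Set (E d)} {T : E d → E n}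
    (hu : MemLp u 2 (volume.restrict R)) (hDu : ∀ i, MemLp (Du i) 2 (volume.restrict R))
    (hT : IsTrace R S u Du T) (hmem : ∀ᵐ x ∂(volume.restrict R), u x ∈ frontier U) (i : Fin d) :
    ∀ᵐ x ∂(volume.restrict R), inner ℝ (ν (u x)) (Du i x) = 0 := by
  have := isFiniteMeasure_restrict_of_isBounded hR
  -- `Z ∘ u` vanishes, hence so do its weak derivatives, which by the chain rule are `-⟨ν(u), ∂ᵢu⟩`.
  obtain ⟨Z, hZ, ⟨M, hM⟩, hZ0, hZ'⟩ := w.exists_defining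
  have hd : ∀ z : E d × E n, fderiv ℝ (fun z : E d × E n => Z z.2) z =
      (fderiv ℝ Z z.2).comp (ContinuousLinearMap.snd ℝ (E d) (E n)) := fun z =>
    (HasFDerivAt.comp z ((hZ.differentiable (by simp)) z.2).hasFDerivAt hasFDerivAt_snd).fderiv
  have hΦ : ContDiff ℝ 1 fun z : E d × E n => Z z.2 := hZ.comp contDiff_snd
  have hM' : ∀ z : E d × E n, ‖fderiv ℝ (fun z : E d × E n => Z z.2) z‖ ≤ M := fun z => by
    rw [hd]
    refine (ContinuousLinearMap.opNorm_comp_le _ _).trans ?_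
    have h1 := ContinuousLinearMap.norm_snd_le ℝ (E d) (E n)
    calc _ ≤ ‖fderiv ℝ Z z.2‖ * 1 := by gcongr
      _ ≤ M := by rw [mul_one]; exact hM _
  have h1 := isWeakPartial_comp hR hΦ hM' hu hDu hT i
  have h2 : MemLp (compDeriv (fun z : E d × E n => Z z.2) u Du i) 2 (volume.restrict R) :=
    memLp_compDeriv hΦ hM' hu.aestronglyMeasurable hDu i
  have h3 := ae_eq_zero_of_isWeakPartial_const hRo h1 (h2.integrable (by norm_num)) (b := 0)
    (by filter_upwards [hmem] with x hx using hZ0 _ hx)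
  filter_upwards [h3, hmem] with x hx hxU
  rw [compDeriv, hd] at hx
  have h4 := hZ' _ hxU (Du i x)
  simp only [ContinuousLinearMap.comp_apply, ContinuousLinearMap.coe_snd'] at hx
  rw [hx] at h4
  linarith

end WeakDerivatives

/-! ### The signed distance to the interface inside the domain -/

section Interface

variable {d : ℕ} {Ω Ωp : Set (E d)} {δ₀ : ℝ}

namespace IsInterface

variable (h : IsInterface Ω Ωp δ₀)

include h

lemma slab_subset : {x | Metric.infDist x (frontier Ωp) < δ₀} ⊆ Ω := by
  intro x hx
  obtain ⟨p, hp, hxp⟩ := (Metric.infDist_lt_iff h.nonempty_interface).1 hx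
  by_contra hxΩ
  obtain ⟨z, hz, hz'⟩ := exists_mem_frontier_dist_add
    (h.closure_plus (frontier_subset_closure hp)) hxΩ
  have h1 := h.far p hp z hz
  have h2 : 0 ≤ dist z x := dist_nonneg
  rw [dist_comm] at hxp
  linarith

lemma isDefining (hδ₀ : 0 < δ₀) : IsDefining (sgnDist Ωp) δ₀ := by
  refine isDefining_sgnDist hδ₀ h.isOpen_plus
    (h.bounded_domain.subset (subset_closure.trans h.closure_plus)) h.nonempty_interface
    h.smooth_interface (h.projection.mono fun x hx => ⟨h.slab_subset hx, ?_⟩)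
  have : Metric.infDist x (frontier Ωp) < δ₀ := hx
  linarith

lemma plus_eq : Ωp = {x | 0 < sgnDist Ωp x} := by
  ext x
  exact (sgnDist_pos_iff h.isOpen_plus h.nonempty_interface).symm

lemma minus_eq : Ω \ closure Ωp = Ω ∩ {x | sgnDist Ωp x < 0} := by
  ext x
  exact and_congr_right fun _ => (sgnDist_neg_iff h.isOpen_plus h.nonempty_interface).symm

lemma frontier_eq : frontier Ωp = {x | sgnDist Ωp x = 0} := by
  ext x
  exact (sgnDist_eq_zero_iff h.nonempty_interface).symm

lemma nonneg_subset : {x | 0 ≤ sgnDist Ωp x} ⊆ Ω := by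
  intro x hx
  refine h.closure_plus ?_
  by_contra hx'
  have h1 := (sgnDist_neg_iff h.isOpen_plus h.nonempty_interface).2 hx'
  exact absurd hx (not_le.2 h1)

/-- In dimension zero all frontiers are empty. The charts need dimension `m + 1`. -/
lemma dim_ne_zero : d ≠ 0 := by
  rintro rfl
  obtain ⟨x, hx⟩ := h.nonempty_interface
  rcases Subsingleton.eq_empty_or_singleton (s := Ωp) (Set.subsingleton_of_subsingleton) with h1 | ⟨y, h1⟩
  · rw [h1] at hx
    simp at hx
  · have : Ωp = univ := by
      rw [h1]
      exact eq_univ_of_forall fun z => Subsingleton.elim z y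
    rw [this] at hx
    simp at hx

end IsInterface

end Interface

/-! ### The profile as a function of the signed distance -/

section Transition

variable {G : ℝ → ℝ} {ℓ δ δ₀ δ₁ K ε : ℝ} {s : ℝ → ℝ}

namespace IsDefining

variable {d : ℕ} {D : E d → ℝ} (h : IsDefining D δ₀)

include h

lemma contDiff_comp_transition (hs : IsTransition G ℓ δ δ₁ K ε s) (hδ₁ : δ₁ < δ₀) :
    ContDiff ℝ 1 (fun x => s (D x)) ∧ HasCompactSupport fun x => s (D x) := by
  have h0 : ∀ t, δ₁ < |t| → s t = 0 := fun t ht => hs.eq_zero_of_abs t ht.le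
  have h1 := h.contDiff_comp_smul (k := 1) (by simp) hs.contDiff hδ₁ h0
    (B := fun _ => (1 : ℝ)) contDiffOn_const
  have h2 := h.hasCompactSupport_comp_smul h0 fun _ => (1 : ℝ)
  simp only [smul_eq_mul, mul_one] at h1 h2
  exact ⟨h1, h2⟩

/-- Where `|D| ≥ δ₀` the function `D` is only Lipschitz, but there `Ψ'(D) = 0`: the increments of
`Ψ` are of smaller order than those of `D`, hence than `‖y - x‖`. -/
lemma hasFDerivAt_comp_of_hasDerivAt {Ψ g : ℝ → ℝ} (hΨ : ∀ t, HasDerivAt Ψ (g t) t)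
    (hg0 : ∀ t, δ ≤ |t| → g t = 0) (hδ : δ < δ₀) (x : E d) :
    HasFDerivAt (fun x => Ψ (D x)) (g (D x) • fderiv ℝ D x) x := by
  rcases lt_or_ge |D x| δ₀ with hx | hx
  · exact (hΨ (D x)).comp_hasFDerivAt x
      ((h.contDiffAt hx).differentiableAt (by simp)).hasFDerivAt
  · have hgx : g (D x) = 0 := hg0 _ (hδ.le.trans hx)
    rw [hgx, zero_smul]
    have h1 := hΨ (D x)
    rw [hgx, hasDerivAt_iff_isLittleO] at h1
    have h2 := h1.comp_tendsto (h.continuous.tendsto x)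
    have h3 : ((fun y => y - D x) ∘ D) =O[𝓝 x] fun y => y - x := by
      refine Asymptotics.IsBigO.of_bound 1 (Eventually.of_forall fun y => ?_)
      simpa using h.lipschitz.norm_sub_le y x
    refine HasFDerivAt.of_isLittleO ((h2.trans_isBigO h3).congr_left fun y => ?_)
    simp

lemma contDiff_comp_of_hasDerivAt {Ψ g : ℝ → ℝ} (hΨ : ∀ t, HasDerivAt Ψ (g t) t)
    (hgc : Continuous g) (hg0 : ∀ t, δ ≤ |t| → g t = 0) (hδ : δ < δ₀) :
    ContDiff ℝ 1 fun x => Ψ (D x) := by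
  have hd := h.hasFDerivAt_comp_of_hasDerivAt hΨ hg0 hδ
  rw [contDiff_one_iff_fderiv]
  refine ⟨fun x => (hd x).differentiableAt, ?_⟩
  rw [show (fderiv ℝ fun x => Ψ (D x)) = fun x => g (D x) • fderiv ℝ D x from
    funext fun x => (hd x).fderiv]
  refine (h.contDiff_comp_smul (k := 0) (B := fderiv ℝ D) (by simp) (contDiff_zero.2 hgc) hδ
    (fun t ht => hg0 t ht.le) ?_).continuous
  exact contDiffOn_zero.2 (h.smooth.continuousOn_fderiv_of_isOpen (h.isOpen_slab _) (by simp))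

lemma sum_fderiv_transition_sq_le (hs : IsTransition G ℓ δ δ₁ K ε s) (hδ : δ < δ₀) {x : E d}
    (hx : 0 < D x) :
    ∑ i, fderiv ℝ (fun x => s (D x)) x (basisVec i) ^ 2 ≤ deriv s (D x) ^ 2 := by
  rw [sum_fderiv_sq]
  rcases lt_or_ge |D x| δ₀ with hx' | hx'
  · have h1 : HasFDerivAt (fun x => s (D x)) (deriv s (D x) • fderiv ℝ D x) x :=
      ((hs.contDiff.differentiable (by simp)) (D x)).hasDerivAt.comp_hasFDerivAt x
        ((h.contDiffAt hx').differentiableAt (by simp)).hasFDerivAt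
    rw [h1.fderiv, norm_smul, h.norm_fderiv x hx', mul_one, Real.norm_eq_abs, sq_abs]
  · have h1 : (fun x => s (D x)) =ᶠ[𝓝 x] fun _ => 0 := by
      rw [abs_of_pos hx] at hx'
      filter_upwards [h.continuous.continuousAt.eventually_const_lt (hδ.trans_le hx')] with y hy
      exact hs.eq_zero _ hy.le
    rw [h1.fderiv_eq]
    simp
    positivity

end IsDefining

/-- The constant is chosen before `ε` and `s`. Multiplied by `ε/2`, the second term on the right is
`O(ε)` after integration. -/
lemma WellFrame.exists_sum_norm_compDeriv_sq_le {n d : ℕ} {U V : Set (E n)} {ν : E n → E n}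
    {μ : E n → ℝ} (w : WellFrame U V δ₀ ν μ) (hU : Bornology.IsBounded U) (hℓ : 0 ≤ ℓ)
    {c γ : ℝ → ℝ} (hc : ∀ s, HasDerivAt c (γ s) s) (hγ : ∀ s, γ s ∈ Icc (0 : ℝ) 1)
    (hcs : ∀ s, 0 ≤ s → 0 ≤ c s ∧ c s ≤ s * γ s) {D : E d → ℝ} (h : IsDefining D δ₀)
    {R : Set (E d)} (hRm : MeasurableSet R) (hR : ∀ x ∈ R, 0 < D x) {u : E d → E n}
    {Du : Fin d → E d → E n}
    (hu : ∀ᵐ x ∂(volume.restrict R), u x ∈ frontier U)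
    (hDu : ∀ i, ∀ᵐ x ∂(volume.restrict R), inner ℝ (ν (u x)) (Du i x) = 0)
    (hδ : δ < δ₀) (hδ₁ : δ₁ < δ₀) :
    ∃ C, 0 ≤ C ∧ ∀ ε s, IsTransition G ℓ δ δ₁ K ε s → ∀ᵐ x ∂(volume.restrict R),
      ∑ i, ‖compDeriv (sideMap (fun x => s (D x)) c ν μ) u Du i x‖ ^ 2 ≤
        deriv s (D x) ^ 2 + C * ∑ i, ‖Du i x‖ ^ 2 := by
  obtain ⟨C, hC0, hC⟩ := w.exists_norm_fderiv_sideMap_sq_le (d := d) hU hℓ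
  refine ⟨C, hC0, fun ε s hs => ?_⟩
  filter_upwards [hu, ae_all_iff.2 hDu, ae_restrict_mem hRm] with x hx hx' hxR
  have hD := hR x hxR
  calc ∑ i, ‖compDeriv (sideMap (fun x => s (D x)) c ν μ) u Du i x‖ ^ 2
      ≤ ∑ i, (fderiv ℝ (fun x => s (D x)) x (basisVec i) ^ 2 + C * ‖Du i x‖ ^ 2) :=
        Finset.sum_le_sum fun i _ => hC (h.contDiff_comp_transition hs hδ₁).1 hc hγ hcs x
          ⟨hs.nonneg _, hs.le _ hD.le⟩ _ hx _ _ (hx' i)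
    _ = ∑ i, fderiv ℝ (fun x => s (D x)) x (basisVec i) ^ 2 + C * ∑ i, ‖Du i x‖ ^ 2 := by
        rw [Finset.sum_add_distrib, Finset.mul_sum]
    _ ≤ _ := add_le_add (h.sum_fderiv_transition_sq_le hs hδ hD) le_rfl

lemma IsCutoff.one_sub_le {φ : ℝ → ℝ} (hφ : IsCutoff φ) (x : ℝ) : 1 - φ x ≤ 4 * x ^ 2 := by
  rcases le_or_gt |x| (1 / 2) with hx | hx
  · linarith [hφ.lower x hx]
  · have h1 : (1 / 2) ^ 2 ≤ |x| ^ 2 := pow_le_pow_left₀ (by norm_num) hx.le 2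
    rw [sq_abs] at h1
    linarith [hφ.nonneg x]

/-- The deficit of the energy of the transition against the calibration. -/
lemma exists_transition_energy_le {f : ℝ → ℝ} {c₁ c₂ c₃ c₄ : ℝ} (hf : IsProfile f c₁ c₂ c₃ c₄ δ₀)
    (hδ₀ : 0 < δ₀) (hδ : 0 < δ) {φ : ℝ → ℝ} (hφ : IsCutoff φ) (hK : 0 ≤ K) :
    ∃ C, 0 ≤ C ∧ ∀ ε s, 0 < ε → IsTransition (speed f) ℓ δ δ₁ K ε s → ∀ t, 0 ≤ t →
      ε / 2 * deriv s t ^ 2 + 1 / ε * f (s t ^ 2) - φ (t / δ₀) * (speed f (s t) * -deriv s t)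
        ≤ C * ε := by
  obtain ⟨a, ha, hGa⟩ := hf.exists_speed_le hδ₀
  set Λ := 2 * √ℓ / δ with hΛ
  have hΛ0 : 0 ≤ Λ := by positivity
  -- The first two summands bound what the cut-off `φ` loses, the third the extra term `Λ √s` of the
  -- profile equation.
  refine ⟨4 * a ^ 2 * K ^ 2 / δ₀ ^ 2 + 4 * a * Λ * δ * √ℓ * K / δ₀ ^ 2 + Λ ^ 2 * √ℓ ^ 2 / 2,
    by positivity, fun ε s hε hs t ht => ?_⟩
  set S := s t with hS
  have hS0 : 0 ≤ S := hs.nonneg t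
  set r := √S with hr
  have hr0 : 0 ≤ r := Real.sqrt_nonneg _
  have hrr : r ^ 2 = S := Real.sq_sqrt hS0
  have hrℓ : r ≤ √ℓ := Real.sqrt_le_sqrt (hs.le t ht)
  set g := speed f S with hg
  have hg0 : 0 ≤ g := speed_nonneg f S
  have hgS : g ≤ a * S := hGa S hS0
  have hgf : f (S ^ 2) = g ^ 2 / 2 := by
    have := hf.speed_sq S
    rw [← hg] at this
    linarith
  have htS : t * S ≤ K * ε := hs.mul_le t ht
  have htr : t * r ≤ δ * √ℓ := by
    rcases le_total t δ with h | h
    · exact mul_le_mul h hrℓ hr0 hδ.le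
    · have : r = 0 := by rw [hr, hS, hs.eq_zero t h, Real.sqrt_zero]
      rw [this, mul_zero]
      positivity
  rw [hs.deriv_eq t ht, hgf]
  set p := φ (t / δ₀)
  have hp : 1 - p ≤ 4 * t ^ 2 / δ₀ ^ 2 := by
    have := hφ.one_sub_le (t / δ₀)
    rwa [div_pow, ← mul_div_assoc] at this
  -- Equipartition: with `-s' = g/ε + Λ r` the energy density is `g · (-s') + ε Λ² r²/2`.
  have e : ε / 2 * (-(g / ε + Λ * r)) ^ 2 + 1 / ε * (g ^ 2 / 2) - p * (g * - -(g / ε + Λ * r)) =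
      (1 - p) * (g ^ 2 / ε + g * Λ * r) + ε * Λ ^ 2 * r ^ 2 / 2 := by
    field_simp
    ring
  rw [e]
  have h1 : (1 - p) * (g ^ 2 / ε + g * Λ * r) ≤
      4 * t ^ 2 / δ₀ ^ 2 * ((a * S) ^ 2 / ε + a * S * Λ * r) := by
    have hnn : 0 ≤ g ^ 2 / ε + g * Λ * r := by positivity
    refine (mul_le_mul_of_nonneg_right hp hnn).trans ?_
    gcongr
  have h2 : 4 * t ^ 2 / δ₀ ^ 2 * ((a * S) ^ 2 / ε + a * S * Λ * r) =
      4 * a ^ 2 / δ₀ ^ 2 / ε * (t * S) ^ 2 + 4 * a * Λ / δ₀ ^ 2 * ((t * S) * (t * r)) := by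
    field_simp
  have h3 : (t * S) ^ 2 ≤ (K * ε) ^ 2 := pow_le_pow_left₀ (by positivity) htS 2
  have h4 : (t * S) * (t * r) ≤ (K * ε) * (δ * √ℓ) :=
    mul_le_mul htS htr (by positivity) (by positivity)
  have h5 : 4 * a ^ 2 / δ₀ ^ 2 / ε * (t * S) ^ 2 ≤ 4 * a ^ 2 / δ₀ ^ 2 / ε * (K * ε) ^ 2 := by
    gcongr
  have h6 : 4 * a * Λ / δ₀ ^ 2 * ((t * S) * (t * r)) ≤
      4 * a * Λ / δ₀ ^ 2 * ((K * ε) * (δ * √ℓ)) := by gcongr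
  have h7 : ε * Λ ^ 2 * r ^ 2 / 2 ≤ ε * Λ ^ 2 * √ℓ ^ 2 / 2 := by gcongr
  have h8 : 4 * a ^ 2 / δ₀ ^ 2 / ε * (K * ε) ^ 2 = 4 * a ^ 2 * K ^ 2 / δ₀ ^ 2 * ε := by
    field_simp
  have h9 : 4 * a * Λ / δ₀ ^ 2 * ((K * ε) * (δ * √ℓ)) =
      4 * a * Λ * δ * √ℓ * K / δ₀ ^ 2 * ε := by
    field_simp
  linarith

/-- The one-dimensional profile of the quasi-distance. -/
lemma IsTransition.exists_primitive (hG : Continuous G)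
    (hs : IsTransition G ℓ δ δ₁ K ε s) : ∃ Ψ : ℝ → ℝ,
      (∀ r, HasDerivAt Ψ (G (s |r|) * -deriv s |r|) r) ∧
      (∀ r, 0 ≤ r → Ψ r = 2 * (∫ y in (0 : ℝ)..ℓ, G y) - ∫ y in (0 : ℝ)..(s r), G y) ∧
      ∀ r, r ≤ 0 → Ψ r = ∫ y in (0 : ℝ)..(s (-r)), G y := by
  set P : ℝ → ℝ := fun y => ∫ l in (0 : ℝ)..y, G l with hP
  have hPd : ∀ y, HasDerivAt P (G y) y := fun y =>
    intervalIntegral.integral_hasDerivAt_right (hG.intervalIntegrable _ _)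
      (hG.stronglyMeasurableAtFilter _ _) hG.continuousAt
  set g : ℝ → ℝ := fun r => G (s r) * -deriv s r with hg
  have hgc : Continuous g :=
    (hG.comp hs.contDiff.continuous).mul (hs.contDiff.continuous_deriv (by simp)).neg
  have hgc' : Continuous fun r => g |r| := hgc.comp continuous_abs
  have hint : ∀ r, 0 ≤ r → ∫ t in (0 : ℝ)..r, g |t| = P ℓ - P (s r) := by
    intro r hr
    rw [intervalIntegral.integral_congr (g := g) fun t ht => by
      rw [uIcc_of_le hr] at ht
      rw [abs_of_nonneg ht.1]]
    have h1 : ∀ t ∈ uIcc 0 r, HasDerivAt (fun t => -P (s t)) (g t) t := fun t _ => by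
      have := (HasDerivAt.comp t (hPd (s t))
        ((hs.contDiff.differentiable (by simp)) t).hasDerivAt).neg
      exact this.congr_deriv (by simp [hg])
    rw [intervalIntegral.integral_eq_sub_of_hasDerivAt h1 (hgc.intervalIntegrable _ _),
      hs.map_zero]
    ring
  -- The derivative is even in `r`, and the value on the interface is `P ℓ`, half of the total jump.
  refine ⟨fun r => P ℓ + ∫ t in (0 : ℝ)..r, g |t|, fun r => ?_, fun r hr => ?_, fun r hr => ?_⟩
  · exact (intervalIntegral.integral_hasDerivAt_right (hgc'.intervalIntegrable _ _)
      (hgc'.stronglyMeasurableAtFilter _ _) hgc'.continuousAt).const_add _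
  · beta_reduce
    rw [hint r hr]
    ring
  · have h1 := intervalIntegral.integral_comp_neg (fun t => g |t|) (a := 0) (b := -r)
    simp only [abs_neg, neg_zero, neg_neg] at h1
    beta_reduce
    rw [intervalIntegral.integral_symm, ← h1, hint (-r) (by linarith)]
    ring

end Transition

/-! ### Testing the calibration -/

section Calibration

lemma IsWeakPartial.mono {d : ℕ} {V : Type*} [NormedAddCommGroup V] [NormedSpace ℝ V]
    {R N : Set (E d)} (hN : N ⊆ R) {i : Fin d} {u g : E d → V} (h : IsWeakPartial R i u g) :
    IsWeakPartial N i u g := by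
  intro θ hθ hθc hθN
  have h1 := h θ hθ hθc (hθN.trans hN)
  have hd : ∀ {S : Set (E d)}, tsupport θ ⊆ S → ∀ x, x ∉ S →
      fderiv ℝ θ x (basisVec i) • u x = 0 := fun hS x hx => by
    have : fderiv ℝ θ x = 0 := by
      by_contra hne
      exact hx (hS (support_fderiv_subset ℝ hne))
    rw [this]
    simp
  have hθ0 : ∀ {S : Set (E d)}, tsupport θ ⊆ S → ∀ x, x ∉ S → θ x • g x = 0 := fun hS x hx => by
    rw [image_eq_zero_of_notMem_tsupport fun hx' => hx (hS hx'), zero_smul]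
  rw [setIntegral_eq_integral_of_forall_compl_eq_zero (hd (hθN.trans hN)),
    setIntegral_eq_integral_of_forall_compl_eq_zero (hθ0 (hθN.trans hN))] at h1
  rw [setIntegral_eq_integral_of_forall_compl_eq_zero (hd hθN),
    setIntegral_eq_integral_of_forall_compl_eq_zero (hθ0 hθN), h1]

/-- Integrability is not required: otherwise the integral is `0` by convention, which is why `a`
must be nonnegative. -/
lemma integral_le_const_mul {X : Type*} [MeasurableSpace X] {μ : Measure X} [IsFiniteMeasure μ]
    {g : X → ℝ} {a : ℝ} (ha : 0 ≤ a) (hg : ∀ᵐ x ∂μ, g x ≤ a) :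
    ∫ x, g x ∂μ ≤ a * μ.real univ := by
  by_cases hi : Integrable g μ
  · have := integral_mono_ae hi (integrable_const a) hg
    rwa [integral_const, smul_eq_mul, mul_comm] at this
  · rw [integral_undef hi]
    positivity

namespace IsDefining

variable {m : ℕ} {D : E (m + 1) → ℝ} {δ₀ : ℝ} (h : IsDefining D δ₀) {Ω : Set (E (m + 1))}

include h

lemma exists_volume_real_le (hΩb : Bornology.IsBounded Ω) :
    ∃ C, 0 ≤ C ∧ ∀ r, 0 < r → volume.real (Ω ∩ {x | |D x| < r}) ≤ C * r := by
  obtain ⟨C, r₀, hr₀, hC⟩ := h.exists_volume_le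
  have hΩ := measure_lt_top_of_isBounded hΩb
  refine ⟨C + volume.real Ω / r₀, by positivity, fun r hr => ?_⟩
  rcases lt_or_ge r r₀ with hrr | hrr
  · have h1 := hC r ⟨hr, hrr⟩
    have h2 : volume.real (Ω ∩ {x | |D x| < r}) ≤ C * r := by
      refine ENNReal.toReal_le_of_le_ofReal (by positivity) ?_
      refine (measure_mono inter_subset_right).trans (h1.trans ?_)
      rw [ENNReal.ofReal_mul (NNReal.coe_nonneg C), ENNReal.ofReal_coe_nnreal]
    have h3 : 0 ≤ volume.real Ω / r₀ * r := by positivity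
    linarith
  · have h1 : volume.real (Ω ∩ {x | |D x| < r}) ≤ volume.real Ω :=
      measureReal_mono inter_subset_left hΩ.ne
    have h2 : volume.real Ω ≤ volume.real Ω / r₀ * r := by
      rw [div_mul_eq_mul_div, le_div_iff₀ hr₀]
      gcongr
    have h3 : 0 ≤ C * r := by positivity
    linarith

/-- Testing the calibration with the difference between the derivative of `ψ` and that of the
one-dimensional profile `Ψ ∘ D`, from which `ψ` differs only close to the interface. -/
lemma exists_calibration_error_le (hΩ : IsOpen Ω) (hΩb : Bornology.IsBounded Ω)
    (hslab : {x | |D x| < δ₀} ⊆ Ω) {φ : ℝ → ℝ} (hφ : ContDiff ℝ ∞ φ) {δ : ℝ} (hδ : 0 < δ)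
    (hδδ₀ : δ < δ₀) {B ρ : ℝ} (hB : 0 ≤ B) (hρ : 0 < ρ) :
    ∃ C, 0 ≤ C ∧ ∀ ε, 0 < ε → ∀ {Ψ g : ℝ → ℝ} {ψ : E (m + 1) → ℝ}
      {Dψ : Fin (m + 1) → E (m + 1) → ℝ} {b₁ b₂ : ℝ}, (∀ t, HasDerivAt Ψ (g t) t) →
      Continuous g → (∀ t, δ ≤ |t| → g t = 0) → MemH1 Ω ψ Dψ →
      (∀ᵐ x ∂(volume.restrict Ω), |ψ x - Ψ (D x)| ≤ B ∧ (ρ * ε < |D x| → ψ x = Ψ (D x))) →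
      (∀ᵐ x ∂(volume.restrict Ω), (δ < D x → ψ x = b₁) ∧ (D x < -δ → ψ x = b₂)) →
      ∃ Q : E (m + 1) → ℝ, IntegrableOn Q Ω ∧
        (∀ᵐ x ∂(volume.restrict Ω), Q x = ∑ i, φ (D x / δ₀) * fderiv ℝ D x (basisVec i) *
          (g (D x) * fderiv ℝ D x (basisVec i) - Dψ i x)) ∧ ∫ x in Ω, Q x ≤ C * ε := by
  have := isFiniteMeasure_restrict_of_isBounded hΩb
  obtain ⟨Cv, hCv0, hCv⟩ := h.exists_volume_real_le hΩb
  -- The field `φ(D/δ₀) ∇D` need not be smooth up to `|D| = δ₀`. Cutting it off between `δ` and `δ₀`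
  -- gives true test functions and changes nothing, since both derivatives vanish almost everywhere
  -- where `|D| > δ`.
  obtain ⟨χ, hχ, hχ1, hχ0, -⟩ := exists_cutoff (a := (2 * δ + δ₀) / 3) (b := (δ + 2 * δ₀) / 3)
    (by linarith) (by linarith)
  set q : ℝ → ℝ := fun t => χ t * φ (t / δ₀) with hq
  have hqC : ContDiff ℝ ∞ q := hχ.mul (hφ.comp (contDiff_id.div_const _))
  have hq0 : ∀ t, (δ + 2 * δ₀) / 3 < |t| → q t = 0 := fun t ht => by
    simp only [hq, hχ0 t ht.le, zero_mul]
  have hr : (δ + 2 * δ₀) / 3 < δ₀ := by linarith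
  set θ : Fin (m + 1) → E (m + 1) → ℝ := fun i x => q (D x) • fderiv ℝ D x (basisVec i) with hθ
  have hθC : ∀ i, ContDiff ℝ ∞ (θ i) := fun i => by
    refine h.contDiff_comp_smul le_rfl hqC hr hq0 ?_
    exact (h.smooth.fderiv_of_isOpen (h.isOpen_slab _) (m := ∞) (by simp)).clm_apply
      contDiffOn_const
  have hθ1 : ∀ i, ContDiff ℝ 1 (θ i) := fun i => (hθC i).of_le (by simp)
  have hθc : ∀ i, HasCompactSupport (θ i) := fun i => h.hasCompactSupport_comp_smul hq0 _
  have hθΩ : ∀ i, tsupport (θ i) ⊆ Ω := fun i =>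
    (h.tsupport_comp_smul_subset hq0 _).trans fun x hx => hslab (lt_of_le_of_lt hx hr)
  choose Cθ hCθ using fun i => (hasCompactSupport_fderiv_basisVec (hθc i) i).exists_bound_of_continuous
    (continuous_fderiv_basisVec (hθ1 i) i)
  choose Bθ hBθ using fun i => (hθc i).exists_bound_of_continuous (hθ1 i).continuous
  have hCθ0 : ∀ i, 0 ≤ Cθ i := fun i => (norm_nonneg _).trans (hCθ i 0)
  refine ⟨∑ i, Cθ i * B * (Cv * (2 * ρ)), Finset.sum_nonneg fun i _ => by
    have := hCθ0 i
    positivity, ?_⟩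
  intro ε hε Ψ g ψ Dψ b₁ b₂ hΨ hgc hg0 hψ hψΨ hψb
  have hΨd := h.hasFDerivAt_comp_of_hasDerivAt hΨ hg0 hδδ₀
  have hΨC := h.contDiff_comp_of_hasDerivAt hΨ hgc hg0 hδδ₀
  have hw : ∀ i x, fderiv ℝ (fun x => Ψ (D x)) x (basisVec i) =
      g (D x) * fderiv ℝ D x (basisVec i) := fun i x => by
    rw [(hΨd x).fderiv]
    simp
  have hflat : ∀ {N : Set (E (m + 1))} {b : ℝ}, IsOpen N → N ⊆ Ω →
      (∀ᵐ x ∂(volume.restrict N), ψ x = b) →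
      ∀ i, ∀ᵐ x ∂(volume.restrict Ω), x ∈ N → Dψ i x = 0 := by
    intro N b hNo hN hb i
    have h1 := ae_eq_zero_of_isWeakPartial_const hNo ((hψ.weak i).mono hN)
      (IntegrableOn.mono_set ((hψ.memLp_deriv i).integrable (by norm_num)) hN) hb
    rw [ae_restrict_iff' hNo.measurableSet] at h1
    exact ae_restrict_of_ae h1
  have hz1 := hflat (N := Ω ∩ {x | δ < D x}) (b := b₁)
    (hΩ.inter (isOpen_lt continuous_const h.continuous)) inter_subset_left (by
      filter_upwards [ae_restrict_of_ae_restrict_of_subset inter_subset_left hψb,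
        ae_restrict_mem (hΩ.inter (isOpen_lt continuous_const h.continuous)).measurableSet]
        with x hx hxN using hx.1 hxN.2)
  have hz2 := hflat (N := Ω ∩ {x | D x < -δ}) (b := b₂)
    (hΩ.inter (isOpen_lt h.continuous continuous_const)) inter_subset_left (by
      filter_upwards [ae_restrict_of_ae_restrict_of_subset inter_subset_left hψb,
        ae_restrict_mem (hΩ.inter (isOpen_lt h.continuous continuous_const)).measurableSet]
        with x hx hxN using hx.2 hxN.2)
  have hwi : ∀ i, Integrable (fun x => θ i x * (g (D x) * fderiv ℝ D x (basisVec i)))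
      (volume.restrict Ω) := fun i => by
    simp only [← hw]
    exact (memLp_of_continuous_of_isBounded ((hθ1 i).continuous.mul
      (continuous_fderiv_basisVec hΨC i)) hΩb 1).integrable le_rfl
  have hDi : ∀ i, Integrable (fun x => θ i x * Dψ i x) (volume.restrict Ω) := fun i =>
    ((hψ.memLp_deriv i).integrable (by norm_num)).bdd_mul (c := Bθ i)
      (hθ1 i).continuous.aestronglyMeasurable (Eventually.of_forall (hBθ i))
  have hfd : ∀ i, Integrable (fun x => fderiv ℝ (θ i) x (basisVec i) * ψ x)
      (volume.restrict Ω) := fun i =>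
    (hψ.memLp.integrable (by norm_num)).bdd_mul (c := Cθ i)
      (continuous_fderiv_basisVec (hθ1 i) i).aestronglyMeasurable (Eventually.of_forall (hCθ i))
  have hfΨ : ∀ i, Integrable (fun x => fderiv ℝ (θ i) x (basisVec i) * Ψ (D x))
      (volume.restrict Ω) := fun i =>
    (memLp_of_continuous_of_isBounded ((continuous_fderiv_basisVec (hθ1 i) i).mul
      hΨC.continuous) hΩb 1).integrable le_rfl
  refine ⟨fun x => ∑ i, θ i x * (g (D x) * fderiv ℝ D x (basisVec i) - Dψ i x), ?_, ?_, ?_⟩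
  · refine integrable_finsetSum _ fun i _ => ?_
    simp only [mul_sub]
    exact (hwi i).sub (hDi i)
  · filter_upwards [ae_all_iff.2 hz1, ae_all_iff.2 hz2, ae_restrict_mem hΩ.measurableSet]
      with x hx1 hx2 hxΩ
    refine Finset.sum_congr rfl fun i _ => ?_
    rcases le_or_gt |D x| ((2 * δ + δ₀) / 3) with hx | hx
    · simp only [hθ, hq, hχ1 _ hx, one_mul, smul_eq_mul]
    · have hδx : δ < |D x| := by linarith
      have h0 : Dψ i x = 0 := by
        rcases lt_abs.1 hδx with h1 | h1
        · exact hx1 i ⟨hxΩ, h1⟩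
        · exact hx2 i ⟨hxΩ, by simp only [mem_ofPred_eq]; linarith⟩
      rw [h0, hg0 _ hδx.le]
      simp
  · have hzero : ∀ i x, x ∉ Ω → θ i x = 0 := fun i x hx =>
      image_eq_zero_of_notMem_tsupport fun hx' => hx (hθΩ i hx')
    have hzero' : ∀ i x, x ∉ Ω → fderiv ℝ (θ i) x = 0 := fun i x hx => by
      by_contra hne
      exact hx (hθΩ i (support_fderiv_subset ℝ hne))
    -- The derivative is moved onto `θ`, by the definition of the weak derivative for `ψ` and
    -- classically for `Ψ ∘ D`.
    have hone : ∀ i, ∫ x in Ω, θ i x * (g (D x) * fderiv ℝ D x (basisVec i) - Dψ i x) =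
        ∫ x in Ω, fderiv ℝ (θ i) x (basisVec i) * (ψ x - Ψ (D x)) := by
      intro i
      have h1 : ∫ x in Ω, θ i x * Dψ i x = -∫ x in Ω, fderiv ℝ (θ i) x (basisVec i) * ψ x := by
        have := hψ.weak i (θ i) (hθC i) (hθc i) (hθΩ i)
        simp only [smul_eq_mul] at this
        rw [this, neg_neg]
      have h2 : ∫ x in Ω, θ i x * (g (D x) * fderiv ℝ D x (basisVec i)) =
          -∫ x in Ω, fderiv ℝ (θ i) x (basisVec i) * Ψ (D x) := by
        rw [setIntegral_eq_integral_of_forall_compl_eq_zero fun x hx => by rw [hzero i x hx, zero_mul],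
          setIntegral_eq_integral_of_forall_compl_eq_zero fun x hx => by rw [hzero' i x hx]; simp]
        have := integral_smul_fderiv_eq_neg hΨC (hθ1 i) (hθc i) i
        simp only [smul_eq_mul, hw] at this
        have e : ∀ x, θ i x * (g (D x) * fderiv ℝ D x (basisVec i)) =
            g (D x) * fderiv ℝ D x (basisVec i) * θ i x := fun x => mul_comm _ _
        have e' : ∀ x, fderiv ℝ (θ i) x (basisVec i) * Ψ (D x) =
            Ψ (D x) * fderiv ℝ (θ i) x (basisVec i) := fun x => mul_comm _ _
        simp only [e, e']
        rw [this, neg_neg]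
      simp only [mul_sub]
      rw [integral_sub (hwi i) (hDi i), integral_sub (hfd i) (hfΨ i), h1, h2]
      ring
    have hbound : ∀ i, ∫ x in Ω, fderiv ℝ (θ i) x (basisVec i) * (ψ x - Ψ (D x)) ≤
        Cθ i * B * (Cv * (2 * ρ)) * ε := by
      intro i
      -- The functions may differ where `|D| ≤ ρ ε`; the doubled width gives an open slab containing
      -- that set, of volume `O(ε)`.
      have hA : MeasurableSet {x | |D x| < 2 * ρ * ε} := (h.isOpen_slab _).measurableSet
      have h1 : ∀ᵐ x ∂(volume.restrict Ω), fderiv ℝ (θ i) x (basisVec i) * (ψ x - Ψ (D x)) ≤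
          {x | |D x| < 2 * ρ * ε}.indicator (fun _ => Cθ i * B) x := by
        filter_upwards [hψΨ] with x hx
        by_cases hxA : |D x| < 2 * ρ * ε
        · rw [indicator_of_mem (show x ∈ {x | |D x| < 2 * ρ * ε} from hxA)]
          refine (le_abs_self _).trans ?_
          rw [abs_mul]
          exact mul_le_mul (hCθ i x) hx.1 (abs_nonneg _) (hCθ0 i)
        · rw [indicator_of_notMem (show x ∉ {x | |D x| < 2 * ρ * ε} from hxA)]
          have h2 : ρ * ε < |D x| := by
            have : 0 < ρ * ε := by positivity
            rw [not_lt] at hxA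
            linarith
          rw [hx.2 h2, sub_self, mul_zero]
      have hi : Integrable (fun x => fderiv ℝ (θ i) x (basisVec i) * (ψ x - Ψ (D x)))
          (volume.restrict Ω) := by
        simp only [mul_sub]
        exact (hfd i).sub (hfΨ i)
      refine (integral_mono_ae hi ((integrable_const _).indicator hA) h1).trans ?_
      rw [integral_indicator_const _ hA, measureReal_restrict_apply hA, smul_eq_mul, inter_comm]
      have h2 := hCv (2 * ρ * ε) (by positivity)
      have h3 : 0 ≤ Cθ i * B := mul_nonneg (hCθ0 i) hB
      calc _ ≤ Cv * (2 * ρ * ε) * (Cθ i * B) := mul_le_mul_of_nonneg_right h2 h3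
        _ = _ := by ring
    rw [integral_finsetSum _ fun i _ => by
      simp only [mul_sub]
      exact (hwi i).sub (hDi i), Finset.sum_mul]
    refine Finset.sum_le_sum fun i _ => ?_
    rw [hone i]
    exact hbound i

end IsDefining

end Calibration

/-! ### The quasi-distance of displaced points -/

section SideValues

open scoped NNReal

variable {d n : ℕ} {Up Um : Set (E n)} {f : ℝ → ℝ} {c₁ c₂ c₃ c₄ δ₀ : ℝ} {ν : E n → E n}
  {μ : E n → ℝ} {c γ : ℝ → ℝ} {A : E d → ℝ} {K : ℝ≥0} {x : E d} {p : E n}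

/-- This crude bound holds for every displacement, also beyond `δ₀`, where the quasi-distance is not
an explicit function of `A x`. -/
lemma abs_quasiDist_sideMap_sub_le (hK : LipschitzWith K (quasiDist f Up Um)) {U V : Set (E n)}
    (w : WellFrame U V δ₀ ν μ) (hcs : ∀ s, 0 ≤ s → 0 ≤ c s ∧ c s ≤ s * γ s)
    (hγ : ∀ s, γ s ∈ Icc (0 : ℝ) 1) (hx : 0 ≤ A x) (hp : p ∈ frontier U) :
    |quasiDist f Up Um (sideMap A c ν μ (x, p)) - quasiDist f Up Um p| ≤ K * A x := by
  refine (hK.norm_sub_le _ _).trans ?_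
  gcongr
  exact w.norm_sideMap_sub_le hcs hγ hx hp

/-- Up to `δ₀` there is no shortening, and the signed distance to the well is exactly minus the
displacement. -/
lemma quasiDist_sideMap_plus (hW : IsWells Up Um δ₀) (hδ₀ : 0 < δ₀) (w : WellFrame Up Um δ₀ ν μ)
    (hc : ∀ s, s ≤ δ₀ → c s = 0) (hx : A x ∈ Icc 0 δ₀) (hp : p ∈ frontier Up) :
    quasiDist f Up Um (sideMap A c ν μ (x, p)) =
      surfaceTension f Up Um - ∫ l in (0 : ℝ)..(A x), speed f l := by
  have h1 := w.sgnDist_sideMap hc hδ₀ hx hp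
  have h2 := hW.four_mul_le_wellDist
  have h3 : Metric.infDist (sideMap A c ν μ (x, p)) (frontier Up) = A x := by
    rw [← abs_sgnDist, h1, abs_neg, abs_of_nonneg hx.1]
  have h4 := hW.wellDist_le_infDist_add (sideMap A c ν μ (x, p))
  rw [quasiDist_of_lt (by linarith [hx.2]) (by linarith [hx.2]), h1, integral_speed_neg]
  ring

lemma quasiDist_sideMap_minus (hW : IsWells Up Um δ₀) (hδ₀ : 0 < δ₀) (w : WellFrame Um Up δ₀ ν μ)
    (hc : ∀ s, s ≤ δ₀ → c s = 0) (hx : A x ∈ Icc 0 δ₀) (hp : p ∈ frontier Um) :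
    quasiDist f Up Um (sideMap A c ν μ (x, p)) = ∫ l in (0 : ℝ)..(A x), speed f l := by
  have h1 := w.sgnDist_sideMap hc hδ₀ hx hp
  have h2 := hW.four_mul_le_wellDist
  have h3 : Metric.infDist (sideMap A c ν μ (x, p)) (frontier Um) = A x := by
    rw [← abs_sgnDist, h1, abs_neg, abs_of_nonneg hx.1]
  rw [quasiDist_of_le (by linarith [hx.2]), h3]

end SideValues

/-! ### Bounds for the two energies -/

section Energies

open scoped NNReal

lemma gradient_apply {d : ℕ} (D : E d → ℝ) (x : E d) (i : Fin d) :
    gradient D x i = fderiv ℝ D x (basisVec i) := by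
  have h1 : inner ℝ (gradient D x) (basisVec i) = fderiv ℝ D x (basisVec i) := by
    simp [gradient]
  rw [← h1, basisVec, EuclideanSpace.inner_single_right]
  simp

lemma IsDefining.sum_fderiv_sq {d : ℕ} {D : E d → ℝ} {δ₀ : ℝ} (h : IsDefining D δ₀) {x : E d}
    (hx : |D x| < δ₀) : ∑ i, fderiv ℝ D x (basisVec i) ^ 2 = 1 := by
  have h1 : ‖gradient D x‖ = 1 := by
    rw [← h.norm_fderiv x hx]
    simp [gradient]
  simp only [← gradient_apply]
  rw [← one_pow 2, ← h1, EuclideanSpace.norm_sq_eq]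
  simp

lemma IsDefining.ae_of_pos_neg {m : ℕ} {D : E (m + 1) → ℝ} {δ₀ : ℝ} (h : IsDefining D δ₀)
    {Ω : Set (E (m + 1))} (hsub : {x | 0 ≤ D x} ⊆ Ω) {P : E (m + 1) → Prop}
    (hp : ∀ᵐ x ∂(volume.restrict {x | 0 < D x}), P x)
    (hn : ∀ᵐ x ∂(volume.restrict (Ω ∩ {x | D x < 0})), P x) :
    ∀ᵐ x ∂(volume.restrict Ω), P x := by
  rw [Measure.restrict_congr_set (h.ae_eq_union hsub), ae_restrict_union_iff]
  exact ⟨hp, hn⟩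

/-- A function which is close to a well is determined by the one-dimensional profile away from the
interface. -/
lemma IsTransition.abs_sub_profile_le {G : ℝ → ℝ} {ℓ δ δ₀ δ₁ K ε : ℝ} {s : ℝ → ℝ} (hδ₀ : 0 < δ₀)
    (hs : IsTransition G ℓ δ δ₁ K ε s) {K₁ K₂ : ℝ≥0} {P : ℝ → ℝ}
    (hP : LipschitzWith K₂ P) (hP0 : P 0 = 0) {t ψ b σ : ℝ} (hσ : |σ| = 1) (ht : 0 ≤ t)
    (hψ : |ψ - b| ≤ K₁ * s t) (hψP : s t ≤ δ₀ → ψ = b + σ * P (s t)) :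
    |ψ - (b + σ * P (s t))| ≤ (K₁ + K₂) * ℓ ∧ (K / δ₀ * ε < t → ψ = b + σ * P (s t)) ∧
      (δ ≤ t → ψ = b) := by
  have h1 : |P (s t)| ≤ K₂ * s t := by
    have := hP.norm_sub_le (s t) 0
    rwa [hP0, sub_zero, sub_zero, Real.norm_eq_abs, Real.norm_of_nonneg (hs.nonneg t)] at this
  refine ⟨?_, fun htK => hψP ?_, fun htδ => ?_⟩
  · calc |ψ - (b + σ * P (s t))| = |(ψ - b) - σ * P (s t)| := by ring_nf
      _ ≤ |ψ - b| + |σ * P (s t)| := abs_sub _ _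
      _ ≤ K₁ * s t + K₂ * s t := by
        rw [abs_mul, hσ, one_mul]
        exact add_le_add hψ h1
      _ ≤ (K₁ + K₂) * ℓ := by
        rw [← add_mul]
        gcongr
        exact hs.le t ht
  -- `t s(t) ≤ K ε` forces `s(t) ≤ δ₀` once `t > K ε/δ₀`.
  · by_contra hne
    rw [not_le] at hne
    have h2 := hs.mul_le t ht
    have h3 : K * ε < t * δ₀ := by
      calc K * ε = K / δ₀ * ε * δ₀ := by field_simp
        _ < t * δ₀ := by gcongr
    have h4 : t * δ₀ ≤ t * s t := by gcongr
    linarith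
  · rw [hs.eq_zero t htδ, mul_zero] at hψ
    linarith [abs_nonpos_iff.1 hψ]

lemma abs_trunc_le {δ₀ : ℝ} (hδ₀ : 0 ≤ δ₀) (r : ℝ) : |trunc δ₀ r| ≤ |r| := by
  unfold trunc
  rw [abs_le]
  constructor
  · refine le_max_iff.2 (Or.inr (le_min (neg_abs_le r) ?_))
    linarith [abs_nonneg r]
  · exact max_le (by linarith [abs_nonneg r]) ((min_le_left _ _).trans (le_abs_self r))

variable {d n : ℕ} {f : ℝ → ℝ} {Up Um : Set (E n)} {φ : ℝ → ℝ} {δ₀ ε : ℝ} {Ω Ωp : Set (E d)}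
  {u : E d → E n}

/-- The modulated energy, after testing the calibration with the one-dimensional profile. -/
lemma modulatedEnergy_le (h : IsDefining (sgnDist Ωp) δ₀) [IsFiniteMeasure (volume.restrict Ω)]
    {Du : Fin d → E d → E n} {Dψ : Fin d → E d → ℝ} {Q w : E d → ℝ} {g : ℝ → ℝ} {C₁ C₂ C₃ δ : ℝ}
    (hε : 0 ≤ ε) (hC₁ : 0 ≤ C₁) (hC₂ : 0 ≤ C₂) (hC₃ : 0 ≤ C₃) (hQ : IntegrableOn Q Ω)
    (hQe : ∀ᵐ x ∂(volume.restrict Ω), Q x =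
      ∑ i, φ (sgnDist Ωp x / δ₀) * fderiv ℝ (sgnDist Ωp) x (basisVec i) *
        (g (sgnDist Ωp x) * fderiv ℝ (sgnDist Ωp) x (basisVec i) - Dψ i x))
    (hQC : ∫ x in Ω, Q x ≤ C₁ * ε) (hδ : δ < δ₀) (hg : ∀ t, δ ≤ |t| → g t = 0)
    (hw : IntegrableOn w Ω) (hw0 : ∀ x, 0 ≤ w x)
    (hle : ∀ᵐ x ∂(volume.restrict Ω), ε / 2 * (∑ i, ‖Du i x‖ ^ 2) +
      1 / ε * potential f Up Um (u x) - φ (sgnDist Ωp x / δ₀) * g (sgnDist Ωp x) ≤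
        C₂ * ε + C₃ * ε * w x) :
    modulatedEnergy f Up Um φ δ₀ Ω Ωp ε u Du Dψ ≤
      (C₁ + C₂ * volume.real Ω + C₃ * ∫ x in Ω, w x) * ε := by
  have hw1 : 0 ≤ ∫ x in Ω, w x := integral_nonneg hw0
  unfold modulatedEnergy
  by_cases hI : IntegrableOn (fun x => ε / 2 * (∑ i, ‖Du i x‖ ^ 2) +
      1 / ε * potential f Up Um (u x) - ∑ i, normalExt φ δ₀ Ωp x i * Dψ i x) Ω
  · have h1 : ∀ᵐ x ∂(volume.restrict Ω), ε / 2 * (∑ i, ‖Du i x‖ ^ 2) +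
        1 / ε * potential f Up Um (u x) - ∑ i, normalExt φ δ₀ Ωp x i * Dψ i x ≤
          Q x + (C₂ * ε + C₃ * ε * w x) := by
      filter_upwards [hQe, hle] with x hx1 hx2
      -- This uses `|∇D| = 1` where `|D| < δ₀`; elsewhere `g` vanishes.
      have h2 : Q x = φ (sgnDist Ωp x / δ₀) * g (sgnDist Ωp x) -
          ∑ i, normalExt φ δ₀ Ωp x i * Dψ i x := by
        have h3 : φ (sgnDist Ωp x / δ₀) * g (sgnDist Ωp x) *
            ∑ i, fderiv ℝ (sgnDist Ωp) x (basisVec i) ^ 2 =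
              φ (sgnDist Ωp x / δ₀) * g (sgnDist Ωp x) := by
          rcases lt_or_ge |sgnDist Ωp x| δ₀ with h4 | h4
          · rw [h.sum_fderiv_sq h4, mul_one]
          · rw [hg _ (hδ.le.trans h4)]
            simp
        rw [hx1, ← h3, Finset.mul_sum, ← Finset.sum_sub_distrib]
        refine Finset.sum_congr rfl fun i _ => ?_
        simp only [normalExt, PiLp.smul_apply, smul_eq_mul, gradient_apply]
        ring
      linarith
    have hc : IntegrableOn (fun _ : E d => C₂ * ε) Ω := integrable_const _
    have hcw : IntegrableOn (fun x => C₂ * ε + C₃ * ε * w x) Ω := hc.add (hw.const_mul _)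
    refine (integral_mono_ae hI (hQ.add hcw) h1).trans ?_
    have e : ∫ x in Ω, (Q x + (C₂ * ε + C₃ * ε * w x)) =
        (∫ x in Ω, Q x) + (C₂ * ε * volume.real Ω + C₃ * ε * ∫ x in Ω, w x) := by
      rw [integral_add hQ hcw,
        integral_add hc (hw.const_mul (C₃ * ε)), integral_const_mul (C₃ * ε) w, integral_const]
      rw [measureReal_restrict_apply_univ, smul_eq_mul]
      ring
    refine (le_of_eq e).trans ?_
    linarith
  -- If the density is not integrable, its integral is `0` by convention and the bound holds because
  -- the constants are nonnegative.
  · rw [integral_undef hI]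
    positivity

/-- The bulk energy of a map which is close to the wells away from the interface. -/
lemma bulkEnergy_le (hδ₀ : 0 ≤ δ₀) [IsFiniteMeasure (volume.restrict Ω)] {a : ℝ} (ha : 0 ≤ a)
    (hF : 0 ≤ surfaceTension f Up Um)
    (hu : ∀ᵐ x ∂(volume.restrict Ω),
      (phase Ω Ωp x = 1 ∧
        |quasiDist f Up Um (u x) - surfaceTension f Up Um| * |sgnDist Ωp x| ≤ a) ∨
      (phase Ω Ωp x = -1 ∧ |quasiDist f Up Um (u x)| * |sgnDist Ωp x| ≤ a)) :
    bulkEnergy f Up Um δ₀ Ω Ωp u ≤ 3 * a * volume.real Ω := by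
  have key : ∀ {y z r : ℝ}, |y| ≤ z → z * |r| ≤ a → |y| * |trunc δ₀ r| ≤ a := fun {y z r} h1 h2 =>
    (mul_le_mul h1 (abs_trunc_le hδ₀ r) (abs_nonneg _) ((abs_nonneg _).trans h1)).trans h2
  have h1 := integral_le_const_mul (μ := volume.restrict Ω) (a := 2 * a)
    (g := fun x => (surfaceTension f Up Um * phase Ω Ωp x - surfaceTension f Up Um
      + 2 * max (surfaceTension f Up Um - quasiDist f Up Um (u x)) 0)
        * trunc δ₀ (sgnDist Ωp x)) (by positivity) <| by
    filter_upwards [hu] with x hx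
    set y := surfaceTension f Up Um * phase Ω Ωp x - surfaceTension f Up Um
      + 2 * max (surfaceTension f Up Um - quasiDist f Up Um (u x)) 0 with hy
    refine (le_abs_self _).trans ?_
    rw [abs_mul]
    -- `y / 2` is `(c_F - ψ)⁺` on the positive side and `(c_F - ψ)⁺ - c_F` on the negative one,
    -- bounded in absolute value by `|ψ - c_F|` and `|ψ|` respectively.
    have e : |y| = 2 * |y / 2| := by
      rw [abs_div, abs_two]
      ring
    rw [e, mul_assoc]
    refine mul_le_mul_of_nonneg_left ?_ zero_le_two
    rcases hx with ⟨h1, h3⟩ | ⟨h1, h3⟩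
    · refine key ?_ h3
      rw [hy, h1, abs_le]
      rcases max_cases (surfaceTension f Up Um - quasiDist f Up Um (u x)) 0 with h | h <;>
      constructor <;>
      linarith [neg_abs_le (quasiDist f Up Um (u x) - surfaceTension f Up Um),
        le_abs_self (quasiDist f Up Um (u x) - surfaceTension f Up Um)]
    · refine key ?_ h3
      rw [hy, h1, abs_le]
      rcases max_cases (surfaceTension f Up Um - quasiDist f Up Um (u x)) 0 with h | h <;>
      constructor <;>
      linarith [neg_abs_le (quasiDist f Up Um (u x)), le_abs_self (quasiDist f Up Um (u x))]
  have h2 := integral_le_const_mul (μ := volume.restrict Ω) (a := a)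
    (g := fun x => max (quasiDist f Up Um (u x) - surfaceTension f Up Um) 0
        * |trunc δ₀ (sgnDist Ωp x)|) ha <| by
    filter_upwards [hu] with x hx
    have e : max (quasiDist f Up Um (u x) - surfaceTension f Up Um) 0 =
        |max (quasiDist f Up Um (u x) - surfaceTension f Up Um) 0| :=
      (abs_of_nonneg (le_max_right _ _)).symm
    rw [e]
    rcases hx with ⟨-, h3⟩ | ⟨-, h3⟩
    · refine key ?_ h3
      rw [← e]
      exact max_le (le_abs_self _) (abs_nonneg _)
    · refine key ?_ h3
      rw [← e]
      exact max_le (by linarith [le_abs_self (quasiDist f Up Um (u x))]) (abs_nonneg _)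
  unfold bulkEnergy
  rw [measureReal_restrict_apply_univ] at h1 h2
  linarith

end Energies

end KRS

end

/-! ### Construction of the initial data -/

set_option maxHeartbeats 400000 in
theorem theorem1p2 {d n : ℕ}
    -- the wells `𝔪± = frontier Up, frontier Um` and the potential
    (Up Um : Set (KRS.E n)) (f : ℝ → ℝ) (c₁ c₂ c₃ c₄ δ₀ : ℝ) (hδ₀ : 0 < δ₀)
    (hwells : KRS.IsWells Up Um δ₀)
    (hf : KRS.IsProfile f c₁ c₂ c₃ c₄ δ₀)
    (hF : ContDiff ℝ ∞ (KRS.potential f Up Um))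
    -- the domain, the interface `Σ₀ = frontier Ωp` and the cut-off function
    (Ω Ωp : Set (KRS.E d)) (hint : KRS.IsInterface Ω Ωp δ₀)
    (φ : ℝ → ℝ) (hφ : KRS.IsCutoff φ)
    -- `H¹` maps into the wells on the two sides of the interface
    (δ : ℝ) (hδ : 0 < δ) (hδδ₀ : δ < δ₀)
    (up um : KRS.E d → KRS.E n) (Dup Dum : Fin d → KRS.E d → KRS.E n)
    (hup : KRS.MemH1 Ωp up Dup) (hum : KRS.MemH1 (Ω \ closure Ωp) um Dum)
    (hup_mem : ∀ᵐ x ∂(volume.restrict Ωp), up x ∈ frontier Up)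
    (hum_mem : ∀ᵐ x ∂(volume.restrict (Ω \ closure Ωp)), um x ∈ frontier Um)
    -- whose traces on `Σ₀` form a minimal pair
    (Tp Tm : KRS.E d → KRS.E n)
    (hTp : KRS.IsTrace Ωp (frontier Ωp) up Dup Tp)
    (hTm : KRS.IsTrace (Ω \ closure Ωp) (frontier Ωp) um Dum Tm)
    (hpair : ∀ᵐ p ∂((Measure.hausdorffMeasure ((d : ℝ) - 1)).restrict (frontier Ωp)),
      ‖Tp p - Tm p‖ = KRS.wellDist Up Um) :
    ∃ C : ℝ, ∀ ε : ℝ, 0 < ε →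
      ∃ (u : KRS.E d → KRS.E n) (Du : Fin d → KRS.E d → KRS.E n) (Dψ : Fin d → KRS.E d → ℝ),
        KRS.MemH1 Ω u Du ∧
        MemLp u ⊤ (volume.restrict Ω) ∧
        KRS.MemH1 Ω (fun x => KRS.quasiDist f Up Um (u x)) Dψ ∧
        (∀ x ∈ Ωp, 2 * δ ≤ Metric.infDist x (frontier Ωp) → u x = up x) ∧
        (∀ x ∈ Ω \ closure Ωp, 2 * δ ≤ Metric.infDist x (frontier Ωp) → u x = um x) ∧
        KRS.modulatedEnergy f Up Um φ δ₀ Ω Ωp ε u Du Dψ ≤ C * ε ∧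
        KRS.bulkEnergy f Up Um δ₀ Ω Ωp u ≤ C * ε := by
  classical
  obtain ⟨m, rfl⟩ := Nat.exists_eq_succ_of_ne_zero hint.dim_ne_zero
  have hΩ := hint.isOpen_domain
  have hΩb := hint.bounded_domain
  have hfin := KRS.isFiniteMeasure_restrict_of_isBounded hΩb
  have h := hint.isDefining hδ₀
  have hPe := hint.plus_eq
  have hMe := hint.minus_eq
  have hsub := hint.nonneg_subset
  have hslab : {x | |KRS.sgnDist Ωp x| < δ₀} ⊆ Ω := fun x hx => hint.slab_subset (by
    simpa only [mem_ofPred_eq, KRS.abs_sgnDist] using hx)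
  have hDabs : ∀ x, Metric.infDist x (frontier Ωp) = |KRS.sgnDist Ωp x| := fun x =>
    (KRS.abs_sgnDist Ωp x).symm
  have hph1 : ∀ x, 0 < KRS.sgnDist Ωp x → KRS.phase Ω Ωp x = 1 := fun x hx => by
    have h1 : x ∈ Ωp := by rw [hPe]; exact hx
    simp [KRS.phase, h1, subset_closure h1]
  have hph2 : ∀ x ∈ Ω, KRS.sgnDist Ωp x < 0 → KRS.phase Ω Ωp x = -1 := fun x hxΩ hx => by
    have h1 : x ∈ Ω \ closure Ωp := by rw [hMe]; exact ⟨hxΩ, hx⟩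
    have h2 : x ∉ Ωp := fun h3 => h1.2 (subset_closure h3)
    simp [KRS.phase, h1.1, h1.2, h2]
  have hFe := hint.frontier_eq
  obtain ⟨D, hD⟩ : ∃ D, D = KRS.sgnDist Ωp := ⟨_, rfl⟩
  rw [hFe] at hTp hTm hpair
  rw [hMe] at hum hum_mem hTm
  simp only [← hD] at h hPe hMe hsub hslab hDabs hph1 hph2 hTp hTm hpair hum hum_mem
  rw [hPe] at hup hup_mem hTp
  have hL := hwells.wellDist_pos
  have hL4 := hwells.four_mul_le_wellDist
  -- Each side covers half the distance of the wells, so the two sides meet at midpoints.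
  set ℓ := KRS.wellDist Up Um / 2 with hℓ
  have hℓ0 : 0 < ℓ := by positivity
  set δ₁ := (δ + δ₀) / 2 with hδ₁
  have hδδ₁ : δ < δ₁ := by linarith
  have hδ₁δ₀ : δ₁ < δ₀ := by linarith
  obtain ⟨a, -, hGa⟩ := hf.exists_speed_le hδ₀
  obtain ⟨κ, hκ, hGκ⟩ := hf.exists_le_speed hδ₀ hℓ0
  have hGc := hf.continuous_speed hδ₀
  obtain ⟨νp, μp, wp⟩ := hwells.exists_wellFrame hδ₀
  obtain ⟨νm, μm, wm⟩ := hwells.symm.exists_wellFrame hδ₀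
  obtain ⟨c, γ, hc, hcγ, hγ, hc0, hcs, hcI⟩ := KRS.exists_shift hδ₀
  obtain ⟨K₁, hK₁⟩ := hwells.exists_lipschitz_quasiDist hf hδ₀
  obtain ⟨K₂, hK₂⟩ := hf.exists_primitive_lipschitz hδ₀
  set K := ℓ / κ with hK
  have hK0 : 0 < K := by positivity
  have hmpos := h.measurableSet_pos
  have hmneg := h.measurableSet_neg hΩ
  have hnegO : IsOpen (Ω ∩ {x | D x < 0}) := hΩ.inter (isOpen_lt h.continuous continuous_const)
  have hposO : IsOpen {x | 0 < D x} := isOpen_lt continuous_const h.continuous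
  have hposb := KRS.IsDefining.isBounded_pos hΩb hsub
  have hnegb : Bornology.IsBounded (Ω ∩ {x | D x < 0}) := hΩb.subset inter_subset_left
  obtain ⟨C₁, hC₁, hE₁⟩ := wp.exists_sum_norm_compDeriv_sq_le (G := KRS.speed f) (K := K) hwells.bounded_plus hℓ0.le
    hcγ hγ hcs h hmpos (fun x hx => hx) hup_mem
    (fun i => wp.ae_inner_eq_zero hposO hposb hup.memLp hup.memLp_deriv hTp hup_mem i) hδδ₀ hδ₁δ₀
  obtain ⟨C₂, hC₂, hE₂⟩ := wm.exists_sum_norm_compDeriv_sq_le (G := KRS.speed f) (K := K) hwells.bounded_minus hℓ0.le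
    hcγ hγ hcs h.neg hmneg (fun x hx => by simpa using hx.2) hum_mem
    (fun i => wm.ae_inner_eq_zero hnegO hnegb hum.memLp hum.memLp_deriv hTm hum_mem i) hδδ₀ hδ₁δ₀
  obtain ⟨C₃, hC₃, hE₃⟩ := KRS.exists_transition_energy_le (δ₁ := δ₁) (ℓ := ℓ) hf hδ₀ hδ hφ hK0.le
  -- `B` bounds `|ψ - Ψ ∘ D|`, by the two Lipschitz constants and `s ≤ ℓ`. `ρ ε` is the distance
  -- beyond which `s ≤ δ₀`, so that `ψ` is given by the profile.
  obtain ⟨C₄, hC₄, hE₄⟩ := h.exists_calibration_error_le hΩ hΩb hslab hφ.smooth hδ hδδ₀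
    (B := (K₁ + K₂) * ℓ) (ρ := K / δ₀) (by positivity) (by positivity)
  -- the integrable majorant of the energy density
  set w : KRS.E (m + 1) → ℝ := fun x =>
    if 0 < D x then ∑ i, ‖Dup i x‖ ^ 2 else ∑ i, ‖Dum i x‖ ^ 2 with hw
  have hw0 : ∀ x, 0 ≤ w x := fun x => by
    simp only [hw]
    split_ifs <;> positivity
  have hwi : IntegrableOn w Ω := by
    have := h.memLp_ite hsub (p := 1)
      (memLp_one_iff_integrable.2 (integrable_finsetSum Finset.univ fun i _ =>
        (hup.memLp_deriv i).integrable_norm_pow two_ne_zero))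
      (memLp_one_iff_integrable.2 (integrable_finsetSum Finset.univ fun i _ =>
        (hum.memLp_deriv i).integrable_norm_pow two_ne_zero))
    exact memLp_one_iff_integrable.1 this
  have hw1 : 0 ≤ ∫ x in Ω, w x := integral_nonneg hw0
  have hTpm := h.ae_trace_mem (fun x hx => hx.1) hup.memLp_deriv hTp isClosed_frontier hup_mem
  -- The trace inequality is one-sided. The negative side is the positive side of `-D`.
  have hTmm := h.neg.ae_trace_mem (R := Ω ∩ {x | D x < 0}) (u := um) (T := Tm) (Du := Dum)
    (fun x hx => ⟨hslab (by simpa using hx.2), by simpa using hx.1⟩) hum.memLp_deriv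
    (by simpa only [neg_eq_zero] using hTm) isClosed_frontier hum_mem
  simp only [neg_eq_zero] at hTmm
  set Ce := C₄ + C₃ * volume.real Ω + (C₁ + C₂) / 2 * ∫ x in Ω, w x with hCe
  set Cb := 3 * (K₁ * K) * volume.real Ω with hCb
  have hCe0 : 0 ≤ Ce := by positivity
  have hCb0 : 0 ≤ Cb := by positivity
  -- All constants so far precede `ε`. Both summands are nonnegative, so their sum serves both
  -- energies.
  refine ⟨Ce + Cb, fun ε hε => ?_⟩
  obtain ⟨s, hs⟩ := KRS.exists_profile hGc hκ hℓ0 hδ hδδ₁ hGa hGκ hε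
  obtain ⟨Ψ, hΨ, hΨp, hΨm⟩ := hs.exists_primitive hGc
  have hP0 : ∫ l in (0 : ℝ)..0, KRS.speed f l = 0 := intervalIntegral.integral_same
  have hcF : KRS.surfaceTension f Up Um = 2 * ∫ l in (0 : ℝ)..ℓ, KRS.speed f l := rfl
  have hcF0 : 0 ≤ KRS.surfaceTension f Up Um := by
    rw [hcF]
    exact mul_nonneg zero_le_two
      (intervalIntegral.integral_nonneg hℓ0.le fun l _ => KRS.speed_nonneg f l)
  have hmem : ∀ t, 0 ≤ t → s t ∈ Icc 0 ℓ := fun t ht => ⟨hs.nonneg t, hs.le t ht⟩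
  -- the map on both sides of the interface
  obtain ⟨hAp, hApc⟩ := h.contDiff_comp_transition hs hδ₁δ₀
  obtain ⟨hAm, hAmc⟩ := h.neg.contDiff_comp_transition hs hδ₁δ₀
  set Φp := KRS.sideMap (fun x => s (D x)) c νp μp with hΦp
  set Φm := KRS.sideMap (fun x => s (-D x)) c νm μm with hΦm
  have hcc0 : c 0 = 0 := hc0 0 hδ₀.le
  obtain ⟨Mp, hMp⟩ := KRS.exists_norm_fderiv_sideMap_le hAp hApc hc hcc0 wp.contDiff_normal
    wp.hasCompactSupport wp.contDiff_weight
  obtain ⟨Mm, hMm⟩ := KRS.exists_norm_fderiv_sideMap_le hAm hAmc hc hcc0 wm.contDiff_normal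
    wm.hasCompactSupport wm.contDiff_weight
  have hΦpC := KRS.contDiff_sideMap hAp hc wp.contDiff_normal wp.contDiff_weight
  have hΦmC := KRS.contDiff_sideMap hAm hc wm.contDiff_normal wm.contDiff_weight
  -- The traces lie in the wells and form minimal pairs, and `s 0 = ℓ`, so both sides take the value
  -- of the midpoint.
  have hTe : ∀ᵐ x ∂((KRS.surf (m + 1)).restrict {x | D x = 0}), Φp (x, Tp x) = Φm (x, Tm x) := by
    filter_upwards [hTpm, hTmm, hpair,
      ae_restrict_mem (isClosed_eq h.continuous continuous_const).measurableSet] with x h1 h2 h3 h4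
    have h4 : D x = 0 := h4
    have h5 : dist (Tp x) (Tm x) = KRS.wellDist Up Um := by rw [dist_eq_norm, h3]
    rw [hΦp, hΦm, wp.sideMap_eq_midpoint (by simp [h4, hs.map_zero, hℓ]) h1 h2 h5,
      wm.sideMap_eq_midpoint (by simp [h4, hs.map_zero, hℓ, KRS.wellDist_comm Um]) h2 h1
        (by rw [dist_comm, h5, KRS.wellDist_comm]), midpoint_comm]
  have hplus : ∀ x, 0 < D x → up x ∈ frontier Up →
      KRS.potential f Up Um (Φp (x, up x)) = f (s (D x) ^ 2) ∧
      |KRS.quasiDist f Up Um (Φp (x, up x)) - KRS.surfaceTension f Up Um| ≤ K₁ * s (D x) ∧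
      |KRS.quasiDist f Up Um (Φp (x, up x)) - Ψ (D x)| ≤ (K₁ + K₂) * ℓ ∧
      (K / δ₀ * ε < D x → KRS.quasiDist f Up Um (Φp (x, up x)) = Ψ (D x)) ∧
      (δ ≤ D x → KRS.quasiDist f Up Um (Φp (x, up x)) = KRS.surfaceTension f Up Um) := by
    intro x hx hp
    have h1 := KRS.abs_quasiDist_sideMap_sub_le (A := fun x => s (D x)) hK₁ wp hcs hγ
      (hs.nonneg (D x)) hp
    rw [hwells.quasiDist_plus hp] at h1
    have h2 := hs.abs_sub_profile_le hδ₀ (hK₂ 0) hP0 (σ := -1) (by simp) hx.le h1 fun h3 => by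
      rw [KRS.quasiDist_sideMap_plus hwells hδ₀ wp hc0 ⟨hs.nonneg _, h3⟩ hp]
      ring
    have h3 : Ψ (D x) =
        KRS.surfaceTension f Up Um + -1 * ∫ l in (0 : ℝ)..(s (D x)), KRS.speed f l := by
      rw [hΨp _ hx.le, hcF]
      ring
    rw [h3]
    exact ⟨wp.potential_sideMap hf hwells hδ₀ hc0 hcs hcI (hmem _ hx.le) hp, h1, h2⟩
  have hminus : ∀ x, D x < 0 → um x ∈ frontier Um →
      KRS.potential f Up Um (Φm (x, um x)) = f (s (-D x) ^ 2) ∧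
      |KRS.quasiDist f Up Um (Φm (x, um x))| ≤ K₁ * s (-D x) ∧
      |KRS.quasiDist f Up Um (Φm (x, um x)) - Ψ (D x)| ≤ (K₁ + K₂) * ℓ ∧
      (K / δ₀ * ε < -D x → KRS.quasiDist f Up Um (Φm (x, um x)) = Ψ (D x)) ∧
      (δ ≤ -D x → KRS.quasiDist f Up Um (Φm (x, um x)) = 0) := by
    intro x hx hp
    have hx' : 0 ≤ -D x := by linarith
    have h1 := KRS.abs_quasiDist_sideMap_sub_le (A := fun x => s (-D x)) hK₁ wm hcs hγ
      (hs.nonneg (-D x)) hp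
    rw [hwells.quasiDist_minus hp] at h1
    have h2 := hs.abs_sub_profile_le hδ₀ (hK₂ 0) hP0 (σ := 1) (by simp) hx' h1 fun h3 => by
      rw [KRS.quasiDist_sideMap_minus hwells hδ₀ wm hc0 ⟨hs.nonneg _, h3⟩ hp]
      ring
    have h3 : Ψ (D x) = 0 + 1 * ∫ l in (0 : ℝ)..(s (-D x)), KRS.speed f l := by
      rw [hΨm _ hx.le]
      ring
    rw [h3]
    rw [sub_zero] at h1
    refine ⟨?_, h1, h2⟩
    rw [KRS.potential_comm]
    refine wm.potential_sideMap hf hwells.symm hδ₀ hc0 hcs hcI ?_ hp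
    rw [KRS.wellDist_comm]
    exact hmem _ hx'
  set u : KRS.E (m + 1) → KRS.E n := fun x => if 0 < D x then Φp (x, up x) else Φm (x, um x)
    with hu
  have hup' : ∀ x, 0 < D x → u x = Φp (x, up x) := fun x hx => if_pos hx
  have hum' : ∀ x, D x ≤ 0 → u x = Φm (x, um x) := fun x hx => if_neg (not_lt.2 hx)
  obtain ⟨Dψ, hDψ⟩ := h.exists_memH1_lipschitz_comp hΩ hΩb hsub hΦpC hΦmC hMp hMm hup.memLp
    hup.memLp_deriv hum.memLp hum.memLp_deriv hTp hTm hTe hup' hum' hK₁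
  set Du : Fin (m + 1) → KRS.E (m + 1) → KRS.E n := fun i x =>
    if 0 < D x then KRS.compDeriv Φp up Dup i x else KRS.compDeriv Φm um Dum i x with hDu
  have hψ : ∀ᵐ x ∂(volume.restrict Ω),
      |KRS.quasiDist f Up Um (u x) - Ψ (D x)| ≤ (K₁ + K₂) * ℓ ∧
      (K / δ₀ * ε < |D x| → KRS.quasiDist f Up Um (u x) = Ψ (D x)) := by
    refine h.ae_of_pos_neg hsub ?_ ?_
    · filter_upwards [hup_mem, ae_restrict_mem hmpos] with x h1 h2
      have h2 : 0 < D x := h2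
      rw [hup' x h2, abs_of_pos h2]
      exact ⟨(hplus x h2 h1).2.2.1, (hplus x h2 h1).2.2.2.1⟩
    · filter_upwards [hum_mem, ae_restrict_mem hmneg] with x h1 h2
      have h2 : D x < 0 := h2.2
      rw [hum' x h2.le, abs_of_neg h2]
      exact ⟨(hminus x h2 h1).2.2.1, (hminus x h2 h1).2.2.2.1⟩
  have hψb : ∀ᵐ x ∂(volume.restrict Ω),
      (δ < D x → KRS.quasiDist f Up Um (u x) = KRS.surfaceTension f Up Um) ∧
      (D x < -δ → KRS.quasiDist f Up Um (u x) = 0) := by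
    refine h.ae_of_pos_neg hsub ?_ ?_
    · filter_upwards [hup_mem, ae_restrict_mem hmpos] with x h1 h2
      have h2 : 0 < D x := h2
      rw [hup' x h2]
      exact ⟨fun h3 => (hplus x h2 h1).2.2.2.2 h3.le, fun h3 => by linarith⟩
    · filter_upwards [hum_mem, ae_restrict_mem hmneg] with x h1 h2
      have h2 : D x < 0 := h2.2
      rw [hum' x h2.le]
      exact ⟨fun h3 => by linarith, fun h3 => (hminus x h2 h1).2.2.2.2 (by linarith)⟩
  have hg0 : ∀ t, δ ≤ |t| → KRS.speed f (s |t|) * -deriv s |t| = 0 := fun t ht => by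
    have h0 : KRS.speed f 0 = 0 := by simp [KRS.speed, hf.map_zero]
    rw [hs.eq_zero _ ht, h0, zero_mul]
  have hgc : Continuous fun t => KRS.speed f (s |t|) * -deriv s |t| :=
    (hGc.comp (hs.contDiff.continuous.comp continuous_abs)).mul
      ((hs.contDiff.continuous_deriv (by simp)).comp continuous_abs).neg
  obtain ⟨Q, hQ, hQe, hQC⟩ := hE₄ ε hε hΨ hgc hg0 hDψ hψ hψb
  -- On each side this adds `ε/2` times the gradient bound to the one-dimensional deficit. The
  -- coefficient `(C₁ + C₂)/2` covers both sides at once.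
  have hdens : ∀ᵐ x ∂(volume.restrict Ω), ε / 2 * (∑ i, ‖Du i x‖ ^ 2) +
      1 / ε * KRS.potential f Up Um (u x) -
        φ (D x / δ₀) * (KRS.speed f (s |D x|) * -deriv s |D x|) ≤
          C₃ * ε + (C₁ + C₂) / 2 * ε * w x := by
    refine h.ae_of_pos_neg hsub ?_ ?_
    · filter_upwards [hup_mem, ae_restrict_mem hmpos, hE₁ ε s hs] with x h1 h2 h3
      have h2 : 0 < D x := h2
      have h4 : ∀ i, Du i x = KRS.compDeriv Φp up Dup i x := fun i => if_pos h2
      have h5 : w x = ∑ i, ‖Dup i x‖ ^ 2 := if_pos h2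
      have h6 := hE₃ ε s hε hs (D x) h2.le
      simp only [h4]
      rw [hup' x h2, (hplus x h2 h1).1, h5, abs_of_pos h2]
      have h7 := mul_le_mul_of_nonneg_left h3 (half_pos hε).le
      have h8 : 0 ≤ C₂ / 2 * ε * ∑ i, ‖Dup i x‖ ^ 2 := by positivity
      linarith
    · filter_upwards [hum_mem, ae_restrict_mem hmneg, hE₂ ε s hs] with x h1 h2 h3
      have h2 : D x < 0 := h2.2
      have h4 : ∀ i, Du i x = KRS.compDeriv Φm um Dum i x := fun i => if_neg (not_lt.2 h2.le)
      have h5 : w x = ∑ i, ‖Dum i x‖ ^ 2 := if_neg (not_lt.2 h2.le)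
      have h6 := hE₃ ε s hε hs (-D x) (by linarith)
      -- The one-dimensional estimate is used at the positive time `-D x`; evenness of `φ` restores
      -- the argument `D x`.
      rw [neg_div, hφ.even] at h6
      simp only [h4]
      rw [hum' x h2.le, (hminus x h2 h1).1, h5, abs_of_neg h2]
      have h7 := mul_le_mul_of_nonneg_left h3 (half_pos hε).le
      have h8 : 0 ≤ C₁ / 2 * ε * ∑ i, ‖Dum i x‖ ^ 2 := by positivity
      linarith
  refine ⟨u, Du, Dψ, h.memH1_ite_comp hΩ hΩb hsub hΦpC hΦmC hMp hMm hup.memLp hup.memLp_deriv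
    hum.memLp hum.memLp_deriv hTp hTm hTe, ?_, hDψ, ?_, ?_, ?_, ?_⟩
  · obtain ⟨Rp, hRp⟩ := (KRS.isCompact_frontier_of_isBounded
      hwells.bounded_plus).isBounded.exists_norm_le
    obtain ⟨Rm, hRm⟩ := (KRS.isCompact_frontier_of_isBounded
      hwells.bounded_minus).isBounded.exists_norm_le
    exact h.memLp_ite hsub
      (KRS.memLp_comp hposb hΦpC hMp
        (memLp_top_of_bound hup.memLp.aestronglyMeasurable Rp (hup_mem.mono fun x hx => hRp _ hx)))
      (KRS.memLp_comp hnegb hΦmC hMm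
        (memLp_top_of_bound hum.memLp.aestronglyMeasurable Rm (hum_mem.mono fun x hx => hRm _ hx)))
  · intro x hx hxδ
    rw [hPe] at hx
    have hx : 0 < D x := hx
    rw [hDabs, abs_of_pos hx] at hxδ
    rw [hup' x hx, hΦp, KRS.sideMap]
    -- The profile vanishes already from distance `δ` on, and `c 0 = 0`, so the point is not
    -- displaced.
    simp [hs.eq_zero (D x) (by linarith), hcc0]
  · intro x hx hxδ
    rw [hMe] at hx
    have hx : D x < 0 := hx.2
    rw [hDabs, abs_of_neg hx] at hxδ
    rw [hum' x hx.le, hΦm, KRS.sideMap]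
    simp [hs.eq_zero (-D x) (by linarith), hcc0]
  · subst hD
    have h1 := KRS.modulatedEnergy_le (g := fun t => KRS.speed f (s |t|) * -deriv s |t|) h hε.le
      hC₄ hC₃ (div_nonneg (add_nonneg hC₁ hC₂) zero_le_two) hQ hQe hQC hδδ₀ hg0 hwi hw0 hdens
    refine h1.trans (mul_le_mul_of_nonneg_right ?_ hε.le)
    linarith
  · have h1 : KRS.bulkEnergy f Up Um δ₀ Ω Ωp u ≤ 3 * (K₁ * (K * ε)) * volume.real Ω := by
      refine KRS.bulkEnergy_le hδ₀.le (by positivity) hcF0 ?_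
      rw [← hD]
      refine h.ae_of_pos_neg hsub ?_ ?_
      · filter_upwards [hup_mem, ae_restrict_mem hmpos] with x h1 h2
        have h2 : 0 < D x := h2
        refine Or.inl ⟨hph1 x h2, ?_⟩
        rw [hup' x h2, abs_of_pos h2]
        refine (mul_le_mul_of_nonneg_right (hplus x h2 h1).2.1 h2.le).trans ?_
        rw [mul_assoc, mul_comm (s _)]
        exact mul_le_mul_of_nonneg_left (hs.mul_le _ h2.le) (NNReal.coe_nonneg K₁)
      · filter_upwards [hum_mem, ae_restrict_mem hmneg] with x h1 h2
        have h3 : D x < 0 := h2.2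
        have h4 : 0 ≤ -D x := by linarith
        refine Or.inr ⟨hph2 x h2.1 h3, ?_⟩
        rw [hum' x h3.le, abs_of_neg h3]
        refine (mul_le_mul_of_nonneg_right (hminus x h3 h1).2.1 h4).trans ?_
        rw [mul_assoc, mul_comm (s _)]
        exact mul_le_mul_of_nonneg_left (hs.mul_le _ h4) (NNReal.coe_nonneg K₁)
    refine h1.trans ?_
    have h2 : 3 * (K₁ * (K * ε)) * volume.real Ω = Cb * ε := by
      rw [hCb]
      ring
    rw [h2]
    exact mul_le_mul_of_nonneg_right (by linarith) hε.le
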